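/- Let $0<\xi_1<\ell_0<\xi_2<\ell_1<\ell$ and let $\alpha_0,\alpha_1,\alpha_2,\gamma_1,\gamma_2,\gamma_3>0$. Put $\alpha=\alpha_2$, $\kappa=\alpha_0$ on $(\ell_0,\ell_1)$ and $\alpha=\alpha_1$, $\kappa=0$ on $(0,\ell_0)\cup(\ell_1,\ell)$. Consider the clamped Euler–Bernoulli beam of unit density $$u_{tt}+\left(\alpha u_{xx}+\kappa u_{txx}\right)_{xx}=0 \quad\text{on } I=(0,\xi_1)\cup(\xi_1,\ell_0)\cup(\ell_0,\xi_2)\cup(\xi_2,\ell_1)\cup(\ell_1,\ell),$$ with $u=u_x=0$ at $x=0,\ell$, which is of Kelvin–Voigt type on $(\ell_0,\ell_1)$ and has pointwise dampers at $\xi_1$ and $\xi_2$. Let $\mathcal H=H^2_0(0,\ell)\times L^2(0,\ell)$ (complex-valued functions) with $\|(u,v)\|_{\mathcal H}^2=\int_0^\ell\left(|v|^2+\alpha|u_{xx}|^2\right)dx$, and write $M=\alpha u_{xx}+\kappa v_{xx}$ and $[\![f]\!]_\xi=f(\xi^+)-f(\xi^-)$. Let $\mathcal A$ be the operator $$\mathcal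 A(u,v)=\left(v,\,-M_{xx}\right)$$ in $\mathcal H$ (with $M_{xx}$ taken on $I$), whose domain consists of all $(u,v)$ with $u,v\in H^2_0(0,\ell)$, $M\in H^2(I)$ and $$[\![M]\!]_{\ell_i}=[\![M_x]\!]_{\ell_i}=0\ (i=0,1),\qquad [\![M]\!]_{\xi_1}=0,\quad [\![M_x]\!]_{\xi_1}=-\gamma_1v(\xi_1),$$ $$[\![M]\!]_{\xi_2}=\gamma_3v_x(\xi_2),\quad [\![M_x]\!]_{\xi_2}=-\gamma_2v(\xi_2).$$ Then $\mathcal A$ generates a $C_0$-semigroup $(e^{\mathcal At})_{t\ge0}$ on $\mathcal H$, and this semigroup is of Gevrey class $\delta$ for $t>0$, for every $\delta>4$: the map $t\mapsto e^{\mathcal At}$ is infinitely differentiable on $(0,\infty)$ in the operator norm, and for every compact $K\subset(0,\infty)$ and every $\theta>0$ there is a constant $C=C(K,\theta,\delta)$ such that $$\left\|\tfrac{d^n}{dt^n}e^{\mathcal At}\right\|_{\mathcal L(\mathcal H)}\le C\,\theta^n\,(n!)^\delta\qquad\text{for all } t\in K,\ n=0,1,2,\dots$$ Moreover $i\mathbb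 R\subset\varrho(\mathcal A)$, and there are constants $C,\lambda_0$ such that $|\lambda|^{1/4}\,\|(i\lambda-\mathcal A)^{-1}\|_{\mathcal L(\mathcal H)}\le C$ for all real $\lambda$ with $|\lambda|\ge\lambda_0$. -/

import Mathlib

open MeasureTheory Set Filter Topology
open scoped ContDiff Nat

noncomputable section

/-! ## Strongly continuous semigroups -/

section Semigroup

variable {X : Type*} [NormedAddCommGroup X] [NormedSpace ℂ X]

/-- `S` (restricted to times `t ≥ 0`) is a strongly continuous semigroup of bounded linear
operators on `X`; the values `S t` for `t < 0` are irrelevant. -/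
structure IsC0Semigroup (S : ℝ → X →L[ℂ] X) : Prop where
  map_zero : S 0 = ContinuousLinearMap.id ℂ X
  map_add : ∀ s t : ℝ, 0 ≤ s → 0 ≤ t → S (s + t) = (S s).comp (S t)
  tendsto_zero : ∀ x : X, Tendsto (fun t : ℝ => S t x) (𝓝[>] 0) (𝓝 x)

/-- The unbounded operator `A` is the infinitesimal generator of `S`: its domain is the set of
all `x` for which `lim_{t → 0+} (S t x - x) / t` exists, and `A x` is this limit. -/
def IsGeneratorOf (A : X →ₗ.[ℂ] X) (S : ℝ → X →L[ℂ] X) : Prop :=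
  ∀ x y : X, (x, y) ∈ A.graph ↔
    Tendsto (fun t : ℝ => ((t : ℂ)⁻¹) • (S t x - x)) (𝓝[>] 0) (𝓝 y)

/-- `S` is of Gevrey class `δ` for `t > t₀`: it is infinitely differentiable in operator norm on
`(t₀, ∞)`, and for every compact `K ⊆ (t₀, ∞)` and every `θ > 0` there is a constant `C` such that
`‖S⁽ⁿ⁾(t)‖ ≤ C θⁿ (n!)^δ` for all `t ∈ K` and all `n`. -/
def IsGevreySemigroup (S : ℝ → X →L[ℂ] X) (δ t₀ : ℝ) : Prop :=
  ContDiffOn ℝ ∞ S (Ioi t₀) ∧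
  ∀ K : Set ℝ, IsCompact K → K ⊆ Ioi t₀ → ∀ θ : ℝ, 0 < θ →
    ∃ C : ℝ, ∀ t ∈ K, ∀ n : ℕ, ‖iteratedDeriv n S t‖ ≤ C * θ ^ n * ((n ! : ℕ) : ℝ) ^ δ

/-- The bounded operator `R` is the resolvent `(z - A)⁻¹` of the unbounded operator `A`.
Thus `z` lies in the resolvent set of `A` iff such an `R` exists. -/
def IsResolventAt (A : X →ₗ.[ℂ] X) (z : ℂ) (R : X →L[ℂ] X) : Prop :=
  (∀ F : X, ∃ h : R F ∈ A.domain, z • R F - A ⟨R F, h⟩ = F) ∧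
  ∀ U : A.domain, R (z • (U : X) - A U) = U

end Semigroup

/-! ## The Sobolev space `H²` on an interval -/

/-- `f ∈ H²(a, b)` with `f' = g` and `f'' = h`: the function `h` is square integrable on `(a, b)`,
and on `(a, b)` the functions `g` and `f` are indefinite integrals of `h` and of `g`. (In dimension
one this says that `f` is the continuously differentiable representative of an element of
`H²(a, b)`, `g` is its derivative, and `h` its second weak derivative.) -/
structure HasH2Deriv (a b : ℝ) (f g h : ℝ → ℂ) : Prop where
  memLp : MemLp h 2 (volume.restrict (Ioo a b))
  sub_eq_snd : ∀ x ∈ Ioo a b, ∀ y ∈ Ioo a b, g y - g x = ∫ t in x..y, h t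
  sub_eq_fst : ∀ x ∈ Ioo a b, ∀ y ∈ Ioo a b, f y - f x = ∫ t in x..y, g t

/-- The jump `f(ξ⁺) - f(ξ⁻)` exists (both one-sided limits exist) and equals `c`. -/
def HasJump (f : ℝ → ℂ) (ξ : ℝ) (c : ℂ) : Prop :=
  ∃ l r : ℂ, Tendsto f (𝓝[<] ξ) (𝓝 l) ∧ Tendsto f (𝓝[>] ξ) (𝓝 r) ∧ r - l = c

lemma HasJump.add {f f' : ℝ → ℂ} {ξ : ℝ} {c c' : ℂ} (h : HasJump f ξ c) (h' : HasJump f' ξ c') :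
    HasJump (f + f') ξ (c + c') := by
  obtain ⟨l, r, h1, h2, h3⟩ := h
  obtain ⟨l', r', h1', h2', h3'⟩ := h'
  exact ⟨l + l', r + r', h1.add h1', h2.add h2', by rw [← h3, ← h3']; ring⟩

lemma HasJump.const_smul {f : ℝ → ℂ} {ξ : ℝ} {c : ℂ} (h : HasJump f ξ c) (z : ℂ) :
    HasJump (z • f) ξ (z * c) := by
  obtain ⟨l, r, h1, h2, h3⟩ := h
  exact ⟨z • l, z • r, h1.const_smul z, h2.const_smul z, by
    rw [← h3, smul_eq_mul, smul_eq_mul]; ring⟩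

namespace HasH2Deriv

variable {a b : ℝ} {f g h f' g' h' : ℝ → ℂ}

lemma uIcc_sub {x y : ℝ} (hx : x ∈ Ioo a b) (hy : y ∈ Ioo a b) : uIcc x y ⊆ Ioo a b :=
  (ordConnected_Ioo).uIcc_subset hx hy

lemma intervalIntegrable_snd (H : HasH2Deriv a b f g h) {x y : ℝ} (hx : x ∈ Ioo a b)
    (hy : y ∈ Ioo a b) : IntervalIntegrable h volume x y := by
  have h1 : IntegrableOn h (Ioo a b) volume := H.memLp.integrable (by norm_num)
  rw [intervalIntegrable_iff]
  exact h1.mono_set (uIoc_subset_uIcc.trans (uIcc_sub hx hy))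

lemma continuousOn_of_primitive {g h : ℝ → ℂ}
    (hi : ∀ x ∈ Ioo a b, ∀ y ∈ Ioo a b, IntervalIntegrable h volume x y)
    (hg : ∀ x ∈ Ioo a b, ∀ y ∈ Ioo a b, g y - g x = ∫ t in x..y, h t) :
    ContinuousOn g (Ioo a b) := by
  intro x hx
  obtain ⟨c, hac, hcx⟩ := exists_between hx.1
  obtain ⟨d, hxd, hdb⟩ := exists_between hx.2
  have hc : c ∈ Ioo a b := ⟨hac, hcx.trans hx.2⟩
  have hd : d ∈ Ioo a b := ⟨hx.1.trans hxd, hdb⟩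
  have h1 : ContinuousOn (fun y => ∫ t in c..y, h t) (uIcc c d) :=
    intervalIntegral.continuousOn_primitive_interval'
      (hi c hc d hd) left_mem_uIcc
  have h2 : ContinuousOn g (uIcc c d) := by
    refine (h1.add (continuousOn_const (c := g c))).congr ?_
    intro y hy
    have := hg c hc y (uIcc_sub hc hd hy)
    change g y = (∫ t in c..y, h t) + g c
    rw [← this]; ring
  have hcd : Icc c d ∈ 𝓝 x := Icc_mem_nhds hcx hxd
  rw [uIcc_of_le (hcx.trans hxd).le] at h2
  exact (h2.continuousAt hcd).continuousWithinAt

lemma continuousOn_fst (H : HasH2Deriv a b f g h) : ContinuousOn g (Ioo a b) :=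
  continuousOn_of_primitive (fun _ hx _ hy => H.intervalIntegrable_snd hx hy) H.sub_eq_snd

lemma intervalIntegrable_fst (H : HasH2Deriv a b f g h) {x y : ℝ} (hx : x ∈ Ioo a b)
    (hy : y ∈ Ioo a b) : IntervalIntegrable g volume x y :=
  (H.continuousOn_fst.mono (uIcc_sub hx hy)).intervalIntegrable

lemma continuousOn (H : HasH2Deriv a b f g h) : ContinuousOn f (Ioo a b) :=
  continuousOn_of_primitive (fun _ hx _ hy => H.intervalIntegrable_fst hx hy) H.sub_eq_fst

lemma add (H : HasH2Deriv a b f g h) (H' : HasH2Deriv a b f' g' h') :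
    HasH2Deriv a b (f + f') (g + g') (h + h') where
  memLp := H.memLp.add H'.memLp
  sub_eq_snd x hx y hy := by
    have e := intervalIntegral.integral_add (H.intervalIntegrable_snd hx hy)
      (H'.intervalIntegrable_snd hx hy)
    simp only [Pi.add_apply]
    rw [e, ← H.sub_eq_snd x hx y hy, ← H'.sub_eq_snd x hx y hy]; ring
  sub_eq_fst x hx y hy := by
    have e := intervalIntegral.integral_add (H.intervalIntegrable_fst hx hy)
      (H'.intervalIntegrable_fst hx hy)
    simp only [Pi.add_apply]
    rw [e, ← H.sub_eq_fst x hx y hy, ← H'.sub_eq_fst x hx y hy]; ring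

lemma const_smul (H : HasH2Deriv a b f g h) (z : ℂ) :
    HasH2Deriv a b (z • f) (z • g) (z • h) where
  memLp := H.memLp.const_smul z
  sub_eq_snd x hx y hy := by
    simp only [Pi.smul_apply]
    rw [intervalIntegral.integral_smul, ← H.sub_eq_snd x hx y hy, smul_sub]
  sub_eq_fst x hx y hy := by
    simp only [Pi.smul_apply]
    rw [intervalIntegral.integral_smul, ← H.sub_eq_fst x hx y hy, smul_sub]

lemma zero : HasH2Deriv a b 0 0 0 where
  memLp := MemLp.zero
  sub_eq_snd := by simp
  sub_eq_fst := by simp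

lemma congr_snd (H : HasH2Deriv a b f g h) (e : h' =ᵐ[volume.restrict (Ioo a b)] h) :
    HasH2Deriv a b f g h' where
  memLp := (memLp_congr_ae e).2 H.memLp
  sub_eq_snd x hx y hy := by
    rw [H.sub_eq_snd x hx y hy]
    apply intervalIntegral.integral_congr_ae
    have e' := (ae_restrict_iff' measurableSet_Ioo).1 e
    filter_upwards [e'] with t ht htm
    exact (ht (uIcc_sub hx hy (uIoc_subset_uIcc htm))).symm
  sub_eq_fst := H.sub_eq_fst

/-- A function all of whose integrals over compact subintervals of `(a, b)` vanish is zero a.e. -/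
lemma ae_zero_of_integral_zero {h : ℝ → ℂ} (hi : IntegrableOn h (Ioo a b) volume)
    (h0 : ∀ x ∈ Ioo a b, ∀ y ∈ Ioo a b, ∫ t in x..y, h t = 0) :
    h =ᵐ[volume.restrict (Ioo a b)] 0 := by
  rcases lt_or_ge a b with hab | hab
  swap
  · rw [Ioo_eq_empty (not_lt.2 hab), Measure.restrict_empty, ae_zero]; exact eventually_bot
  have hL : LocallyIntegrable ((Ioo a b).indicator h) volume :=
    ((integrable_indicator_iff measurableSet_Ioo).2 hi).locallyIntegrable
  obtain ⟨c, hc⟩ := exists_between hab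
  have key := LocallyIntegrable.ae_hasDerivAt_integral hL
  rw [Filter.EventuallyEq, ae_restrict_iff' measurableSet_Ioo]
  filter_upwards [key] with x hx hxm
  have h1 := hx c
  have h2 : (fun y => ∫ t in c..y, (Ioo a b).indicator h t) =ᶠ[𝓝 x] fun _ => 0 := by
    filter_upwards [Ioo_mem_nhds hxm.1 hxm.2] with y hy
    rw [← h0 c hc y hy]
    apply intervalIntegral.integral_congr
    intro t ht
    exact indicator_of_mem (uIcc_sub hc hy ht) h
  have h3 := (h1.congr_of_eventuallyEq h2.symm).unique (hasDerivAt_const x (0 : ℂ))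
  rw [indicator_of_mem hxm] at h3
  simpa using h3

/-- The derivatives are determined by the almost everywhere class of the function. -/
lemma ae_zero (H : HasH2Deriv a b f g h) (e : f =ᵐ[volume.restrict (Ioo a b)] 0) :
    h =ᵐ[volume.restrict (Ioo a b)] 0 := by
  have hf : EqOn f 0 (Ioo a b) :=
    Measure.eqOn_open_of_ae_eq e isOpen_Ioo H.continuousOn continuousOn_const
  have hg : EqOn g 0 (Ioo a b) := by
    intro x hx
    obtain ⟨d, hxd, hdb⟩ := exists_between hx.2
    have hd : d ∈ Ioo a b := ⟨hx.1.trans hxd, hdb⟩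
    have hder : HasDerivAt (fun y => ∫ t in d..y, g t) (g x) x :=
      intervalIntegral.integral_hasDerivAt_right (H.intervalIntegrable_fst hd hx)
        (H.continuousOn_fst.stronglyMeasurableAtFilter isOpen_Ioo x hx)
        (H.continuousOn_fst.continuousAt (isOpen_Ioo.mem_nhds hx))
    have h2 : (fun _ => (0 : ℂ)) =ᶠ[𝓝 x] (fun y => ∫ t in d..y, g t) := by
      filter_upwards [isOpen_Ioo.mem_nhds hx] with y hy
      rw [← H.sub_eq_fst d hd y hy, hf hd, hf hy]; simp
    exact (hder.congr_of_eventuallyEq h2).unique (hasDerivAt_const x (0 : ℂ))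
  refine ae_zero_of_integral_zero (H.memLp.integrable (by norm_num)) ?_
  intro x hx y hy
  rw [← H.sub_eq_snd x hx y hy, hg hx, hg hy]; simp

end HasH2Deriv

/-! ## The beam -/

/-- The data of the beam: it occupies `(0, ℓ)`, is elastic on `(0, ℓ₀) ∪ (ℓ₁, ℓ)` and
viscoelastic of Kelvin-Voigt type on `(ℓ₀, ℓ₁)`, and carries pointwise dampers at `ξ₁` (elastic
part) and `ξ₂` (viscoelastic part). -/
structure BeamData where
  ℓ : ℝ
  ℓ₀ : ℝ
  ℓ₁ : ℝ
  ξ₁ : ℝ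
  ξ₂ : ℝ
  α₀ : ℝ
  α₁ : ℝ
  α₂ : ℝ
  γ₁ : ℝ
  γ₂ : ℝ
  γ₃ : ℝ
  ξ₁_pos : 0 < ξ₁
  ξ₁_lt : ξ₁ < ℓ₀
  lt_ξ₂ : ℓ₀ < ξ₂
  ξ₂_lt : ξ₂ < ℓ₁
  ℓ₁_lt : ℓ₁ < ℓ
  α₀_pos : 0 < α₀
  α₁_pos : 0 < α₁
  α₂_pos : 0 < α₂
  γ₁_pos : 0 < γ₁
  γ₂_pos : 0 < γ₂
  γ₃_pos : 0 < γ₃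

namespace BeamData

open Classical in
/-- The stiffness `α(x)`: `α₂` on the viscoelastic part, `α₁` on the elastic part. -/
def α (p : BeamData) (x : ℝ) : ℝ := if x ∈ Ioo p.ℓ₀ p.ℓ₁ then p.α₂ else p.α₁

open Classical in
/-- The viscosity `κ(x)`: `α₀` on the viscoelastic part, `0` on the elastic part. -/
def κ (p : BeamData) (x : ℝ) : ℝ := if x ∈ Ioo p.ℓ₀ p.ℓ₁ then p.α₀ else 0

/-- Lebesgue measure on `(0, ℓ)`. -/
abbrev vol (p : BeamData) : Measure ℝ := volume.restrict (Ioo 0 p.ℓ)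

/-- The complex space `L²(0, ℓ)`. -/
abbrev L2 (p : BeamData) : Type := Lp ℂ 2 p.vol

/-- The vector space `H²₀(0, ℓ)`. An element is a function `u` recorded together with its
derivative `u'` and its second weak derivative `u'' ∈ L²(0, ℓ)`; `u` and `u'` are extended by zero
outside `(0, ℓ)`, and the clamped boundary conditions `u = u' = 0` at `0` and `ℓ` say that these
extensions are continuous. -/
def h20 (p : BeamData) : Submodule ℂ ((ℝ → ℂ) × (ℝ → ℂ) × p.L2) where
  carrier := {u | HasH2Deriv 0 p.ℓ u.1 u.2.1 u.2.2 ∧ Continuous u.1 ∧ Continuous u.2.1 ∧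
    ∀ x, x ∉ Ioo 0 p.ℓ → u.1 x = 0 ∧ u.2.1 x = 0}
  add_mem' := by
    rintro u w ⟨h1, h2, h3, h4⟩ ⟨k1, k2, k3, k4⟩
    refine ⟨(h1.add k1).congr_snd (Lp.coeFn_add _ _), h2.add k2, h3.add k3, fun x hx => ?_⟩
    simp [h4 x hx, k4 x hx]
  zero_mem' := by
    refine ⟨HasH2Deriv.zero.congr_snd (Lp.coeFn_zero _ _ _), continuous_const, continuous_const,
      fun x hx => ?_⟩
    simp
  smul_mem' := by
    rintro z u ⟨h1, h2, h3, h4⟩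
    refine ⟨(h1.const_smul z).congr_snd (Lp.coeFn_smul _ _), h2.const_smul z, h3.const_smul z,
      fun x hx => ?_⟩
    simp [h4 x hx]

/-- The space `H²₀(0, ℓ)` as a type, to be normed by `(∫ α |u''|²)^(1/2)`. -/
def H20 (p : BeamData) : Type := ↥p.h20

namespace H20

variable {p : BeamData}

instance : AddCommGroup p.H20 := inferInstanceAs (AddCommGroup ↥p.h20)
instance : Module ℂ p.H20 := inferInstanceAs (Module ℂ ↥p.h20)

/-- The function `u`. -/
def fn (u : p.H20) : ℝ → ℂ := (Subtype.val u).1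
/-- The derivative `u'`. -/
def d1 (u : p.H20) : ℝ → ℂ := (Subtype.val u).2.1
/-- The second derivative `u''`. -/
def d2 (u : p.H20) : p.L2 := (Subtype.val u).2.2

lemma fn_add (u w : p.H20) : (u + w).fn = u.fn + w.fn := rfl
lemma d1_add (u w : p.H20) : (u + w).d1 = u.d1 + w.d1 := rfl
lemma d2_add (u w : p.H20) : (u + w).d2 = u.d2 + w.d2 := rfl
lemma fn_smul (z : ℂ) (u : p.H20) : (z • u).fn = z • u.fn := rfl
lemma d1_smul (z : ℂ) (u : p.H20) : (z • u).d1 = z • u.d1 := rfl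
lemma d2_smul (z : ℂ) (u : p.H20) : (z • u).d2 = z • u.d2 := rfl
lemma fn_zero : (0 : p.H20).fn = 0 := rfl
lemma d1_zero : (0 : p.H20).d1 = 0 := rfl
lemma d2_zero : (0 : p.H20).d2 = 0 := rfl

lemma hasH2Deriv (u : p.H20) : HasH2Deriv 0 p.ℓ u.fn u.d1 u.d2 := (Subtype.property u).1
lemma continuous_fn (u : p.H20) : Continuous u.fn := (Subtype.property u).2.1
lemma continuous_d1 (u : p.H20) : Continuous u.d1 := (Subtype.property u).2.2.1
lemma fn_eq_zero (u : p.H20) {x : ℝ} (hx : x ∉ Ioo 0 p.ℓ) : u.fn x = 0 :=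
  ((Subtype.property u).2.2.2 x hx).1
lemma d1_eq_zero (u : p.H20) {x : ℝ} (hx : x ∉ Ioo 0 p.ℓ) : u.d1 x = 0 :=
  ((Subtype.property u).2.2.2 x hx).2

lemma ext {u w : p.H20} (h1 : u.fn = w.fn) (h2 : u.d1 = w.d1) (h3 : u.d2 = w.d2) : u = w :=
  Subtype.ext (Prod.ext h1 (Prod.ext h2 h3))

/-- A continuous function vanishing off `(0, L)` and constant on `(0, L)` is zero. -/
lemma zero_of_const {L : ℝ} {f : ℝ → ℂ} (hc : Continuous f) (h0 : ∀ x, x ∉ Ioo 0 L → f x = 0)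
    (h : ∀ x ∈ Ioo 0 L, ∀ y ∈ Ioo 0 L, f y - f x = 0) : f = 0 := by
  funext x
  by_cases hx : x ∈ Ioo 0 L
  swap
  · exact h0 x hx
  have h1 : Tendsto f (𝓝[>] 0) (𝓝 (f 0)) := hc.continuousAt.continuousWithinAt
  have h2 : Tendsto f (𝓝[>] 0) (𝓝 (f x)) := by
    refine tendsto_const_nhds.congr' ?_
    filter_upwards [Ioo_mem_nhdsGT (hx.1.trans hx.2)] with y hy
    exact (sub_eq_zero.1 (h y hy x hx))
  have := tendsto_nhds_unique h2 h1
  rw [this, h0 0 (by simp)]; rfl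

lemma eq_zero_of_d2 (u : p.H20) (h : u.d2 = 0) : u = 0 := by
  have e : (u.d2 : ℝ → ℂ) =ᵐ[p.vol] 0 := by rw [h]; exact Lp.coeFn_zero _ _ _
  have H : HasH2Deriv 0 p.ℓ u.fn u.d1 0 := u.hasH2Deriv.congr_snd e.symm
  have h1 : u.d1 = 0 := by
    refine zero_of_const u.continuous_d1 (fun x hx => u.d1_eq_zero hx) ?_
    intro x hx y hy
    simpa using H.sub_eq_snd x hx y hy
  have h0 : u.fn = 0 := by
    refine zero_of_const u.continuous_fn (fun x hx => u.fn_eq_zero hx) ?_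
    intro x hx y hy
    simpa [h1] using H.sub_eq_fst x hx y hy
  exact ext h0 h1 h

end H20

lemma α_pos (p : BeamData) (x : ℝ) : 0 < p.α x := by
  unfold α; split_ifs
  exacts [p.α₂_pos, p.α₁_pos]

lemma measurable_α (p : BeamData) : Measurable p.α :=
  Measurable.ite measurableSet_Ioo measurable_const measurable_const

lemma α_le (p : BeamData) (x : ℝ) : p.α x ≤ max p.α₁ p.α₂ := by
  unfold α; split_ifs
  exacts [le_max_right _ _, le_max_left _ _]

lemma integrable_α_inner (p : BeamData) (f g : p.L2) :
    Integrable (fun x => (p.α x : ℂ) * inner ℂ (f x) (g x)) p.vol := by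
  refine (L2.integrable_inner (𝕜 := ℂ) f g).bdd_mul (c := max p.α₁ p.α₂)
    (Complex.measurable_ofReal.comp p.measurable_α).aestronglyMeasurable ?_
  refine Eventually.of_forall fun x => ?_
  rw [Complex.norm_real, Real.norm_of_nonneg (p.α_pos x).le]
  exact p.α_le x

/-- The inner product `∫₀^ℓ α u'' conj(w'') dx` on `H²₀(0, ℓ)`
(conjugate-linear in the first argument, as is usual in Mathlib). -/
@[reducible] def innerCore (p : BeamData) : InnerProductSpace.Core ℂ p.H20 where
  inner u w := ∫ x, (p.α x : ℂ) * inner ℂ (u.d2 x) (w.d2 x) ∂p.vol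
  conj_inner_symm u w := by
    rw [← integral_conj]
    refine integral_congr_ae (Eventually.of_forall fun x => ?_)
    simp only [map_mul, Complex.conj_ofReal, inner_conj_symm]
  re_inner_nonneg u := by
    have h : ∀ x, (p.α x : ℂ) * inner ℂ (u.d2 x) (u.d2 x)
        = ((p.α x * ‖u.d2 x‖ ^ 2 : ℝ) : ℂ) := fun x => by
      rw [inner_self_eq_norm_sq_to_K]; push_cast; rfl
    simp only [h]
    rw [integral_complex_ofReal]
    exact integral_nonneg fun x => mul_nonneg (p.α_pos x).le (by positivity)
  add_left u v w := by
    rw [← integral_add (p.integrable_α_inner _ _) (p.integrable_α_inner _ _)]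
    refine integral_congr_ae ?_
    rw [H20.d2_add]
    filter_upwards [Lp.coeFn_add u.d2 v.d2] with x hx
    rw [hx, Pi.add_apply, inner_add_left, mul_add]
  smul_left u w z := by
    rw [← integral_const_mul]
    refine integral_congr_ae ?_
    rw [H20.d2_smul]
    filter_upwards [Lp.coeFn_smul z u.d2] with x hx
    rw [hx, Pi.smul_apply, inner_smul_left]; ring
  definite u hu := by
    apply H20.eq_zero_of_d2
    have h : ∀ x, (p.α x : ℂ) * inner ℂ (u.d2 x) (u.d2 x)
        = ((p.α x * ‖u.d2 x‖ ^ 2 : ℝ) : ℂ) := fun x => by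
      rw [inner_self_eq_norm_sq_to_K]; push_cast; rfl
    have hint := p.integrable_α_inner u.d2 u.d2
    simp only [h] at hu hint
    rw [integral_complex_ofReal, Complex.ofReal_eq_zero] at hu
    have hint' : Integrable (fun x => p.α x * ‖u.d2 x‖ ^ 2) p.vol := by
      exact_mod_cast hint.re
    rw [integral_eq_zero_iff_of_nonneg
      (fun x => mul_nonneg (p.α_pos x).le (by positivity)) hint'] at hu
    rw [Lp.eq_zero_iff_ae_eq_zero]
    filter_upwards [hu] with x hx
    simpa [(p.α_pos x).ne'] using hx

instance (p : BeamData) : NormedAddCommGroup p.H20 := p.innerCore.toNormedAddCommGroup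
instance (p : BeamData) : InnerProductSpace ℂ p.H20 := .ofCore p.innerCore.toCore

/-- The phase space `𝓗 = H²₀(0, ℓ) × L²(0, ℓ)` with
`‖(u, v)‖² = ∫₀^ℓ (|v|² + α |u''|²) dx`. -/
abbrev Phase (p : BeamData) : Type := WithLp 2 (p.H20 × p.L2)

/-- `U = (u, v)` belongs to the domain of the beam operator and `𝓐 U = F = (F₁, F₂)`. That is,
`v ∈ H²₀(0, ℓ)`, `F₁ = v`, the bending moment `M = α u'' + κ v''` is `H²` on each of the intervals
`(0, ξ₁)`, `(ξ₁, ℓ₀)`, `(ℓ₀, ξ₂)`, `(ξ₂, ℓ₁)`, `(ℓ₁, ℓ)` (with derivatives `M₁`, `M₂` there), the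
transmission conditions at the points `ξ₁`, `ℓ₀`, `ξ₂`, `ℓ₁` hold, and `F₂ = -M''`. -/
def OperatorGraph (p : BeamData) (U F : p.Phase) : Prop :=
  -- the velocity `v` is the element `F.fst` of `H²₀(0, ℓ)`
  (U.snd : ℝ → ℂ) =ᵐ[p.vol] F.fst.fn ∧
  ∃ M M₁ M₂ : ℝ → ℂ,
    (∀ᵐ x ∂p.vol, M x = p.α x * U.fst.d2 x + p.κ x * F.fst.d2 x) ∧
    HasH2Deriv 0 p.ξ₁ M M₁ M₂ ∧ HasH2Deriv p.ξ₁ p.ℓ₀ M M₁ M₂ ∧ HasH2Deriv p.ℓ₀ p.ξ₂ M M₁ M₂ ∧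
    HasH2Deriv p.ξ₂ p.ℓ₁ M M₁ M₂ ∧ HasH2Deriv p.ℓ₁ p.ℓ M M₁ M₂ ∧
    HasJump M p.ℓ₀ 0 ∧ HasJump M₁ p.ℓ₀ 0 ∧ HasJump M p.ℓ₁ 0 ∧ HasJump M₁ p.ℓ₁ 0 ∧
    HasJump M p.ξ₁ 0 ∧ HasJump M₁ p.ξ₁ (-(p.γ₁ * F.fst.fn p.ξ₁)) ∧
    HasJump M p.ξ₂ (p.γ₃ * F.fst.d1 p.ξ₂) ∧ HasJump M₁ p.ξ₂ (-(p.γ₂ * F.fst.fn p.ξ₂)) ∧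
    (∀ᵐ x ∂p.vol, F.snd x = -M₂ x)

lemma OperatorGraph.add {p : BeamData} {U F U' F' : p.Phase} (h : p.OperatorGraph U F)
    (h' : p.OperatorGraph U' F') : p.OperatorGraph (U + U') (F + F') := by
  obtain ⟨hv, M, M₁, M₂, e, a1, a2, a3, a4, a5, j1, j2, j3, j4, j5, j6, j7, j8, eF⟩ := h
  obtain ⟨hv', M', M₁', M₂', e', b1, b2, b3, b4, b5, k1, k2, k3, k4, k5, k6, k7, k8, eF'⟩ := h'
  refine ⟨?_, M + M', M₁ + M₁', M₂ + M₂', ?_, a1.add b1, a2.add b2, a3.add b3, a4.add b4,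
    a5.add b5, by simpa using j1.add k1, by simpa using j2.add k2, by simpa using j3.add k3,
    by simpa using j4.add k4, by simpa using j5.add k5, ?_, ?_, ?_, ?_⟩
  · filter_upwards [hv, hv', Lp.coeFn_add U.snd U'.snd] with x h1 h2 h3
    rw [WithLp.add_snd, h3, WithLp.add_fst, H20.fn_add, Pi.add_apply, Pi.add_apply, h1, h2]
  · filter_upwards [e, e', Lp.coeFn_add U.fst.d2 U'.fst.d2, Lp.coeFn_add F.fst.d2 F'.fst.d2]
      with x h1 h2 h3 h4
    rw [WithLp.add_fst, WithLp.add_fst, H20.d2_add, H20.d2_add, h3, h4, Pi.add_apply, h1, h2,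
      Pi.add_apply, Pi.add_apply]
    ring
  · convert j6.add k6 using 1
    rw [WithLp.add_fst, H20.fn_add, Pi.add_apply]; ring
  · convert j7.add k7 using 1
    rw [WithLp.add_fst, H20.d1_add, Pi.add_apply]; ring
  · convert j8.add k8 using 1
    rw [WithLp.add_fst, H20.fn_add, Pi.add_apply]; ring
  · filter_upwards [eF, eF', Lp.coeFn_add F.snd F'.snd] with x h1 h2 h3
    rw [WithLp.add_snd, h3, Pi.add_apply, h1, h2, Pi.add_apply]; ring

lemma OperatorGraph.const_smul {p : BeamData} {U F : p.Phase} (h : p.OperatorGraph U F) (z : ℂ) :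
    p.OperatorGraph (z • U) (z • F) := by
  obtain ⟨hv, M, M₁, M₂, e, a1, a2, a3, a4, a5, j1, j2, j3, j4, j5, j6, j7, j8, eF⟩ := h
  refine ⟨?_, z • M, z • M₁, z • M₂, ?_, a1.const_smul z, a2.const_smul z, a3.const_smul z,
    a4.const_smul z, a5.const_smul z, by simpa using j1.const_smul z,
    by simpa using j2.const_smul z, by simpa using j3.const_smul z,
    by simpa using j4.const_smul z, by simpa using j5.const_smul z, ?_, ?_, ?_, ?_⟩
  · filter_upwards [hv, Lp.coeFn_smul z U.snd] with x h1 h3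
    rw [WithLp.smul_snd, h3, WithLp.smul_fst, H20.fn_smul, Pi.smul_apply, Pi.smul_apply, h1]
  · filter_upwards [e, Lp.coeFn_smul z U.fst.d2, Lp.coeFn_smul z F.fst.d2] with x h1 h3 h4
    rw [WithLp.smul_fst, WithLp.smul_fst, H20.d2_smul, H20.d2_smul, h3, h4, Pi.smul_apply, h1,
      Pi.smul_apply, Pi.smul_apply, smul_eq_mul, smul_eq_mul, smul_eq_mul]
    ring
  · convert j6.const_smul z using 1
    rw [WithLp.smul_fst, H20.fn_smul, Pi.smul_apply, smul_eq_mul]; ring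
  · convert j7.const_smul z using 1
    rw [WithLp.smul_fst, H20.d1_smul, Pi.smul_apply, smul_eq_mul]; ring
  · convert j8.const_smul z using 1
    rw [WithLp.smul_fst, H20.fn_smul, Pi.smul_apply, smul_eq_mul]; ring
  · filter_upwards [eF, Lp.coeFn_smul z F.snd] with x h1 h3
    rw [WithLp.smul_snd, h3, Pi.smul_apply, h1, Pi.smul_apply, smul_eq_mul, smul_eq_mul]; ring

/-- The graph of the beam operator as a subspace. -/
def graph (p : BeamData) : Submodule ℂ (p.Phase × p.Phase) where
  carrier := {x | p.OperatorGraph x.1 x.2}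
  add_mem' h h' := h.add h'
  zero_mem' := by
    refine ⟨?_, 0, 0, 0, ?_, .zero, .zero, .zero, .zero, .zero, ?_⟩
    · exact Lp.coeFn_zero _ _ _
    · filter_upwards [Lp.coeFn_zero ℂ 2 p.vol] with x hx
      change (0 : ℂ) = p.α x * ((0 : p.L2) : ℝ → ℂ) x + p.κ x * ((0 : p.L2) : ℝ → ℂ) x
      rw [hx]; simp
    · have hj : ∀ ξ, HasJump 0 ξ 0 := fun ξ => ⟨0, 0, tendsto_const_nhds, tendsto_const_nhds,
        by simp⟩
      refine ⟨hj _, hj _, hj _, hj _, hj _, by simpa [H20.fn_zero] using hj _,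
        by simpa [H20.d1_zero] using hj _, by simpa [H20.fn_zero] using hj _, ?_⟩
      filter_upwards [Lp.coeFn_zero ℂ 2 p.vol] with x hx
      change ((0 : p.L2) : ℝ → ℂ) x = -(0 : ℂ)
      rw [hx]; simp
  smul_mem' z _ h := h.const_smul z

/-- The graph is single-valued. -/
lemma graph_functional (p : BeamData) (x : p.Phase × p.Phase) (hx : x ∈ p.graph)
    (h0 : x.1 = 0) : x.2 = 0 := by
  obtain ⟨U, F⟩ := x
  change U = 0 at h0
  change p.OperatorGraph U F at hx
  change F = 0
  subst h0
  obtain ⟨hv, M, M₁, M₂, e, a1, a2, a3, a4, a5, -, -, -, -, -, -, -, -, eF⟩ := hx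
  have hz : ((0 : p.L2) : ℝ → ℂ) =ᵐ[p.vol] 0 := Lp.coeFn_zero _ _ _
  have hF1 : F.fst.fn =ᵐ[p.vol] 0 := hv.symm.trans hz
  have hd2 : (F.fst.d2 : ℝ → ℂ) =ᵐ[p.vol] 0 := F.fst.hasH2Deriv.ae_zero hF1
  have hF : F.fst = 0 := H20.eq_zero_of_d2 _ ((Lp.eq_zero_iff_ae_eq_zero).2 hd2)
  have hM : M =ᵐ[p.vol] 0 := by
    filter_upwards [e, hz, hd2] with x h1 h2 h3
    have h2' : ((0 : p.Phase).fst.d2 : ℝ → ℂ) x = 0 := h2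
    rw [h1, h2', h3]; simp
  have o1 := p.ξ₁_pos
  have o2 := p.ξ₁_lt
  have o3 := p.lt_ξ₂
  have o4 := p.ξ₂_lt
  have o5 := p.ℓ₁_lt
  have main : ∀ a b : ℝ, 0 ≤ a → b ≤ p.ℓ → HasH2Deriv a b M M₁ M₂ →
      ∀ᵐ x, x ∈ Ioo a b → M₂ x = 0 := by
    intro a b ha hb H
    rw [← ae_restrict_iff' measurableSet_Ioo]
    exact H.ae_zero (ae_restrict_of_ae_restrict_of_subset (Ioo_subset_Ioo ha hb) hM)
  have hM2 : M₂ =ᵐ[p.vol] 0 := by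
    rw [Filter.EventuallyEq, ae_restrict_iff' measurableSet_Ioo]
    have hn : ∀ c : ℝ, ∀ᵐ x, x ≠ c := fun c => by
      rw [ae_iff]; simp
    filter_upwards [main _ _ le_rfl (by linarith) a1, main _ _ (by linarith) (by linarith) a2,
      main _ _ (by linarith) (by linarith) a3, main _ _ (by linarith) (by linarith) a4,
      main _ _ (by linarith) le_rfl a5, hn p.ξ₁, hn p.ℓ₀, hn p.ξ₂, hn p.ℓ₁]
      with x h1 h2 h3 h4 h5 n1 n2 n3 n4 hx
    rcases lt_or_gt_of_ne n1 with c | c1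
    · exact h1 ⟨hx.1, c⟩
    rcases lt_or_gt_of_ne n2 with c | c2
    · exact h2 ⟨c1, c⟩
    rcases lt_or_gt_of_ne n3 with c | c3
    · exact h3 ⟨c2, c⟩
    rcases lt_or_gt_of_ne n4 with c | c4
    · exact h4 ⟨c3, c⟩
    exact h5 ⟨c4, hx.2⟩
  have hS : F.snd = 0 := by
    rw [Lp.eq_zero_iff_ae_eq_zero]
    filter_upwards [eF, hM2] with x h1 h2
    rw [h1, h2]; simp
  exact WithLp.ofLp_injective 2 (Prod.ext hF hS)

/-- The beam operator `𝓐 (u, v) = (v, -(α u'' + κ v'')'')` in `𝓗`, with its domain. -/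
def operator (p : BeamData) : p.Phase →ₗ.[ℂ] p.Phase := p.graph.toLinearPMap

lemma mem_operator_graph (p : BeamData) (U F : p.Phase) :
    (U, F) ∈ p.operator.graph ↔ p.OperatorGraph U F := by
  rw [operator, Submodule.toLinearPMap_graph_eq _ p.graph_functional]; rfl

end BeamData

end

/-! ## Indefinite integrals on compact intervals -/

/-! Green's formula for `𝓐 U = F`, tested with the velocity `v`, shows that Re⟨U, 𝓐U⟩ is minus the
energy lost to the viscosity and to the dampers at ξ₁, ξ₂ (`OperatorGraph.re_inner`), so the
operator is dissipative. The equation `𝓐 U = F` can be integrated explicitly up to an affine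
function, and the weak form bounds the solution (`exists_operatorGraph`,
`OperatorGraph.exists_norm_le`); hence 0 is in the resolvent set, and the Lumer–Phillips theorem
(`IsDissipative.exists_semigroup`) yields the semigroup. By
`IsDissipative.exists_resolvent_of_bound` the imaginary axis then only requires a priori bounds for
iλU − 𝓐U = F.

These bounds are proved for the unknowns v = iλu − F₁ and M. On an elastic segment v'' = iλM/α − f₂
and M'' = g − iλv. Write |λ| = μ⁸, E = ‖U‖, ‖F‖ = μ²n and r = 2√(En) + n; the claim is E ≤ Cn. (a)
Dissipation bounds v'' and M in L² of the Kelvin–Voigt part, and v(ξ₁), by Cμr. Interpolation on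
windows of length μ⁻² gives |v|, |v'| ≲ r and |M'| ≲ μ⁴r pointwise there
(`IsPrim.viscoelastic_bound_of_high`). (b) These traces pass through the interfaces, but the same
interpolation gives only μ²r for M, which is too weak. On the elastic side w = M/√α − iσv, σ = sgn
λ, satisfies w'' = k²w + data with k of order μ⁴. Integrating the first order relation for w' − kw
expresses M at the end by M'/k, v'/k and v, up to an exponentially damped contribution of the far
end (`ElasticOn.factor_isPrim`, `ElasticOn.exists_moment_bound`). (c) A multiplier centred at the
clamped end bounds the elastic energy by the interface terms and by the jump of M' at ξ₁
(`ElasticOn.multiplier_estimate`). Together E² ≤ C(rE + r² + (E/μ⁶)²)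
(`FrequencySystem.exists_energy_sq_le`); absorbing the last term gives E ≤ Cr, and Young's
inequality removes the √(En) in r. At a fixed λ ≠ 0 cruder bounds suffice: viscoelastic traces,
followed by a Grönwall argument from the interfaces outwards (`FrequencySystem.exists_energy_le`).

Gevrey regularity is abstract (`IsDissipative.isGevreySemigroup`). On Re z = 1 the resolvent is
O(|z|^(-1/4)). The Laplace transform of t^m S(t) is m! R(z)^(m+1), and with m = 4k+4 the transform
of t^m S(t)A^k is O(|z|^(-5/4)), hence integrable; Fourier inversion gives ‖S(t)A^k‖ ≤ D e^t
t^(-(4k+4)) (`IsC0Semigroup.exists_norm_apply_sub_one_pow_le`). The n-th derivative A^n S(t), n = kj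
+ r, splits into j factors A^k S(s) with s of order t/j and one remainder, so it is bounded by about
(n!)^(4+4/k) times a geometric factor. For k large the exponent is below δ, and the gap pays for the
geometric factor and for θ^n (`IsSmoothingSemigroup.isGevreySemigroup`). -/

/-- On `[a, b]` the function `F` is an indefinite integral of the integrable function `f`. -/
structure IsPrim (a b : ℝ) (F f : ℝ → ℂ) : Prop where
  le : a ≤ b
  int : IntervalIntegrable f volume a b
  eq : ∀ x ∈ Icc a b, F x = F a + ∫ t in a..x, f t

namespace IsPrim

variable {a b : ℝ} {F G f g : ℝ → ℂ}

lemma intOn (H : IsPrim a b F f) {x y : ℝ} (hx : x ∈ Icc a b) (hy : y ∈ Icc a b) :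
    IntervalIntegrable f volume x y := by
  refine H.int.mono_set ?_
  rw [uIcc_of_le H.le]
  exact ordConnected_Icc.uIcc_subset hx hy

lemma sub_eq (H : IsPrim a b F f) {x y : ℝ} (hx : x ∈ Icc a b) (hy : y ∈ Icc a b) :
    F y - F x = ∫ t in x..y, f t := by
  have ha : a ∈ Icc a b := left_mem_Icc.2 H.le
  rw [H.eq x hx, H.eq y hy, ← intervalIntegral.integral_add_adjacent_intervals
    (H.intOn ha hx) (H.intOn hx hy)]
  ring

lemma integral_eq (H : IsPrim a b F f) : ∫ t in a..b, f t = F b - F a :=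
  (H.sub_eq (left_mem_Icc.2 H.le) (right_mem_Icc.2 H.le)).symm

lemma mono (H : IsPrim a b F f) {c d : ℝ} (hc : a ≤ c) (hcd : c ≤ d) (hd : d ≤ b) :
    IsPrim c d F f where
  le := hcd
  int := H.intOn ⟨hc, hcd.trans hd⟩ ⟨hc.trans hcd, hd⟩
  eq x hx := by
    rw [← H.sub_eq ⟨hc, hcd.trans hd⟩ ⟨hc.trans hx.1, hx.2.trans hd⟩]; ring

lemma continuousOn (H : IsPrim a b F f) : ContinuousOn F (Icc a b) := by
  have h1 : ContinuousOn (fun y => ∫ t in a..y, f t) (uIcc a b) :=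
    intervalIntegral.continuousOn_primitive_interval' H.int left_mem_uIcc
  rw [uIcc_of_le H.le] at h1
  exact (continuousOn_const.add h1).congr H.eq

lemma congr_ae (H : IsPrim a b F f) (e : ∀ᵐ x, x ∈ Ioo a b → g x = f x) : IsPrim a b F g := by
  have hb : ∀ᵐ x : ℝ, x ≠ b := by rw [ae_iff]; simp
  have e' : ∀ᵐ x, x ∈ Ioc a b → f x = g x := by
    filter_upwards [e, hb] with x h1 h2 h3
    exact (h1 ⟨h3.1, lt_of_le_of_ne h3.2 h2⟩).symm
  refine ⟨H.le, ?_, fun x hx => ?_⟩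
  · refine H.int.congr_ae ?_
    rw [uIoc_of_le H.le, Filter.EventuallyEq, ae_restrict_iff' measurableSet_Ioc]
    exact e'
  · rw [H.eq x hx]
    congr 1
    apply intervalIntegral.integral_congr_ae
    rw [uIoc_of_le hx.1]
    filter_upwards [e'] with t ht htm
    exact ht ⟨htm.1, htm.2.trans hx.2⟩

lemma congr (H : IsPrim a b F f) (e : ∀ x, g x = f x) : IsPrim a b F g :=
  H.congr_ae (Eventually.of_forall fun x _ => e x)

lemma congr_fst (H : IsPrim a b F f) (e : EqOn G F (Icc a b)) : IsPrim a b G f :=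
  ⟨H.le, H.int, fun x hx => by rw [e hx, e (left_mem_Icc.2 H.le)]; exact H.eq x hx⟩

lemma add (H : IsPrim a b F f) (K : IsPrim a b G g) :
    IsPrim a b (fun x => F x + G x) (fun x => f x + g x) where
  le := H.le
  int := H.int.add K.int
  eq x hx := by
    have ha : a ∈ Icc a b := left_mem_Icc.2 H.le
    rw [intervalIntegral.integral_add (H.intOn ha hx) (K.intOn ha hx), H.eq x hx, K.eq x hx]
    ring

lemma const_mul (H : IsPrim a b F f) (z : ℂ) :
    IsPrim a b (fun x => z * F x) (fun x => z * f x) where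
  le := H.le
  int := H.int.const_mul z
  eq x hx := by
    rw [intervalIntegral.integral_const_mul, H.eq x hx]; ring

lemma sub (H : IsPrim a b F f) (K : IsPrim a b G g) :
    IsPrim a b (fun x => F x - G x) (fun x => f x - g x) := by
  have := H.add (K.const_mul (-1))
  refine (this.congr fun x => by ring).congr_fst fun x _ => ?_
  ring

lemma conj (H : IsPrim a b F f) :
    IsPrim a b (fun x => starRingEnd ℂ (F x)) (fun x => starRingEnd ℂ (f x)) where
  le := H.le
  int := by
    have := H.int
    rw [intervalIntegrable_iff] at this ⊢
    exact (LinearIsometryEquiv.integrable_comp_iff Complex.conjLIE).2 this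
  eq x hx := by
    rw [H.eq x hx, map_add, intervalIntegral.integral_of_le hx.1, ← integral_conj,
      ← intervalIntegral.integral_of_le hx.1]

lemma of_hasDerivAt (hab : a ≤ b) (h : ∀ x, HasDerivAt F (f x) x) (hf : Continuous f) :
    IsPrim a b F f where
  le := hab
  int := hf.intervalIntegrable _ _
  eq x hx := by
    rw [intervalIntegral.integral_eq_sub_of_hasDerivAt (fun y _ => h y)
      (hf.intervalIntegrable _ _)]
    ring

lemma const (hab : a ≤ b) (z : ℂ) : IsPrim a b (fun _ => z) (fun _ => 0) :=
  of_hasDerivAt hab (fun x => hasDerivAt_const x z) continuous_const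

/-- The real and imaginary parts of the integral are primitives of integrable real functions; scalar
multiplication by 1 and `I` reassembles `F` from them. -/
lemma absolutelyContinuous (H : IsPrim a b F f) : AbsolutelyContinuousOnInterval F a b := by
  have hint : IntegrableOn f (Ioc a b) := (intervalIntegrable_iff_integrableOn_Ioc_of_le H.le).1 H.int
  have hre : IntervalIntegrable (fun t => (f t).re) volume a b :=
    (intervalIntegrable_iff_integrableOn_Ioc_of_le H.le).2 hint.re
  have him : IntervalIntegrable (fun t => (f t).im) volume a b :=
    (intervalIntegrable_iff_integrableOn_Ioc_of_le H.le).2 hint.im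
  have hc : ∀ z : ℂ, AbsolutelyContinuousOnInterval (fun _ => z) a b := fun z =>
    (LipschitzWith.const z).lipschitzOnWith.absolutelyContinuousOnInterval (K := 0)
  have h1 := ((hre.absolutelyContinuousOnInterval_intervalIntegral (c := a) (by simp)).smul
    (hc 1)).add ((him.absolutelyContinuousOnInterval_intervalIntegral (c := a) (by simp)).smul
    (hc Complex.I))
  have h2 := (hc (F a)).add h1
  have key : ∀ x ∈ Icc a b, F x = F a + ((∫ t in a..x, (f t).re : ℝ) • (1 : ℂ)
      + (∫ t in a..x, (f t).im : ℝ) • Complex.I) := by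
    intro x hx
    rw [H.eq x hx]
    congr 1
    have hi : IntegrableOn f (Ioc a x) := hint.mono_set (Ioc_subset_Ioc_right hx.2)
    rw [intervalIntegral.integral_of_le hx.1, intervalIntegral.integral_of_le hx.1,
      intervalIntegral.integral_of_le hx.1]
    have := integral_re_add_im hi
    rw [← this]
    simp
  rw [absolutelyContinuousOnInterval_iff] at h2 ⊢
  intro ε hε
  obtain ⟨δ, hδ, h⟩ := h2 ε hε
  refine ⟨δ, hδ, fun E hE hs => ?_⟩
  refine lt_of_eq_of_lt ?_ (h E hE hs)
  refine Finset.sum_congr rfl fun i hi => ?_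
  have := hE.1 i hi
  rw [uIcc_of_le H.le] at this
  rw [key _ this.1, key _ this.2]
  rfl

lemma ae_hasDerivAt (H : IsPrim a b F f) : ∀ᵐ x, x ∈ Ioo a b → HasDerivAt F (f x) x := by
  filter_upwards [H.int.ae_hasDerivAt_integral] with x hx hxm
  have h1 := hx (by rw [uIcc_of_le H.le]; exact Ioo_subset_Icc_self hxm) a (by simp)
  refine (h1.const_add (F a)).congr_of_eventuallyEq ?_
  filter_upwards [Ioo_mem_nhds hxm.1 hxm.2] with y hy
  exact H.eq y (Ioo_subset_Icc_self hy)

/-- Absolutely continuous functions are indefinite integrals of their derivatives. -/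
lemma of_absolutelyContinuous (hab : a ≤ b) (hF : AbsolutelyContinuousOnInterval F a b)
    (hf : IntervalIntegrable f volume a b) (h : ∀ᵐ x, x ∈ Ioo a b → HasDerivAt F (f x) x) :
    IsPrim a b F f := by
  have K : IsPrim a b (fun x => ∫ t in a..x, f t) f := ⟨hab, hf, fun x _ => by simp⟩
  have hne : ∀ c : ℝ, ∀ᵐ x : ℝ, x ≠ c := fun c => by rw [ae_iff]; simp
  -- `F` minus the primitive of `f` is absolutely continuous with zero derivative almost everywhere,
  -- hence constant. The two endpoints are discarded as a null set.
  have h0 := (hF.sub K.absolutelyContinuous).const_of_ae_hasDerivAt_zero (by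
    filter_upwards [h, K.ae_hasDerivAt, hne a, hne b] with x h1 h2 h3 h4 hx
    rw [uIcc_of_le hab] at hx
    have hx' : x ∈ Ioo a b := ⟨lt_of_le_of_ne hx.1 (Ne.symm h3), lt_of_le_of_ne hx.2 h4⟩
    simpa using (h1 hx').sub (h2 hx'))
  obtain ⟨C, hC⟩ := h0
  rw [uIcc_of_le hab] at hC
  refine ⟨hab, hf, fun x hx => ?_⟩
  have e1 := hC x hx
  have e2 := hC a (left_mem_Icc.2 hab)
  simp only [Pi.sub_apply, intervalIntegral.integral_same, sub_zero] at e1 e2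
  rw [e2, ← e1]; ring

/-- Products of absolutely continuous functions are absolutely continuous, and the product rule
holds almost everywhere. Combined with `integral_eq`, this is every integration by parts below. -/
lemma mul (H : IsPrim a b F f) (K : IsPrim a b G g) :
    IsPrim a b (fun x => F x * G x) (fun x => f x * G x + F x * g x) := by
  refine of_absolutelyContinuous H.le ?_ ?_ ?_
  · exact H.absolutelyContinuous.smul K.absolutelyContinuous
  · have h1 := H.continuousOn
    have h2 := K.continuousOn
    rw [← uIcc_of_le H.le] at h1 h2
    exact (H.int.mul_continuousOn h2).add (K.int.continuousOn_mul h1)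
  · filter_upwards [H.ae_hasDerivAt, K.ae_hasDerivAt] with x h1 h2 hx
    exact (h1 hx).mul (h2 hx)

end IsPrim

/-- An `H²` function on an open interval extends, with its derivative, to the closed interval. -/
lemma HasH2Deriv.exists_isPrim {a b : ℝ} {f g h : ℝ → ℂ} (hab : a < b)
    (H : HasH2Deriv a b f g h) : ∃ F G : ℝ → ℂ, IsPrim a b F G ∧ IsPrim a b G h ∧
      EqOn F f (Ioo a b) ∧ EqOn G g (Ioo a b) := by
  -- The primitives are based at an interior point because `f` and `g` are only controlled on the
  -- open interval.
  obtain ⟨c, hc⟩ := exists_between hab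
  have hint : IntervalIntegrable h volume a b := by
    rw [intervalIntegrable_iff_integrableOn_Ioc_of_le hab.le, integrableOn_Ioc_iff_integrableOn_Ioo]
    exact H.memLp.integrable (by norm_num)
  have hcm : c ∈ Icc a b := Ioo_subset_Icc_self hc
  have hsub : ∀ k : ℝ → ℂ, IntervalIntegrable k volume a b → ∀ x ∈ Icc a b, ∀ y ∈ Icc a b,
      IntervalIntegrable k volume x y := by
    intro k hk x hx y hy
    refine hk.mono_set ?_
    rw [uIcc_of_le hab.le]
    exact ordConnected_Icc.uIcc_subset hx hy
  have prim : ∀ (k : ℝ → ℂ) (z : ℂ), IntervalIntegrable k volume a b →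
      IsPrim a b (fun x => z + ∫ t in c..x, k t) k := by
    intro k z hk
    refine ⟨hab.le, hk, fun x hx => ?_⟩
    have := intervalIntegral.integral_add_adjacent_intervals
      (hsub k hk c hcm a (left_mem_Icc.2 hab.le)) (hsub k hk a (left_mem_Icc.2 hab.le) x hx)
    rw [← this]; ring
  have pG := prim h (g c) hint
  have hGint : IntervalIntegrable (fun x => g c + ∫ t in c..x, h t) volume a b := by
    apply ContinuousOn.intervalIntegrable
    rw [uIcc_of_le hab.le]; exact pG.continuousOn
  have pF := prim _ (f c) hGint
  have eG : EqOn (fun x => g c + ∫ t in c..x, h t) g (Ioo a b) := fun x hx => by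
    simp only [← H.sub_eq_snd c hc x hx]; ring
  refine ⟨_, _, pF, pG, fun x hx => ?_, eG⟩
  have : ∫ t in c..x, (g c + ∫ s in c..t, h s) = ∫ t in c..x, g t := by
    apply intervalIntegral.integral_congr
    intro t ht
    exact eG (HasH2Deriv.uIcc_sub hc hx ht)
  simp only [this, ← H.sub_eq_fst c hc x hx]; ring

lemma IsPrim.tendsto_left {a b : ℝ} {F f k : ℝ → ℂ} (hab : a < b) (H : IsPrim a b F f)
    (e : EqOn F k (Ioo a b)) : Tendsto k (𝓝[>] a) (𝓝 (F a)) := by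
  have h1 : Tendsto F (𝓝[>] a) (𝓝 (F a)) := by
    have := (H.continuousOn a (left_mem_Icc.2 hab.le)).mono_left
      (nhdsWithin_mono a (Ioo_subset_Icc_self : Ioo a b ⊆ Icc a b))
    rwa [nhdsWithin_Ioo_eq_nhdsGT hab] at this
  refine h1.congr' ?_
  filter_upwards [Ioo_mem_nhdsGT hab] with x hx using e hx

lemma IsPrim.tendsto_right {a b : ℝ} {F f k : ℝ → ℂ} (hab : a < b) (H : IsPrim a b F f)
    (e : EqOn F k (Ioo a b)) : Tendsto k (𝓝[<] b) (𝓝 (F b)) := by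
  have h1 : Tendsto F (𝓝[<] b) (𝓝 (F b)) := by
    have := (H.continuousOn b (right_mem_Icc.2 hab.le)).mono_left
      (nhdsWithin_mono b (Ioo_subset_Icc_self : Ioo a b ⊆ Icc a b))
    rwa [nhdsWithin_Ioo_eq_nhdsLT hab] at this
  refine h1.congr' ?_
  filter_upwards [Ioo_mem_nhdsLT hab] with x hx using e hx

/-- One-sided limits are unique, so a jump is the difference of the boundary values of the two
closed-interval extensions. -/
lemma HasJump.eq_of_isPrim {a b c : ℝ} {F f G g k : ℝ → ℂ} {z : ℂ} (h : HasJump k b z)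
    (hab : a < b) (hbc : b < c) (HF : IsPrim a b F f) (HG : IsPrim b c G g)
    (eF : EqOn F k (Ioo a b)) (eG : EqOn G k (Ioo b c)) : G b - F b = z := by
  obtain ⟨l, r, h1, h2, h3⟩ := h
  rw [← h3, tendsto_nhds_unique h1 (HF.tendsto_right hab eF),
    tendsto_nhds_unique h2 (HG.tendsto_left hbc eG)]

/-! ## Interpolation inequalities on short intervals -/

/-- The `L²(a, b)` norm of `f` is at most `m`. -/
structure L2Le (a b : ℝ) (f : ℝ → ℂ) (m : ℝ) : Prop where
  nonneg : 0 ≤ m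
  meas : AEStronglyMeasurable f (volume.restrict (Ioo a b))
  le : eLpNorm f 2 (volume.restrict (Ioo a b)) ≤ ENNReal.ofReal m

namespace L2Le

variable {a b : ℝ} {f g : ℝ → ℂ} {m n : ℝ}

lemma memLp (H : L2Le a b f m) : MemLp f 2 (volume.restrict (Ioo a b)) :=
  ⟨H.meas, H.le.trans_lt ENNReal.ofReal_lt_top⟩

lemma mono (H : L2Le a b f m) {c d : ℝ} (hc : a ≤ c) (hd : d ≤ b) : L2Le c d f m where
  nonneg := H.nonneg
  meas := H.meas.mono_measure (Measure.restrict_mono (Ioo_subset_Ioo hc hd) le_rfl)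
  le := (eLpNorm_mono_measure _ (Measure.restrict_mono (Ioo_subset_Ioo hc hd) le_rfl)).trans H.le

lemma mono_right (H : L2Le a b f m) (h : m ≤ n) : L2Le a b f n :=
  ⟨H.nonneg.trans h, H.meas, H.le.trans (ENNReal.ofReal_le_ofReal h)⟩

lemma congr_ae (H : L2Le a b f m) (e : ∀ᵐ x, x ∈ Ioo a b → g x = f x) : L2Le a b g m := by
  rw [← ae_restrict_iff' measurableSet_Ioo] at e
  exact ⟨H.nonneg, H.meas.congr (EventuallyEq.symm e), by rw [eLpNorm_congr_ae e]; exact H.le⟩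

lemma add (H : L2Le a b f m) (K : L2Le a b g n) : L2Le a b (fun x => f x + g x) (m + n) where
  nonneg := add_nonneg H.nonneg K.nonneg
  meas := H.meas.add K.meas
  le := by
    rw [ENNReal.ofReal_add H.nonneg K.nonneg]
    exact (eLpNorm_add_le H.meas K.meas (by norm_num)).trans (add_le_add H.le K.le)

lemma const_mul (H : L2Le a b f m) (z : ℂ) : L2Le a b (fun x => z * f x) (‖z‖ * m) where
  nonneg := mul_nonneg (norm_nonneg _) H.nonneg
  meas := H.meas.const_mul z
  le := by
    rw [ENNReal.ofReal_mul (norm_nonneg _), ofReal_norm]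
    have : (fun x => z * f x) = z • f := rfl
    rw [this, eLpNorm_const_smul]
    gcongr
    exact H.le

lemma sub (H : L2Le a b f m) (K : L2Le a b g n) : L2Le a b (fun x => f x - g x) (m + n) := by
  have := H.add (K.const_mul (-1))
  simp only [norm_neg, norm_one, one_mul, neg_mul, ← sub_eq_add_neg] at this
  exact this

lemma integral_sq_le (H : L2Le a b f m) : ∫ x in Ioo a b, ‖f x‖ ^ 2 ≤ m ^ 2 := by
  have h1 := H.memLp.eLpNorm_eq_integral_rpow_norm (by norm_num) (by norm_num)
  have h2 := H.le
  rw [h1, ENNReal.ofReal_le_ofReal_iff H.nonneg] at h2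
  simp only [ENNReal.toReal_ofNat, Real.rpow_ofNat] at h2
  have h3 : 0 ≤ ∫ x in Ioo a b, ‖f x‖ ^ 2 := integral_nonneg fun x => by positivity
  have h4 := pow_le_pow_left₀ (Real.rpow_nonneg h3 _) h2 2
  rw [← Real.rpow_natCast (_ ^ _), ← Real.rpow_mul h3] at h4
  norm_num at h4
  exact h4

lemma of_integral_sq_le (hf : MemLp f 2 (volume.restrict (Ioo a b))) (hm : 0 ≤ m)
    (h : ∫ x in Ioo a b, ‖f x‖ ^ 2 ≤ m ^ 2) : L2Le a b f m where
  nonneg := hm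
  meas := hf.1
  le := by
    rw [hf.eLpNorm_eq_integral_rpow_norm (by norm_num) (by norm_num)]
    apply ENNReal.ofReal_le_ofReal
    simp only [ENNReal.toReal_ofNat, Real.rpow_ofNat]
    have h3 : 0 ≤ ∫ x in Ioo a b, ‖f x‖ ^ 2 := integral_nonneg fun x => by positivity
    calc _ ≤ (m ^ 2) ^ (2⁻¹ : ℝ) := Real.rpow_le_rpow h3 h (by norm_num)
      _ = m := by
        rw [← Real.rpow_natCast, ← Real.rpow_mul hm]; norm_num

lemma of_bound (hf : AEStronglyMeasurable f (volume.restrict (Ioo a b))) {s K : ℝ} (hs : 0 ≤ s)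
    (hK : 0 ≤ K) (hab : b - a ≤ s ^ 2) (h : ∀ x ∈ Ioo a b, ‖f x‖ ≤ K) : L2Le a b f (s * K) := by
  have hm : MemLp f 2 (volume.restrict (Ioo a b)) :=
    MemLp.of_bound hf K ((ae_restrict_iff' measurableSet_Ioo).2 (Eventually.of_forall h))
  refine of_integral_sq_le hm (by positivity) ?_
  have h1 := setIntegral_mono_on (μ := volume) (s := Ioo a b) (f := fun x => ‖f x‖ ^ 2)
    (g := fun _ => K ^ 2) hm.norm.integrable_sq (by simp) measurableSet_Ioo
    (fun x hx => pow_le_pow_left₀ (norm_nonneg _) (h x hx) 2)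
  refine h1.trans ?_
  rw [setIntegral_const, smul_eq_mul, Real.volume_real_Ioo, mul_pow]
  refine mul_le_mul_of_nonneg_right (max_le hab (by positivity)) (by positivity)

lemma intervalIntegrable (H : L2Le a b f m) (hab : a ≤ b) : IntervalIntegrable f volume a b := by
  rw [intervalIntegrable_iff_integrableOn_Ioc_of_le hab, integrableOn_Ioc_iff_integrableOn_Ioo]
  exact H.memLp.integrable (by norm_num)

/-- Cauchy–Schwarz. Measuring the length by `s ^ 2` keeps all later powers integral. -/
lemma integral_norm_le (H : L2Le a b f m) {s : ℝ} (hs : 0 ≤ s) (hab : a ≤ b)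
    (h : b - a ≤ s ^ 2) : ∫ x in a..b, ‖f x‖ ≤ s * m := by
  rw [intervalIntegral.integral_of_le hab, integral_Ioc_eq_integral_Ioo]
  have h1 : ENNReal.ofReal (∫ x in Ioo a b, ‖f x‖) = eLpNorm f 1 (volume.restrict (Ioo a b)) := by
    rw [eLpNorm_one_eq_lintegral_enorm, ofReal_integral_norm_eq_lintegral_enorm
      (H.memLp.integrable (by norm_num))]
  have h2 := eLpNorm_le_eLpNorm_mul_rpow_measure_univ (p := 1) (q := 2) (by norm_num) H.meas
  rw [← h1] at h2
  have h3 : (volume.restrict (Ioo a b)) univ ^ (1 / (1 : ENNReal).toReal - 1 / (2 : ENNReal).toReal)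
      ≤ ENNReal.ofReal s := by
    rw [Measure.restrict_apply_univ, Real.volume_Ioo]
    norm_num
    calc _ ≤ ENNReal.ofReal (s ^ 2) ^ (1 / 2 : ℝ) := by gcongr
      _ = ENNReal.ofReal s := by
        rw [ENNReal.ofReal_rpow_of_nonneg (by positivity) (by norm_num), ← Real.sqrt_eq_rpow,
          Real.sqrt_sq hs]
  have h4 := h2.trans (mul_le_mul' H.le h3)
  rw [← ENNReal.ofReal_mul H.nonneg, ENNReal.ofReal_le_ofReal_iff (mul_nonneg H.nonneg hs)] at h4
  linarith

end L2Le

lemma norm_integral_mul_le {a b K : ℝ} {P f : ℝ → ℂ} (hab : a ≤ b) (hf : IntervalIntegrable f volume a b)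
    (hK : ∀ x ∈ Icc a b, ‖P x‖ ≤ K) :
    ‖∫ x in a..b, P x * f x‖ ≤ K * ∫ x in a..b, ‖f x‖ := by
  rw [← intervalIntegral.integral_const_mul]
  refine intervalIntegral.norm_integral_le_of_norm_le hab ?_ (hf.norm.const_mul K)
  refine Eventually.of_forall fun x hx => ?_
  rw [norm_mul]
  exact mul_le_mul_of_nonneg_right (hK x (Ioc_subset_Icc_self hx)) (norm_nonneg _)

namespace IsPrim

variable {a b : ℝ} {F f g h : ℝ → ℂ}

lemma norm_sub_le (H : IsPrim a b F f) {n s : ℝ} (hf : L2Le a b f n) (hs : 0 ≤ s)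
    (hL : b - a ≤ s ^ 2) {x y : ℝ} (hx : x ∈ Icc a b) (hy : y ∈ Icc a b) :
    ‖F y - F x‖ ≤ s * n := by
  rw [H.sub_eq hx hy]
  refine le_trans ?_ (hf.integral_norm_le hs H.le hL)
  refine (intervalIntegral.norm_integral_le_integral_norm_uIoc).trans ?_
  rw [intervalIntegral.integral_of_le H.le]
  refine setIntegral_mono_set ?_ (Eventually.of_forall fun _ => norm_nonneg _)
    (LE.le.eventuallyLE ?_)
  · exact ((intervalIntegrable_iff_integrableOn_Ioc_of_le H.le).1 H.int).norm
  · intro t ht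
    exact ⟨(le_min hx.1 hy.1).trans_lt ht.1, ht.2.trans (max_le hx.2 hy.2)⟩

lemma norm_sub_le_of_bound (H : IsPrim a b F f) {K : ℝ} (hf : ∀ x ∈ Icc a b, ‖f x‖ ≤ K)
    {x y : ℝ} (hx : x ∈ Icc a b) (hy : y ∈ Icc a b) : ‖F y - F x‖ ≤ K * (b - a) := by
  have hK : 0 ≤ K := (norm_nonneg _).trans (hf x hx)
  rw [H.sub_eq hx hy]
  refine (intervalIntegral.norm_integral_le_of_norm_le_const (C := K) fun t ht => hf t
    ⟨(le_min hx.1 hy.1).trans ht.1.le, ht.2.trans (max_le hx.2 hy.2)⟩).trans ?_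
  refine mul_le_mul_of_nonneg_left (abs_le.2 ⟨?_, ?_⟩) hK <;> linarith [hx.1, hx.2, hy.1, hy.2]

lemma ofReal (hab : a ≤ b) : IsPrim a b (fun t => (t : ℂ)) (fun _ => 1) :=
  of_hasDerivAt hab (fun x => (hasDerivAt_id x).ofReal_comp) continuous_const

lemma bump (hab : a ≤ b) :
    IsPrim a b (fun t => ((t - a) * (b - t) : ℂ)) (fun t => (a + b - 2 * t : ℂ)) := by
  have h1 := (ofReal hab).sub (const hab (a : ℂ))
  have h2 := (const hab (b : ℂ)).sub (ofReal hab)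
  refine (h1.mul h2).congr fun x => ?_
  ring

lemma norm_bump_le {a b x : ℝ} (hx : x ∈ Icc a b) :
    ‖((x - a) * (b - x) : ℂ)‖ ≤ (b - a) ^ 2 ∧ ‖(a + b - 2 * x : ℂ)‖ ≤ b - a := by
  constructor
  · rw [← Complex.ofReal_sub, ← Complex.ofReal_sub, ← Complex.ofReal_mul, Complex.norm_real,
      Real.norm_eq_abs, abs_of_nonneg (mul_nonneg (by linarith [hx.1]) (by linarith [hx.2]))]
    nlinarith [hx.1, hx.2]
  · have : (a + b - 2 * x : ℂ) = ((a + b - 2 * x : ℝ) : ℂ) := by push_cast; ring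
    rw [this, Complex.norm_real, Real.norm_eq_abs, abs_le]
    constructor <;> linarith [hx.1, hx.2]

/-- If `g` oscillates by at most `ρ`, it is controlled by its average against a weight `P ≥ 0`. -/
lemma norm_le_of_weight {ρ I K : ℝ} {P : ℝ → ℝ} {g : ℝ → ℂ} (hab : a ≤ b) (hP : Continuous P)
    (hP0 : ∀ t ∈ Icc a b, 0 ≤ P t) (hI : ∫ t in a..b, P t = I) (hI0 : 0 < I)
    (hg : ContinuousOn g (Icc a b)) {x : ℝ}
    (hρ : ∀ y ∈ Icc a b, ‖g y - g x‖ ≤ ρ) (hK : ‖∫ t in a..b, (P t : ℂ) * g t‖ ≤ K) :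
    ‖g x‖ ≤ K / I + ρ := by
  have hPc : Continuous fun t => (P t : ℂ) := Complex.continuous_ofReal.comp hP
  have hgi : IntervalIntegrable (fun t => g t - g x) volume a b := by
    refine ContinuousOn.intervalIntegrable ?_
    rw [uIcc_of_le hab]; exact hg.sub continuousOn_const
  -- Freeze `g` at `x`: the frozen part carries the mass `I` of the weight, and the remainder is at
  -- most `ρ * I`.
  have e : (∫ t in a..b, (P t : ℂ) * g t) = (I : ℂ) * g x
      + ∫ t in a..b, (P t : ℂ) * (g t - g x) := by
    rw [← hI, ← intervalIntegral.integral_ofReal, ← intervalIntegral.integral_mul_const,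
      ← intervalIntegral.integral_add]
    · exact intervalIntegral.integral_congr fun t _ => by ring
    · exact (hPc.mul continuous_const).intervalIntegrable _ _
    · exact hgi.continuousOn_mul hPc.continuousOn
  have h2 : ‖∫ t in a..b, (P t : ℂ) * (g t - g x)‖ ≤ ρ * I := by
    rw [← hI, ← intervalIntegral.integral_const_mul]
    refine intervalIntegral.norm_integral_le_of_norm_le hab ?_
      ((hP.intervalIntegrable _ _).const_mul ρ)
    refine Eventually.of_forall fun t ht => ?_
    have htm := Ioc_subset_Icc_self ht
    rw [norm_mul, Complex.norm_real, Real.norm_of_nonneg (hP0 t htm), mul_comm]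
    exact mul_le_mul_of_nonneg_right (hρ t htm) (hP0 t htm)
  have h3 : ‖(I : ℂ) * g x‖ ≤ K + ρ * I := by
    have : (I : ℂ) * g x = (∫ t in a..b, (P t : ℂ) * g t)
      - ∫ t in a..b, (P t : ℂ) * (g t - g x) := by rw [e]; ring
    rw [this]
    exact (_root_.norm_sub_le _ _).trans (add_le_add hK h2)
  rw [norm_mul, Complex.norm_real, Real.norm_of_nonneg hI0.le] at h3
  rw [div_add' _ _ _ hI0.ne', le_div_iff₀ hI0]
  linarith

lemma integral_bump : ∫ t in a..b, (t - a) * (b - t) = (b - a) ^ 3 / 6 := by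
  have : ∀ t ∈ uIcc a b, HasDerivAt (fun t => (b - a) * (t - a) ^ 2 / 2 - (t - a) ^ 3 / 3)
      ((t - a) * (b - t)) t := by
    intro t _
    have h1 : HasDerivAt (fun t => t - a) 1 t := (hasDerivAt_id t).sub_const a
    have := ((h1.pow 2).const_mul ((b - a) / 2)).sub ((h1.pow 3).div_const 3)
    refine (this.congr_deriv ?_).congr_of_eventuallyEq (Eventually.of_forall fun t => ?_)
    · push_cast; ring
    · simp only [Pi.sub_apply, Pi.pow_apply]; ring
  rw [intervalIntegral.integral_eq_sub_of_hasDerivAt this (by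
    apply Continuous.intervalIntegrable; fun_prop)]
  ring

/-- The Beta value B(4,4) = 3!·3!/7! = 1/140, scaled to length `b - a`; this is the mass of the
weight in `interpolation_moment`. -/
lemma integral_bump_cube : ∫ t in a..b, ((t - a) * (b - t)) ^ 3 = (b - a) ^ 7 / 140 := by
  have : ∀ t ∈ uIcc a b, HasDerivAt (fun t => (b - a) ^ 3 * (t - a) ^ 4 / 4
      - 3 * (b - a) ^ 2 * (t - a) ^ 5 / 5 + (b - a) * (t - a) ^ 6 / 2 - (t - a) ^ 7 / 7)
      (((t - a) * (b - t)) ^ 3) t := by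
    intro t _
    have h1 : HasDerivAt (fun t => t - a) 1 t := (hasDerivAt_id t).sub_const a
    have := ((((h1.pow 4).const_mul ((b - a) ^ 3 / 4)).sub
      ((h1.pow 5).const_mul (3 * (b - a) ^ 2 / 5))).add
      ((h1.pow 6).const_mul ((b - a) / 2))).sub ((h1.pow 7).div_const 7)
    refine (this.congr_deriv ?_).congr_of_eventuallyEq (Eventually.of_forall fun t => ?_)
    · push_cast; ring
    · simp only [Pi.sub_apply, Pi.pow_apply, Pi.add_apply]; ring
  rw [intervalIntegral.integral_eq_sub_of_hasDerivAt this (by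
    apply Continuous.intervalIntegrable; fun_prop)]
  ring

/-- Interpolation: pointwise bounds for `F` and `F'` by the `L²` norms of `F` and `F''` on an
interval of length `s²`. -/
lemma interpolation (H : IsPrim a b F f) (K : IsPrim a b f g) {s m n : ℝ} (hs : 0 < s)
    (hL : b - a = s ^ 2) (hm : L2Le a b F m) (hn : L2Le a b g n) {x : ℝ} (hx : x ∈ Icc a b) :
    ‖F x‖ ≤ 7 * m / s + s ^ 3 * n ∧ ‖f x‖ ≤ 6 * m / s ^ 3 + s * n := by
  have hab := H.le
  have hF1 := hm.integral_norm_le hs.le hab hL.le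
  -- The bump vanishes at both ends, so averaging `f` against it equals averaging `F` against minus
  -- its derivative. Its mass `s ^ 6 / 6` is the source of the 6.
  have key : ∀ y ∈ Icc a b, ‖f y‖ ≤ 6 * m / s ^ 3 + s * n := by
    intro y hy
    have := norm_le_of_weight (P := fun t => (t - a) * (b - t)) (ρ := s * n)
      (K := s ^ 2 * (s * m)) hab (by fun_prop)
      (fun t ht => mul_nonneg (by linarith [ht.1]) (by linarith [ht.2])) integral_bump
      (by rw [hL]; positivity) K.continuousOn (x := y)
      (fun z hz => K.norm_sub_le hn hs.le hL.le hy hz) (by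
        have h1 := ((bump hab).mul H).integral_eq
        rw [intervalIntegral.integral_add] at h1
        · have h2 : (∫ t in a..b, (((t - a) * (b - t) : ℝ) : ℂ) * f t)
              = - ∫ t in a..b, (a + b - 2 * t : ℂ) * F t := by
            push_cast
            linear_combination h1
          rw [h2, norm_neg]
          refine (norm_integral_mul_le hab (hm.intervalIntegrable hab) (K := s ^ 2)
            fun t ht => hL ▸ (norm_bump_le ht).2).trans ?_
          gcongr
        · refine (hm.intervalIntegrable hab).continuousOn_mul (Continuous.continuousOn ?_)
          fun_prop
        · refine H.int.continuousOn_mul (Continuous.continuousOn ?_)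
          fun_prop)
    refine this.trans (le_of_eq ?_)
    rw [hL]; field_simp
  refine ⟨?_, key x hx⟩
  -- With the constant weight, the oscillation of `F` is at most sup |f| times `s ^ 2`; the 7 is 1
  -- from the average plus 6 from the oscillation.
  have := norm_le_of_weight (P := fun _ => 1) (ρ := (6 * m / s ^ 3 + s * n) * s ^ 2)
      (K := s * m) (I := s ^ 2) hab continuous_const (fun t ht => zero_le_one) (by simp [hL])
      (by positivity) H.continuousOn (x := x)
      (fun z hz => hL ▸ H.norm_sub_le_of_bound key hx hz) (by
        simp only [Complex.ofReal_one, one_mul]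
        exact (intervalIntegral.norm_integral_le_integral_norm hab).trans hF1)
  refine this.trans (le_of_eq ?_)
  field_simp; ring

/-- Two integrations by parts move the second derivative from `M` to the test function, whose
vanishing to first order at the ends removes the boundary terms. Since `M2 = k - I * lam * v`, an
average of `v` is bounded with a gain of `1 / |lam|`. -/
lemma norm_integral_test_le {v M M1 M2 k P P1 P2 : ℝ → ℂ} {lam s m N K0 K2 : ℝ}
    (HM : IsPrim a b M M1) (HM1 : IsPrim a b M1 M2) (Hv : ContinuousOn v (Icc a b))
    (hs : 0 < s) (hL : b - a = s ^ 2) (hm : L2Le a b M m) (hk : L2Le a b k N)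
    (e : ∀ᵐ x, x ∈ Ioo a b → M2 x = k x - Complex.I * lam * v x)
    (HP : IsPrim a b P P1) (HP1 : IsPrim a b P1 P2) (hP2 : ContinuousOn P2 (Icc a b))
    (ha : P a = 0) (hb : P b = 0) (ha1 : P1 a = 0) (hb1 : P1 b = 0)
    (hK0 : ∀ x ∈ Icc a b, ‖P x‖ ≤ K0) (hK2 : ∀ x ∈ Icc a b, ‖P2 x‖ ≤ K2) :
    |lam| * ‖∫ t in a..b, P t * v t‖ ≤ K0 * (s * N) + K2 * (s * m) := by
  have hab := HM.le
  have cont : ∀ {F G : ℝ → ℂ}, ContinuousOn F (Icc a b) → IntervalIntegrable G volume a b →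
      IntervalIntegrable (fun t => F t * G t) volume a b := fun hF hG =>
    hG.continuousOn_mul (by rwa [uIcc_of_le hab])
  have ii : ∀ {F : ℝ → ℂ}, ContinuousOn F (Icc a b) → IntervalIntegrable F volume a b :=
    fun hF => ContinuousOn.intervalIntegrable (by rwa [uIcc_of_le hab])
  have hM2 : IsPrim a b M1 (fun x => k x - Complex.I * lam * v x) :=
    HM1.congr_ae (by filter_upwards [e] with x hx hxm using (hx hxm).symm)
  have h1 := ((HP.mul hM2).sub (HP1.mul HM)).integral_eq
  have hki := hk.intervalIntegrable hab
  have hPk := cont HP.continuousOn hki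
  have hPv := cont HP.continuousOn (ii Hv)
  have hPM := cont hP2 (ii HM.continuousOn)
  have h2 : (∫ t in a..b, (P t * k t - Complex.I * lam * (P t * v t)) - P2 t * M t) = 0 := by
    simp only [ha, hb, ha1, hb1, zero_mul, sub_zero] at h1
    rw [← h1]
    refine intervalIntegral.integral_congr fun t _ => ?_
    ring
  rw [intervalIntegral.integral_sub (hPk.sub (hPv.const_mul _)) hPM,
    intervalIntegral.integral_sub hPk (hPv.const_mul _),
    intervalIntegral.integral_const_mul] at h2
  have h3 : Complex.I * lam * (∫ t in a..b, P t * v t)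
      = (∫ t in a..b, P t * k t) - ∫ t in a..b, P2 t * M t := by linear_combination -h2
  have h4 := congrArg norm h3
  rw [norm_mul, norm_mul, Complex.norm_I, Complex.norm_real, Real.norm_eq_abs, one_mul] at h4
  rw [h4]
  have hK0' : 0 ≤ K0 := (norm_nonneg _).trans (hK0 a (left_mem_Icc.2 hab))
  have hK2' : 0 ≤ K2 := (norm_nonneg _).trans (hK2 a (left_mem_Icc.2 hab))
  refine (_root_.norm_sub_le _ _).trans (add_le_add ?_ ?_)
  · refine (norm_integral_mul_le hab hki hK0).trans ?_
    exact mul_le_mul_of_nonneg_left (hk.integral_norm_le hs.le hab hL.le) hK0'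
  · refine (norm_integral_mul_le hab (ii HM.continuousOn) hK2).trans ?_
    exact mul_le_mul_of_nonneg_left (hm.integral_norm_le hs.le hab hL.le) hK2'

/-- Interpolation between `v''` and a bending moment `M` with `M'' = k - iλv`, on an interval of
length `s²`. -/
lemma interpolation_moment {v v1 v2 M M1 M2 k : ℝ → ℂ} {lam s m n N : ℝ}
    (HM : IsPrim a b M M1) (HM1 : IsPrim a b M1 M2) (Hv : IsPrim a b v v1)
    (Hv1 : IsPrim a b v1 v2) (hlam : lam ≠ 0)
    (hs : 0 < s) (hL : b - a = s ^ 2) (hm : L2Le a b M m) (hk : L2Le a b k N)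
    (hn : L2Le a b v2 n)
    (e : ∀ᵐ x, x ∈ Ioo a b → M2 x = k x - Complex.I * lam * v x) {x : ℝ} (hx : x ∈ Icc a b) :
    ‖v x‖ ≤ 10000 * (m / s ^ 5 + N / s) / |lam| + s ^ 3 * n ∧
    ‖v1 x‖ ≤ 10000 * (m / s ^ 7 + N / s ^ 3) / |lam| + s * n := by
  have hab := HM.le
  have hl : 0 < |lam| := abs_pos.2 hlam
  have hm0 := hm.nonneg
  have hN0 := hk.nonneg
  set Q : ℝ → ℂ := fun t => ((t - a) * (b - t) : ℂ) with hQ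
  set Q1 : ℝ → ℂ := fun t => (a + b - 2 * t : ℂ) with hQ1
  have HQ : IsPrim a b Q Q1 := bump hab
  have HQ1 : IsPrim a b Q1 (fun _ => -2) := by
    refine ((const hab ((a : ℂ) + b)).sub ((ofReal hab).const_mul 2)).congr fun x => ?_
    ring
  -- The cube is used because its first and second derivatives also vanish at the ends. Both `Q ^ 3`
  -- and `(Q ^ 3)'` are then admissible tests: the first yields an average of `v`, the second an
  -- average of `v1` after one integration by parts.
  have P0 : IsPrim a b (fun t => Q t ^ 3) (fun t => 3 * Q t ^ 2 * Q1 t) := by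
    refine ((HQ.mul (HQ.mul HQ)).congr fun x => ?_).congr_fst fun x _ => ?_ <;> ring
  have P1 : IsPrim a b (fun t => 3 * Q t ^ 2 * Q1 t)
      (fun t => 6 * Q t * Q1 t ^ 2 - 6 * Q t ^ 2) := by
    refine (((HQ.mul (HQ.mul HQ1)).const_mul 3).congr fun x => ?_).congr_fst fun x _ => ?_ <;> ring
  have P2 : IsPrim a b (fun t => 6 * Q t * Q1 t ^ 2 - 6 * Q t ^ 2)
      (fun t => 6 * Q1 t ^ 3 - 36 * Q t * Q1 t) := by
    refine ((((HQ.mul (HQ1.mul HQ1)).const_mul 6).sub ((HQ.mul HQ).const_mul 6)).congr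
      fun x => ?_).congr_fst fun x _ => ?_ <;> ring
  have c3 : ContinuousOn (fun t => 6 * Q1 t ^ 3 - 36 * Q t * Q1 t) (Icc a b) := by
    apply Continuous.continuousOn; fun_prop
  have Qa : Q a = 0 := by simp [hQ]
  have Qb : Q b = 0 := by simp [hQ]
  have bQ : ∀ t ∈ Icc a b, ‖Q t‖ ≤ s ^ 4 := fun t ht => by
    have := (norm_bump_le ht).1
    rw [hL] at this; linarith
  have bQ1 : ∀ t ∈ Icc a b, ‖Q1 t‖ ≤ s ^ 2 := fun t ht => by
    have := (norm_bump_le ht).2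
    rwa [hL] at this
  have b0 : ∀ t ∈ Icc a b, ‖Q t ^ 3‖ ≤ s ^ 12 := fun t ht => by
    rw [norm_pow]
    calc ‖Q t‖ ^ 3 ≤ (s ^ 4) ^ 3 := by gcongr; exact bQ t ht
      _ = s ^ 12 := by ring
  have b1 : ∀ t ∈ Icc a b, ‖3 * Q t ^ 2 * Q1 t‖ ≤ 3 * s ^ 10 := fun t ht => by
    rw [norm_mul, norm_mul, norm_pow]
    calc ‖(3 : ℂ)‖ * ‖Q t‖ ^ 2 * ‖Q1 t‖ ≤ ‖(3 : ℂ)‖ * (s ^ 4) ^ 2 * s ^ 2 := by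
          gcongr
          exacts [bQ t ht, bQ1 t ht]
      _ = 3 * s ^ 10 := by norm_num; ring
  have b2 : ∀ t ∈ Icc a b, ‖6 * Q t * Q1 t ^ 2 - 6 * Q t ^ 2‖ ≤ 12 * s ^ 8 := fun t ht => by
    refine (_root_.norm_sub_le _ _).trans ?_
    rw [norm_mul (6 * Q t), norm_mul 6 (Q t), norm_mul 6 (Q t ^ 2), norm_pow, norm_pow]
    calc ‖(6 : ℂ)‖ * ‖Q t‖ * ‖Q1 t‖ ^ 2 + ‖(6 : ℂ)‖ * ‖Q t‖ ^ 2
        ≤ ‖(6 : ℂ)‖ * s ^ 4 * (s ^ 2) ^ 2 + ‖(6 : ℂ)‖ * (s ^ 4) ^ 2 := by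
          gcongr
          exacts [bQ t ht, bQ1 t ht, bQ t ht]
      _ = 12 * s ^ 8 := by norm_num; ring
  have b3 : ∀ t ∈ Icc a b, ‖6 * Q1 t ^ 3 - 36 * Q t * Q1 t‖ ≤ 42 * s ^ 6 := fun t ht => by
    refine (_root_.norm_sub_le _ _).trans ?_
    rw [norm_mul, norm_mul, norm_mul, norm_pow]
    calc ‖(6 : ℂ)‖ * ‖Q1 t‖ ^ 3 + ‖(36 : ℂ)‖ * ‖Q t‖ * ‖Q1 t‖
        ≤ ‖(6 : ℂ)‖ * (s ^ 2) ^ 3 + ‖(36 : ℂ)‖ * s ^ 4 * s ^ 2 := by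
          gcongr
          exacts [bQ1 t ht, bQ t ht, bQ1 t ht]
      _ = 42 * s ^ 6 := by norm_num; ring
  have T0 := norm_integral_test_le HM HM1 Hv.continuousOn hs hL hm hk e P0 P1 P2.continuousOn
    (by simp [Qa]) (by simp [Qb]) (by simp [Qa]) (by simp [Qb]) b0 b2
  have T1 := norm_integral_test_le HM HM1 Hv.continuousOn hs hL hm hk e P1 P2 c3
    (by simp [Qa]) (by simp [Qb]) (by simp [Qa]) (by simp [Qb]) b1 b3
  have hI : ∫ t in a..b, ((t - a) * (b - t)) ^ 3 = s ^ 14 / 140 := by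
    rw [integral_bump_cube, hL]; ring
  have hP0 : ∀ t ∈ Icc a b, 0 ≤ ((t - a) * (b - t)) ^ 3 := fun t ht =>
    pow_nonneg (mul_nonneg (by linarith [ht.1]) (by linarith [ht.2])) 3
  have eP : (fun t : ℝ => ((((t - a) * (b - t)) ^ 3 : ℝ) : ℂ)) = fun t => Q t ^ 3 := by
    funext t; simp [hQ]
  have hv1 : ∀ y ∈ Icc a b, ‖v1 y‖ ≤
      (3 * s ^ 10 * (s * N) + 42 * s ^ 6 * (s * m)) / |lam| / (s ^ 14 / 140) + s * n := by
    intro y hy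
    refine norm_le_of_weight (P := fun t => ((t - a) * (b - t)) ^ 3) hab (by fun_prop) hP0 hI
      (by positivity) Hv1.continuousOn
      (fun z hz => Hv1.norm_sub_le hn hs.le hL.le hy hz) ?_
    have h1 := (P0.mul Hv).integral_eq
    rw [intervalIntegral.integral_add
      (P0.int.mul_continuousOn (by rw [uIcc_of_le hab]; exact Hv.continuousOn))
      (Hv.int.continuousOn_mul (by rw [uIcc_of_le hab]; exact P0.continuousOn))] at h1
    have h2 : (∫ t in a..b, Q t ^ 3 * v1 t) = - ∫ t in a..b, 3 * Q t ^ 2 * Q1 t * v t := by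
      simp only [Qa, Qb] at h1
      linear_combination h1
    have h3 : (∫ t in a..b, ((((t - a) * (b - t)) ^ 3 : ℝ) : ℂ) * v1 t)
        = ∫ t in a..b, Q t ^ 3 * v1 t :=
      intervalIntegral.integral_congr fun t _ => by rw [← congrFun eP t]
    rw [h3, h2, norm_neg, le_div_iff₀ hl, mul_comm]
    exact T1
  -- Here 420 = 3·140 and 5880 = 42·140. In `e2` below, 560 = 140 + 420 and 7560 = 12·140 + 5880.
  -- All are rounded up to 10000.
  have e1 : (3 * s ^ 10 * (s * N) + 42 * s ^ 6 * (s * m)) / |lam| / (s ^ 14 / 140)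
      = (420 * (N / s ^ 3) + 5880 * (m / s ^ 7)) / |lam| := by field_simp; ring
  rw [e1] at hv1
  have n7 : 0 ≤ m / s ^ 7 := by positivity
  have n3 : 0 ≤ N / s ^ 3 := by positivity
  refine ⟨?_, ?_⟩
  · have := norm_le_of_weight (P := fun t => ((t - a) * (b - t)) ^ 3) hab (by fun_prop) hP0 hI
      (by positivity) Hv.continuousOn (x := x)
      (fun z hz => Hv.norm_sub_le_of_bound hv1 hx hz)
      (K := (s ^ 12 * (s * N) + 12 * s ^ 8 * (s * m)) / |lam|) (by
        have h3 : (∫ t in a..b, ((((t - a) * (b - t)) ^ 3 : ℝ) : ℂ) * v t)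
            = ∫ t in a..b, Q t ^ 3 * v t :=
          intervalIntegral.integral_congr fun t _ => by rw [← congrFun eP t]
        rw [h3, le_div_iff₀ hl, mul_comm]
        exact T0)
    refine this.trans ?_
    rw [hL]
    have e2 : (s ^ 12 * (s * N) + 12 * s ^ 8 * (s * m)) / |lam| / (s ^ 14 / 140)
        + ((420 * (N / s ^ 3) + 5880 * (m / s ^ 7)) / |lam| + s * n) * s ^ 2
        = (560 * (N / s) + 7560 * (m / s ^ 5)) / |lam| + s ^ 3 * n := by field_simp; ring
    rw [e2]
    have n5 : 0 ≤ m / s ^ 5 := by positivity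
    have n1 : 0 ≤ N / s := by positivity
    gcongr
    linarith
  · refine (hv1 x hx).trans ?_
    gcongr
    linarith

end IsPrim

/-! ## The space `H²₀(0, ℓ)` -/

namespace BeamData

variable {p : BeamData}

lemma ℓ_pos (p : BeamData) : 0 < p.ℓ := by
  linarith [p.ξ₁_pos, p.ξ₁_lt, p.lt_ξ₂, p.ξ₂_lt, p.ℓ₁_lt]


lemma ℓ₀_lt_ℓ₁ (p : BeamData) : p.ℓ₀ < p.ℓ₁ := p.lt_ξ₂.trans p.ξ₂_lt

lemma κ_nonneg (p : BeamData) (x : ℝ) : 0 ≤ p.κ x := by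
  unfold κ; split_ifs
  exacts [p.α₀_pos.le, le_rfl]

lemma κ_le (p : BeamData) (x : ℝ) : p.κ x ≤ p.α₀ := by
  unfold κ; split_ifs
  exacts [le_rfl, p.α₀_pos.le]

lemma measurable_κ (p : BeamData) : Measurable p.κ :=
  Measurable.ite measurableSet_Ioo measurable_const measurable_const

lemma le_α (p : BeamData) (x : ℝ) : min p.α₁ p.α₂ ≤ p.α x := by
  unfold α; split_ifs
  exacts [min_le_right _ _, min_le_left _ _]

lemma min_α_pos (p : BeamData) : 0 < min p.α₁ p.α₂ := lt_min p.α₁_pos p.α₂_pos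

lemma norm_sq_L2 (f : p.L2) : ‖f‖ ^ 2 = ∫ x in Ioo 0 p.ℓ, ‖f x‖ ^ 2 := by
  have h := L2.inner_def (𝕜 := ℂ) f f
  have h1 : ∀ x, inner ℂ (f x) (f x) = ((‖f x‖ ^ 2 : ℝ) : ℂ) := fun x => by
    rw [inner_self_eq_norm_sq_to_K]; push_cast; rfl
  simp only [h1] at h
  rw [inner_self_eq_norm_sq_to_K, integral_complex_ofReal] at h
  exact Complex.ofReal_injective ((Complex.ofReal_pow _ _).trans h)

lemma l2Le_coe (f : p.L2) : L2Le 0 p.ℓ f ‖f‖ :=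
  .of_integral_sq_le (Lp.memLp f) (norm_nonneg _) (norm_sq_L2 f).ge

lemma integrable_α_sq (f : p.L2) : Integrable (fun x => p.α x * ‖f x‖ ^ 2) p.vol := by
  have h := (p.integrable_α_inner f f).re
  refine h.congr (Eventually.of_forall fun x => ?_)
  have h1 : (p.α x : ℂ) * inner ℂ (f x) (f x) = ((p.α x * ‖f x‖ ^ 2 : ℝ) : ℂ) := by
    rw [inner_self_eq_norm_sq_to_K]; push_cast; rfl
  simp only [h1]
  exact Complex.ofReal_re _

lemma norm_sq_H20 (u : p.H20) : ‖u‖ ^ 2 = ∫ x in Ioo 0 p.ℓ, p.α x * ‖u.d2 x‖ ^ 2 := by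
  have h : inner ℂ u u = ∫ x, (p.α x : ℂ) * inner ℂ (u.d2 x) (u.d2 x) ∂p.vol := rfl
  have h1 : ∀ x, (p.α x : ℂ) * inner ℂ (u.d2 x) (u.d2 x)
      = ((p.α x * ‖u.d2 x‖ ^ 2 : ℝ) : ℂ) := fun x => by
    rw [inner_self_eq_norm_sq_to_K]; push_cast; rfl
  simp only [h1] at h
  rw [inner_self_eq_norm_sq_to_K, integral_complex_ofReal] at h
  exact Complex.ofReal_injective ((Complex.ofReal_pow _ _).trans h)

lemma min_α_mul_norm_sq_d2_le (u : p.H20) : min p.α₁ p.α₂ * ‖u.d2‖ ^ 2 ≤ ‖u‖ ^ 2 := by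
  rw [norm_sq_L2, norm_sq_H20, ← integral_const_mul]
  refine integral_mono ((Lp.memLp u.d2).norm.integrable_sq.const_mul _) (integrable_α_sq _) ?_
  intro x
  exact mul_le_mul_of_nonneg_right (p.le_α x) (by positivity)

lemma norm_sq_le_max_α (u : p.H20) : ‖u‖ ^ 2 ≤ max p.α₁ p.α₂ * ‖u.d2‖ ^ 2 := by
  rw [norm_sq_L2, norm_sq_H20, ← integral_const_mul]
  refine integral_mono (integrable_α_sq _) ((Lp.memLp u.d2).norm.integrable_sq.const_mul _) ?_
  intro x
  exact mul_le_mul_of_nonneg_right (p.α_le x) (by positivity)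

lemma norm_d2_le (u : p.H20) : ‖u.d2‖ ≤ (1 / √(min p.α₁ p.α₂)) * ‖u‖ := by
  have h := p.min_α_mul_norm_sq_d2_le u
  have h0 := Real.sqrt_pos.2 p.min_α_pos
  rw [one_div_mul_eq_div, le_div_iff₀ h0]
  refine abs_le_of_sq_le_sq' ?_ (norm_nonneg _) |>.2
  rw [mul_pow, Real.sq_sqrt p.min_α_pos.le]; linarith

lemma norm_le_d2 (u : p.H20) : ‖u‖ ≤ √(max p.α₁ p.α₂) * ‖u.d2‖ := by
  have h := p.norm_sq_le_max_α u
  have h0 : 0 ≤ max p.α₁ p.α₂ := p.min_α_pos.le.trans (min_le_max)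
  refine abs_le_of_sq_le_sq' ?_ (by positivity) |>.2
  rw [mul_pow, Real.sq_sqrt h0]; linarith

lemma norm_sq_phase (U : p.Phase) : ‖U‖ ^ 2 = ‖U.fst‖ ^ 2 + ‖U.snd‖ ^ 2 :=
  WithLp.prod_norm_sq_eq_of_L2 U

lemma norm_fst_le (U : p.Phase) : ‖U.fst‖ ≤ ‖U‖ := by
  refine abs_le_of_sq_le_sq' ?_ (norm_nonneg _) |>.2
  rw [norm_sq_phase]; nlinarith [sq_nonneg ‖U.snd‖]

lemma norm_snd_le (U : p.Phase) : ‖U.snd‖ ≤ ‖U‖ := by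
  refine abs_le_of_sq_le_sq' ?_ (norm_nonneg _) |>.2
  rw [norm_sq_phase]; nlinarith [sq_nonneg ‖U.fst‖]

namespace H20

/-- The zero extensions are continuous, hence agree up to the ends with the extensions to the closed
interval, the open interval being dense. -/
lemma isPrim (u : p.H20) : IsPrim 0 p.ℓ u.fn u.d1 ∧ IsPrim 0 p.ℓ u.d1 u.d2 := by
  obtain ⟨F, G, h1, h2, e1, e2⟩ := u.hasH2Deriv.exists_isPrim p.ℓ_pos
  have key : ∀ {f g : ℝ → ℂ}, ContinuousOn f (Icc 0 p.ℓ) → Continuous g →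
      EqOn f g (Ioo 0 p.ℓ) → EqOn g f (Icc 0 p.ℓ) := by
    intro f g hf hg e
    refine (e.of_subset_closure hf hg.continuousOn Ioo_subset_Icc_self ?_).symm
    rw [closure_Ioo p.ℓ_pos.ne]
  have c2 := key h2.continuousOn u.continuous_d1 e2
  refine ⟨(h1.congr_ae (Eventually.of_forall fun x hx => (e2 hx).symm)).congr_fst
    (key h1.continuousOn u.continuous_fn e1), h2.congr_fst c2⟩

lemma fn_zero_left (u : p.H20) : u.fn 0 = 0 := u.fn_eq_zero (by simp)
lemma d1_zero_left (u : p.H20) : u.d1 0 = 0 := u.d1_eq_zero (by simp)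
lemma fn_zero_right (u : p.H20) : u.fn p.ℓ = 0 := u.fn_eq_zero (by simp)
lemma d1_zero_right (u : p.H20) : u.d1 p.ℓ = 0 := u.d1_eq_zero (by simp)

/-- Integrating twice from the clamped end 0 controls the derivative by the L² norm of `d2`, and
then the function by its derivative. -/
lemma exists_bound (p : BeamData) : ∃ C : ℝ, 0 < C ∧ ∀ (u : p.H20) (x : ℝ),
    ‖u.fn x‖ ≤ C * ‖u‖ ∧ ‖u.d1 x‖ ≤ C * ‖u‖ := by
  have hℓ := p.ℓ_pos
  set s := √p.ℓ with hs
  have hs2 : p.ℓ - 0 = s ^ 2 := by rw [hs, Real.sq_sqrt hℓ.le, sub_zero]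
  have hs0 : 0 < s := Real.sqrt_pos.2 hℓ
  set K := 1 / √(min p.α₁ p.α₂) with hK
  have hK0 : 0 < K := by have := Real.sqrt_pos.2 p.min_α_pos; positivity
  refine ⟨s * K + s * K * p.ℓ, by positivity, fun u x => ?_⟩
  by_cases hx : x ∈ Ioo 0 p.ℓ
  swap
  · rw [u.fn_eq_zero hx, u.d1_eq_zero hx, norm_zero]
    exact ⟨by positivity, by positivity⟩
  have h1 : ∀ y ∈ Icc 0 p.ℓ, ‖u.d1 y‖ ≤ s * (K * ‖u‖) := by
    intro y hy
    have := u.isPrim.2.norm_sub_le ((l2Le_coe u.d2).mono_right (norm_d2_le u)) hs0.le hs2.le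
      (left_mem_Icc.2 hℓ.le) hy
    rwa [u.d1_zero_left, sub_zero] at this
  have h2 := u.isPrim.1.norm_sub_le_of_bound h1 (left_mem_Icc.2 hℓ.le) (Ioo_subset_Icc_self hx)
  rw [u.fn_zero_left, sub_zero, sub_zero] at h2
  have h3 := h1 x (Ioo_subset_Icc_self hx)
  have hu := norm_nonneg u
  constructor
  · refine h2.trans ?_
    have : 0 ≤ s * K * ‖u‖ := by positivity
    linarith
  · refine h3.trans ?_
    have : 0 ≤ s * K * p.ℓ * ‖u‖ := by positivity
    linarith

/-- The second derivative as a linear map. -/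
noncomputable def d2Lin (p : BeamData) : p.H20 →ₗ[ℂ] p.L2 where
  toFun := d2
  map_add' := d2_add
  map_smul' := d2_smul

/-- The second derivative as a bounded operator. -/
noncomputable def d2CLM (p : BeamData) : p.H20 →L[ℂ] p.L2 :=
  (d2Lin p).mkContinuous _ norm_d2_le

end H20

lemma memLp_of_continuous (p : BeamData) {f : ℝ → ℂ} (hf : Continuous f) : MemLp f 2 p.vol := by
  have h1 : IsCompact (Icc 0 p.ℓ) := isCompact_Icc
  obtain ⟨C, hC⟩ := h1.exists_bound_of_continuousOn hf.continuousOn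
  exact MemLp.of_bound hf.aestronglyMeasurable C ((ae_restrict_iff' measurableSet_Ioo).2
    (Eventually.of_forall fun x hx => hC x (Ioo_subset_Icc_self hx)))

/-- The constant function `1` in `L²(0, ℓ)`. -/
noncomputable def oneL2 (p : BeamData) : p.L2 :=
  (p.memLp_of_continuous (f := fun _ => 1) continuous_const).toLp

/-- The function `x` in `L²(0, ℓ)`. -/
noncomputable def idL2 (p : BeamData) : p.L2 :=
  (p.memLp_of_continuous (f := fun x => (x : ℂ)) Complex.continuous_ofReal).toLp

lemma inner_oneL2 (f : p.L2) : inner ℂ p.oneL2 f = ∫ x in 0..p.ℓ, f x := by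
  rw [L2.inner_def, intervalIntegral.integral_of_le p.ℓ_pos.le, integral_Ioc_eq_integral_Ioo]
  refine integral_congr_ae ?_
  filter_upwards [(p.memLp_of_continuous (f := fun _ => 1) continuous_const).coeFn_toLp] with x hx
  rw [oneL2, hx]; simp

lemma inner_idL2 (f : p.L2) : inner ℂ p.idL2 f = ∫ x in 0..p.ℓ, (x : ℂ) * f x := by
  rw [L2.inner_def, intervalIntegral.integral_of_le p.ℓ_pos.le, integral_Ioc_eq_integral_Ioo]
  refine integral_congr_ae ?_
  filter_upwards [(p.memLp_of_continuous (f := fun x => (x : ℂ))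
    Complex.continuous_ofReal).coeFn_toLp] with x hx
  rw [idL2, hx]; simp [mul_comm]

lemma intervalIntegrable_coe (f : p.L2) : IntervalIntegrable f volume 0 p.ℓ :=
  (l2Le_coe f).intervalIntegrable p.ℓ_pos.le

lemma isPrim_integral {a b : ℝ} {f : ℝ → ℂ} (hab : a ≤ b) (hf : IntervalIntegrable f volume a b) :
    IsPrim a b (fun x => ∫ t in a..x, f t) f := ⟨hab, hf, fun x _ => by simp⟩

/-- The range of the second derivative on `H²₀` consists of the functions orthogonal to `1, x`. -/
lemma mem_range_d2 (h : p.L2) :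
    (∃ u : p.H20, u.d2 = h) ↔ inner ℂ p.oneL2 h = 0 ∧ inner ℂ p.idL2 h = 0 := by
  have hℓ := p.ℓ_pos
  have X := IsPrim.ofReal hℓ.le
  have hc : ∀ {g : ℝ → ℂ}, IntervalIntegrable g volume 0 p.ℓ →
      IntervalIntegrable (fun x => (x : ℂ) * g x) volume 0 p.ℓ := fun hg =>
    hg.continuousOn_mul Complex.continuous_ofReal.continuousOn
  rw [inner_oneL2, inner_idL2]
  constructor
  -- Integrate `u''`, and `(x u')' = u' + x u''`, over the beam; all boundary terms vanish by
  -- clamping.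
  · rintro ⟨u, rfl⟩
    have h1 := u.isPrim.2.integral_eq
    rw [u.d1_zero_left, u.d1_zero_right, sub_zero] at h1
    have h2 := (X.mul u.isPrim.2).integral_eq
    have h3 := u.isPrim.1.integral_eq
    simp only [one_mul] at h2
    rw [intervalIntegral.integral_add u.isPrim.1.int (hc u.isPrim.2.int), h3,
      u.d1_zero_left, u.d1_zero_right, u.fn_zero_left, u.fn_zero_right] at h2
    exact ⟨h1, by simpa using h2⟩
  · rintro ⟨h1, h2⟩
    have ii := intervalIntegrable_coe h
    -- `G`, and below `F`, are iterated primitives of the zero extension of `h`. Orthogonality to 1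
    -- gives `G p.ℓ = 0`, orthogonality to x then gives `F p.ℓ = 0`, so both vanish off the beam.
    set G : ℝ → ℂ := fun x => ∫ t in (0 : ℝ)..x, (Ioo 0 p.ℓ).indicator h t with hG
    have hi : Integrable ((Ioo 0 p.ℓ).indicator h) volume :=
      (integrable_indicator_iff measurableSet_Ioo).2 ((Lp.memLp h).integrable (by norm_num))
    have hGc : Continuous G := intervalIntegral.continuous_primitive
      (fun a b => hi.intervalIntegrable) 0
    have PG : IsPrim 0 p.ℓ G h := (isPrim_integral hℓ.le hi.intervalIntegrable).congr_ae
      (Eventually.of_forall fun x hx => (indicator_of_mem hx _).symm)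
    have G0 : G 0 = 0 := by simp [hG]
    have Gl : G p.ℓ = 0 := by
      have := PG.integral_eq
      rw [h1, G0] at this; simpa using this.symm
    have hconst : ∀ x, x ∉ Ioo 0 p.ℓ → G x = 0 := by
      intro x hx
      have hz : ∀ {a b : ℝ}, (∀ t ∈ uIcc a b, t ∉ Ioo 0 p.ℓ) →
          ∫ t in a..b, (Ioo 0 p.ℓ).indicator h t = 0 := by
        intro a b hab
        rw [intervalIntegral.integral_congr (g := fun _ => 0)]
        · simp
        · intro t ht
          exact indicator_of_notMem (hab t ht) _
      rcases lt_or_ge x p.ℓ with hx1 | hx1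
      · have hx0 : x ≤ 0 := by
          by_contra h0
          exact hx ⟨not_le.1 h0, hx1⟩
        refine hz fun t ht htm => ?_
        rw [uIcc_of_ge hx0] at ht
        exact absurd htm.1 (not_lt.2 ht.2)
      · have : G x = G p.ℓ + ∫ t in p.ℓ..x, (Ioo 0 p.ℓ).indicator h t :=
          (intervalIntegral.integral_add_adjacent_intervals hi.intervalIntegrable
            hi.intervalIntegrable).symm
        rw [this, Gl, zero_add]
        refine hz fun t ht htm => ?_
        rw [uIcc_of_le hx1] at ht
        exact absurd htm.2 (not_lt.2 ht.1)
    set F : ℝ → ℂ := fun x => ∫ t in (0 : ℝ)..x, G t with hF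
    have hFd : ∀ x, HasDerivAt F (G x) x := fun x =>
      intervalIntegral.integral_hasDerivAt_right (hGc.intervalIntegrable _ _)
        (hGc.stronglyMeasurableAtFilter _ _) hGc.continuousAt
    have PF : IsPrim 0 p.ℓ F G := IsPrim.of_hasDerivAt hℓ.le hFd hGc
    have hFc : Continuous F := continuous_iff_continuousAt.2 fun x => (hFd x).continuousAt
    have F0 : F 0 = 0 := by simp [hF]
    have Fl : F p.ℓ = 0 := by
      have h3 := (X.mul PG).integral_eq
      simp only [one_mul] at h3
      rw [intervalIntegral.integral_add PF.int (hc PG.int), h2, G0, Gl, PF.integral_eq, F0] at h3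
      simpa using h3
    have hF0 : ∀ x, x ∉ Ioo 0 p.ℓ → F x = 0 := by
      intro x hx
      have hz : ∀ {a b : ℝ}, (∀ t ∈ uIcc a b, t ∉ Ioo 0 p.ℓ) → ∫ t in a..b, G t = 0 := by
        intro a b hab
        rw [intervalIntegral.integral_congr (g := fun _ => 0)]
        · simp
        · intro t ht
          exact hconst t (hab t ht)
      rcases lt_or_ge x p.ℓ with hx1 | hx1
      · have hx0 : x ≤ 0 := by
          by_contra h0
          exact hx ⟨not_le.1 h0, hx1⟩
        refine hz fun t ht htm => ?_
        rw [uIcc_of_ge hx0] at ht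
        exact absurd htm.1 (not_lt.2 ht.2)
      · have : F x = F p.ℓ + ∫ t in p.ℓ..x, G t :=
          (intervalIntegral.integral_add_adjacent_intervals (hGc.intervalIntegrable _ _)
            (hGc.intervalIntegrable _ _)).symm
        rw [this, Fl, zero_add]
        refine hz fun t ht htm => ?_
        rw [uIcc_of_le hx1] at ht
        exact absurd htm.2 (not_lt.2 ht.1)
    have mem : ((F, G, h) : (ℝ → ℂ) × (ℝ → ℂ) × p.L2) ∈ p.h20 := by
      refine ⟨⟨Lp.memLp h, fun x hx y hy => ?_, fun x hx y hy => ?_⟩, hFc, hGc,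
        fun x hx => ⟨hF0 x hx, hconst x hx⟩⟩
      · exact PG.sub_eq (Ioo_subset_Icc_self hx) (Ioo_subset_Icc_self hy)
      · exact PF.sub_eq (Ioo_subset_Icc_self hx) (Ioo_subset_Icc_self hy)
    exact ⟨(⟨_, mem⟩ : ↥p.h20), rfl⟩

/-- The second derivative is an isomorphism onto the orthogonal complement of {1, x} in L², which is
closed, so completeness is inherited. -/
instance : CompleteSpace p.H20 := by
  refine Metric.complete_of_cauchySeq_tendsto fun u hu => ?_
  have hd : CauchySeq fun n => (u n).d2 :=
    hu.map (H20.d2CLM p).uniformContinuous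
  obtain ⟨h, hh⟩ := cauchySeq_tendsto_of_complete hd
  have perp : ∀ e : p.L2, (∀ w : p.H20, inner ℂ e w.d2 = 0) → inner ℂ e h = 0 := by
    intro e he
    have := (Filter.Tendsto.inner (𝕜 := ℂ) (tendsto_const_nhds (x := e)) hh)
    simp only [he] at this
    exact tendsto_nhds_unique this tendsto_const_nhds
  obtain ⟨w, hw⟩ := (mem_range_d2 h).2
    ⟨perp _ fun w => ((mem_range_d2 _).1 ⟨w, rfl⟩).1, perp _ fun w => ((mem_range_d2 _).1 ⟨w, rfl⟩).2⟩
  refine ⟨w, ?_⟩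
  rw [tendsto_iff_norm_sub_tendsto_zero] at hh ⊢
  refine squeeze_zero (fun _ => norm_nonneg _) (fun n => norm_le_d2 _) ?_
  have : ∀ n, (u n - w).d2 = (u n).d2 - h := fun n => by
    rw [← hw]; exact map_sub (H20.d2CLM p) _ _
  simp only [this]
  simpa using hh.const_mul (√(max p.α₁ p.α₂))

/-- An element of `L²` orthogonal to all second derivatives of `H²₀` is affine. -/
lemma exists_affine (S : p.L2) (hS : ∀ w : p.H20, inner ℂ S w.d2 = 0) :
    ∃ c₀ c₁ : ℂ, ∀ᵐ x ∂p.vol, S x = c₀ + c₁ * x := by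
  set V : Submodule ℂ p.L2 := Submodule.span ℂ {p.oneL2, p.idL2} with hV
  have : FiniteDimensional ℂ V := FiniteDimensional.span_of_finite ℂ (by simp)
  have h1 : S - V.starProjection S ∈ Vᗮ := V.sub_starProjection_mem_orthogonal S
  have hP : V.starProjection S ∈ V := V.starProjection_apply_mem S
  have hperp : ∀ e ∈ V, inner ℂ e (S - V.starProjection S) = 0 := fun e he =>
    (Submodule.mem_orthogonal _ _).1 h1 e he
  obtain ⟨w, hw⟩ := (mem_range_d2 _).2 ⟨hperp p.oneL2 (Submodule.subset_span (by simp)),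
    hperp p.idL2 (Submodule.subset_span (by simp))⟩
  -- The component of `S` orthogonal to {1, x} is itself a second derivative, so it is orthogonal
  -- both to `S` and to the projection of `S`, hence to itself.
  have h2 : S - V.starProjection S = 0 := by
    have e1 := hS w
    have e2 := hperp _ hP
    rw [hw] at e1
    have : inner ℂ (S - V.starProjection S) (S - V.starProjection S) = (0 : ℂ) := by
      rw [inner_sub_left, e1, e2, sub_zero]
    exact inner_self_eq_zero.1 this
  rw [sub_eq_zero] at h2
  rw [← h2, hV, Submodule.mem_span_pair] at hP
  obtain ⟨c₀, c₁, hc⟩ := hP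
  refine ⟨c₀, c₁, ?_⟩
  rw [← hc]
  filter_upwards [Lp.coeFn_add (c₀ • p.oneL2) (c₁ • p.idL2), Lp.coeFn_smul c₀ p.oneL2,
    Lp.coeFn_smul c₁ p.idL2, (p.memLp_of_continuous (f := fun _ => 1) continuous_const).coeFn_toLp,
    (p.memLp_of_continuous (f := fun x => (x : ℂ)) Complex.continuous_ofReal).coeFn_toLp]
    with x e1 e2 e3 e4 e5
  rw [e1, Pi.add_apply, e2, e3, Pi.smul_apply, Pi.smul_apply, oneL2, idL2, e4, e5]
  simp

end BeamData

/-! ## Bending moments and Green's formula -/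

namespace BeamData

variable {p : BeamData} {U F : p.Phase}

/-- On `(a, b)` the bending moment of `U`, with `𝓐 U = F`, is `M`, and `M' = N`, up to the ends. -/
structure MomentOn (p : BeamData) (U F : p.Phase) (a b : ℝ) (M N : ℝ → ℂ) : Prop where
  lt : a < b
  prim : IsPrim a b M N
  prim' : IsPrim a b N (fun x => -F.snd x)
  eq : ∀ᵐ x, x ∈ Ioo a b → M x = p.α x * U.fst.d2 x + p.κ x * F.fst.d2 x

/-- The bending moment on the five pieces of the beam, with the transmission conditions. -/
structure Moments (p : BeamData) (U F : p.Phase) (M N : Fin 5 → ℝ → ℂ) : Prop where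
  vel : (U.snd : ℝ → ℂ) =ᵐ[p.vol] F.fst.fn
  m0 : p.MomentOn U F 0 p.ξ₁ (M 0) (N 0)
  m1 : p.MomentOn U F p.ξ₁ p.ℓ₀ (M 1) (N 1)
  m2 : p.MomentOn U F p.ℓ₀ p.ξ₂ (M 2) (N 2)
  m3 : p.MomentOn U F p.ξ₂ p.ℓ₁ (M 3) (N 3)
  m4 : p.MomentOn U F p.ℓ₁ p.ℓ (M 4) (N 4)
  jM1 : M 1 p.ξ₁ = M 0 p.ξ₁
  jN1 : N 1 p.ξ₁ = N 0 p.ξ₁ - p.γ₁ * F.fst.fn p.ξ₁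
  jM2 : M 2 p.ℓ₀ = M 1 p.ℓ₀
  jN2 : N 2 p.ℓ₀ = N 1 p.ℓ₀
  jM3 : M 3 p.ξ₂ = M 2 p.ξ₂ + p.γ₃ * F.fst.d1 p.ξ₂
  jN3 : N 3 p.ξ₂ = N 2 p.ξ₂ - p.γ₂ * F.fst.fn p.ξ₂
  jM4 : M 4 p.ℓ₁ = M 3 p.ℓ₁
  jN4 : N 4 p.ℓ₁ = N 3 p.ℓ₁

/-- Each open piece is extended to its closure separately, because the moment and the shear force
may have two values at a node; the jumps become equations between these boundary values. -/
lemma OperatorGraph.exists_moments (h : p.OperatorGraph U F) : ∃ M N, p.Moments U F M N := by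
  obtain ⟨hv, M, M₁, M₂, e, a1, a2, a3, a4, a5, j1, j2, j3, j4, j5, j6, j7, j8, eF⟩ := h
  have o1 := p.ξ₁_pos
  have o2 := p.ξ₁_lt
  have o3 := p.lt_ξ₂
  have o4 := p.ξ₂_lt
  have o5 := p.ℓ₁_lt
  rw [ae_restrict_iff' measurableSet_Ioo] at e eF
  have piece : ∀ {a b : ℝ}, 0 ≤ a → b ≤ p.ℓ → a < b → HasH2Deriv a b M M₁ M₂ →
      ∃ m n, p.MomentOn U F a b m n ∧ EqOn m M (Ioo a b) ∧ EqOn n M₁ (Ioo a b) := by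
    intro a b ha hb hab H
    obtain ⟨m, n, h1, h2, e1, e2⟩ := H.exists_isPrim hab
    refine ⟨m, n, ⟨hab, h1, h2.congr_ae ?_, ?_⟩, e1, e2⟩
    · filter_upwards [eF] with x hx hxm
      rw [hx (Ioo_subset_Ioo ha hb hxm), neg_neg]
    · filter_upwards [e] with x hx hxm
      rw [e1 hxm, hx (Ioo_subset_Ioo ha hb hxm)]
  obtain ⟨m0, n0, p0, e0, f0⟩ := piece le_rfl (by linarith) o1 a1
  obtain ⟨m1, n1, p1, e1, f1⟩ := piece (by linarith) (by linarith) o2 a2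
  obtain ⟨m2, n2, p2, e2, f2⟩ := piece (by linarith) (by linarith) o3 a3
  obtain ⟨m3, n3, p3, e3, f3⟩ := piece (by linarith) (by linarith) o4 a4
  obtain ⟨m4, n4, p4, e4, f4⟩ := piece (by linarith) le_rfl o5 a5
  refine ⟨![m0, m1, m2, m3, m4], ![n0, n1, n2, n3, n4], hv, p0, p1, p2, p3, p4, ?_, ?_, ?_, ?_,
    ?_, ?_, ?_, ?_⟩
  · exact sub_eq_zero.1 (j5.eq_of_isPrim o1 o2 p0.prim p1.prim e0 e1)
  · have := j6.eq_of_isPrim o1 o2 p0.prim' p1.prim' f0 f1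
    change n1 _ = n0 _ - _
    linear_combination this
  · exact sub_eq_zero.1 (j1.eq_of_isPrim o2 o3 p1.prim p2.prim e1 e2)
  · exact sub_eq_zero.1 (j2.eq_of_isPrim o2 o3 p1.prim' p2.prim' f1 f2)
  · have := j7.eq_of_isPrim o3 o4 p2.prim p3.prim e2 e3
    change m3 _ = m2 _ + _
    linear_combination this
  · have := j8.eq_of_isPrim o3 o4 p2.prim' p3.prim' f2 f3
    change n3 _ = n2 _ - _
    linear_combination this
  · exact sub_eq_zero.1 (j3.eq_of_isPrim o4 o5 p3.prim p4.prim e3 e4)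
  · exact sub_eq_zero.1 (j4.eq_of_isPrim o4 o5 p3.prim' p4.prim' f3 f4)

/-- The integrand of the weak form of the beam equation, tested with `w`. -/
noncomputable def weakIntegrand (p : BeamData) (U F : p.Phase) (w : p.H20) (x : ℝ) : ℂ :=
  F.snd x * starRingEnd ℂ (w.fn x)
    + (p.α x * U.fst.d2 x + p.κ x * F.fst.d2 x) * starRingEnd ℂ (w.d2 x)

/-- In the derivative of M w̄' − N w̄ the cross terms N w̄' cancel, and −N' is `F.snd`. -/
lemma MomentOn.isPrim {a b : ℝ} {M N : ℝ → ℂ} (h : p.MomentOn U F a b M N) (ha : 0 ≤ a)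
    (hb : b ≤ p.ℓ) (w : p.H20) :
    IsPrim a b (fun x => M x * starRingEnd ℂ (w.d1 x) - N x * starRingEnd ℂ (w.fn x))
      (p.weakIntegrand U F w) := by
  have hab := h.lt.le
  have w0 := (w.isPrim.1.mono ha hab hb).conj
  have w1 := (w.isPrim.2.mono ha hab hb).conj
  refine ((h.prim.mul w1).sub (h.prim'.mul w0)).congr_ae ?_
  filter_upwards [h.eq] with x hx hxm
  rw [weakIntegrand, ← hx hxm]
  ring

/-- Green's formula: the weak form of `𝓐 U = F`. -/
lemma OperatorGraph.weak_form (h : p.OperatorGraph U F) (w : p.H20) :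
    IntervalIntegrable (p.weakIntegrand U F w) volume 0 p.ℓ ∧
    (∫ x in 0..p.ℓ, p.weakIntegrand U F w x) =
      -(p.γ₁ * F.fst.fn p.ξ₁ * starRingEnd ℂ (w.fn p.ξ₁)
        + p.γ₂ * F.fst.fn p.ξ₂ * starRingEnd ℂ (w.fn p.ξ₂)
        + p.γ₃ * F.fst.d1 p.ξ₂ * starRingEnd ℂ (w.d1 p.ξ₂)) := by
  obtain ⟨M, N, H⟩ := h.exists_moments
  have o1 := p.ξ₁_pos
  have o2 := p.ξ₁_lt
  have o3 := p.lt_ξ₂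
  have o4 := p.ξ₂_lt
  have o5 := p.ℓ₁_lt
  have k0 := H.m0.isPrim le_rfl (by linarith) w
  have k1 := H.m1.isPrim (by linarith) (by linarith) w
  have k2 := H.m2.isPrim (by linarith) (by linarith) w
  have k3 := H.m3.isPrim (by linarith) (by linarith) w
  have k4 := H.m4.isPrim (by linarith) le_rfl w
  have i1 := k0.int.trans k1.int
  have i2 := i1.trans k2.int
  have i3 := i2.trans k3.int
  refine ⟨i3.trans k4.int, ?_⟩
  -- The sum telescopes: only the jumps at ξ₁ and ξ₂ survive, since `w` and its derivative are
  -- continuous and vanish at both ends of the beam.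
  rw [← intervalIntegral.integral_add_adjacent_intervals i3 k4.int,
    ← intervalIntegral.integral_add_adjacent_intervals i2 k3.int,
    ← intervalIntegral.integral_add_adjacent_intervals i1 k2.int,
    ← intervalIntegral.integral_add_adjacent_intervals k0.int k1.int,
    k0.integral_eq, k1.integral_eq, k2.integral_eq, k3.integral_eq, k4.integral_eq,
    H.jM1, H.jN1, H.jM2, H.jN2, H.jM3, H.jN3, H.jM4, H.jN4,
    w.fn_zero_left, w.fn_zero_right, w.d1_zero_left, w.d1_zero_right]
  simp only [map_zero]
  ring

lemma integrable_κ_sq (f : p.L2) : Integrable (fun x => p.κ x * ‖f x‖ ^ 2) p.vol := by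
  refine (Lp.memLp f).norm.integrable_sq.bdd_mul (c := p.α₀)
    p.measurable_κ.aestronglyMeasurable (Eventually.of_forall fun x => ?_)
  rw [Real.norm_of_nonneg (p.κ_nonneg x)]
  exact p.κ_le x

/-- The rate of dissipation of energy. -/
noncomputable def dissipation (p : BeamData) (v : p.H20) : ℝ :=
  (∫ x in Ioo 0 p.ℓ, p.κ x * ‖v.d2 x‖ ^ 2) + p.γ₁ * ‖v.fn p.ξ₁‖ ^ 2 + p.γ₂ * ‖v.fn p.ξ₂‖ ^ 2
    + p.γ₃ * ‖v.d1 p.ξ₂‖ ^ 2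

lemma inner_phase (U F : p.Phase) : inner ℂ U F
    = (∫ x, (p.α x : ℂ) * inner ℂ (U.fst.d2 x) (F.fst.d2 x) ∂p.vol) + inner ℂ U.snd F.snd :=
  WithLp.prod_inner_apply U F

/-- The energy balance. -/
lemma OperatorGraph.re_inner (h : p.OperatorGraph U F) :
    (inner ℂ U F).re = -p.dissipation F.fst := by
  obtain ⟨-, h2⟩ := h.weak_form F.fst
  have hv := h.1
  set v := F.fst with hvdef
  rw [intervalIntegral.integral_of_le p.ℓ_pos.le, integral_Ioc_eq_integral_Ioo] at h2
  have hκ : Integrable (fun x => ((p.κ x * ‖v.d2 x‖ ^ 2 : ℝ) : ℂ)) p.vol :=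
    (integrable_κ_sq v.d2).ofReal
  -- The test function is the velocity itself. The α term appears as the conjugate of the energy
  -- inner product, which is harmless since only real parts are compared.
  have e : (∫ x in Ioo 0 p.ℓ, p.weakIntegrand U F v x)
      = starRingEnd ℂ (∫ x, (p.α x : ℂ) * inner ℂ (U.fst.d2 x) (v.d2 x) ∂p.vol)
        + inner ℂ U.snd F.snd + ((∫ x in Ioo 0 p.ℓ, p.κ x * ‖v.d2 x‖ ^ 2 : ℝ) : ℂ) := by
    rw [← integral_conj, L2.inner_def, ← integral_complex_ofReal, ← integral_add, ← integral_add]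
    · refine integral_congr_ae ?_
      filter_upwards [hv] with x hx
      rw [weakIntegrand, ← hx]
      simp only [map_mul, Complex.conj_ofReal, RCLike.inner_apply, Complex.conj_conj]
      push_cast
      rw [← Complex.mul_conj']
      ring
    · exact ((LinearIsometryEquiv.integrable_comp_iff Complex.conjLIE).2
        (p.integrable_α_inner U.fst.d2 v.d2)).add (L2.integrable_inner _ _)
    · exact hκ
    · exact (LinearIsometryEquiv.integrable_comp_iff Complex.conjLIE).2
        (p.integrable_α_inner U.fst.d2 v.d2)
    · exact L2.integrable_inner _ _
  rw [e] at h2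
  have h3 := congrArg Complex.re h2
  have hn : ∀ (c : ℝ) (z : ℂ), ((c : ℂ) * z * starRingEnd ℂ z).re = c * ‖z‖ ^ 2 := by
    intro c z
    rw [mul_assoc, Complex.mul_conj', ← Complex.ofReal_pow, ← Complex.ofReal_mul,
      Complex.ofReal_re]
  simp only [Complex.add_re, Complex.neg_re, hn, Complex.conj_re, Complex.ofReal_re] at h3
  rw [inner_phase, Complex.add_re, dissipation]
  linarith

lemma dissipation_nonneg (v : p.H20) : 0 ≤ p.dissipation v := by
  have h1 : 0 ≤ ∫ x in Ioo 0 p.ℓ, p.κ x * ‖v.d2 x‖ ^ 2 :=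
    integral_nonneg fun x => mul_nonneg (p.κ_nonneg x) (by positivity)
  have := p.γ₁_pos
  have := p.γ₂_pos
  have := p.γ₃_pos
  unfold dissipation
  positivity

lemma OperatorGraph.re_inner_nonpos (h : p.OperatorGraph U F) : (inner ℂ U F).re ≤ 0 := by
  rw [h.re_inner]
  linarith [dissipation_nonneg F.fst]

end BeamData

/-! ## The value `0` belongs to the resolvent set -/

lemma IsPrim.hasH2Deriv {a b : ℝ} {F G h f g : ℝ → ℂ} (HF : IsPrim a b F G) (HG : IsPrim a b G h)
    (hh : MemLp h 2 (volume.restrict (Ioo a b))) (ef : EqOn f F (Ioo a b))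
    (eg : EqOn g G (Ioo a b)) : HasH2Deriv a b f g h where
  memLp := hh
  sub_eq_snd x hx y hy := by
    rw [eg hx, eg hy]
    exact HG.sub_eq (Ioo_subset_Icc_self hx) (Ioo_subset_Icc_self hy)
  sub_eq_fst x hx y hy := by
    rw [ef hx, ef hy, HF.sub_eq (Ioo_subset_Icc_self hx) (Ioo_subset_Icc_self hy)]
    exact intervalIntegral.integral_congr fun t ht => (eg (HasH2Deriv.uIcc_sub hx hy ht)).symm

lemma hasJump_of_isPrim {a b c : ℝ} {F f G g k : ℝ → ℂ} {z : ℂ}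
    (hab : a < b) (hbc : b < c) (HF : IsPrim a b F f) (HG : IsPrim b c G g)
    (eF : EqOn F k (Ioo a b)) (eG : EqOn G k (Ioo b c)) (h : G b - F b = z) : HasJump k b z :=
  ⟨F b, G b, HF.tendsto_right hab eF, HG.tendsto_left hbc eG, h⟩

namespace BeamData

variable {p : BeamData}

lemma exists_primitive (f : p.L2) : ∃ F G : ℝ → ℂ, Continuous F ∧ IsPrim 0 p.ℓ F G ∧
    IsPrim 0 p.ℓ G f := by
  have hi : Integrable ((Ioo 0 p.ℓ).indicator f) volume :=
    (integrable_indicator_iff measurableSet_Ioo).2 ((Lp.memLp f).integrable (by norm_num))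
  have hGc : Continuous fun x => ∫ t in (0 : ℝ)..x, (Ioo 0 p.ℓ).indicator f t :=
    intervalIntegral.continuous_primitive (fun a b => hi.intervalIntegrable) 0
  exact ⟨fun x => ∫ t in (0 : ℝ)..x, ∫ s in (0 : ℝ)..t, (Ioo 0 p.ℓ).indicator f s, _,
    intervalIntegral.continuous_primitive (fun a b => hGc.intervalIntegrable _ _) 0,
    isPrim_integral p.ℓ_pos.le (hGc.intervalIntegrable _ _),
    (isPrim_integral p.ℓ_pos.le hi.intervalIntegrable).congr_ae
      (Eventually.of_forall fun x hx => (indicator_of_mem hx _).symm)⟩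

lemma memLp_mul_coe {c : ℝ → ℝ} {C : ℝ} (hc : Measurable c) (hC : ∀ x, 0 ≤ c x ∧ c x ≤ C)
    (f : p.L2) : MemLp (fun x => (c x : ℂ) * f x) 2 p.vol := by
  refine (Lp.memLp f).of_le_mul (c := C)
    ((Complex.measurable_ofReal.comp hc).aestronglyMeasurable.mul (Lp.memLp f).1) ?_
  refine Eventually.of_forall fun x => ?_
  rw [norm_mul, Complex.norm_real, Real.norm_of_nonneg (hC x).1]
  exact mul_le_mul_of_nonneg_right (hC x).2 (norm_nonneg _)

/-- Solution of `α u'' = T` modulo affine functions. -/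
lemma exists_d2_eq_add_affine {T : ℝ → ℂ} (hT : MemLp T 2 p.vol) :
    ∃ (u : p.H20) (c₀ c₁ : ℂ), ∀ᵐ x ∂p.vol, p.α x * u.d2 x = T x + (c₀ + c₁ * x) := by
  -- Riesz representation in the energy inner product: `u` represents w ↦ ⟨T, w''⟩, so αu'' − T is
  -- orthogonal to every w'' and hence affine.
  set L : p.H20 →L[ℂ] ℂ := (innerSL ℂ hT.toLp).comp (H20.d2CLM p) with hL
  set u : p.H20 := (InnerProductSpace.toDual ℂ p.H20).symm L with hu
  have h1 : ∀ w : p.H20, inner ℂ u w = inner ℂ hT.toLp w.d2 := fun w => by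
    rw [hu, InnerProductSpace.toDual_symm_apply]; rfl
  have hα : MemLp (fun x => (p.α x : ℂ) * u.d2 x) 2 p.vol :=
    memLp_mul_coe p.measurable_α (fun x => ⟨(p.α_pos x).le, p.α_le x⟩) _
  obtain ⟨c₀, c₁, hc⟩ := exists_affine (hα.toLp - hT.toLp) (fun w => by
    rw [inner_sub_left, ← h1, sub_eq_zero, L2.inner_def]
    refine integral_congr_ae ?_
    filter_upwards [hα.coeFn_toLp] with x hx
    rw [hx]
    simp only [RCLike.inner_apply, map_mul, Complex.conj_ofReal]
    ring)
  refine ⟨u, c₀, c₁, ?_⟩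
  filter_upwards [hc, Lp.coeFn_sub hα.toLp hT.toLp, hα.coeFn_toLp, hT.coeFn_toLp] with x e1 e2 e3 e4
  rw [e2, Pi.sub_apply, e3, e4] at e1
  linear_combination e1

/-- The velocity is `F.fst`, so M'' and all jumps of the moment are prescribed by `F`. This fixes M
up to an affine function, which is exactly the freedom needed to solve αu'' = M − κv'' with clamped
ends. -/
lemma exists_operatorGraph (F : p.Phase) : ∃ U : p.Phase, p.OperatorGraph U F := by
  have o1 := p.ξ₁_pos
  have o2 := p.ξ₁_lt
  have o3 := p.lt_ξ₂
  have o4 := p.ξ₂_lt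
  have o5 := p.ℓ₁_lt
  obtain ⟨P, Q, hPc, hP, hQ⟩ := exists_primitive (-F.snd)
  set A₁ : ℂ := -(p.γ₁ * F.fst.fn p.ξ₁) with hA₁
  set A₂ : ℂ := -(p.γ₂ * F.fst.fn p.ξ₂) with hA₂
  set A₃ : ℂ := p.γ₃ * F.fst.d1 p.ξ₂ with hA₃
  -- A particular moment: truncated affine functions build in the slope jump `A₁` at ξ₁, and the
  -- value jump `A₃` and slope jump `A₂` at ξ₂.
  set T : ℝ → ℂ := fun x => P x + (Ioi p.ξ₁).indicator (fun x => A₁ * (x - p.ξ₁)) x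
    + (Ioi p.ξ₂).indicator (fun x => A₃ + A₂ * (x - p.ξ₂)) x with hT
  have hTm : MemLp T 2 p.vol := by
    refine ((p.memLp_of_continuous hPc).add ?_).add ?_
    · exact (p.memLp_of_continuous (by fun_prop)).indicator measurableSet_Ioi
    · exact (p.memLp_of_continuous (by fun_prop)).indicator measurableSet_Ioi
  have hκm : MemLp (fun x => (p.κ x : ℂ) * F.fst.d2 x) 2 p.vol :=
    memLp_mul_coe p.measurable_κ (fun x => ⟨p.κ_nonneg x, p.κ_le x⟩) _
  obtain ⟨u, c₀, c₁, hu⟩ := exists_d2_eq_add_affine (hTm.sub hκm)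
  have hv : MemLp F.fst.fn 2 p.vol := p.memLp_of_continuous F.fst.continuous_fn
  set M : ℝ → ℂ := fun x => T x + (c₀ + c₁ * x) with hM
  set M₁ : ℝ → ℂ := fun x => Q x + (Ioi p.ξ₁).indicator (fun _ => A₁) x
    + (Ioi p.ξ₂).indicator (fun _ => A₂) x + c₁ with hM₁
  have aff : ∀ {a b : ℝ} (d e : ℂ), 0 ≤ a → a ≤ b → b ≤ p.ℓ →
      IsPrim a b (fun x => P x + (d + e * x)) (fun x => Q x + e) ∧
      IsPrim a b (fun x => Q x + e) (-F.snd : p.L2) := by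
    intro a b d e ha hab hb
    constructor
    · refine ((hP.mono ha hab hb).add ((IsPrim.const hab d).add
        ((IsPrim.ofReal hab).const_mul e))).congr fun x => ?_
      ring
    · exact ((hQ.mono ha hab hb).add (IsPrim.const hab e)).congr fun x => by ring
  have e0 : EqOn M (fun x => P x + (c₀ + c₁ * x)) (Ioo 0 p.ξ₁) ∧
      EqOn M₁ (fun x => Q x + c₁) (Ioo 0 p.ξ₁) := by
    constructor <;> intro x hx <;> simp only [hM, hT, hM₁]
    · rw [indicator_of_notMem (by simp; linarith [hx.2]),
        indicator_of_notMem (by simp; linarith [hx.2])]; ring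
    · rw [indicator_of_notMem (by simp; linarith [hx.2]),
        indicator_of_notMem (by simp; linarith [hx.2])]; ring
  have e1 : EqOn M (fun x => P x + (c₀ - A₁ * p.ξ₁ + (c₁ + A₁) * x)) (Ioo p.ξ₁ p.ξ₂) ∧
      EqOn M₁ (fun x => Q x + (c₁ + A₁)) (Ioo p.ξ₁ p.ξ₂) := by
    constructor <;> intro x hx <;> simp only [hM, hT, hM₁]
    · rw [indicator_of_mem (by exact hx.1), indicator_of_notMem (by simp; linarith [hx.2])]; ring
    · rw [indicator_of_mem (by exact hx.1), indicator_of_notMem (by simp; linarith [hx.2])]; ring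
  have e2 : EqOn M (fun x => P x + (c₀ - A₁ * p.ξ₁ + A₃ - A₂ * p.ξ₂ + (c₁ + A₁ + A₂) * x))
      (Ioo p.ξ₂ p.ℓ) ∧ EqOn M₁ (fun x => Q x + (c₁ + A₁ + A₂)) (Ioo p.ξ₂ p.ℓ) := by
    constructor <;> intro x hx <;> simp only [hM, hT, hM₁]
    · rw [indicator_of_mem (show x ∈ Ioi p.ξ₁ from lt_trans (by linarith) hx.1),
        indicator_of_mem (by exact hx.1)]; ring
    · rw [indicator_of_mem (show x ∈ Ioi p.ξ₁ from lt_trans (by linarith) hx.1),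
        indicator_of_mem (by exact hx.1)]; ring
  have sub : ∀ {a b c d : ℝ} {f g : ℝ → ℂ}, EqOn f g (Ioo c d) → c ≤ a → b ≤ d →
      EqOn f g (Ioo a b) := fun h hc hd => h.mono (Ioo_subset_Ioo hc hd)
  have piece : ∀ {a b : ℝ} (d e : ℂ), 0 ≤ a → a < b → b ≤ p.ℓ →
      EqOn M (fun x => P x + (d + e * x)) (Ioo a b) → EqOn M₁ (fun x => Q x + e) (Ioo a b) →
      HasH2Deriv a b M M₁ (-F.snd : p.L2) := by
    intro a b d e ha hab hb h h'
    exact (aff d e ha hab.le hb).1.hasH2Deriv (aff d e ha hab.le hb).2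
      ((Lp.memLp (-F.snd)).mono_measure (Measure.restrict_mono (Ioo_subset_Ioo ha hb) le_rfl)) h h'
  have jump : ∀ {a b c : ℝ} (d e d' e' : ℂ), 0 ≤ a → a < b → b < c → c ≤ p.ℓ →
      EqOn M (fun x => P x + (d + e * x)) (Ioo a b) → EqOn M₁ (fun x => Q x + e) (Ioo a b) →
      EqOn M (fun x => P x + (d' + e' * x)) (Ioo b c) → EqOn M₁ (fun x => Q x + e') (Ioo b c) →
      HasJump M b (d' - d + (e' - e) * b) ∧ HasJump M₁ b (e' - e) := by
    intro a b c d e d' e' ha hab hbc hc h1 h2 h3 h4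
    have p1 := aff d e ha hab.le (hbc.le.trans hc)
    have p2 := aff d' e' (ha.trans hab.le) hbc.le hc
    exact ⟨hasJump_of_isPrim hab hbc p1.1 p2.1 h1.symm h3.symm (by ring),
      hasJump_of_isPrim hab hbc p1.2 p2.2 h2.symm h4.symm (by ring)⟩
  have J1 := jump _ _ _ _ le_rfl o1 o2 (by linarith) e0.1 e0.2
    (sub e1.1 le_rfl (by linarith)) (sub e1.2 le_rfl (by linarith))
  have J2 := jump _ _ _ _ o1.le o2 o3 (by linarith) (sub e1.1 le_rfl (by linarith))
    (sub e1.2 le_rfl (by linarith)) (sub e1.1 o2.le le_rfl) (sub e1.2 o2.le le_rfl)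
  have J3 := jump _ _ _ _ (by linarith) o3 o4 (by linarith) (sub e1.1 o2.le le_rfl)
    (sub e1.2 o2.le le_rfl) (sub e2.1 le_rfl o5.le) (sub e2.2 le_rfl o5.le)
  have J4 := jump _ _ _ _ (by linarith) o4 o5 le_rfl (sub e2.1 le_rfl o5.le)
    (sub e2.2 le_rfl o5.le) (sub e2.1 o4.le le_rfl) (sub e2.2 o4.le le_rfl)
  refine ⟨WithLp.toLp 2 (u, hv.toLp), hv.coeFn_toLp, M, M₁, (-F.snd : p.L2), ?_,
    piece _ _ le_rfl o1 (by linarith) e0.1 e0.2,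
    piece _ _ o1.le o2 (by linarith) (sub e1.1 le_rfl (by linarith)) (sub e1.2 le_rfl (by linarith)),
    piece _ _ (by linarith) o3 (by linarith) (sub e1.1 o2.le le_rfl) (sub e1.2 o2.le le_rfl),
    piece _ _ (by linarith) o4 (by linarith) (sub e2.1 le_rfl o5.le) (sub e2.2 le_rfl o5.le),
    piece _ _ (by linarith) o5 le_rfl (sub e2.1 o4.le le_rfl) (sub e2.2 o4.le le_rfl),
    ?_, ?_, ?_, ?_, ?_, ?_, ?_, ?_, ?_⟩
  · filter_upwards [hu] with x hx
    change T x + (c₀ + c₁ * x) = p.α x * u.d2 x + p.κ x * F.fst.d2 x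
    simp only [Pi.sub_apply] at hx
    linear_combination -hx
  · convert J2.1 using 1; ring
  · convert J2.2 using 1; ring
  · convert J4.1 using 1; ring
  · convert J4.2 using 1; ring
  · convert J1.1 using 1; ring
  · convert J1.2 using 1; ring
  · convert J3.1 using 1; ring
  · convert J3.2 using 1; ring
  · filter_upwards [Lp.coeFn_neg F.snd] with x hx
    rw [hx]; simp

/-- The velocity is part of `F`, so only `u` must be bounded. Testing the weak form with `u` itself
gives ‖u‖² up to terms in `F`; the viscous term is absorbed by Young's inequality. -/
lemma OperatorGraph.exists_norm_le (p : BeamData) : ∃ C : ℝ, ∀ U F : p.Phase,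
    p.OperatorGraph U F → ‖U‖ ≤ C * ‖F‖ := by
  obtain ⟨K, hK, hb⟩ := H20.exists_bound p
  have hℓ := p.ℓ_pos
  have hγ₁ := p.γ₁_pos
  have hγ₂ := p.γ₂_pos
  have hγ₃ := p.γ₃_pos
  have hα₀ := p.α₀_pos
  set s := √p.ℓ with hs
  have hs0 : 0 < s := Real.sqrt_pos.2 hℓ
  have hs2 : p.ℓ - 0 = s ^ 2 := by rw [hs, Real.sq_sqrt hℓ.le, sub_zero]
  set m := min p.α₁ p.α₂ with hm
  have hm0 : 0 < m := p.min_α_pos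
  set K₁ := K * s + (p.γ₁ + p.γ₂ + p.γ₃) * K ^ 2 with hK₁
  have hK₁0 : 0 < K₁ := by positivity
  -- Chosen so that mX²/2 + K₂mY² − α₀XY is the square (mX − α₀Y)²/(2m).
  set K₂ := p.α₀ ^ 2 / (2 * m ^ 2) with hK₂
  have hK₂0 : 0 < K₂ := by positivity
  refine ⟨(1 + 2 * K₁ + 2 * K₂) + s * K, fun U F h => ?_⟩
  have hF := norm_nonneg F
  have hF1 := norm_fst_le F
  have hF2 := norm_snd_le F
  have hsnd : ‖U.snd‖ ≤ s * K * ‖F‖ := by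
    have h1 : L2Le 0 p.ℓ U.snd (s * (K * ‖F.fst‖)) := by
      refine (L2Le.of_bound (F.fst.continuous_fn.aestronglyMeasurable) hs0.le (by positivity) hs2.le
        fun x _ => (hb F.fst x).1).congr_ae ?_
      exact (ae_restrict_iff' measurableSet_Ioo).1 h.1
    have h2 := h1.integral_sq_le
    rw [← norm_sq_L2] at h2
    have h3 := abs_le_of_sq_le_sq' h2 h1.nonneg |>.2
    calc _ ≤ _ := h3
      _ ≤ s * (K * ‖F‖) := by gcongr
      _ = _ := by ring
  set u := U.fst with hu
  set v := F.fst with hv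
  have hw := h.weak_form u
  have i1 : IntervalIntegrable (fun x => ((p.α x * ‖u.d2 x‖ ^ 2 : ℝ) : ℂ)) volume 0 p.ℓ := by
    rw [intervalIntegrable_iff_integrableOn_Ioo_of_le hℓ.le]
    exact (integrable_α_sq u.d2).ofReal
  have e1 : (∫ x in (0 : ℝ)..p.ℓ, ((p.α x * ‖u.d2 x‖ ^ 2 : ℝ) : ℂ)) = ((‖u‖ ^ 2 : ℝ) : ℂ) := by
    rw [norm_sq_H20, intervalIntegral.integral_of_le hℓ.le, integral_Ioc_eq_integral_Ioo,
      integral_complex_ofReal]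
  have e2 := intervalIntegral.integral_sub hw.1 i1
  have i3 : IntervalIntegrable (fun x => K * ‖u‖ * ‖F.snd x‖ + (p.α x * ‖u.d2 x‖ ^ 2 / 2
      + K₂ * (p.α x * ‖v.d2 x‖ ^ 2))) volume 0 p.ℓ := by
    refine ((intervalIntegrable_coe F.snd).norm.const_mul _).add ?_
    rw [intervalIntegrable_iff_integrableOn_Ioo_of_le hℓ.le]
    exact ((integrable_α_sq u.d2).div_const 2).add ((integrable_α_sq v.d2).const_mul K₂)
  have b1 : ‖∫ x in (0 : ℝ)..p.ℓ, (p.weakIntegrand U F u x - ((p.α x * ‖u.d2 x‖ ^ 2 : ℝ) : ℂ))‖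
      ≤ K * ‖u‖ * (s * ‖F.snd‖) + (‖u‖ ^ 2 / 2 + K₂ * ‖v‖ ^ 2) := by
    refine (intervalIntegral.norm_integral_le_of_norm_le hℓ.le
      (Eventually.of_forall fun x _ => ?_) i3).trans ?_
    · have e : p.weakIntegrand U F u x - ((p.α x * ‖u.d2 x‖ ^ 2 : ℝ) : ℂ)
          = F.snd x * starRingEnd ℂ (u.fn x) + p.κ x * v.d2 x * starRingEnd ℂ (u.d2 x) := by
        rw [weakIntegrand]; push_cast; rw [← Complex.mul_conj']; ring
      rw [e]
      refine (norm_add_le _ _).trans (add_le_add ?_ ?_)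
      · rw [norm_mul, RCLike.norm_conj, mul_comm]
        exact mul_le_mul_of_nonneg_right (hb u x).1 (norm_nonneg _)
      · rw [norm_mul, norm_mul, RCLike.norm_conj, Complex.norm_real,
          Real.norm_of_nonneg (p.κ_nonneg x)]
        have a1 := p.le_α x
        have a2 := p.κ_le x
        have a3 := p.κ_nonneg x
        set X := ‖u.d2 x‖ with hX
        set Y := ‖v.d2 x‖ with hY
        have X0 : 0 ≤ X := norm_nonneg _
        have Y0 : 0 ≤ Y := norm_nonneg _
        have c1 : p.κ x * Y * X ≤ p.α₀ * Y * X := by gcongr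
        have c2 : m * X ^ 2 / 2 + K₂ * (m * Y ^ 2) ≤ p.α x * X ^ 2 / 2 + K₂ * (p.α x * Y ^ 2) := by
          gcongr
        have c3 : m * X ^ 2 / 2 + K₂ * (m * Y ^ 2) - p.α₀ * Y * X
            = (m * X - p.α₀ * Y) ^ 2 / (2 * m) := by
          rw [hK₂]; field_simp; ring
        have c4 : 0 ≤ (m * X - p.α₀ * Y) ^ 2 / (2 * m) := by positivity
        linarith
    · rw [intervalIntegral.integral_add, intervalIntegral.integral_const_mul]
      · have d1 := (l2Le_coe F.snd).integral_norm_le hs0.le hℓ.le hs2.le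
        have d2 : (∫ x in (0 : ℝ)..p.ℓ, (p.α x * ‖u.d2 x‖ ^ 2 / 2 + K₂ * (p.α x * ‖v.d2 x‖ ^ 2)))
            = ‖u‖ ^ 2 / 2 + K₂ * ‖v‖ ^ 2 := by
          rw [norm_sq_H20, norm_sq_H20, intervalIntegral.integral_of_le hℓ.le,
            integral_Ioc_eq_integral_Ioo, integral_add ((integrable_α_sq u.d2).div_const 2)
            ((integrable_α_sq v.d2).const_mul K₂), integral_div, integral_const_mul]
        rw [d2]
        gcongr
      · exact (intervalIntegrable_coe F.snd).norm.const_mul _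
      · rw [intervalIntegrable_iff_integrableOn_Ioo_of_le hℓ.le]
        exact ((integrable_α_sq u.d2).div_const 2).add ((integrable_α_sq v.d2).const_mul K₂)
  rw [e2, e1, hw.2] at b1
  have hu0 := norm_nonneg u
  have b2 : ‖(-(p.γ₁ * v.fn p.ξ₁ * starRingEnd ℂ (u.fn p.ξ₁)
        + p.γ₂ * v.fn p.ξ₂ * starRingEnd ℂ (u.fn p.ξ₂)
        + p.γ₃ * v.d1 p.ξ₂ * starRingEnd ℂ (u.d1 p.ξ₂)) : ℂ)‖
      ≤ (p.γ₁ + p.γ₂ + p.γ₃) * K ^ 2 * ‖v‖ * ‖u‖ := by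
    have t : ∀ (c : ℝ) (y z : ℂ), 0 < c → ‖y‖ ≤ K * ‖v‖ → ‖z‖ ≤ K * ‖u‖ →
        ‖(c : ℂ) * y * starRingEnd ℂ z‖ ≤ c * K ^ 2 * ‖v‖ * ‖u‖ := by
      intro c y z hc hy hz
      rw [norm_mul, norm_mul, RCLike.norm_conj, Complex.norm_real, Real.norm_of_nonneg hc.le]
      calc c * ‖y‖ * ‖z‖ ≤ c * (K * ‖v‖) * (K * ‖u‖) := by gcongr
        _ = _ := by ring
    rw [norm_neg]
    refine (norm_add₃_le).trans ?_
    have := t _ _ _ hγ₁ (hb v p.ξ₁).1 (hb u p.ξ₁).1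
    have := t _ _ _ hγ₂ (hb v p.ξ₂).1 (hb u p.ξ₂).1
    have := t _ _ _ hγ₃ (hb v p.ξ₂).2 (hb u p.ξ₂).2
    linarith
  have b3 : ‖u‖ ^ 2 ≤ (p.γ₁ + p.γ₂ + p.γ₃) * K ^ 2 * ‖v‖ * ‖u‖
      + (K * ‖u‖ * (s * ‖F.snd‖) + (‖u‖ ^ 2 / 2 + K₂ * ‖v‖ ^ 2)) := by
    set W : ℂ := (-(p.γ₁ * v.fn p.ξ₁ * starRingEnd ℂ (u.fn p.ξ₁)
        + p.γ₂ * v.fn p.ξ₂ * starRingEnd ℂ (u.fn p.ξ₂)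
        + p.γ₃ * v.d1 p.ξ₂ * starRingEnd ℂ (u.d1 p.ξ₂)) : ℂ)
    have := norm_sub_norm_le (((‖u‖ ^ 2 : ℝ) : ℂ)) W
    rw [norm_sub_rev] at this
    rw [Complex.norm_real, Real.norm_of_nonneg (by positivity)] at this
    linarith
  have b4 : ‖u‖ ^ 2 / 2 ≤ K₁ * ‖F‖ * ‖u‖ + K₂ * ‖F‖ ^ 2 := by
    have c1 : (p.γ₁ + p.γ₂ + p.γ₃) * K ^ 2 * ‖v‖ * ‖u‖
        ≤ (p.γ₁ + p.γ₂ + p.γ₃) * K ^ 2 * ‖F‖ * ‖u‖ := by gcongr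
    have c2 : K * ‖u‖ * (s * ‖F.snd‖) ≤ K * ‖u‖ * (s * ‖F‖) := by gcongr
    have c3 : K₂ * ‖v‖ ^ 2 ≤ K₂ * ‖F‖ ^ 2 := by gcongr
    rw [hK₁]; linarith
  -- If the bound failed, ‖F‖ ≤ ‖u‖, and replacing ‖F‖² by ‖F‖‖u‖ in `b4` gives ‖u‖² ≤ 2(K₁ +
  -- K₂)‖F‖‖u‖, a contradiction.
  have hfst : ‖u‖ ≤ (1 + 2 * K₁ + 2 * K₂) * ‖F‖ := by
    by_contra hcon
    push Not at hcon
    have h0 : ‖F‖ ≤ ‖u‖ := by nlinarith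
    have hpos : 0 < ‖u‖ := lt_of_le_of_lt (by positivity) hcon
    have h1 := mul_lt_mul_of_pos_right hcon hpos
    have h2 : K₂ * ‖F‖ ^ 2 ≤ K₂ * (‖F‖ * ‖u‖) := by rw [sq]; gcongr
    have h3 : 0 ≤ ‖F‖ * ‖u‖ := by positivity
    linarith
  have hU : ‖U‖ ≤ ‖u‖ + ‖U.snd‖ := by
    refine abs_le_of_sq_le_sq' ?_ (by positivity) |>.2
    rw [norm_sq_phase]; nlinarith [norm_nonneg U.snd]
  linarith

end BeamData

/-! ## Estimates on elastic and viscoelastic segments -/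

/-- Reflection carries the right elastic segment to one whose interface is its right end, so a
single set of estimates serves both sides. -/
lemma IsPrim.reflect {a b : ℝ} {F f : ℝ → ℂ} (H : IsPrim a b F f) :
    IsPrim (-b) (-a) (fun x => F (-x)) (fun x => -f (-x)) where
  le := neg_le_neg H.le
  int := by
    have := (H.int.comp_mul_left (c := -1)).symm
    simp only [div_neg, div_one, neg_mul, one_mul] at this
    exact this.neg
  eq x hx := by
    have hx' : -x ∈ Icc a b := ⟨by linarith [hx.2], by linarith [hx.1]⟩
    have hb : b ∈ Icc a b := right_mem_Icc.2 H.le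
    rw [intervalIntegral.integral_neg, intervalIntegral.integral_comp_neg, neg_neg,
      ← H.sub_eq hx' hb]
    ring

lemma L2Le.reflect {a b m : ℝ} {f : ℝ → ℂ} (H : L2Le a b f m) :
    L2Le (-b) (-a) (fun x => f (-x)) m := by
  have hp : MeasurePreserving (fun x : ℝ => -x) (volume.restrict (Ioo (-b) (-a)))
      (volume.restrict (Ioo a b)) := by
    have := (Measure.measurePreserving_neg (volume : Measure ℝ)).restrict_preimage
      (measurableSet_Ioo (a := a) (b := b))
    have e : Neg.neg ⁻¹' Ioo a b = Ioo (-b) (-a) := by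
      ext x; simp only [mem_preimage, mem_Ioo]; constructor <;> rintro ⟨h1, h2⟩ <;>
        constructor <;> linarith
    rwa [e] at this
  refine ⟨H.nonneg, H.meas.comp_measurePreserving hp, ?_⟩
  have := eLpNorm_comp_measurePreserving (p := 2) H.meas hp
  rw [show (fun x => f (-x)) = f ∘ fun x => -x from rfl, this]
  exact H.le

/-- Interpolation is applied at a length dictated by the frequency. The window starts at `x` unless
it would protrude beyond `b`. -/
lemma exists_window {a b x L : ℝ} (hx : x ∈ Icc a b) (h0 : 0 ≤ L) (hL : L ≤ b - a) :
    ∃ c, a ≤ c ∧ c + L ≤ b ∧ x ∈ Icc c (c + L) := by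
  rcases le_total x (b - L) with h | h
  · exact ⟨x, hx.1, by linarith, le_rfl, by linarith⟩
  · exact ⟨b - L, by linarith, by linarith, h, by linarith [hx.2]⟩

lemma norm_I_mul (lam : ℝ) : ‖Complex.I * lam‖ = |lam| := by simp

/-- The system satisfied on an elastic segment by the velocity `v` and the bending moment `M`, with
`v' = v1`, `M' = N`, at frequency `lam`. -/
structure ElasticOn (a b α lam : ℝ) (v v1 M N f2 g : ℝ → ℂ) : Prop where
  α_pos : 0 < α
  lam_ne : lam ≠ 0
  hv : IsPrim a b v v1
  hv1 : IsPrim a b v1 (fun x => Complex.I * lam / α * M x - f2 x)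
  hM : IsPrim a b M N
  hN : IsPrim a b N (fun x => g x - Complex.I * lam * v x)

namespace ElasticOn

variable {a b α lam : ℝ} {v v1 M N f2 g : ℝ → ℂ}

/-- The second order system in (v, M) is invariant under reflection; only the first derivatives
change sign. -/
lemma reflect (H : ElasticOn a b α lam v v1 M N f2 g) :
    ElasticOn (-b) (-a) α lam (fun x => v (-x)) (fun x => -v1 (-x)) (fun x => M (-x))
      (fun x => -N (-x)) (fun x => f2 (-x)) (fun x => g (-x)) where
  α_pos := H.α_pos
  lam_ne := H.lam_ne
  hv := H.hv.reflect
  hv1 := by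
    have := H.hv1.reflect.const_mul (-1)
    exact (this.congr fun x => by ring).congr_fst fun x _ => by simp
  hM := H.hM.reflect
  hN := by
    have := H.hN.reflect.const_mul (-1)
    exact (this.congr fun x => by ring).congr_fst fun x _ => by simp

/-- Pointwise bounds at high frequency. -/
lemma sup_bound (H : ElasticOn a b α lam v v1 M N f2 g) {μ K E r : ℝ} (hμ : 1 ≤ μ)
    (hlam : |lam| = μ ^ 8) (hab : (1 / μ ^ 2) ^ 2 ≤ b - a) (hK : 0 ≤ K) (hE : 0 ≤ E) (hr : 0 ≤ r)
    (h1 : L2Le a b v (K * E)) (h2 : L2Le a b M (K * E))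
    (h3 : L2Le a b f2 (K * (μ ^ 2 * r))) (h4 : L2Le a b g (K * (μ ^ 2 * r)))
    {x : ℝ} (hx : x ∈ Icc a b) :
    ‖v x‖ ≤ K * (8 + 1 / α) * (μ ^ 2 * E + r) ∧ ‖M x‖ ≤ K * (8 + 1 / α) * (μ ^ 2 * E + r) ∧
    ‖v1 x‖ ≤ K * (8 + 1 / α) * (μ ^ 6 * E + r) ∧ ‖N x‖ ≤ K * (8 + 1 / α) * (μ ^ 6 * E + r) := by
  have hα := H.α_pos
  have μ0 : 0 < μ := by linarith
  -- The window has length μ⁻⁴ = |λ|^(-1/2), the wavelength. With s = μ⁻² the two interpolation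
  -- terms E/s and s³|λ|E are both of order μ²E, and E/s³ and s|λ|E both of order μ⁶E.
  obtain ⟨c, hc1, hc2, hxc⟩ := exists_window hx (by positivity) hab
  have hcc : c ≤ c + (1 / μ ^ 2) ^ 2 := by linarith [sq_nonneg (1 / μ ^ 2)]
  have hs : 0 < 1 / μ ^ 2 := by positivity
  have e1 : L2Le a b (fun x => Complex.I * lam / α * M x - f2 x)
      (μ ^ 8 / α * (K * E) + K * (μ ^ 2 * r)) := by
    have := (h2.const_mul (Complex.I * lam / α)).sub h3
    rwa [norm_div, norm_I_mul, Complex.norm_real, Real.norm_of_nonneg hα.le, hlam] at this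
  have e2 : L2Le a b (fun x => g x - Complex.I * lam * v x)
      (K * (μ ^ 2 * r) + μ ^ 8 * (K * E)) := by
    have := h4.sub (h1.const_mul (Complex.I * lam))
    rwa [norm_I_mul, hlam] at this
  have a1 := (H.hv.mono hc1 hcc hc2).interpolation (H.hv1.mono hc1 hcc hc2) hs (by ring)
    (h1.mono hc1 hc2) (e1.mono hc1 hc2) hxc
  have a2 := (H.hM.mono hc1 hcc hc2).interpolation (H.hN.mono hc1 hcc hc2) hs (by ring)
    (h2.mono hc1 hc2) (e2.mono hc1 hc2) hxc
  have hα1 : 0 < 1 / α := by positivity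
  have μ2 : 1 ≤ μ ^ 2 := one_le_pow₀ hμ
  have μ4 : 1 ≤ μ ^ 4 := one_le_pow₀ hμ
  have KE : 0 ≤ K * E := by positivity
  have Kr : 0 ≤ K * r := by positivity
  have Kr1 : K * r / μ ^ 4 ≤ K * r := div_le_self Kr μ4
  have Kr2 : 0 ≤ K * r * (1 / α) := by positivity
  have P2 : 0 ≤ K * E * μ ^ 2 := by positivity
  have P6 : 0 ≤ K * E * μ ^ 6 := by positivity
  have Q2 : 0 ≤ K * E * μ ^ 2 * (1 / α) := by positivity
  have Q6 : 0 ≤ K * E * μ ^ 6 * (1 / α) := by positivity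
  refine ⟨a1.1.trans ?_, a2.1.trans ?_, a1.2.trans ?_, a2.2.trans ?_⟩
  · have : 7 * (K * E) / (1 / μ ^ 2) + (1 / μ ^ 2) ^ 3 * (μ ^ 8 / α * (K * E) + K * (μ ^ 2 * r))
      = 7 * (K * E * μ ^ 2) + K * E * μ ^ 2 * (1 / α) + K * r / μ ^ 4 := by
      field_simp; ring
    rw [this]; linarith
  · have : 7 * (K * E) / (1 / μ ^ 2) + (1 / μ ^ 2) ^ 3 * (K * (μ ^ 2 * r) + μ ^ 8 * (K * E))
      = 8 * (K * E * μ ^ 2) + K * r / μ ^ 4 := by field_simp; ring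
    rw [this]; linarith
  · have : 6 * (K * E) / (1 / μ ^ 2) ^ 3 + 1 / μ ^ 2 * (μ ^ 8 / α * (K * E) + K * (μ ^ 2 * r))
      = 6 * (K * E * μ ^ 6) + K * E * μ ^ 6 * (1 / α) + K * r := by
      field_simp; ring
    rw [this]; linarith
  · have : 6 * (K * E) / (1 / μ ^ 2) ^ 3 + 1 / μ ^ 2 * (K * (μ ^ 2 * r) + μ ^ 8 * (K * E))
      = 7 * (K * E * μ ^ 6) + K * r := by field_simp; ring
    rw [this]; linarith

/-- The exponentially growing factor of the beam operator: an exact first order relation. -/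
lemma factor_isPrim (H : ElasticOn a b α lam v v1 M N f2 g) {A k σ : ℝ} (hA : A ^ 2 = α)
    (hA0 : 0 < A) (hk : k ^ 2 = |lam| / A) (hσ : lam = σ * |lam|) (hσ1 : σ ^ 2 = 1) :
    IsPrim a b (fun x => ((N x / A - Complex.I * σ * v1 x)
        - k * (M x / A - Complex.I * σ * v x)) * Complex.exp (k * (x - b)))
      (fun x => Complex.exp (k * (x - b)) * (g x / A + Complex.I * σ * f2 x)) := by
  have hE : IsPrim a b (fun x : ℝ => Complex.exp (k * (x - b)))
      (fun x : ℝ => k * Complex.exp (k * (x - b))) := by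
    refine IsPrim.of_hasDerivAt H.hv.le (fun x => ?_) (by fun_prop)
    have h1 : HasDerivAt (fun x : ℝ => (k * (x - b) : ℂ)) (k * 1) x :=
      (((hasDerivAt_id x).ofReal_comp).sub_const (b : ℂ)).const_mul (k : ℂ)
    have := h1.cexp
    convert this using 1; ring
  -- With w = M/A − iσv the system gives w'' = k²w + g/A + iσf₂, so (∂ + k)(w' − kw) consists of
  -- data alone and e^(kx) is an integrating factor.
  have hw := (H.hM.const_mul (A : ℂ)⁻¹).sub (H.hv.const_mul (Complex.I * σ))
  have hw1 := (H.hN.const_mul (A : ℂ)⁻¹).sub (H.hv1.const_mul (Complex.I * σ))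
  have := (hw1.sub (hw.const_mul k)).mul hE
  have hA' : (A : ℂ) ≠ 0 := by exact_mod_cast hA0.ne'
  have hAc : (α : ℂ) = (A : ℂ) ^ 2 := by exact_mod_cast hA.symm
  have hkc : (k : ℂ) ^ 2 = (|lam| : ℝ) / A := by exact_mod_cast hk
  have hσc : (lam : ℂ) = σ * (|lam| : ℝ) := by exact_mod_cast hσ
  have hσ1c : (σ : ℂ) ^ 2 = 1 := by exact_mod_cast hσ1
  refine (this.congr fun x => ?_).congr_fst fun x _ => by ring
  rw [hAc, hσc]
  set l : ℂ := ((|lam| : ℝ) : ℂ)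
  have hl : l = k ^ 2 * A := by rw [hkc]; field_simp
  rw [hl]
  field_simp
  linear_combination (k ^ 2 * M x * σ ^ 2) * Complex.I_sq - (k ^ 2 * M x) * hσ1c

end ElasticOn

/-! ### The bending moment at the end of an elastic segment -/

namespace ElasticOn

variable {a b α lam : ℝ} {v v1 M N f2 g : ℝ → ℂ}

set_option maxHeartbeats 1000000 in
/-- At the end of an elastic segment the bending moment is controlled by the shear force, the
velocity and the angular velocity. -/
lemma exists_moment_bound (hab : a < b) (hα : 0 < α) {K B : ℝ} (hK : 0 ≤ K) (hB : 0 ≤ B) :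
    ∃ C : ℝ, 0 ≤ C ∧ ∀ {lam μ E r : ℝ} {v v1 M N f2 g : ℝ → ℂ},
      ElasticOn a b α lam v v1 M N f2 g → 1 ≤ μ → |lam| = μ ^ 8 → 0 ≤ E → 0 ≤ r →
      L2Le a b f2 (K * (μ ^ 2 * r)) → L2Le a b g (K * (μ ^ 2 * r)) →
      ‖v a‖ ≤ B * (μ ^ 2 * E + r) → ‖M a‖ ≤ B * (μ ^ 2 * E + r) →
      ‖v1 a‖ ≤ B * (μ ^ 6 * E + r) → ‖N a‖ ≤ B * (μ ^ 6 * E + r) →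
      ‖M b‖ ≤ C * ((‖N b‖ + ‖v1 b‖) / μ ^ 4 + ‖v b‖ + r + E / μ ^ 6) := by
  -- With A = q² = √α and |λ| = μ⁸ the rate k = √(|λ|/A) is the rational expression μ⁴/q.
  set q := √√α with hq
  have hq0 : 0 < q := Real.sqrt_pos.2 (Real.sqrt_pos.2 hα)
  set A := q ^ 2 with hA
  have hA0 : 0 < A := by positivity
  have hAα : A ^ 2 = α := by
    rw [hA, hq, Real.sq_sqrt (Real.sqrt_nonneg _), Real.sq_sqrt hα.le]
  set L := b - a with hL
  have hL0 : 0 < L := sub_pos.2 hab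
  set s := √L with hs
  have hs0 : 0 < s := Real.sqrt_pos.2 hL0
  have hs2 : L = s ^ 2 := (Real.sq_sqrt hL0.le).symm
  set D := 1 / A + 1 with hD
  have hD0 : 0 < D := by positivity
  set C1 := 2 * q ^ 2 / L ^ 2 * (D * (1 + 1 / q) * B * 2) with hC1
  set C2 := D * (s * K) with hC2
  have hC10 : 0 ≤ C1 := by positivity
  have hC20 : 0 ≤ C2 := by positivity
  refine ⟨A * q * D + A + A * q * (C1 + C2), by positivity, ?_⟩
  intro lam μ E r v v1 M N f2 g H hμ hlam hE hr hf hg va Ma v1a Na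
  have μ0 : 0 < μ := by linarith
  set k := μ ^ 4 / q with hk
  have hk0 : 0 < k := by positivity
  have hk2 : k ^ 2 = |lam| / A := by rw [hk, hlam, hA]; field_simp
  set σ := lam / |lam| with hσ
  have hl0 : |lam| ≠ 0 := abs_ne_zero.2 H.lam_ne
  have hσ1 : lam = σ * |lam| := by rw [hσ]; field_simp
  have hσ2 : σ ^ 2 = 1 := by rw [hσ, div_pow, sq_abs]; exact div_self (pow_ne_zero 2 H.lam_ne)
  have hσn : |σ| = 1 := by rw [hσ, abs_div, abs_abs]; exact div_self hl0
  -- The factor relation is integrated over the whole segment: the exponential weight is 1 at `b`,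
  -- e^(-kL) at `a`, and at most 1 in between.
  have hW := (H.factor_isPrim hAα hA0 hk2 hσ1 hσ2).integral_eq
  have nIσ : ‖Complex.I * (σ : ℂ)‖ = 1 := by simp [hσn]
  have nA : ‖(A : ℂ)‖ = A := by rw [Complex.norm_real, Real.norm_of_nonneg hA0.le]
  have nk : ‖(k : ℂ)‖ = k := by rw [Complex.norm_real, Real.norm_of_nonneg hk0.le]
  -- the integral
  have hint : ‖∫ x in a..b, Complex.exp (k * (x - b)) * (g x / A + Complex.I * σ * f2 x)‖
      ≤ C2 * (μ ^ 2 * r) := by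
    have h1 := (hg.const_mul ((A : ℂ)⁻¹)).add (hf.const_mul (Complex.I * σ))
    have h2 : L2Le a b (fun x => g x / A + Complex.I * σ * f2 x) (D * (K * (μ ^ 2 * r))) := by
      refine ((h1.congr_ae (g := fun x => g x / A + Complex.I * σ * f2 x)
        (Eventually.of_forall fun x _ => by ring))).mono_right (le_of_eq ?_)
      rw [norm_inv, nA, nIσ, hD]; ring
    refine (norm_integral_mul_le hab.le (h2.intervalIntegrable hab.le) (K := 1) fun x hx => ?_).trans ?_
    · rw [Complex.norm_exp]
      refine Real.exp_le_one_iff.2 ?_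
      have : ((k : ℂ) * (x - b)).re = k * (x - b) := by
        rw [← Complex.ofReal_sub, ← Complex.ofReal_mul, Complex.ofReal_re]
      rw [this]
      exact mul_nonpos_of_nonneg_of_nonpos hk0.le (by linarith [hx.2])
    · rw [one_mul]
      refine (h2.integral_norm_le hs0.le hab.le hs2.le).trans (le_of_eq ?_)
      rw [hC2]; ring
  -- the value at the far end
  have hexp : Real.exp (-(k * L)) ≤ 2 / (k * L) ^ 2 := by
    have h1 := Real.quadratic_le_exp_of_nonneg (x := k * L) (by positivity)
    rw [Real.exp_neg, inv_eq_one_div, div_le_div_iff₀ (Real.exp_pos _) (by positivity)]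
    nlinarith [mul_pos hk0 hL0]
  set Wa : ℂ := ((N a / A - Complex.I * σ * v1 a) - k * (M a / A - Complex.I * σ * v a))
      * Complex.exp (k * (a - b)) with hWa
  -- Of the exponential decay only the factor 2/(kL)², of order μ⁻⁸, is used against the a priori
  -- size μ⁶E + μ⁴r of the quantities at the far end.
  have hfar : ‖Wa‖ ≤ C1 * (E / μ ^ 2 + r / μ ^ 4) := by
    have h1 : ‖Complex.exp (k * (a - b))‖ ≤ 2 / (k * L) ^ 2 := by
      rw [Complex.norm_exp]
      have : ((k : ℂ) * (a - b)).re = -(k * L) := by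
        rw [← Complex.ofReal_sub, ← Complex.ofReal_mul, Complex.ofReal_re, hL]; ring
      rw [this]; exact hexp
    have h2 : ‖(N a / A - Complex.I * σ * v1 a) - k * (M a / A - Complex.I * σ * v a)‖
        ≤ D * (B * (μ ^ 6 * E + r)) + k * (D * (B * (μ ^ 2 * E + r))) := by
      refine (norm_sub_le _ _).trans (add_le_add ?_ ?_)
      · refine (norm_sub_le _ _).trans ?_
        rw [norm_div, norm_mul, nA, nIσ, one_mul]
        calc ‖N a‖ / A + ‖v1 a‖ ≤ B * (μ ^ 6 * E + r) / A + B * (μ ^ 6 * E + r) := by gcongr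
          _ = _ := by rw [hD]; ring
      · rw [norm_mul, nk]
        refine mul_le_mul_of_nonneg_left ?_ hk0.le
        refine (norm_sub_le _ _).trans ?_
        rw [norm_div, norm_mul, nA, nIσ, one_mul]
        calc ‖M a‖ / A + ‖v a‖ ≤ B * (μ ^ 2 * E + r) / A + B * (μ ^ 2 * E + r) := by gcongr
          _ = _ := by rw [hD]; ring
    have μ4 : 1 ≤ μ ^ 4 := one_le_pow₀ hμ
    have h3 : D * (B * (μ ^ 6 * E + r)) + k * (D * (B * (μ ^ 2 * E + r)))
        ≤ D * (1 + 1 / q) * B * 2 * (μ ^ 6 * E + μ ^ 4 * r) := by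
      have e : k * (D * (B * (μ ^ 2 * E + r))) = D * (1 / q) * B * (μ ^ 6 * E + μ ^ 4 * r) := by
        rw [hk]; field_simp
      have hrr : r ≤ μ ^ 4 * r := by nlinarith
      have h5 : D * (B * (μ ^ 6 * E + r)) ≤ D * (B * (μ ^ 6 * E + μ ^ 4 * r)) := by gcongr
      have h6 : 0 ≤ D * B * (μ ^ 6 * E + μ ^ 4 * r) := by positivity
      have h7 : 0 ≤ D * (1 / q) * B * (μ ^ 6 * E + μ ^ 4 * r) := by positivity
      rw [e]; linarith
    rw [hWa, norm_mul]
    calc _ ≤ (D * (1 + 1 / q) * B * 2 * (μ ^ 6 * E + μ ^ 4 * r)) * (2 / (k * L) ^ 2) :=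
          mul_le_mul (h2.trans h3) h1 (norm_nonneg _) (by positivity)
      _ = _ := by rw [hC1, hk]; field_simp
  -- Solve for the moment at `b`. Division by k, of order μ⁴, is what makes a shear force of size
  -- μ⁴r contribute only r.
  have e1 : (k : ℂ) * (M b / A) = (N b / A - Complex.I * σ * v1 b) + k * (Complex.I * σ * v b)
      - Wa - ∫ x in a..b, Complex.exp (k * (x - b)) * (g x / A + Complex.I * σ * f2 x) := by
    rw [hW, hWa]
    simp only [sub_self, mul_zero, Complex.exp_zero]
    ring
  have e2 : k * (‖M b‖ / A) ≤ ‖N b‖ / A + ‖v1 b‖ + k * ‖v b‖ + C1 * (E / μ ^ 2 + r / μ ^ 4)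
      + C2 * (μ ^ 2 * r) := by
    have := congrArg norm e1
    rw [norm_mul, norm_div, nk, nA] at this
    rw [this]
    refine (norm_sub_le _ _).trans (add_le_add ?_ hint)
    refine (norm_sub_le _ _).trans (add_le_add ?_ hfar)
    refine (norm_add_le _ _).trans (add_le_add ?_ ?_)
    · refine (norm_sub_le _ _).trans ?_
      rw [norm_div, norm_mul, nA, nIσ, one_mul]
    · rw [norm_mul, norm_mul, nk, nIσ, one_mul]
  have e3 : ‖M b‖ ≤ A * q / μ ^ 4 * (‖N b‖ / A + ‖v1 b‖ + k * ‖v b‖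
      + C1 * (E / μ ^ 2 + r / μ ^ 4) + C2 * (μ ^ 2 * r)) := by
    have : ‖M b‖ = A * q / μ ^ 4 * (k * (‖M b‖ / A)) := by rw [hk]; field_simp
    rw [this]
    exact mul_le_mul_of_nonneg_left e2 (by positivity)
  refine e3.trans ?_
  have μ8 : r / μ ^ 8 ≤ r := div_le_self hr (one_le_pow₀ hμ)
  have μ2 : r / μ ^ 2 ≤ r := div_le_self hr (one_le_pow₀ hμ)
  have e4 : A * q / μ ^ 4 * (‖N b‖ / A + ‖v1 b‖ + k * ‖v b‖
      + C1 * (E / μ ^ 2 + r / μ ^ 4) + C2 * (μ ^ 2 * r))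
      = A * q * (1 / A) * (‖N b‖ / μ ^ 4) + A * q * (‖v1 b‖ / μ ^ 4) + A * ‖v b‖
        + A * q * C1 * (E / μ ^ 6) + A * q * C1 * (r / μ ^ 8) + A * q * C2 * (r / μ ^ 2) := by
    rw [hk]; field_simp; ring
  rw [e4]
  set n1 := ‖N b‖ / μ ^ 4
  set n2 := ‖v1 b‖ / μ ^ 4
  set n3 := E / μ ^ 6
  have hn1 : 0 ≤ n1 := by positivity
  have hn2 : 0 ≤ n2 := by positivity
  have hn3 : 0 ≤ n3 := by positivity
  have hn4 := norm_nonneg (v b)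
  rw [add_div]
  calc _ ≤ A * q * D * (n1 + n2 + ‖v b‖ + r + n3) + A * (n1 + n2 + ‖v b‖ + r + n3)
        + A * q * (C1 + C2) * (n1 + n2 + ‖v b‖ + r + n3) := by
        have t1 : A * q * (1 / A) * n1 + A * q * n2 ≤ A * q * D * (n1 + n2 + ‖v b‖ + r + n3) := by
          have u1 : A * q * (1 / A) * n1 ≤ A * q * D * n1 := by
            gcongr; rw [hD]; linarith
          have u2 : A * q * n2 ≤ A * q * D * n2 := by
            have : 1 ≤ D := by rw [hD]; linarith [show 0 < 1 / A by positivity]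
            have := mul_le_mul_of_nonneg_left this (show 0 ≤ A * q * n2 by positivity)
            linarith
          have u3 : 0 ≤ A * q * D * (‖v b‖ + r + n3) := by positivity
          linarith
        have t2 : A * ‖v b‖ ≤ A * (n1 + n2 + ‖v b‖ + r + n3) := by gcongr; linarith
        have t3 : A * q * C1 * n3 + A * q * C1 * (r / μ ^ 8) + A * q * C2 * (r / μ ^ 2)
            ≤ A * q * (C1 + C2) * (n1 + n2 + ‖v b‖ + r + n3) := by
          have u1 : A * q * C1 * (r / μ ^ 8) ≤ A * q * C1 * r := by gcongr
          have u2 : A * q * C2 * (r / μ ^ 2) ≤ A * q * C2 * r := by gcongr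
          have u3 : 0 ≤ A * q * (C1 + C2) * (n1 + n2 + ‖v b‖) + A * q * C2 * n3 := by positivity
          linarith
        linarith
    _ = _ := by ring

end ElasticOn

/-! ### The multiplier method on elastic segments -/

/-- The quadratic form of the multiplier identity. -/
noncomputable def multiplierForm (α lam y : ℝ) (v v1 M N : ℂ) : ℂ :=
  y / 2 * (v * starRingEnd ℂ v + M * starRingEnd ℂ M / α)
    - Complex.I / lam * (y * N * starRingEnd ℂ v1 - M * starRingEnd ℂ v1)

namespace ElasticOn

variable {a b α lam : ℝ} {v v1 M N f2 g : ℝ → ℂ}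

/-- A Rellich identity for the multiplier (x − x₀)v'. The correction M v̄' cancels the term N v̄'
created by differentiating x − x₀, and adds |M|²/α to the coefficient 1/2. The brackets zw̄ − wz̄
are imaginary, so the real part is a positive density plus data terms. -/
lemma multiplier_isPrim (H : ElasticOn a b α lam v v1 M N f2 g) (x0 : ℝ) :
    IsPrim a b (fun x => multiplierForm α lam (x - x0) (v x) (v1 x) (M x) (N x))
      (fun x => 1 / 2 * (v x * starRingEnd ℂ (v x)) + 3 / 2 * (M x * starRingEnd ℂ (M x) / α)
        + (x - x0) / 2 * (v1 x * starRingEnd ℂ (v x) - v x * starRingEnd ℂ (v1 x))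
        + (x - x0) / 2 * (M x * starRingEnd ℂ (N x) - N x * starRingEnd ℂ (M x)) / α
        + Complex.I / lam * ((x - x0) * N x * starRingEnd ℂ (f2 x) - M x * starRingEnd ℂ (f2 x)
          - (x - x0) * g x * starRingEnd ℂ (v1 x))) := by
  have hα : (α : ℂ) ≠ 0 := by exact_mod_cast H.α_pos.ne'
  have hl : (lam : ℂ) ≠ 0 := by exact_mod_cast H.lam_ne
  have X := (IsPrim.ofReal H.hv.le).sub (IsPrim.const H.hv.le (x0 : ℂ))
  have h1 := (X.mul ((H.hv.mul H.hv.conj).add ((H.hM.mul H.hM.conj).const_mul (α : ℂ)⁻¹))).const_mul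
    (1 / 2)
  have h2 := (((X.mul H.hN).mul H.hv1.conj).sub (H.hM.mul H.hv1.conj)).const_mul (Complex.I / lam)
  refine ((h1.sub h2).congr fun x => ?_).congr_fst fun x _ => ?_
  · simp only [map_sub, map_mul, map_div₀, Complex.conj_I, Complex.conj_ofReal]
    field_simp
    linear_combination (norm := (field_simp; ring1))
      (-(lam : ℂ) * (α * 2 * (x - x0) * v x * starRingEnd ℂ (v1 x)
      + 2 * (x - x0) * N x * starRingEnd ℂ (M x) - 2 * M x * starRingEnd ℂ (M x))) * Complex.I_sq
  · simp only [multiplierForm]; push_cast; ring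

/-- The multiplier estimate. -/
lemma multiplier_estimate (H : ElasticOn a b α lam v v1 M N f2 g) {x0 X V1 NN MM s m n : ℝ}
    (hX : ∀ x ∈ Icc a b, |x - x0| ≤ X) (hV : ∀ x ∈ Icc a b, ‖v1 x‖ ≤ V1)
    (hN : ∀ x ∈ Icc a b, ‖N x‖ ≤ NN) (hM : ∀ x ∈ Icc a b, ‖M x‖ ≤ MM) (hs : 0 ≤ s)
    (hL : b - a ≤ s ^ 2) (hf : L2Le a b f2 m) (hg : L2Le a b g n) :
    (∫ x in a..b, (1 / 2 * ‖v x‖ ^ 2 + 3 / (2 * α) * ‖M x‖ ^ 2)) ≤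
      (multiplierForm α lam (b - x0) (v b) (v1 b) (M b) (N b)).re
      - (multiplierForm α lam (a - x0) (v a) (v1 a) (M a) (N a)).re
      + (X * V1 * (s * n) + (X * NN + MM) * (s * m)) / |lam| := by
  have hab := H.hv.le
  have hα := H.α_pos
  have hl : 0 < |lam| := abs_pos.2 H.lam_ne
  have P := H.multiplier_isPrim x0
  have h1 := congrArg Complex.re P.integral_eq
  rw [Complex.sub_re, ← Complex.reCLM_apply,
    ← ContinuousLinearMap.intervalIntegral_comp_comm _ P.int] at h1
  rw [← h1]
  have ha : a ∈ Icc a b := left_mem_Icc.2 hab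
  have X0 : 0 ≤ X := (abs_nonneg _).trans (hX a ha)
  have V0 : 0 ≤ V1 := (norm_nonneg _).trans (hV a ha)
  have N0 : 0 ≤ NN := (norm_nonneg _).trans (hN a ha)
  have M0 : 0 ≤ MM := (norm_nonneg _).trans (hM a ha)
  have hgi := (hg.intervalIntegrable hab).norm
  have hfi := (hf.intervalIntegrable hab).norm
  -- The data terms pair L² functions with quantities bounded pointwise, so only L¹ norms of `g` and
  -- `f2` enter, and these are at most `s` times the L² norms.
  have h2 : (∫ x in a..b, ((X * V1) * ‖g x‖ + (X * NN + MM) * ‖f2 x‖) / |lam|)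
      ≤ (X * V1 * (s * n) + (X * NN + MM) * (s * m)) / |lam| := by
    rw [intervalIntegral.integral_div, intervalIntegral.integral_add (hgi.const_mul _)
      (hfi.const_mul _), intervalIntegral.integral_const_mul, intervalIntegral.integral_const_mul]
    have := hg.integral_norm_le hs hab hL
    have := hf.integral_norm_le hs hab hL
    gcongr
  refine le_trans ?_ (add_le_add le_rfl h2)
  have hre : IntervalIntegrable (fun x => Complex.reCLM
      (1 / 2 * (v x * starRingEnd ℂ (v x)) + 3 / 2 * (M x * starRingEnd ℂ (M x) / α)
        + (x - x0) / 2 * (v1 x * starRingEnd ℂ (v x) - v x * starRingEnd ℂ (v1 x))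
        + (x - x0) / 2 * (M x * starRingEnd ℂ (N x) - N x * starRingEnd ℂ (M x)) / α
        + Complex.I / lam * ((x - x0) * N x * starRingEnd ℂ (f2 x) - M x * starRingEnd ℂ (f2 x)
          - (x - x0) * g x * starRingEnd ℂ (v1 x)))) volume a b := ⟨P.int.1.re, P.int.2.re⟩
  rw [← intervalIntegral.integral_add hre]
  swap
  · exact ((hgi.const_mul _).add (hfi.const_mul _)).div_const _
  refine intervalIntegral.integral_mono_on hab ?_ ?_ ?_
  · have c1 := H.hv.continuousOn
    have c2 := H.hM.continuousOn
    refine ContinuousOn.intervalIntegrable ?_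
    rw [uIcc_of_le hab]
    fun_prop
  · exact hre.add (((hgi.const_mul _).add (hfi.const_mul _)).div_const _)
  · intro x hx
    set R : ℂ := Complex.I / lam * ((x - x0) * N x * starRingEnd ℂ (f2 x)
      - M x * starRingEnd ℂ (f2 x) - (x - x0) * g x * starRingEnd ℂ (v1 x)) with hR
    have hRn : ‖R‖ ≤ ((X * V1) * ‖g x‖ + (X * NN + MM) * ‖f2 x‖) / |lam| := by
      rw [hR, norm_mul, norm_div, Complex.norm_I, Complex.norm_real, Real.norm_eq_abs,
        div_mul_eq_mul_div, one_mul]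
      gcongr
      have hxn : ‖((x : ℂ) - x0)‖ ≤ X := by
        rw [← Complex.ofReal_sub, Complex.norm_real]; exact hX x hx
      refine (norm_sub_le _ _).trans ?_
      have t1 : ‖((x : ℂ) - x0) * N x * starRingEnd ℂ (f2 x) - M x * starRingEnd ℂ (f2 x)‖
          ≤ (X * NN + MM) * ‖f2 x‖ := by
        refine (norm_sub_le _ _).trans ?_
        rw [norm_mul, norm_mul, norm_mul, RCLike.norm_conj, add_mul]
        have := hN x hx
        have := hM x hx
        gcongr
      have t2 : ‖((x : ℂ) - x0) * g x * starRingEnd ℂ (v1 x)‖ ≤ X * V1 * ‖g x‖ := by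
        rw [norm_mul, norm_mul, RCLike.norm_conj]
        calc ‖((x : ℂ) - x0)‖ * ‖g x‖ * ‖v1 x‖ ≤ X * ‖g x‖ * V1 := by
              have := hV x hx
              gcongr
          _ = _ := by ring
      linarith
    have hre0 := neg_le_of_abs_le (Complex.abs_re_le_norm R)
    have e1 : (1 / 2 * (v x * starRingEnd ℂ (v x)) : ℂ).re = 1 / 2 * ‖v x‖ ^ 2 := by
      rw [Complex.mul_conj', show (1 / 2 * (‖v x‖ : ℂ) ^ 2) = ((1 / 2 * ‖v x‖ ^ 2 : ℝ) : ℂ) by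
        push_cast; ring, Complex.ofReal_re]
    have e2 : (3 / 2 * (M x * starRingEnd ℂ (M x) / α) : ℂ).re = 3 / (2 * α) * ‖M x‖ ^ 2 := by
      rw [Complex.mul_conj', show (3 / 2 * ((‖M x‖ : ℂ) ^ 2 / α))
        = ((3 / (2 * α) * ‖M x‖ ^ 2 : ℝ) : ℂ) by push_cast; field_simp, Complex.ofReal_re]
    have im : ∀ (c : ℝ) (z w : ℂ),
        ((c : ℂ) * (z * starRingEnd ℂ w - w * starRingEnd ℂ z)).re = 0 := by
      intro c z w
      have : (z * starRingEnd ℂ w - w * starRingEnd ℂ z).re = 0 := by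
        simp only [Complex.sub_re, Complex.mul_re, Complex.conj_re, Complex.conj_im]; ring
      rw [Complex.re_ofReal_mul, this, mul_zero]
    have e3 : ((x - x0) / 2 * (v1 x * starRingEnd ℂ (v x) - v x * starRingEnd ℂ (v1 x)) : ℂ).re
        = 0 := by
      have := im ((x - x0) / 2) (v1 x) (v x)
      push_cast at this; exact this
    have e4 : ((x - x0) / 2 * (M x * starRingEnd ℂ (N x) - N x * starRingEnd ℂ (M x)) / α : ℂ).re
        = 0 := by
      have := im ((x - x0) / 2 / α) (M x) (N x)
      push_cast at this
      rw [← this]; congr 1; ring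
    simp only [Complex.reCLM_apply, Complex.add_re, e1, e2, e3, e4]
    linarith

end ElasticOn

/-! ## Energy of elastic segments, traces on viscoelastic segments -/

lemma norm_multiplierForm_le {α : ℝ} (hα : 0 < α) (lam y : ℝ) (v v1 M N : ℂ) :
    ‖multiplierForm α lam y v v1 M N‖ ≤ |y| / 2 * (‖v‖ ^ 2 + ‖M‖ ^ 2 / α)
      + (|y| * ‖N‖ * ‖v1‖ + ‖M‖ * ‖v1‖) / |lam| := by
  unfold multiplierForm
  refine (norm_sub_le _ _).trans (add_le_add ?_ ?_)
  · rw [norm_mul, norm_div, Complex.norm_real, Real.norm_eq_abs, Complex.norm_ofNat]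
    gcongr
    refine (norm_add_le _ _).trans (le_of_eq ?_)
    rw [norm_div, norm_mul, norm_mul, RCLike.norm_conj, RCLike.norm_conj, Complex.norm_real,
      Real.norm_of_nonneg hα.le]
    ring
  · rw [norm_mul, norm_div, Complex.norm_I, Complex.norm_real, Real.norm_eq_abs,
      div_mul_eq_mul_div, one_mul]
    gcongr
    refine (norm_sub_le _ _).trans (le_of_eq ?_)
    rw [norm_mul, norm_mul, norm_mul, RCLike.norm_conj, Complex.norm_real, Real.norm_eq_abs]

namespace ElasticOn

/-- High frequency energy estimate up to boundary terms. -/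
lemma exists_energy_bound {a b α K X x0 : ℝ} (hab : a ≤ b) (hα : 0 < α) (hK : 0 ≤ K)
    (hX : ∀ x ∈ Icc a b, |x - x0| ≤ X) :
    ∃ C, 0 ≤ C ∧ ∀ {lam μ E r : ℝ} {v v1 M N f2 g : ℝ → ℂ},
      ElasticOn a b α lam v v1 M N f2 g → 1 ≤ μ → |lam| = μ ^ 8 → (1 / μ ^ 2) ^ 2 ≤ b - a →
      0 ≤ E → 0 ≤ r → L2Le a b v (K * E) → L2Le a b M (K * E) → L2Le a b f2 (K * (μ ^ 2 * r)) →
      L2Le a b g (K * (μ ^ 2 * r)) →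
      (∫ x in a..b, (1 / 2 * ‖v x‖ ^ 2 + 3 / (2 * α) * ‖M x‖ ^ 2)) ≤
        (multiplierForm α lam (b - x0) (v b) (v1 b) (M b) (N b)).re
        - (multiplierForm α lam (a - x0) (v a) (v1 a) (M a) (N a)).re + C * (r * E + r ^ 2) := by
  have X0 : 0 ≤ X := (abs_nonneg _).trans (hX a (left_mem_Icc.2 hab))
  have P0 : 0 ≤ K * (8 + 1 / α) := by positivity
  refine ⟨(2 * X + 1) * (K * (8 + 1 / α)) * √(b - a) * K, by positivity, ?_⟩
  intro lam μ E r v v1 M N f2 g H hμ hlam hw hE hr h1 h2 h3 h4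
  have sup := fun x hx => H.sup_bound (x := x) hμ hlam hw hK hE hr h1 h2 h3 h4 hx
  refine (H.multiplier_estimate hX (fun x hx => (sup x hx).2.2.1) (fun x hx => (sup x hx).2.2.2)
    (fun x hx => (sup x hx).2.1) (Real.sqrt_nonneg (b - a))
    (Real.sq_sqrt (sub_nonneg.2 hab)).ge h3 h4).trans ?_
  gcongr
  rw [hlam]
  set P := K * (8 + 1 / α)
  set s := √(b - a)
  have s0 : 0 ≤ s := Real.sqrt_nonneg _
  have μ0 : 0 < μ := by linarith
  have μ26 : μ ^ 2 ≤ μ ^ 6 := pow_le_pow_right₀ hμ (by norm_num)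
  have e : P * (μ ^ 2 * E + r) ≤ P * (μ ^ 6 * E + r) := by gcongr
  have Y0 : 0 ≤ P * (μ ^ 6 * E + r) := by positivity
  -- The worst factors v' and N are O(μ⁶E + r) and the data O(μ²r); for the leading product rE the
  -- powers are exactly compensated by |λ| = μ⁸.
  calc _ ≤ (X * (P * (μ ^ 6 * E + r)) * (s * (K * (μ ^ 2 * r)))
        + (X * (P * (μ ^ 6 * E + r)) + P * (μ ^ 6 * E + r)) * (s * (K * (μ ^ 2 * r)))) / μ ^ 8 := by
        gcongr
    _ = (2 * X + 1) * P * s * K * (r * E + r ^ 2 / μ ^ 6) := by field_simp; ring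
    _ ≤ (2 * X + 1) * P * s * K * (r * E + r ^ 2) := by
        gcongr
        exact div_le_self (by positivity) (one_le_pow₀ hμ)

/-- High frequency energy estimate on an elastic segment whose right end is an interface. -/
lemma exists_energy_bound_interface {a b α K C₀ X x0 : ℝ} (hab : a < b) (hα : 0 < α) (hK : 0 ≤ K)
    (hC₀ : 0 ≤ C₀) (hX : ∀ x ∈ Icc a b, |x - x0| ≤ X) :
    ∃ C, 0 ≤ C ∧ ∀ {lam μ E r : ℝ} {v v1 M N f2 g : ℝ → ℂ},
      ElasticOn a b α lam v v1 M N f2 g → 1 ≤ μ → |lam| = μ ^ 8 → (1 / μ ^ 2) ^ 2 ≤ b - a →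
      0 ≤ E → 0 ≤ r → L2Le a b v (K * E) → L2Le a b M (K * E) → L2Le a b f2 (K * (μ ^ 2 * r)) →
      L2Le a b g (K * (μ ^ 2 * r)) →
      ‖v b‖ ≤ C₀ * r → ‖v1 b‖ ≤ C₀ * r → ‖N b‖ ≤ C₀ * (μ ^ 4 * r) →
      (∫ x in a..b, (1 / 2 * ‖v x‖ ^ 2 + 3 / (2 * α) * ‖M x‖ ^ 2)) ≤
        -(multiplierForm α lam (a - x0) (v a) (v1 a) (M a) (N a)).re
          + C * (r * E + r ^ 2 + (E / μ ^ 6) ^ 2) := by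
  have X0 : 0 ≤ X := (abs_nonneg _).trans (hX a (left_mem_Icc.2 hab.le))
  obtain ⟨C1, hC1, H1⟩ := exists_energy_bound hab.le hα hK hX
  obtain ⟨C2, hC2, H2⟩ := exists_moment_bound hab hα hK
    (show 0 ≤ K * (8 + 1 / α) by positivity)
  set D := C2 * (3 * C₀ + 1) with hD
  have D0 : 0 ≤ D := by positivity
  set Q := X / 2 * (C₀ ^ 2 + D ^ 2 / α) + (X * C₀ ^ 2 + D * C₀) with hQ
  have Q0 : 0 ≤ Q := by positivity
  refine ⟨C1 + 2 * Q, by positivity, ?_⟩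
  intro lam μ E r v v1 M N f2 g H hμ hlam hw hE hr h1 h2 h3 h4 b1 b2 b3
  have μ0 : 0 < μ := by linarith
  have sup := H.sup_bound hμ hlam hw hK hE hr h1 h2 h3 h4 (left_mem_Icc.2 hab.le)
  have hM := H2 H hμ hlam hE hr h3 h4 sup.1 sup.2.1 sup.2.2.1 sup.2.2.2
  have μ4 : 1 ≤ μ ^ 4 := one_le_pow₀ hμ
  -- `Z` collects the interface bound `r` and what remains of the far end in `exists_moment_bound`;
  -- |v|, |v1| and |M| at `b` are all O(Z), while |N| is O(μ⁴Z).
  set Z := r + E / μ ^ 6 with hZ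
  have Ez : 0 ≤ E / μ ^ 6 := by positivity
  have hrZ : r ≤ Z := by linarith
  have Z0 : 0 ≤ Z := hr.trans hrZ
  have hMZ : ‖M b‖ ≤ D * Z := by
    refine hM.trans ?_
    have e1 : (‖N b‖ + ‖v1 b‖) / μ ^ 4 ≤ 2 * C₀ * r := by
      rw [div_le_iff₀ (by positivity)]
      have : C₀ * r ≤ C₀ * (μ ^ 4 * r) := by
        gcongr; exact le_mul_of_one_le_left hr μ4
      linarith
    have e2 : (‖N b‖ + ‖v1 b‖) / μ ^ 4 + ‖v b‖ + r + E / μ ^ 6 ≤ (3 * C₀ + 1) * Z := by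
      have : C₀ * r ≤ C₀ * Z := by gcongr
      linarith
    calc _ ≤ C2 * ((3 * C₀ + 1) * Z) := by gcongr
      _ = _ := by rw [hD]; ring
  have main := H1 H hμ hlam hw hE hr h1 h2 h3 h4
  -- The shear term is the largest: |N||v1|/|λ| is of order μ⁴Z²/μ⁸, still below Z².
  have hq : (multiplierForm α lam (b - x0) (v b) (v1 b) (M b) (N b)).re ≤ Q * Z ^ 2 := by
    refine (Complex.re_le_norm _).trans ((norm_multiplierForm_le hα _ _ _ _ _ _).trans ?_)
    have hXb := hX b (right_mem_Icc.2 hab.le)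
    have bv : ‖v b‖ ≤ C₀ * Z := b1.trans (by gcongr)
    have bv1 : ‖v1 b‖ ≤ C₀ * Z := b2.trans (by gcongr)
    have bN : ‖N b‖ ≤ C₀ * (μ ^ 4 * Z) := b3.trans (by gcongr)
    have μ8 : μ ^ 4 ≤ μ ^ 8 := pow_le_pow_right₀ hμ (by norm_num)
    calc _ ≤ X / 2 * ((C₀ * Z) ^ 2 + (D * Z) ^ 2 / α)
          + (X * (C₀ * (μ ^ 4 * Z)) * (C₀ * Z) + D * Z * (C₀ * Z)) / |lam| := by gcongr
      _ ≤ X / 2 * ((C₀ * Z) ^ 2 + (D * Z) ^ 2 / α)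
          + (X * C₀ ^ 2 * Z ^ 2 + D * C₀ * Z ^ 2) := by
          gcongr
          rw [hlam, div_le_iff₀ (by positivity)]
          have t1 : X * C₀ ^ 2 * Z ^ 2 * μ ^ 4 ≤ X * C₀ ^ 2 * Z ^ 2 * μ ^ 8 := by gcongr
          have t2 : D * C₀ * Z ^ 2 * 1 ≤ D * C₀ * Z ^ 2 * μ ^ 8 := by
            gcongr; exact one_le_pow₀ hμ
          linarith
      _ = Q * Z ^ 2 := by rw [hQ]; ring
  have hZ2 : Z ^ 2 ≤ 2 * (r * E + r ^ 2 + (E / μ ^ 6) ^ 2) := by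
    have := sq_nonneg (r - E / μ ^ 6)
    have : 0 ≤ r * E := by positivity
    rw [hZ]; linarith
  have := mul_le_mul_of_nonneg_left hZ2 Q0
  have : C1 * (r * E + r ^ 2) ≤ C1 * (r * E + r ^ 2 + (E / μ ^ 6) ^ 2) :=
    mul_le_mul_of_nonneg_left (by linarith [sq_nonneg (E / μ ^ 6)]) hC1
  linarith

/-- Backward propagation of bounds at a fixed frequency. -/
lemma exists_propagation {a b α lam : ℝ} (hα : 0 < α) :
    ∃ C, 0 ≤ C ∧ ∀ {r : ℝ} {v v1 M N f2 g : ℝ → ℂ}, ElasticOn a b α lam v v1 M N f2 g → 0 ≤ r →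
      L2Le a b f2 r → L2Le a b g r → ‖v b‖ ≤ r → ‖v1 b‖ ≤ r → ‖M b‖ ≤ r → ‖N b‖ ≤ r →
      ∀ x ∈ Icc a b, ‖v x‖ ≤ C * r ∧ ‖v1 x‖ ≤ C * r ∧ ‖M x‖ ≤ C * r ∧ ‖N x‖ ≤ C * r := by
  -- A Grönwall rate: `c` dominates the growth of |v|² + |v1|² + |M|² + |N|² under the first order
  -- system, so multiplied by e^(c(x−b)) this sum increases, up to −(|f2|² + |g|²).
  set c : ℝ := 3 + |lam| + |lam| / α with hc
  have hc0 : 0 ≤ c := by positivity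
  refine ⟨√(6 * Real.exp (c * (b - a))), by positivity, ?_⟩
  intro r v v1 M N f2 g H hr hf hg b1 b2 b3 b4 x hx
  have hxb : Icc x b ⊆ Icc a b := Icc_subset_Icc_left hx.1
  have hE : IsPrim a b (fun x : ℝ => Complex.exp (c * (x - b)))
      (fun x : ℝ => c * Complex.exp (c * (x - b))) := by
    refine IsPrim.of_hasDerivAt H.hv.le (fun x => ?_) (by fun_prop)
    have h1 : HasDerivAt (fun x : ℝ => (c * (x - b) : ℂ)) (c * 1) x :=
      (((hasDerivAt_id x).ofReal_comp).sub_const (b : ℂ)).const_mul (c : ℂ)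
    have := h1.cexp
    convert this using 1; ring
  have T := (hE.mul ((((H.hv.mul H.hv.conj).add (H.hv1.mul H.hv1.conj)).add
    (H.hM.mul H.hM.conj)).add (H.hN.mul H.hN.conj))).mono hx.1 hx.2 le_rfl
  have hre := congrArg Complex.re T.integral_eq
  rw [Complex.sub_re, ← Complex.reCLM_apply,
    ← ContinuousLinearMap.intervalIntegral_comp_comm _ T.int] at hre
  have eexp : ∀ y : ℝ, Complex.exp (c * (y - b)) = ((Real.exp (c * (y - b)) : ℝ) : ℂ) := by
    intro y; push_cast; rfl
  have hfi := ((hf.mono hx.1 le_rfl).memLp.integrable_norm_pow (by norm_num))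
  have hgi := ((hg.mono hx.1 le_rfl).memLp.integrable_norm_pow (by norm_num))
  have hfI : IntervalIntegrable (fun y => ‖f2 y‖ ^ 2) volume x b := by
    rw [intervalIntegrable_iff_integrableOn_Ioo_of_le hx.2]; simpa [IntegrableOn] using hfi
  have hgI : IntervalIntegrable (fun y => ‖g y‖ ^ 2) volume x b := by
    rw [intervalIntegrable_iff_integrableOn_Ioo_of_le hx.2]; simpa [IntegrableOn] using hgi
  have lower : (∫ y in x..b, -(‖f2 y‖ ^ 2 + ‖g y‖ ^ 2)) ≤
      (Complex.exp (c * (b - b)) * (v b * starRingEnd ℂ (v b) + v1 b * starRingEnd ℂ (v1 b)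
        + M b * starRingEnd ℂ (M b) + N b * starRingEnd ℂ (N b))).re
      - (Complex.exp (c * (x - b)) * (v x * starRingEnd ℂ (v x) + v1 x * starRingEnd ℂ (v1 x)
        + M x * starRingEnd ℂ (M x) + N x * starRingEnd ℂ (N x))).re := by
    rw [← hre]
    refine intervalIntegral.integral_mono_on hx.2 (hfI.add hgI).neg ⟨T.int.1.re, T.int.2.re⟩
      (fun y hy => ?_)
    · have e1 := eexp y
      set w : ℝ := Real.exp (c * (y - b)) with hw
      have w0 : 0 < w := Real.exp_pos _
      have w1 : w ≤ 1 := by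
        rw [hw, Real.exp_le_one_iff]
        exact mul_nonpos_of_nonneg_of_nonpos hc0 (by linarith [hy.2])
      have key : ∀ z z' : ℂ, -(2 * (‖z‖ * ‖z'‖)) ≤ (z' * starRingEnd ℂ z + z * starRingEnd ℂ z').re := by
        intro z z'
        have h1 : ‖z' * starRingEnd ℂ z + z * starRingEnd ℂ z'‖ ≤ 2 * (‖z‖ * ‖z'‖) := by
          refine (norm_add_le _ _).trans (le_of_eq ?_)
          rw [norm_mul, norm_mul, RCLike.norm_conj, RCLike.norm_conj]; ring
        exact (neg_le_neg h1).trans (neg_le_of_abs_le (Complex.abs_re_le_norm _))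
      have k1 := key (v y) (v1 y)
      have k2 := key (v1 y) (Complex.I * lam / α * M y - f2 y)
      have k3 := key (M y) (N y)
      have k4 := key (N y) (g y - Complex.I * lam * v y)
      have n2 : ‖Complex.I * lam / α * M y - f2 y‖ ≤ |lam| / α * ‖M y‖ + ‖f2 y‖ := by
        refine (norm_sub_le _ _).trans (le_of_eq ?_)
        rw [norm_mul, norm_div, norm_I_mul, Complex.norm_real, Real.norm_of_nonneg hα.le]
      have n4 : ‖g y - Complex.I * lam * v y‖ ≤ ‖g y‖ + |lam| * ‖v y‖ := by
        refine (norm_sub_le _ _).trans (le_of_eq ?_)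
        rw [norm_mul, norm_I_mul]
      have m2 := mul_le_mul_of_nonneg_left n2 (norm_nonneg (v1 y))
      have m4 := mul_le_mul_of_nonneg_left n4 (norm_nonneg (N y))
      have la : 0 ≤ |lam| / α := by positivity
      have q1 := two_mul_le_add_sq ‖v y‖ ‖v1 y‖
      have q2 := mul_le_mul_of_nonneg_left (two_mul_le_add_sq ‖v1 y‖ ‖M y‖) la
      have q3 := two_mul_le_add_sq ‖v1 y‖ ‖f2 y‖
      have q4 := two_mul_le_add_sq ‖M y‖ ‖N y‖
      have q5 := two_mul_le_add_sq ‖N y‖ ‖g y‖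
      have q6 := mul_le_mul_of_nonneg_left (two_mul_le_add_sq ‖N y‖ ‖v y‖) (abs_nonneg lam)
      have sq : ∀ z : ℂ, (z * starRingEnd ℂ z).re = ‖z‖ ^ 2 := by
        intro z; rw [Complex.mul_conj', ← Complex.ofReal_pow, Complex.ofReal_re]
      rw [Complex.reCLM_apply]
      have main : -(‖f2 y‖ ^ 2 + ‖g y‖ ^ 2) ≤ c * (‖v y‖ ^ 2 + ‖v1 y‖ ^ 2 + ‖M y‖ ^ 2 + ‖N y‖ ^ 2)
          + ((v1 y * starRingEnd ℂ (v y) + v y * starRingEnd ℂ (v1 y)).re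
          + ((Complex.I * lam / α * M y - f2 y) * starRingEnd ℂ (v1 y)
            + v1 y * starRingEnd ℂ (Complex.I * lam / α * M y - f2 y)).re
          + (N y * starRingEnd ℂ (M y) + M y * starRingEnd ℂ (N y)).re
          + ((g y - Complex.I * lam * v y) * starRingEnd ℂ (N y)
            + N y * starRingEnd ℂ (g y - Complex.I * lam * v y)).re) := by
        have p1 := mul_nonneg la (sq_nonneg ‖v y‖)
        have p2 := mul_nonneg la (sq_nonneg ‖N y‖)
        have p3 := mul_nonneg (abs_nonneg lam) (sq_nonneg ‖v1 y‖)
        have p4 := mul_nonneg (abs_nonneg lam) (sq_nonneg ‖M y‖)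
        rw [hc]
        nlinarith [sq_nonneg ‖v y‖, sq_nonneg ‖v1 y‖, sq_nonneg ‖M y‖, sq_nonneg ‖N y‖]
      have main' := mul_le_mul_of_nonneg_left main w0.le
      have hneg : -(‖f2 y‖ ^ 2 + ‖g y‖ ^ 2) ≤ w * -(‖f2 y‖ ^ 2 + ‖g y‖ ^ 2) := by
        have : w * (‖f2 y‖ ^ 2 + ‖g y‖ ^ 2) ≤ 1 * (‖f2 y‖ ^ 2 + ‖g y‖ ^ 2) := by gcongr
        linarith
      refine hneg.trans (main'.trans (le_of_eq ?_))
      rw [e1, ← sq, ← sq, ← sq, ← sq]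
      simp only [← Complex.add_re, ← Complex.re_ofReal_mul, mul_add]
      congr 1
      ring
  rw [intervalIntegral.integral_neg, intervalIntegral.integral_add hfI hgI,
    intervalIntegral.integral_of_le hx.2, intervalIntegral.integral_of_le hx.2,
    integral_Ioc_eq_integral_Ioo, integral_Ioc_eq_integral_Ioo] at lower
  have lf := (hf.mono hx.1 le_rfl).integral_sq_le
  have lg := (hg.mono hx.1 le_rfl).integral_sq_le
  have sq : ∀ z : ℂ, (z * starRingEnd ℂ z).re = ‖z‖ ^ 2 := by
    intro z; rw [Complex.mul_conj', ← Complex.ofReal_pow, Complex.ofReal_re]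
  rw [eexp, eexp, Complex.re_ofReal_mul, Complex.re_ofReal_mul] at lower
  simp only [Complex.add_re, sq, sub_self, mul_zero, Real.exp_zero, one_mul] at lower
  have bsq : ∀ {z : ℂ}, ‖z‖ ≤ r → ‖z‖ ^ 2 ≤ r ^ 2 := fun h => pow_le_pow_left₀ (norm_nonneg _) h 2
  have s1 := bsq b1
  have s2 := bsq b2
  have s3 := bsq b3
  have s4 := bsq b4
  set S := ‖v x‖ ^ 2 + ‖v1 x‖ ^ 2 + ‖M x‖ ^ 2 + ‖N x‖ ^ 2 with hS
  -- The 6 counts four boundary values at `b` and two data integrals, each at most `r ^ 2`.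
  have hS1 : Real.exp (c * (x - b)) * S ≤ 6 * r ^ 2 := by linarith
  have hS2 : S ≤ 6 * Real.exp (c * (b - a)) * r ^ 2 := by
    have e2 : Real.exp (c * (b - x)) ≤ Real.exp (c * (b - a)) := by
      gcongr; exact hx.1
    calc S = Real.exp (c * (b - x)) * (Real.exp (c * (x - b)) * S) := by
          rw [← mul_assoc, ← Real.exp_add, show c * (b - x) + c * (x - b) = 0 by ring,
            Real.exp_zero, one_mul]
      _ ≤ Real.exp (c * (b - a)) * (6 * r ^ 2) := by gcongr
      _ = _ := by ring
  have fin : ∀ z : ℂ, ‖z‖ ^ 2 ≤ S → ‖z‖ ≤ √(6 * Real.exp (c * (b - a))) * r := by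
    intro z hz
    refine abs_le_of_sq_le_sq' ?_ (by positivity) |>.2
    rw [mul_pow, Real.sq_sqrt (by positivity)]
    exact hz.trans hS2
  have t1 := sq_nonneg ‖v x‖
  have t2 := sq_nonneg ‖v1 x‖
  have t3 := sq_nonneg ‖M x‖
  have t4 := sq_nonneg ‖N x‖
  exact ⟨fin _ (by linarith), fin _ (by linarith), fin _ (by linarith), fin _ (by linarith)⟩

end ElasticOn

/-- Pointwise bounds on a viscoelastic segment, by interpolation on windows of length `s ^ 2`. -/
lemma IsPrim.viscoelastic_bound {a b lam s m n k : ℝ} {M N v v1 v2 g : ℝ → ℂ}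
    (hM : IsPrim a b M N) (hN : IsPrim a b N (fun x => g x - Complex.I * lam * v x))
    (hv : IsPrim a b v v1) (hv1 : IsPrim a b v1 v2) (hlam : lam ≠ 0) (hs : 0 < s)
    (hL : s ^ 2 ≤ b - a) (h1 : L2Le a b M m) (h2 : L2Le a b g n) (h3 : L2Le a b v2 k)
    {x : ℝ} (hx : x ∈ Icc a b) :
    ‖v x‖ ≤ 10000 * (m / s ^ 5 + n / s) / |lam| + s ^ 3 * k ∧
    ‖v1 x‖ ≤ 10000 * (m / s ^ 7 + n / s ^ 3) / |lam| + s * k ∧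
    ‖M x‖ ≤ 7 * m / s
      + s ^ 3 * (n + |lam| * (s * (10000 * (m / s ^ 5 + n / s) / |lam| + s ^ 3 * k))) ∧
    ‖N x‖ ≤ 6 * m / s ^ 3
      + s * (n + |lam| * (s * (10000 * (m / s ^ 5 + n / s) / |lam| + s ^ 3 * k))) := by
  obtain ⟨c, hc1, hc2, hxc⟩ := exists_window hx (by positivity) hL
  have hcc : c ≤ c + s ^ 2 := by linarith [sq_nonneg s]
  have w := fun y (hy : y ∈ Icc c (c + s ^ 2)) =>
    (hM.mono hc1 hcc hc2).interpolation_moment (hN.mono hc1 hcc hc2)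
    (hv.mono hc1 hcc hc2) (hv1.mono hc1 hcc hc2) hlam hs (by ring) (h1.mono hc1 hc2)
    (h2.mono hc1 hc2) (h3.mono hc1 hc2) (Eventually.of_forall fun x _ => rfl) hy
  set V := 10000 * (m / s ^ 5 + n / s) / |lam| + s ^ 3 * k with hV
  have m0 := h1.nonneg
  have n0 := h2.nonneg
  have k0 := h3.nonneg
  have V0 : 0 ≤ V := by positivity
  -- Once `v` is bounded on the window, N' = g − iλv is bounded in L², and ordinary interpolation
  -- applies to M.
  have hvL : L2Le c (c + s ^ 2) v (s * V) :=
    L2Le.of_bound ((hv.mono hc1 hcc hc2).continuousOn.mono Ioo_subset_Icc_self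
      |>.aestronglyMeasurable measurableSet_Ioo) hs.le V0 (by linarith)
      fun y hy => (w y (Ioo_subset_Icc_self hy)).1
  have hR : L2Le c (c + s ^ 2) (fun x => g x - Complex.I * lam * v x) (n + |lam| * (s * V)) := by
    have := (h2.mono hc1 hc2).sub (hvL.const_mul (Complex.I * lam))
    rwa [norm_I_mul] at this
  have i := (hM.mono hc1 hcc hc2).interpolation (hN.mono hc1 hcc hc2) hs (by ring)
    (h1.mono hc1 hc2) hR hxc
  exact ⟨(w x hxc).1, (w x hxc).2, i.1, i.2⟩

/-! ## The resolvent equation on the imaginary axis -/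

namespace BeamData

variable {p : BeamData}

lemma α_of_mem {x : ℝ} (hx : x ∈ Ioo p.ℓ₀ p.ℓ₁) : p.α x = p.α₂ := if_pos hx
lemma κ_of_mem {x : ℝ} (hx : x ∈ Ioo p.ℓ₀ p.ℓ₁) : p.κ x = p.α₀ := if_pos hx
lemma α_of_notMem {x : ℝ} (hx : x ∉ Ioo p.ℓ₀ p.ℓ₁) : p.α x = p.α₁ := if_neg hx
lemma κ_of_notMem {x : ℝ} (hx : x ∉ Ioo p.ℓ₀ p.ℓ₁) : p.κ x = 0 := if_neg hx

/-- The first order form of the resolvent equation `iλ U - 𝓐 U = F` on the five pieces of the beam,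
with velocity `v`, `v' = v1`, moments `M j`, `(M j)' = N j`, data `f2, g`; `E`, `mF` and `mD` measure
the energy, the data and the dissipation. -/
structure FrequencySystem (p : BeamData) (K lam E mF mD : ℝ) (v v1 v2 f2 g : ℝ → ℂ)
    (M N : Fin 5 → ℝ → ℂ) : Prop where
  elastic0 : ElasticOn 0 p.ξ₁ p.α₁ lam v v1 (M 0) (N 0) f2 g
  elastic1 : ElasticOn p.ξ₁ p.ℓ₀ p.α₁ lam v v1 (M 1) (N 1) f2 g
  elastic4 : ElasticOn p.ℓ₁ p.ℓ p.α₁ lam v v1 (M 4) (N 4) f2 g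
  hv : IsPrim p.ℓ₀ p.ℓ₁ v v1
  hv1 : IsPrim p.ℓ₀ p.ℓ₁ v1 v2
  hM2 : IsPrim p.ℓ₀ p.ξ₂ (M 2) (N 2)
  hN2 : IsPrim p.ℓ₀ p.ξ₂ (N 2) (fun x => g x - Complex.I * lam * v x)
  hM3 : IsPrim p.ξ₂ p.ℓ₁ (M 3) (N 3)
  hN3 : IsPrim p.ξ₂ p.ℓ₁ (N 3) (fun x => g x - Complex.I * lam * v x)
  v1_left : v1 0 = 0
  v1_right : v1 p.ℓ = 0
  jM1 : M 1 p.ξ₁ = M 0 p.ξ₁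
  jN1 : N 1 p.ξ₁ = N 0 p.ξ₁ - p.γ₁ * v p.ξ₁
  jM2 : M 2 p.ℓ₀ = M 1 p.ℓ₀
  jN2 : N 2 p.ℓ₀ = N 1 p.ℓ₀
  jM4 : M 4 p.ℓ₁ = M 3 p.ℓ₁
  jN4 : N 4 p.ℓ₁ = N 3 p.ℓ₁
  bv : L2Le 0 p.ℓ v (K * E)
  bf2 : L2Le 0 p.ℓ f2 (K * mF)
  bg : L2Le 0 p.ℓ g (K * mF)
  bM0 : L2Le 0 p.ξ₁ (M 0) (K * E)
  bM1 : L2Le p.ξ₁ p.ℓ₀ (M 1) (K * E)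
  bM4 : L2Le p.ℓ₁ p.ℓ (M 4) (K * E)
  bv2 : L2Le p.ℓ₀ p.ℓ₁ v2 (K * mD)
  bM2 : L2Le p.ℓ₀ p.ξ₂ (M 2) (K * mD)
  bM3 : L2Le p.ξ₂ p.ℓ₁ (M 3) (K * mD)
  bvξ : ‖v p.ξ₁‖ ≤ K * mD
  energy : E ^ 2 ≤ 2 * ((∫ x in 0..p.ξ₁, (1 / 2 * ‖v x‖ ^ 2 + 3 / (2 * p.α₁) * ‖M 0 x‖ ^ 2))
    + (∫ x in p.ξ₁..p.ℓ₀, (1 / 2 * ‖v x‖ ^ 2 + 3 / (2 * p.α₁) * ‖M 1 x‖ ^ 2))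
    + (∫ x in p.ℓ₁..p.ℓ, (1 / 2 * ‖v x‖ ^ 2 + 3 / (2 * p.α₁) * ‖M 4 x‖ ^ 2)))
    + (∫ x in p.ℓ₀..p.ℓ₁, ‖v x‖ ^ 2) + K * ((mD + mF) / lam) ^ 2

/-- The term iλ‖U‖² is imaginary, so the energy balance equates the dissipation with Re⟨U, F⟩. -/
lemma OperatorGraph.dissipation_le {U F : p.Phase} {lam : ℝ}
    (h : p.OperatorGraph U ((Complex.I * lam) • U - F)) :
    p.dissipation ((Complex.I * lam : ℂ) • U - F).fst ≤ ‖U‖ * ‖F‖ := by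
  have h1 := h.re_inner
  have h2 : (inner ℂ U ((Complex.I * lam : ℂ) • U)).re = 0 := by
    rw [inner_smul_right, inner_self_eq_norm_sq_to_K, mul_assoc, Complex.I_mul_re]
    simp [← Complex.ofReal_pow]
  rw [inner_sub_right, Complex.sub_re, h2, zero_sub, neg_inj] at h1
  rw [← h1]
  exact (Complex.re_le_norm _).trans (norm_inner_le_norm _ _)

lemma integral_mono_Ioo {a b : ℝ} {f g : ℝ → ℝ} (hab : a ≤ b)
    (hf : IntervalIntegrable f volume a b) (hg : IntervalIntegrable g volume a b)
    (h : ∀ᵐ x, x ∈ Ioo a b → f x ≤ g x) : ∫ x in a..b, f x ≤ ∫ x in a..b, g x := by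
  refine intervalIntegral.integral_mono_ae_restrict hab hf hg ?_
  rw [← restrict_Ioo_eq_restrict_Icc, Filter.EventuallyLE, ae_restrict_iff' measurableSet_Ioo]
  exact h

/-- On an elastic piece α|u''|² = |M|²/α, so twice the multiplier density dominates the energy
density. -/
lemma integral_elastic_le {a b lam : ℝ} {v v1 M N f2 g u w : ℝ → ℂ} (hα : 0 < p.α₁)
    (H : ElasticOn a b p.α₁ lam v v1 M N f2 g)
    (hm : ∀ᵐ x, x ∈ Ioo a b → p.α x = p.α₁ ∧ M x = p.α₁ * u x ∧ w x = v x)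
    (hi : IntervalIntegrable (fun x => p.α x * ‖u x‖ ^ 2 + ‖w x‖ ^ 2) volume a b) :
    ∫ x in a..b, (p.α x * ‖u x‖ ^ 2 + ‖w x‖ ^ 2) ≤
      2 * ∫ x in a..b, (1 / 2 * ‖v x‖ ^ 2 + 3 / (2 * p.α₁) * ‖M x‖ ^ 2) := by
  have hab := H.hv.le
  rw [← intervalIntegral.integral_const_mul]
  refine integral_mono_Ioo hab hi ?_ ?_
  · have c1 := H.hv.continuousOn
    have c2 := H.hM.continuousOn
    refine ContinuousOn.intervalIntegrable ?_
    rw [uIcc_of_le hab]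
    fun_prop
  · filter_upwards [hm] with x hx hxm
    obtain ⟨h1, h2, h3⟩ := hx hxm
    rw [h1, h2, h3, norm_mul, Complex.norm_real, Real.norm_of_nonneg hα.le, mul_pow]
    have : 3 / (2 * p.α₁) * (p.α₁ ^ 2 * ‖u x‖ ^ 2) = 3 / 2 * (p.α₁ * ‖u x‖ ^ 2) := by
      field_simp
    rw [this]
    have : 0 ≤ p.α₁ * ‖u x‖ ^ 2 := by positivity
    linarith

/-- The resolvent equation on the imaginary axis as a first order system. -/
lemma exists_frequencySystem (p : BeamData) : ∃ K, 0 < K ∧ ∀ {lam : ℝ} {U F : p.Phase}, lam ≠ 0 →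
    p.OperatorGraph U ((Complex.I * lam : ℂ) • U - F) → ∃ v v1 v2 f2 g M N,
      p.FrequencySystem K lam ‖U‖ ‖F‖ (√(‖U‖ * ‖F‖) * (1 + 1 / |lam|) + ‖F‖ / |lam|)
        v v1 v2 f2 g M N := by
  have o1 := p.ξ₁_pos
  have o2 := p.ξ₁_lt
  have o3 := p.lt_ξ₂
  have o4 := p.ξ₂_lt
  have o5 := p.ℓ₁_lt
  have a0 := p.α₀_pos
  have a1 := p.α₁_pos
  have a2 := p.α₂_pos
  have g1 := p.γ₁_pos
  set c := 1 / √(min p.α₁ p.α₂) with hc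
  have c0 : 0 ≤ c := by positivity
  set q := 1 / √p.α₀ with hq
  have q0 : 0 ≤ q := by positivity
  set t := 1 / √p.γ₁ with ht
  have t0 : 0 ≤ t := by positivity
  set K := 1 + c + p.α₁ * c + q + (p.α₂ * (q + c) + p.α₀ * q) + t + p.α₂ * (q + c) ^ 2 with hK
  have k1 : 0 ≤ p.α₁ * c := by positivity
  have k2 : 0 ≤ p.α₂ * (q + c) := by positivity
  have k3 : 0 ≤ p.α₀ * q := by positivity
  have k4 : 0 ≤ p.α₂ * (q + c) ^ 2 := by positivity
  refine ⟨K, by positivity, ?_⟩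
  intro lam U F hlam h
  have hl : 0 < |lam| := abs_pos.2 hlam
  obtain ⟨M, N, H⟩ := h.exists_moments
  -- `A` is the image of `U` under the operator. Its first component iλu − F₁ is the velocity, and
  -- replaces u as the unknown.
  set A : p.Phase := (Complex.I * lam : ℂ) • U - F with hA
  have hdis : p.dissipation A.fst ≤ ‖U‖ * ‖F‖ := h.dissipation_le
  set d := √(‖U‖ * ‖F‖) with hd
  have d0 : 0 ≤ d := Real.sqrt_nonneg _
  have hd2 : d ^ 2 = ‖U‖ * ‖F‖ := Real.sq_sqrt (by positivity)
  -- Dissipation bounds v'' by a multiple of `d`; the terms with 1/|λ| account for u'' = (v'' +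
  -- F₁'')/(iλ).
  set mD := d * (1 + 1 / |lam|) + ‖F‖ / |lam| with hmD
  have dmD : d ≤ mD := by
    have : 0 ≤ d * (1 / |lam|) := by positivity
    have : 0 ≤ ‖F‖ / |lam| := by positivity
    rw [hmD]; linarith
  have mD0 : 0 ≤ mD := d0.trans dmD
  have en0 := norm_nonneg U
  have fn0 := norm_nonneg F
  -- almost everywhere relations
  have eA1 : ∀ᵐ x, x ∈ Ioo 0 p.ℓ → A.fst.d2 x = Complex.I * lam * U.fst.d2 x - F.fst.d2 x := by
    rw [← ae_restrict_iff' measurableSet_Ioo]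
    have e : A.fst.d2 = (Complex.I * lam : ℂ) • U.fst.d2 - F.fst.d2 := by
      have := (H20.d2CLM p).map_sub ((Complex.I * lam : ℂ) • U.fst) F.fst
      rw [ContinuousLinearMap.map_smul] at this
      exact this
    rw [e]
    filter_upwards [Lp.coeFn_sub ((Complex.I * lam : ℂ) • U.fst.d2) F.fst.d2,
      Lp.coeFn_smul (Complex.I * lam : ℂ) U.fst.d2] with x h1 h2
    rw [h1, Pi.sub_apply, h2, Pi.smul_apply, smul_eq_mul]
  have eA2 : ∀ᵐ x, x ∈ Ioo 0 p.ℓ →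
      F.snd x - Complex.I * lam * A.fst.fn x = -A.snd x := by
    rw [← ae_restrict_iff' measurableSet_Ioo]
    have e : A.snd = (Complex.I * lam : ℂ) • U.snd - F.snd := rfl
    rw [e]
    filter_upwards [Lp.coeFn_sub ((Complex.I * lam : ℂ) • U.snd) F.snd,
      Lp.coeFn_smul (Complex.I * lam : ℂ) U.snd, H.vel] with x h1 h2 h3
    rw [h1, Pi.sub_apply, h2, Pi.smul_apply, smul_eq_mul, ← h3]; ring
  have eV : ∀ᵐ x, x ∈ Ioo 0 p.ℓ → A.fst.fn x = U.snd x := by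
    rw [← ae_restrict_iff' measurableSet_Ioo]
    exact H.vel.symm
  set v := A.fst.fn with hv
  set v1 := A.fst.d1 with hv1
  set f2 : ℝ → ℂ := (F.fst.d2 : ℝ → ℂ)
  set g : ℝ → ℂ := (F.snd : ℝ → ℂ)
  obtain ⟨pv, pv1⟩ := A.fst.isPrim
  -- bounds on the data
  have bf2 : L2Le 0 p.ℓ f2 (c * ‖F‖) := (l2Le_coe F.fst.d2).mono_right
    ((norm_d2_le _).trans (mul_le_mul_of_nonneg_left (norm_fst_le F) c0))
  have bu2 : L2Le 0 p.ℓ U.fst.d2 (c * ‖U‖) := (l2Le_coe U.fst.d2).mono_right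
    ((norm_d2_le _).trans (mul_le_mul_of_nonneg_left (norm_fst_le U) c0))
  have bg : L2Le 0 p.ℓ g ‖F‖ := (l2Le_coe F.snd).mono_right (norm_snd_le F)
  have bv : L2Le 0 p.ℓ v ‖U‖ := ((l2Le_coe U.snd).mono_right (norm_snd_le U)).congr_ae eV
  have elastic : ∀ {a b : ℝ} {m n : ℝ → ℂ}, 0 ≤ a → b ≤ p.ℓ → (b ≤ p.ℓ₀ ∨ p.ℓ₁ ≤ a) →
      p.MomentOn U A a b m n → ElasticOn a b p.α₁ lam v v1 m n f2 g ∧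
        L2Le a b m (p.α₁ * (c * ‖U‖)) ∧
        ∀ᵐ x, x ∈ Ioo a b → p.α x = p.α₁ ∧ m x = p.α₁ * U.fst.d2 x ∧ U.snd x = v x := by
    intro a b m n ha hb hs Hm
    have hab := Hm.lt.le
    have hn : ∀ x ∈ Ioo a b, x ∉ Ioo p.ℓ₀ p.ℓ₁ := by
      rintro x ⟨h1, h2⟩ ⟨h3, h4⟩
      rcases hs with h5 | h5 <;> linarith
    have em : ∀ᵐ x, x ∈ Ioo a b → m x = p.α₁ * U.fst.d2 x := by
      filter_upwards [Hm.eq] with x hx hxm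
      rw [hx hxm, α_of_notMem (hn x hxm), κ_of_notMem (hn x hxm)]; simp
    have hsub : ∀ x, x ∈ Ioo a b → x ∈ Ioo 0 p.ℓ := fun x hx => ⟨ha.trans_lt hx.1, hx.2.trans_le hb⟩
    refine ⟨⟨a1, hlam, pv.mono ha hab hb, (pv1.mono ha hab hb).congr_ae ?_, Hm.prim,
      Hm.prim'.congr_ae ?_⟩, ?_, ?_⟩
    · filter_upwards [em, eA1] with x h1 h2 hxm
      rw [h1 hxm, h2 (hsub x hxm)]
      have : (p.α₁ : ℂ) ≠ 0 := by exact_mod_cast a1.ne'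
      field_simp
    · filter_upwards [eA2] with x h2 hxm
      exact h2 (hsub x hxm)
    · have := ((bu2.mono ha hb).const_mul p.α₁).congr_ae em
      rwa [Complex.norm_real, Real.norm_of_nonneg a1.le] at this
    · filter_upwards [em, eV] with x h1 h2 hxm
      exact ⟨α_of_notMem (hn x hxm), h1 hxm, (h2 (hsub x hxm)).symm⟩
  obtain ⟨E0, B0, R0⟩ := elastic le_rfl (by linarith) (Or.inl (by linarith)) H.m0
  obtain ⟨E1, B1, R1⟩ := elastic (by linarith) (by linarith) (Or.inl (by linarith)) H.m1
  obtain ⟨E4, B4, R4⟩ := elastic (by linarith) le_rfl (Or.inr le_rfl) H.m4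
  -- the viscoelastic part
  have hsub : ∀ x, x ∈ Ioo p.ℓ₀ p.ℓ₁ → x ∈ Ioo 0 p.ℓ :=
    fun x hx => ⟨(by linarith : (0:ℝ) < p.ℓ₀).trans hx.1, hx.2.trans o5⟩
  have bv2 : L2Le p.ℓ₀ p.ℓ₁ A.fst.d2 (q * d) := by
    refine L2Le.of_integral_sq_le ((l2Le_coe A.fst.d2).mono (by linarith) (by linarith)).memLp
      (by positivity) ?_
    have e1 : ∫ x in Ioo p.ℓ₀ p.ℓ₁, p.κ x * ‖A.fst.d2 x‖ ^ 2 ≤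
        ∫ x in Ioo 0 p.ℓ, p.κ x * ‖A.fst.d2 x‖ ^ 2 :=
      setIntegral_mono_set (integrable_κ_sq A.fst.d2) (Eventually.of_forall fun x =>
        mul_nonneg (p.κ_nonneg x) (by positivity)) (Eventually.of_forall hsub)
    have e2 : ∫ x in Ioo p.ℓ₀ p.ℓ₁, p.κ x * ‖A.fst.d2 x‖ ^ 2
        = p.α₀ * ∫ x in Ioo p.ℓ₀ p.ℓ₁, ‖A.fst.d2 x‖ ^ 2 := by
      rw [← integral_const_mul]
      refine setIntegral_congr_fun measurableSet_Ioo fun x hx => ?_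
      simp only [κ_of_mem hx]
    have e3 : ∫ x in Ioo 0 p.ℓ, p.κ x * ‖A.fst.d2 x‖ ^ 2 ≤ d ^ 2 := by
      rw [hd2]
      refine le_trans ?_ hdis
      have := p.γ₂_pos
      have := p.γ₃_pos
      have : 0 ≤ p.γ₁ * ‖A.fst.fn p.ξ₁‖ ^ 2 + p.γ₂ * ‖A.fst.fn p.ξ₂‖ ^ 2
        + p.γ₃ * ‖A.fst.d1 p.ξ₂‖ ^ 2 := by positivity
      unfold dissipation
      linarith
    rw [mul_pow, hq, div_pow, one_pow, Real.sq_sqrt a0.le, one_div_mul_eq_div, le_div_iff₀ a0]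
    linarith
  -- Viscosity controls v'' directly, and this relation gives control of u'' with a gain of 1/|λ|.
  -- The whole moment αu'' + κv'' is therefore of the size of the dissipation.
  have eu : ∀ᵐ x, x ∈ Ioo p.ℓ₀ p.ℓ₁ →
      U.fst.d2 x = (Complex.I * lam : ℂ)⁻¹ * (A.fst.d2 x + F.fst.d2 x) := by
    filter_upwards [eA1] with x h1 hxm
    rw [h1 (hsub x hxm)]
    have : (lam : ℂ) ≠ 0 := by exact_mod_cast hlam
    field_simp
    ring
  have bu2' : L2Le p.ℓ₀ p.ℓ₁ U.fst.d2 (|lam|⁻¹ * (q * d + c * ‖F‖)) := by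
    have := ((bv2.add (bf2.mono (by linarith) (by linarith))).const_mul
      (Complex.I * lam : ℂ)⁻¹).congr_ae eu
    rwa [norm_inv, norm_I_mul] at this
  have kv : ∀ {a b : ℝ} {m n : ℝ → ℂ}, p.ℓ₀ ≤ a → b ≤ p.ℓ₁ → p.MomentOn U A a b m n →
      IsPrim a b n (fun x => g x - Complex.I * lam * v x) ∧ L2Le a b m (K * mD) := by
    intro a b m n ha hb Hm
    have hs : ∀ x, x ∈ Ioo a b → x ∈ Ioo p.ℓ₀ p.ℓ₁ :=
      fun x hx => ⟨ha.trans_lt hx.1, hx.2.trans_le hb⟩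
    refine ⟨Hm.prim'.congr_ae ?_, ?_⟩
    · filter_upwards [eA2] with x h2 hxm
      exact h2 (hsub x (hs x hxm))
    · have B := ((bu2'.const_mul p.α₂).add (bv2.const_mul p.α₀)).mono ha hb
      rw [Complex.norm_real, Complex.norm_real, Real.norm_of_nonneg a0.le,
        Real.norm_of_nonneg a2.le] at B
      refine (B.congr_ae ?_).mono_right ?_
      · filter_upwards [Hm.eq] with x hx hxm
        rw [hx hxm, α_of_mem (hs x hxm), κ_of_mem (hs x hxm)]
      · have e1 : |lam|⁻¹ * (q * d + c * ‖F‖) ≤ (q + c) * mD := by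
          have : (q + c) * mD - |lam|⁻¹ * (q * d + c * ‖F‖)
            = (q + c) * d + q * (‖F‖ * |lam|⁻¹) + c * (d * |lam|⁻¹) := by
            rw [hmD]; simp only [div_eq_mul_inv]; ring
          have : 0 ≤ (q + c) * d + q * (‖F‖ * |lam|⁻¹) + c * (d * |lam|⁻¹) := by positivity
          linarith
        calc _ ≤ p.α₂ * ((q + c) * mD) + p.α₀ * (q * mD) := by gcongr
          _ = (p.α₂ * (q + c) + p.α₀ * q) * mD := by ring
          _ ≤ K * mD := by gcongr; rw [hK]; linarith
  obtain ⟨P2, B2⟩ := kv le_rfl o4.le H.m2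
  obtain ⟨P3, B3⟩ := kv o3.le le_rfl H.m3
  -- The jumps at ξ₂ are not recorded: the two viscoelastic pieces are estimated separately from
  -- their own L² bounds, without matching at ξ₂.
  refine ⟨v, v1, A.fst.d2, f2, g, M, N, ?_⟩
  refine
    { elastic0 := E0, elastic1 := E1, elastic4 := E4
      hv := pv.mono (by linarith) (by linarith) (by linarith)
      hv1 := pv1.mono (by linarith) (by linarith) (by linarith)
      hM2 := H.m2.prim, hN2 := P2, hM3 := H.m3.prim, hN3 := P3
      v1_left := A.fst.d1_zero_left, v1_right := A.fst.d1_zero_right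
      jM1 := H.jM1, jN1 := H.jN1, jM2 := H.jM2, jN2 := H.jN2, jM4 := H.jM4, jN4 := H.jN4
      bv := bv.mono_right (le_mul_of_one_le_left en0 (by rw [hK]; linarith))
      bf2 := bf2.mono_right (mul_le_mul_of_nonneg_right (by rw [hK]; linarith) fn0)
      bg := bg.mono_right (le_mul_of_one_le_left fn0 (by rw [hK]; linarith))
      bM0 := B0.mono_right (by
        rw [← mul_assoc]; exact mul_le_mul_of_nonneg_right (by rw [hK]; linarith) en0)
      bM1 := B1.mono_right (by
        rw [← mul_assoc]; exact mul_le_mul_of_nonneg_right (by rw [hK]; linarith) en0)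
      bM4 := B4.mono_right (by
        rw [← mul_assoc]; exact mul_le_mul_of_nonneg_right (by rw [hK]; linarith) en0)
      bv2 := bv2.mono_right (mul_le_mul (by rw [hK]; linarith) dmD d0 (by positivity))
      bM2 := B2, bM3 := B3, bvξ := ?_, energy := ?_ }
  · have h1 : p.γ₁ * ‖v p.ξ₁‖ ^ 2 ≤ d ^ 2 := by
      rw [hd2]
      refine le_trans ?_ hdis
      have e0 : 0 ≤ ∫ x in Ioo 0 p.ℓ, p.κ x * ‖A.fst.d2 x‖ ^ 2 :=
        integral_nonneg fun x => mul_nonneg (p.κ_nonneg x) (by positivity)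
      have := p.γ₂_pos
      have := p.γ₃_pos
      have : 0 ≤ p.γ₂ * ‖A.fst.fn p.ξ₂‖ ^ 2 + p.γ₃ * ‖A.fst.d1 p.ξ₂‖ ^ 2 := by positivity
      unfold dissipation
      linarith
    have h2 : ‖v p.ξ₁‖ ≤ t * d := by
      refine abs_le_of_sq_le_sq' ?_ (by positivity) |>.2
      rw [mul_pow, ht, div_pow, one_pow, Real.sq_sqrt g1.le, one_div_mul_eq_div, le_div_iff₀ g1]
      linarith
    exact h2.trans (mul_le_mul (by rw [hK]; linarith) dmD d0 (by positivity))
  · set e : ℝ → ℝ := fun x => p.α x * ‖U.fst.d2 x‖ ^ 2 + ‖U.snd x‖ ^ 2 with he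
    have hi : Integrable e p.vol :=
      (p.integrable_α_sq U.fst.d2).add (by simpa using (Lp.memLp U.snd).integrable_norm_pow (by norm_num))
    have hE : ‖U‖ ^ 2 = ∫ x in 0..p.ℓ, e x := by
      rw [norm_sq_phase, norm_sq_H20, norm_sq_L2, intervalIntegral.integral_of_le p.ℓ_pos.le,
        integral_Ioc_eq_integral_Ioo, ← integral_add (p.integrable_α_sq U.fst.d2)]
      simpa using (Lp.memLp U.snd).integrable_norm_pow (by norm_num)
    have hI : IntervalIntegrable e volume 0 p.ℓ := by
      rw [intervalIntegrable_iff_integrableOn_Ioo_of_le p.ℓ_pos.le]; exact hi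
    have sub : ∀ {a b : ℝ}, 0 ≤ a → a ≤ b → b ≤ p.ℓ → IntervalIntegrable e volume a b := by
      intro a b ha hab hb
      refine hI.mono_set ?_
      rw [uIcc_of_le hab, uIcc_of_le p.ℓ_pos.le]
      exact Icc_subset_Icc ha hb
    have i0 := sub le_rfl o1.le (by linarith)
    have i1 := sub o1.le o2.le (by linarith)
    have i2 := sub (by linarith) p.ℓ₀_lt_ℓ₁.le o5.le
    have i4 := sub (by linarith) o5.le le_rfl
    rw [hE, ← intervalIntegral.integral_add_adjacent_intervals ((i0.trans i1).trans i2) i4,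
      ← intervalIntegral.integral_add_adjacent_intervals (i0.trans i1) i2,
      ← intervalIntegral.integral_add_adjacent_intervals i0 i1]
    have j0 : (∫ x in 0..p.ξ₁, e x) ≤ _ := integral_elastic_le a1 E0 R0 i0
    have j1 : (∫ x in p.ξ₁..p.ℓ₀, e x) ≤ _ := integral_elastic_le a1 E1 R1 i1
    have j4 : (∫ x in p.ℓ₁..p.ℓ, e x) ≤ _ := integral_elastic_le a1 E4 R4 i4
    -- On the viscoelastic part the potential energy is of order ((mD + ‖F‖)/λ)², so only the
    -- kinetic energy remains to be estimated.
    have j2 : ∫ x in p.ℓ₀..p.ℓ₁, e x ≤ (∫ x in p.ℓ₀..p.ℓ₁, ‖v x‖ ^ 2)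
        + K * ((mD + ‖F‖) / lam) ^ 2 := by
      have hvi : IntervalIntegrable (fun x => ‖v x‖ ^ 2) volume p.ℓ₀ p.ℓ₁ :=
        (A.fst.continuous_fn.norm.pow 2).intervalIntegrable _ _
      have hui : IntervalIntegrable (fun x => p.α₂ * ‖U.fst.d2 x‖ ^ 2) volume p.ℓ₀ p.ℓ₁ := by
        rw [intervalIntegrable_iff_integrableOn_Ioo_of_le p.ℓ₀_lt_ℓ₁.le]
        exact Integrable.const_mul (by simpa using bu2'.memLp.integrable_norm_pow (by norm_num)) _
      have s1 : ∫ x in p.ℓ₀..p.ℓ₁, e x ≤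
          ∫ x in p.ℓ₀..p.ℓ₁, (p.α₂ * ‖U.fst.d2 x‖ ^ 2 + ‖v x‖ ^ 2) := by
        refine integral_mono_Ioo p.ℓ₀_lt_ℓ₁.le i2 (hui.add hvi) ?_
        filter_upwards [eV] with x h1 hxm
        simp only [he]
        rw [α_of_mem hxm, h1 (hsub x hxm)]
      rw [intervalIntegral.integral_add hui hvi, intervalIntegral.integral_const_mul] at s1
      have s2 := bu2'.integral_sq_le
      rw [← integral_Ioc_eq_integral_Ioo, ← intervalIntegral.integral_of_le p.ℓ₀_lt_ℓ₁.le] at s2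
      have s2 := mul_le_mul_of_nonneg_left s2 a2.le
      have s3 : p.α₂ * (|lam|⁻¹ * (q * d + c * ‖F‖)) ^ 2 ≤ K * ((mD + ‖F‖) / lam) ^ 2 := by
        have : ((mD + ‖F‖) / lam) ^ 2 = (|lam|⁻¹ * (mD + ‖F‖)) ^ 2 := by
          rw [mul_pow, inv_pow, sq_abs]; ring
        rw [this]
        have h5 : q * d + c * ‖F‖ ≤ (q + c) * (mD + ‖F‖) := by
          have : q * d ≤ q * mD := by gcongr
          have : 0 ≤ q * ‖F‖ + c * mD := by positivity
          linarith
        calc p.α₂ * (|lam|⁻¹ * (q * d + c * ‖F‖)) ^ 2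
            ≤ p.α₂ * (|lam|⁻¹ * ((q + c) * (mD + ‖F‖))) ^ 2 := by gcongr
          _ = p.α₂ * (q + c) ^ 2 * (|lam|⁻¹ * (mD + ‖F‖)) ^ 2 := by ring
          _ ≤ _ := by gcongr; rw [hK]; linarith
      linarith
    linarith

end BeamData

/-! ## A priori bounds on the imaginary axis -/

/-- The scale s = 1/μ balances the terms of `viscoelastic_bound`: with M and v'' of size μr, both
M/(s⁷|λ|) and s·v'' are of size r, and M/s³ is of size μ⁴r. -/
lemma IsPrim.viscoelastic_bound_of_high {a b lam μ K r : ℝ} {M N v v1 v2 g : ℝ → ℂ}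
    (hM : IsPrim a b M N) (hN : IsPrim a b N (fun x => g x - Complex.I * lam * v x))
    (hv : IsPrim a b v v1) (hv1 : IsPrim a b v1 v2) (hμ : 1 ≤ μ) (hlam : |lam| = μ ^ 8)
    (hL : 1 / μ ^ 2 ≤ b - a) (hK : 0 ≤ K) (hr : 0 ≤ r) (h1 : L2Le a b M (K * (μ * r)))
    (h2 : L2Le a b g (K * (μ ^ 2 * r))) (h3 : L2Le a b v2 (K * (μ * r)))
    {x : ℝ} (hx : x ∈ Icc a b) :
    ‖v x‖ ≤ 30000 * K * r ∧ ‖v1 x‖ ≤ 30000 * K * r ∧ ‖N x‖ ≤ 30000 * K * (μ ^ 4 * r) := by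
  have μ0 : 0 < μ := by linarith
  have hlam0 : lam ≠ 0 := by
    rw [← abs_pos, hlam]; positivity
  have B := hM.viscoelastic_bound hN hv hv1 hlam0 (s := 1 / μ) (by positivity)
    (by rw [div_pow, one_pow]; exact hL) h1 h2 h3 hx
  rw [hlam] at B
  have Kr : 0 ≤ K * r := by positivity
  set V := 10000 * (K * (μ * r) / (1 / μ) ^ 5 + K * (μ ^ 2 * r) / (1 / μ)) / μ ^ 8
    + (1 / μ) ^ 3 * (K * (μ * r)) with hV
  have i3 : K * r / μ ^ 3 ≤ K * r := div_le_self Kr (one_le_pow₀ hμ)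
  have hV1 : V = (10001 * (K * r) + 10000 * (K * r / μ ^ 3)) / μ ^ 2 := by
    rw [hV]; field_simp; ring
  have hV2 : V ≤ 20001 * (K * r) / μ ^ 2 := by
    rw [hV1]; gcongr; linarith
  have hV3 : V ≤ 20001 * (K * r) := hV2.trans (div_le_self (by positivity) (one_le_pow₀ hμ))
  refine ⟨B.1.trans (by linarith), B.2.1.trans ?_, B.2.2.2.trans ?_⟩
  · have : 10000 * (K * (μ * r) / (1 / μ) ^ 7 + K * (μ ^ 2 * r) / (1 / μ) ^ 3) / μ ^ 8
        + 1 / μ * (K * (μ * r)) = 10001 * (K * r) + 10000 * (K * r / μ ^ 3) := by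
      field_simp; ring
    rw [this]; linarith
  · have e1 : 6 * (K * (μ * r)) / (1 / μ) ^ 3 + 1 / μ * (K * (μ ^ 2 * r) + μ ^ 8 * (1 / μ * V))
        = 6 * (K * r) * μ ^ 4 + K * r * μ + μ ^ 6 * V := by field_simp; ring
    have e2 : μ ^ 6 * V ≤ μ ^ 6 * (20001 * (K * r) / μ ^ 2) := by gcongr
    have e3 : μ ^ 6 * (20001 * (K * r) / μ ^ 2) = 20001 * (K * r) * μ ^ 4 := by field_simp
    have e4 : K * r * μ ≤ K * r * μ ^ 4 := by
      gcongr; exact le_self_pow₀ hμ (by norm_num)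
    have e5 : 0 ≤ K * r * μ ^ 4 := by positivity
    rw [e1]; linarith

/-- For a fixed frequency the window is the whole segment, and every coefficient becomes a constant.
-/
lemma IsPrim.exists_viscoelastic_bound {a b lam K : ℝ} (hab : a < b) (hlam : lam ≠ 0)
    (hK : 0 ≤ K) : ∃ C, 0 ≤ C ∧ ∀ {r : ℝ} {M N v v1 v2 g : ℝ → ℂ}, 0 ≤ r →
      IsPrim a b M N → IsPrim a b N (fun x => g x - Complex.I * lam * v x) →
      IsPrim a b v v1 → IsPrim a b v1 v2 → L2Le a b M (K * r) → L2Le a b g (K * r) →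
      L2Le a b v2 (K * r) → ∀ x ∈ Icc a b,
        ‖v x‖ ≤ C * r ∧ ‖v1 x‖ ≤ C * r ∧ ‖M x‖ ≤ C * r ∧ ‖N x‖ ≤ C * r := by
  set s := √(b - a) with hs
  have s0 : 0 < s := Real.sqrt_pos.2 (by linarith)
  have hsq : s ^ 2 = b - a := Real.sq_sqrt (by linarith)
  have hl : 0 < |lam| := abs_pos.2 hlam
  set V := 10000 * (K / s ^ 5 + K / s) / |lam| + s ^ 3 * K with hV
  set A := 10000 * (K / s ^ 7 + K / s ^ 3) / |lam| + s * K with hA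
  set B := 7 * K / s + s ^ 3 * (K + |lam| * (s * V)) with hB
  set D := 6 * K / s ^ 3 + s * (K + |lam| * (s * V)) with hD
  have V0 : 0 ≤ V := by positivity
  have A0 : 0 ≤ A := by positivity
  have B0 : 0 ≤ B := by positivity
  have D0 : 0 ≤ D := by positivity
  refine ⟨V + A + B + D, by positivity, ?_⟩
  intro r M N v v1 v2 g hr hM hN hv hv1 h1 h2 h3 x hx
  obtain ⟨b1, b2, b3, b4⟩ := hM.viscoelastic_bound hN hv hv1 hlam s0 hsq.le h1 h2 h3 hx
  refine ⟨b1.trans ?_, b2.trans ?_, b3.trans ?_, b4.trans ?_⟩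
  · calc _ = V * r := by rw [hV]; ring
      _ ≤ _ := by gcongr; linarith
  · calc _ = A * r := by rw [hA]; ring
      _ ≤ _ := by gcongr; linarith
  · calc _ = B * r := by rw [hB, hV]; ring
      _ ≤ _ := by gcongr; linarith
  · calc _ = D * r := by rw [hD, hV]; ring
      _ ≤ _ := by gcongr; linarith

/-- Young's inequality, as (√E − A√n)² ≥ 0; it removes the square root that the dissipation bound
√(‖U‖‖F‖) brings in. -/
lemma le_of_le_sqrt_mul_add {E A B n : ℝ} (hE : 0 ≤ E) (hn : 0 ≤ n)
    (h : E ≤ A * √(E * n) + B * n) : E ≤ (A ^ 2 + 2 * B) * n := by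
  have h1 : √(E * n) = √E * √n := Real.sqrt_mul hE n
  have h2 := Real.sq_sqrt hE
  have h3 := Real.sq_sqrt hn
  have h4 := sq_nonneg (√E - A * √n)
  rw [show (√E - A * √n) ^ 2 = √E ^ 2 - 2 * (A * (√E * √n)) + A ^ 2 * √n ^ 2 by ring, h2, h3,
    ← h1] at h4
  linarith

lemma integral_energy_le_of_bound {a b α R : ℝ} {v M : ℝ → ℂ} (hab : a ≤ b) (hα : 0 < α)
    (hv : ContinuousOn v (Icc a b)) (hM : ContinuousOn M (Icc a b))
    (h1 : ∀ x ∈ Icc a b, ‖v x‖ ≤ R) (h2 : ∀ x ∈ Icc a b, ‖M x‖ ≤ R) :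
    ∫ x in a..b, (1 / 2 * ‖v x‖ ^ 2 + 3 / (2 * α) * ‖M x‖ ^ 2)
      ≤ (b - a) * (1 / 2 + 3 / (2 * α)) * R ^ 2 := by
  have e : ∫ _ in a..b, (1 / 2 * R ^ 2 + 3 / (2 * α) * R ^ 2)
      = (b - a) * (1 / 2 + 3 / (2 * α)) * R ^ 2 := by
    rw [intervalIntegral.integral_const, smul_eq_mul]; ring
  rw [← e]
  refine intervalIntegral.integral_mono_on hab ?_ (by simp) fun x hx => ?_
  · refine ContinuousOn.intervalIntegrable ?_
    rw [uIcc_of_le hab]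
    fun_prop
  · have := h1 x hx
    have := h2 x hx
    gcongr

lemma integral_sq_le_of_bound {a b R : ℝ} {v : ℝ → ℂ} (hab : a ≤ b)
    (hv : ContinuousOn v (Icc a b)) (h1 : ∀ x ∈ Icc a b, ‖v x‖ ≤ R) :
    ∫ x in a..b, ‖v x‖ ^ 2 ≤ (b - a) * R ^ 2 := by
  have e : ∫ _ in a..b, R ^ 2 = (b - a) * R ^ 2 := by
    rw [intervalIntegral.integral_const, smul_eq_mul]
  rw [← e]
  refine intervalIntegral.integral_mono_on hab ?_ (by simp) fun x hx => ?_
  · refine ContinuousOn.intervalIntegrable ?_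
    rw [uIcc_of_le hab]
    fun_prop
  · have := h1 x hx
    gcongr

/-! ### The a priori bound at a fixed nonzero frequency -/

namespace BeamData

variable {p : BeamData}

namespace FrequencySystem

lemma mono {K lam E mF mD mF' mD' : ℝ} {v v1 v2 f2 g : ℝ → ℂ}
    {M N : Fin 5 → ℝ → ℂ} (hK : 0 ≤ K) (H : p.FrequencySystem K lam E mF mD v v1 v2 f2 g M N)
    (hF0 : 0 ≤ mF) (hD0 : 0 ≤ mD) (hF : mF ≤ mF') (hD : mD ≤ mD') :
    p.FrequencySystem K lam E mF' mD' v v1 v2 f2 g M N where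
  __ := H
  bf2 := H.bf2.mono_right (by gcongr)
  bg := H.bg.mono_right (by gcongr)
  bv2 := H.bv2.mono_right (by gcongr)
  bM2 := H.bM2.mono_right (by gcongr)
  bM3 := H.bM3.mono_right (by gcongr)
  bvξ := H.bvξ.trans (by gcongr)
  energy := by
    refine H.energy.trans ?_
    rw [div_pow, div_pow]
    gcongr

/-- Energy estimate at a fixed nonzero frequency. -/
lemma exists_energy_le (p : BeamData) {K lam : ℝ} (hK : 0 ≤ K) (hlam : lam ≠ 0) :
    ∃ C, 0 ≤ C ∧ ∀ {E r : ℝ} {v v1 v2 f2 g : ℝ → ℂ} {M N : Fin 5 → ℝ → ℂ}, 0 ≤ E → 0 ≤ r →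
      p.FrequencySystem K lam E r r v v1 v2 f2 g M N → E ≤ C * r := by
  have o1 := p.ξ₁_pos
  have o2 := p.ξ₁_lt
  have o3 := p.lt_ξ₂
  have o4 := p.ξ₂_lt
  have o5 := p.ℓ₁_lt
  have o6 := p.ℓ₀_lt_ℓ₁
  have a1 := p.α₁_pos
  have g1 := p.γ₁_pos
  obtain ⟨C2, hC2, T2⟩ := IsPrim.exists_viscoelastic_bound o3 hlam hK
  obtain ⟨C3, hC3, T3⟩ := IsPrim.exists_viscoelastic_bound o4 hlam hK
  obtain ⟨D1, hD1, S1⟩ := ElasticOn.exists_propagation (a := p.ξ₁) (b := p.ℓ₀) (lam := lam) a1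
  obtain ⟨D0, hD0, S0⟩ := ElasticOn.exists_propagation (a := 0) (b := p.ξ₁) (lam := lam) a1
  obtain ⟨D4, hD4, S4⟩ := ElasticOn.exists_propagation (a := -p.ℓ) (b := -p.ℓ₁) (lam := lam) a1
  -- Bounds on (ξ₁, ℓ₀), (0, ξ₁) and (ℓ₁, ℓ), obtained by propagating all four traces outwards from
  -- the interfaces. The factor 1 + γ₁ is the cost of the shear jump at ξ₁. The conditions at the
  -- outer ends are not needed here.
  set P1 := D1 * (K + C2) with hP1
  set P0 := D0 * (K + (1 + p.γ₁) * P1) with hP0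
  set P4 := D4 * (K + C3) with hP4
  have P1n : 0 ≤ P1 := by positivity
  have P0n : 0 ≤ P0 := by positivity
  have P4n : 0 ≤ P4 := by positivity
  set Q := 1 / 2 + 3 / (2 * p.α₁) with hQ
  have Qn : 0 ≤ Q := by positivity
  set T := 2 * (p.ξ₁ * Q * P0 ^ 2 + (p.ℓ₀ - p.ξ₁) * Q * P1 ^ 2 + (p.ℓ - p.ℓ₁) * Q * P4 ^ 2)
    + (p.ℓ₁ - p.ℓ₀) * (C2 + C3) ^ 2 + K * (2 / lam) ^ 2 with hT
  have Tn : 0 ≤ T := by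
    have := sub_nonneg.2 o2.le
    have := sub_nonneg.2 o5.le
    have := sub_nonneg.2 o6.le
    positivity
  refine ⟨√T, Real.sqrt_nonneg _, ?_⟩
  intro E r v v1 v2 f2 g M N hE hr H
  have hv2 := T2 hr H.hM2 H.hN2 (H.hv.mono le_rfl o3.le o4.le) (H.hv1.mono le_rfl o3.le o4.le)
    H.bM2 (H.bg.mono (by linarith) (by linarith)) (H.bv2.mono le_rfl o4.le)
  have hv3 := T3 hr H.hM3 H.hN3 (H.hv.mono o3.le o4.le le_rfl) (H.hv1.mono o3.le o4.le le_rfl)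
    H.bM3 (H.bg.mono (by linarith) (by linarith)) (H.bv2.mono o3.le le_rfl)
  obtain ⟨l1, l2, l3, l4⟩ := hv2 p.ℓ₀ (left_mem_Icc.2 o3.le)
  rw [H.jM2] at l3
  rw [H.jN2] at l4
  obtain ⟨m1, m2, m3, m4⟩ := hv3 p.ℓ₁ (right_mem_Icc.2 o4.le)
  rw [← H.jM4] at m3
  rw [← H.jN4] at m4
  have kr : 0 ≤ K * r := by positivity
  have up2 : C2 * r ≤ (K + C2) * r := by linarith
  have up3 : C3 * r ≤ (K + C3) * r := by linarith
  have hs1 := S1 H.elastic1 (by positivity : 0 ≤ (K + C2) * r)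
    ((H.bf2.mono (by linarith) (by linarith)).mono_right
      (mul_le_mul_of_nonneg_right (by linarith) hr))
    ((H.bg.mono (by linarith) (by linarith)).mono_right
      (mul_le_mul_of_nonneg_right (by linarith) hr))
    (l1.trans up2) (l2.trans up2) (l3.trans up2) (l4.trans up2)
  simp only [← mul_assoc, ← hP1] at hs1
  obtain ⟨n1, n2, n3, n4⟩ := hs1 p.ξ₁ (left_mem_Icc.2 o2.le)
  rw [H.jM1] at n3
  have n5 : ‖N 0 p.ξ₁‖ ≤ (1 + p.γ₁) * P1 * r := by
    have e : N 0 p.ξ₁ = N 1 p.ξ₁ + p.γ₁ * v p.ξ₁ := by rw [H.jN1]; ring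
    rw [e]
    refine (norm_add_le _ _).trans ?_
    rw [norm_mul, Complex.norm_real, Real.norm_of_nonneg g1.le]
    have := mul_le_mul_of_nonneg_left n1 g1.le
    linarith
  have up0 : (1 + p.γ₁) * P1 * r ≤ (K + (1 + p.γ₁) * P1) * r := by linarith
  have up0' : P1 * r ≤ (K + (1 + p.γ₁) * P1) * r := by
    have : 0 ≤ p.γ₁ * P1 * r := by positivity
    linarith
  have upK : K * r ≤ (K + (1 + p.γ₁) * P1) * r := by
    have : 0 ≤ (1 + p.γ₁) * P1 * r := by positivity
    linarith
  have hs0 := S0 H.elastic0 (by positivity : 0 ≤ (K + (1 + p.γ₁) * P1) * r)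
    ((H.bf2.mono le_rfl (by linarith)).mono_right upK)
    ((H.bg.mono le_rfl (by linarith)).mono_right upK)
    (n1.trans up0') (n2.trans up0') (n3.trans up0') (n5.trans up0)
  simp only [← mul_assoc] at hs0
  have hs4 := S4 H.elastic4.reflect (by positivity : 0 ≤ (K + C3) * r)
    ((H.bf2.mono (by linarith) le_rfl).mono_right
      (mul_le_mul_of_nonneg_right (by linarith) hr)).reflect
    ((H.bg.mono (by linarith) le_rfl).mono_right
      (mul_le_mul_of_nonneg_right (by linarith) hr)).reflect
    (by rw [neg_neg]; exact m1.trans up3) (by rw [neg_neg, norm_neg]; exact m2.trans up3)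
    (by rw [neg_neg]; exact m3.trans up3) (by rw [neg_neg, norm_neg]; exact m4.trans up3)
  simp only [← mul_assoc, ← hP4] at hs4
  have j0 := integral_energy_le_of_bound (R := P0 * r) o1.le a1 H.elastic0.hv.continuousOn
    H.elastic0.hM.continuousOn (fun x hx => (hs0 x hx).1.trans_eq (by rw [hP0]))
    (fun x hx => (hs0 x hx).2.2.1.trans_eq (by rw [hP0]))
  have j1 := integral_energy_le_of_bound o2.le a1 H.elastic1.hv.continuousOn
    H.elastic1.hM.continuousOn (fun x hx => (hs1 x hx).1) (fun x hx => (hs1 x hx).2.2.1)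
  have neg : ∀ x ∈ Icc p.ℓ₁ p.ℓ, -x ∈ Icc (-p.ℓ) (-p.ℓ₁) := fun x hx =>
    ⟨by linarith [hx.2], by linarith [hx.1]⟩
  have j4 := integral_energy_le_of_bound o5.le a1 H.elastic4.hv.continuousOn
    H.elastic4.hM.continuousOn
    (fun x hx => by simpa using (hs4 (-x) (neg x hx)).1)
    (fun x hx => by simpa using (hs4 (-x) (neg x hx)).2.2.1)
  have c2 : C2 * r ≤ (C2 + C3) * r := by gcongr; linarith
  have c3 : C3 * r ≤ (C2 + C3) * r := by gcongr; linarith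
  have jv := integral_sq_le_of_bound o6.le H.hv.continuousOn (R := (C2 + C3) * r) (fun x hx => by
    rcases le_total x p.ξ₂ with h | h
    · exact (hv2 x ⟨hx.1, h⟩).1.trans c2
    · exact (hv3 x ⟨h, hx.2⟩).1.trans c3)
  have key : E ^ 2 ≤ (√T * r) ^ 2 := by
    rw [mul_pow, Real.sq_sqrt Tn]
    refine H.energy.trans ?_
    have e1 : K * ((r + r) / lam) ^ 2 = K * (2 / lam) ^ 2 * r ^ 2 := by ring
    rw [e1, hT]
    rw [← hQ] at j0 j1 j4
    linarith
  exact abs_le_of_sq_le_sq' key (by positivity) |>.2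

end FrequencySystem

/-- A priori bound at each nonzero frequency. -/
lemma exists_norm_le_of_frequency (p : BeamData) {lam : ℝ} (hlam : lam ≠ 0) :
    ∃ C, ∀ {U F : p.Phase}, p.OperatorGraph U ((Complex.I * lam : ℂ) • U - F) →
      ‖U‖ ≤ C * ‖F‖ := by
  obtain ⟨K, hK, H⟩ := p.exists_frequencySystem
  obtain ⟨C, hC, T⟩ := FrequencySystem.exists_energy_le p hK.le hlam
  have hl : 0 < |lam| := abs_pos.2 hlam
  refine ⟨(C * (1 + 1 / |lam|)) ^ 2 + 2 * (C * (1 + 1 / |lam|)), ?_⟩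
  intro U F h
  obtain ⟨v, v1, v2, f2, g, M, N, S⟩ := H hlam h
  have n0 := norm_nonneg F
  have hmD : 0 ≤ √(‖U‖ * ‖F‖) * (1 + 1 / |lam|) + ‖F‖ / |lam| := by positivity
  -- Data and dissipation are both placed below their sum; the bound so obtained still contains
  -- √(‖U‖‖F‖).
  have := T (norm_nonneg U) (add_nonneg n0 hmD) (S.mono hK.le n0 hmD (by linarith) (by linarith))
  refine le_of_le_sqrt_mul_add (norm_nonneg U) n0 (this.trans (le_of_eq ?_))
  ring

end BeamData

/-! ### The a priori bound at high frequency -/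

namespace BeamData

variable {p : BeamData}

namespace FrequencySystem

/-- Energy estimate at high frequency. -/
lemma exists_energy_sq_le (p : BeamData) {K : ℝ} (hK : 0 ≤ K) :
    ∃ C, 0 ≤ C ∧ ∀ {lam μ E r : ℝ} {v v1 v2 f2 g : ℝ → ℂ} {M N : Fin 5 → ℝ → ℂ}, 0 ≤ E → 0 ≤ r →
      1 ≤ μ → |lam| = μ ^ 8 → 1 / μ ^ 2 ≤ p.ξ₁ → 1 / μ ^ 2 ≤ p.ℓ₀ - p.ξ₁ →
      1 / μ ^ 2 ≤ p.ξ₂ - p.ℓ₀ → 1 / μ ^ 2 ≤ p.ℓ₁ - p.ξ₂ → 1 / μ ^ 2 ≤ p.ℓ - p.ℓ₁ →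
      p.FrequencySystem K lam E (μ ^ 2 * r) (μ * r) v v1 v2 f2 g M N →
      E ^ 2 ≤ C * (r * E + r ^ 2 + (E / μ ^ 6) ^ 2) := by
  have o1 := p.ξ₁_pos
  have o2 := p.ξ₁_lt
  have o3 := p.lt_ξ₂
  have o4 := p.ξ₂_lt
  have o5 := p.ℓ₁_lt
  have o6 := p.ℓ₀_lt_ℓ₁
  have a1 := p.α₁_pos
  have g1 := p.γ₁_pos
  have C₀n : 0 ≤ 30000 * K := by positivity
  -- The multiplier is centred at 0 on both left segments, so that boundary terms cancel across ξ₁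
  -- up to the damper, and at the image −ℓ of the other clamped end on the reflected right segment.
  obtain ⟨C0, hC0, T0⟩ := ElasticOn.exists_energy_bound (a := 0) (b := p.ξ₁) (X := p.ℓ) (x0 := 0)
    o1.le a1 hK (fun x hx => by rw [sub_zero, abs_of_nonneg hx.1]; linarith [hx.2])
  obtain ⟨C1, hC1, T1⟩ := ElasticOn.exists_energy_bound_interface (X := p.ℓ) (x0 := 0)
    o2 a1 hK C₀n (fun x hx => by
      rw [sub_zero, abs_of_nonneg (by linarith [hx.1])]; linarith [hx.2])
  obtain ⟨C4, hC4, T4⟩ := ElasticOn.exists_energy_bound_interface (X := p.ℓ) (x0 := -p.ℓ)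
    (neg_lt_neg o5) a1 hK C₀n (fun x hx => by
      rw [abs_of_nonneg (by linarith [hx.1])]; linarith [hx.2])
  set P := p.ξ₁ * p.γ₁ * K * (K * (8 + 1 / p.α₁)) with hP
  have Pn : 0 ≤ P := by positivity
  set V := (p.ℓ₁ - p.ℓ₀) * (30000 * K) ^ 2 with hV
  have Vn : 0 ≤ V := by
    have := sub_nonneg.2 o6.le
    positivity
  refine ⟨2 * (C0 + C1 + C4 + P) + V + 4 * K, by positivity, ?_⟩
  intro lam μ E r v v1 v2 f2 g M N hE hr hμ hlam w0 w1 w2 w3 w4 H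
  have μ0 : 0 < μ := by linarith
  have hw : ∀ {L : ℝ}, 1 / μ ^ 2 ≤ L → (1 / μ ^ 2) ^ 2 ≤ L := by
    intro L h
    refine le_trans ?_ h
    rw [sq]
    exact mul_le_of_le_one_left (by positivity) (by
      rw [div_le_one (by positivity)]; exact one_le_pow₀ hμ)
  have tr2 := fun x hx => H.hM2.viscoelastic_bound_of_high H.hN2 (H.hv.mono le_rfl o3.le o4.le)
    (H.hv1.mono le_rfl o3.le o4.le) hμ hlam w2 hK hr H.bM2 (H.bg.mono (by linarith) (by linarith))
    (H.bv2.mono le_rfl o4.le) (x := x) hx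
  have tr3 := fun x hx => H.hM3.viscoelastic_bound_of_high H.hN3 (H.hv.mono o3.le o4.le le_rfl)
    (H.hv1.mono o3.le o4.le le_rfl) hμ hlam w3 hK hr H.bM3 (H.bg.mono (by linarith) (by linarith))
    (H.bv2.mono o3.le le_rfl) (x := x) hx
  obtain ⟨l1, l2, l3⟩ := tr2 p.ℓ₀ (left_mem_Icc.2 o3.le)
  rw [H.jN2] at l3
  obtain ⟨m1, m2, m3⟩ := tr3 p.ℓ₁ (right_mem_Icc.2 o4.le)
  rw [← H.jN4] at m3
  have j0 := T0 H.elastic0 hμ hlam (by rw [sub_zero]; exact hw w0) hE hr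
    (H.bv.mono le_rfl (by linarith)) H.bM0 (H.bf2.mono le_rfl (by linarith))
    (H.bg.mono le_rfl (by linarith))
  have bv1 := H.bv.mono o1.le (by linarith : p.ℓ₀ ≤ p.ℓ)
  have bf1 := H.bf2.mono o1.le (by linarith : p.ℓ₀ ≤ p.ℓ)
  have bg1 := H.bg.mono o1.le (by linarith : p.ℓ₀ ≤ p.ℓ)
  have j1 := T1 H.elastic1 hμ hlam (hw w1) hE hr bv1 H.bM1 bf1 bg1 l1 l2 l3
  have sup := H.elastic1.sup_bound hμ hlam (hw w1) hK hE hr bv1 H.bM1 bf1 bg1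
    (left_mem_Icc.2 o2.le)
  have j4 := T4 H.elastic4.reflect hμ hlam (by rw [neg_sub_neg]; exact hw w4) hE hr
    (H.bv.mono (by linarith) le_rfl).reflect H.bM4.reflect
    (H.bf2.mono (by linarith) le_rfl).reflect (H.bg.mono (by linarith) le_rfl).reflect
    (by rw [neg_neg]; exact m1) (by rw [neg_neg, norm_neg]; exact m2)
    (by rw [neg_neg, norm_neg]; exact m3)
  have e4 : (∫ x in -p.ℓ..-p.ℓ₁, (1 / 2 * ‖v (-x)‖ ^ 2 + 3 / (2 * p.α₁) * ‖M 4 (-x)‖ ^ 2))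
      = ∫ x in p.ℓ₁..p.ℓ, (1 / 2 * ‖v x‖ ^ 2 + 3 / (2 * p.α₁) * ‖M 4 x‖ ^ 2) := by
    rw [intervalIntegral.integral_comp_neg
      (fun x => 1 / 2 * ‖v x‖ ^ 2 + 3 / (2 * p.α₁) * ‖M 4 x‖ ^ 2), neg_neg, neg_neg]
  rw [e4] at j4
  -- At the clamped end x − x₀ = 0 and v' = 0, which annihilates every term of the form, including
  -- the uncontrolled M and N.
  have q0 : multiplierForm p.α₁ lam (0 - 0) (v 0) (v1 0) (M 0 0) (N 0 0) = 0 := by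
    rw [H.v1_left]; simp [multiplierForm]
  have q4 : multiplierForm p.α₁ lam (-p.ℓ - -p.ℓ) (v (- -p.ℓ)) (-v1 (- -p.ℓ)) (M 4 (- -p.ℓ))
      (-N 4 (- -p.ℓ)) = 0 := by
    rw [neg_neg, H.v1_right]; simp [multiplierForm]
  rw [q0, Complex.zero_re] at j0
  rw [q4, Complex.zero_re] at j4
  -- At ξ₁ only the shear force jumps, leaving ξ₁γ₁ v v̄'/λ up to a factor of modulus one. The
  -- damper bounds v by μr, and v' is O(μ⁶E + r), against |λ| = μ⁸.
  have q1 : (multiplierForm p.α₁ lam (p.ξ₁ - 0) (v p.ξ₁) (v1 p.ξ₁) (M 0 p.ξ₁) (N 0 p.ξ₁)).re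
      - (multiplierForm p.α₁ lam (p.ξ₁ - 0) (v p.ξ₁) (v1 p.ξ₁) (M 1 p.ξ₁) (N 1 p.ξ₁)).re
      ≤ P * (r * E + r ^ 2) := by
    rw [← Complex.sub_re]
    refine (Complex.re_le_norm _).trans ?_
    have e : multiplierForm p.α₁ lam (p.ξ₁ - 0) (v p.ξ₁) (v1 p.ξ₁) (M 0 p.ξ₁) (N 0 p.ξ₁)
        - multiplierForm p.α₁ lam (p.ξ₁ - 0) (v p.ξ₁) (v1 p.ξ₁) (M 1 p.ξ₁) (N 1 p.ξ₁)
        = -(Complex.I / lam * (p.ξ₁ * (p.γ₁ * v p.ξ₁) * starRingEnd ℂ (v1 p.ξ₁))) := by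
      rw [H.jM1, H.jN1]; simp only [multiplierForm, sub_zero]; ring
    rw [e, norm_neg, norm_mul, norm_div, Complex.norm_I, Complex.norm_real, Real.norm_eq_abs,
      norm_mul, norm_mul, norm_mul, RCLike.norm_conj, Complex.norm_real, Complex.norm_real,
      Real.norm_of_nonneg o1.le, Real.norm_of_nonneg g1.le, hlam]
    calc _ ≤ 1 / μ ^ 8 * (p.ξ₁ * (p.γ₁ * (K * (μ * r)))
          * (K * (8 + 1 / p.α₁) * (μ ^ 6 * E + r))) := by
          have := H.bvξ
          have := sup.2.2.1
          gcongr
      _ = P * (r * E / μ + r ^ 2 / μ ^ 7) := by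
          rw [hP]; field_simp
      _ ≤ P * (r * E + r ^ 2) := by
          gcongr
          · exact div_le_self (by positivity) hμ
          · exact div_le_self (by positivity) (one_le_pow₀ hμ)
  have jv := integral_sq_le_of_bound o6.le H.hv.continuousOn (R := 30000 * K * r) (fun x hx => by
    rcases le_total x p.ξ₂ with h | h
    · exact (tr2 x ⟨hx.1, h⟩).1
    · exact (tr3 x ⟨h, hx.2⟩).1)
  have last : K * ((μ * r + μ ^ 2 * r) / lam) ^ 2 ≤ 4 * K * r ^ 2 := by
    have e1 : ((μ * r + μ ^ 2 * r) / lam) ^ 2 = ((μ * r + μ ^ 2 * r) / μ ^ 8) ^ 2 := by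
      rw [← hlam, div_pow, div_pow, sq_abs]
    have e2 : (μ * r + μ ^ 2 * r) / μ ^ 8 ≤ 2 * r := by
      rw [div_le_iff₀ (by positivity)]
      have t1 : μ * r ≤ μ ^ 8 * r := by gcongr; exact le_self_pow₀ hμ (by norm_num)
      have t2 : μ ^ 2 * r ≤ μ ^ 8 * r := by
        gcongr
        norm_num
      linarith
    rw [e1]
    calc _ ≤ K * (2 * r) ^ 2 := by gcongr
      _ = _ := by ring
  refine H.energy.trans ?_
  have z1 : 0 ≤ r * E := by positivity
  have z2 : 0 ≤ r ^ 2 := by positivity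
  have z3 : 0 ≤ (E / μ ^ 6) ^ 2 := by positivity
  have d0 : C0 * (r * E + r ^ 2) ≤ C0 * (r * E + r ^ 2 + (E / μ ^ 6) ^ 2) :=
    mul_le_mul_of_nonneg_left (by linarith) hC0
  have dP : P * (r * E + r ^ 2) ≤ P * (r * E + r ^ 2 + (E / μ ^ 6) ^ 2) :=
    mul_le_mul_of_nonneg_left (by linarith) Pn
  have dV : (p.ℓ₁ - p.ℓ₀) * (30000 * K * r) ^ 2 ≤ V * (r * E + r ^ 2 + (E / μ ^ 6) ^ 2) := by
    have : (p.ℓ₁ - p.ℓ₀) * (30000 * K * r) ^ 2 = V * r ^ 2 := by rw [hV]; ring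
    rw [this]; exact mul_le_mul_of_nonneg_left (by linarith) Vn
  have dK : 4 * K * r ^ 2 ≤ 4 * K * (r * E + r ^ 2 + (E / μ ^ 6) ^ 2) :=
    mul_le_mul_of_nonneg_left (by linarith) (by positivity)
  linarith

/-- Absorption of the lower order term. -/
lemma exists_energy_le_of_high (p : BeamData) {K : ℝ} (hK : 0 ≤ K) :
    ∃ C μ₀, 0 ≤ C ∧ 1 ≤ μ₀ ∧ ∀ {lam μ E r : ℝ} {v v1 v2 f2 g : ℝ → ℂ} {M N : Fin 5 → ℝ → ℂ},
      0 ≤ E → 0 ≤ r → μ₀ ≤ μ → |lam| = μ ^ 8 →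
      p.FrequencySystem K lam E (μ ^ 2 * r) (μ * r) v v1 v2 f2 g M N → E ≤ C * r := by
  obtain ⟨C, hC, H⟩ := exists_energy_sq_le p hK
  have o1 := p.ξ₁_pos
  have o2 := sub_pos.2 p.ξ₁_lt
  have o3 := sub_pos.2 p.lt_ξ₂
  have o4 := sub_pos.2 p.ξ₂_lt
  have o5 := sub_pos.2 p.ℓ₁_lt
  have ev : ∀ {L : ℝ}, 0 < L → ∀ᶠ μ : ℝ in atTop, 1 / μ ^ 2 ≤ L := by
    intro L hL
    have : Tendsto (fun μ : ℝ => 1 / μ ^ 2) atTop (𝓝 0) :=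
      tendsto_const_nhds.div_atTop (tendsto_pow_atTop two_ne_zero)
    exact this.eventually_le_const hL
  have := (((((ev o1).and (ev o2)).and ((ev o3).and (ev o4))).and (ev o5)).and
    ((eventually_ge_atTop 1).and (eventually_ge_atTop (2 * C))))
  obtain ⟨μ₀, hμ₀⟩ := eventually_atTop.1 this
  refine ⟨2 * C + 1, max μ₀ 1, by positivity, le_max_right _ _, ?_⟩
  intro lam μ E r v v1 v2 f2 g M N hE hr hμ hlam S
  obtain ⟨⟨⟨⟨w0, w1⟩, w2, w3⟩, w4⟩, w5, w6⟩ := hμ₀ μ ((le_max_left _ _).trans hμ)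
  have := H hE hr w5 hlam w0 w1 w2 w3 w4 S
  -- Since μ ≥ 2C and μ ≥ 1, also μ¹² ≥ 2C, and the far-end remainder is absorbed into the left-hand
  -- side.
  have small : C * (E / μ ^ 6) ^ 2 ≤ E ^ 2 / 2 := by
    rw [div_pow, mul_div_assoc', div_le_div_iff₀ (by positivity) (by norm_num)]
    have : 2 * C ≤ (μ ^ 6) ^ 2 := by
      rw [← pow_mul]; exact w6.trans (le_self_pow₀ w5 (by norm_num))
    have := mul_le_mul_of_nonneg_left this (sq_nonneg E)
    linarith
  by_contra! hlt
  have h1 : E ^ 2 ≤ 2 * C * (r * E + r ^ 2) := by linarith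
  have h2 : r ≤ E := by nlinarith
  have h3 : 0 < E := lt_of_le_of_lt (by positivity) hlt
  have h4 : (2 * C + 1) * r * E < E ^ 2 := by
    rw [sq]; exact mul_lt_mul_of_pos_right hlt h3
  have h5 : (2 * C + 1) * r * r ≤ r * E := by
    rw [mul_comm r E]; exact mul_le_mul_of_nonneg_right hlt.le hr
  nlinarith [sq_nonneg r]

end FrequencySystem

/-- The resolvent estimate at high frequency. -/
lemma exists_norm_le_of_high (p : BeamData) : ∃ C lam₀ : ℝ, ∀ {lam : ℝ} {U F : p.Phase},
    lam₀ ≤ |lam| → p.OperatorGraph U ((Complex.I * lam : ℂ) • U - F) →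
      |lam| ^ (1 / 4 : ℝ) * ‖U‖ ≤ C * ‖F‖ := by
  obtain ⟨K, hK, H⟩ := p.exists_frequencySystem
  obtain ⟨C, μ₀, hC, hμ₀, T⟩ := FrequencySystem.exists_energy_le_of_high p hK.le
  refine ⟨(C * 2) ^ 2 + 2 * C, μ₀ ^ 8, ?_⟩
  intro lam U F hl h
  have hl1 : 1 ≤ |lam| := (one_le_pow₀ hμ₀).trans hl
  have hl0 : 0 < |lam| := by linarith
  -- With the eighth root all exponents in the estimates are integers; the desired power |λ|^(1/4)
  -- is μ².
  set μ := |lam| ^ (1 / 8 : ℝ) with hμ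
  have μpos : 0 < μ := Real.rpow_pos_of_pos hl0 _
  have hlam : |lam| = μ ^ 8 := by
    rw [hμ, ← Real.rpow_natCast, ← Real.rpow_mul hl0.le]; norm_num
  have hμ2 : |lam| ^ (1 / 4 : ℝ) = μ ^ 2 := by
    rw [hμ, ← Real.rpow_natCast, ← Real.rpow_mul hl0.le]; norm_num
  have hμμ : μ₀ ≤ μ := by
    rw [hlam] at hl
    exact le_of_pow_le_pow_left₀ (by norm_num) μpos.le hl
  have h1μ : 1 ≤ μ := hμ₀.trans hμμ
  obtain ⟨v, v1, v2, f2, g, M, N, S⟩ := H (abs_pos.1 hl0) h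
  -- `n` is the size to be proved for ‖U‖. With r = 2√(‖U‖n) + n the data are at most μ²r, and
  -- √(‖U‖‖F‖) = μ√(‖U‖n) is at most μr: this scaling produces the exponent 1/4.
  set n := ‖F‖ / μ ^ 2 with hn
  have n0 : 0 ≤ n := by positivity
  have hF : ‖F‖ = μ ^ 2 * n := by rw [hn]; field_simp
  have en := norm_nonneg U
  set e := √(‖U‖ * n) with he
  have e0 : 0 ≤ e := Real.sqrt_nonneg _
  have hsq : √(‖U‖ * ‖F‖) = μ * e := by
    rw [hF, he, show ‖U‖ * (μ ^ 2 * n) = μ ^ 2 * (‖U‖ * n) by ring, Real.sqrt_mul (by positivity),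
      Real.sqrt_sq μpos.le]
  have S' := S.mono (mF' := μ ^ 2 * (2 * e + n)) (mD' := μ * (2 * e + n)) hK.le (norm_nonneg F)
    (by positivity) (by rw [hF]; gcongr; linarith) (by
      rw [hsq, hF, hlam]
      have t1 : 1 / μ ^ 8 ≤ 1 := by
        rw [div_le_one (by positivity)]; exact one_le_pow₀ h1μ
      have t2 : μ ^ 2 * n / μ ^ 8 ≤ μ * n := by
        rw [div_le_iff₀ (by positivity)]
        have : μ ^ 2 * n ≤ μ ^ 9 * n := by
          gcongr
          norm_num
        calc _ ≤ _ := this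
          _ = _ := by ring
      have t3 : μ * e * (1 + 1 / μ ^ 8) ≤ μ * e * 2 := by gcongr; linarith
      linarith)
  have := T en (by positivity) hμμ hlam S'
  have := le_of_le_sqrt_mul_add (A := C * 2) (B := C) en n0 (this.trans (le_of_eq (by ring)))
  rw [hμ2, hF]
  calc μ ^ 2 * ‖U‖ ≤ μ ^ 2 * (((C * 2) ^ 2 + 2 * C) * n) := by gcongr
    _ = _ := by ring

end BeamData

/-! ## Resolvents of unbounded operators -/

section Resolvent

variable {X : Type*} [NormedAddCommGroup X] [NormedSpace ℂ X] {A : X →ₗ.[ℂ] X}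

/-- Written with the graph, the resolvent equation is a membership linear in (U, F), without proofs
of membership in the domain. -/
lemma isResolventAt_iff {z : ℂ} {R : X →L[ℂ] X} : IsResolventAt A z R ↔
    (∀ F, (R F, z • R F - F) ∈ A.graph) ∧ ∀ U F, (U, z • U - F) ∈ A.graph → R F = U := by
  constructor
  · rintro ⟨h1, h2⟩
    refine ⟨fun F => ?_, fun U F hU => ?_⟩
    · obtain ⟨h, e⟩ := h1 F
      rw [LinearPMap.mem_graph_iff]
      refine ⟨⟨R F, h⟩, rfl, ?_⟩
      exact (sub_sub_cancel (z • R F) _).symm.trans (congrArg (z • R F - ·) e)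
    · obtain ⟨y, e1, e2⟩ := A.mem_graph_iff.1 hU
      have := h2 y
      rw [e2, e1] at this
      simpa using this
  · rintro ⟨h1, h2⟩
    refine ⟨fun F => ?_, fun U => ?_⟩
    · obtain ⟨y, e1, e2⟩ := A.mem_graph_iff.1 (h1 F)
      simp only at e1 e2
      have hd : R F ∈ A.domain := e1 ▸ y.2
      refine ⟨hd, ?_⟩
      rw [show (⟨R F, hd⟩ : A.domain) = y from Subtype.ext e1.symm, e2]
      simp
    · refine h2 _ _ ?_
      rw [sub_sub_cancel]
      exact A.mem_graph U

/-- A boundedly invertible operator has a resolvent. -/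
lemma exists_isResolventAt {z : ℂ} {C : ℝ} (hC : 0 ≤ C)
    (hs : ∀ F, ∃ U, (U, z • U - F) ∈ A.graph)
    (hb : ∀ U F, (U, z • U - F) ∈ A.graph → ‖U‖ ≤ C * ‖F‖) :
    ∃ R, IsResolventAt A z R ∧ ‖R‖ ≤ C := by
  choose R hR using hs
  have uniq : ∀ U V F, (U, z • U - F) ∈ A.graph → (V, z • V - F) ∈ A.graph → U = V := by
    intro U V F h1 h2
    have h := hb (U - V) 0 (by
      have := A.graph.sub_mem h1 h2
      convert this using 1
      refine Prod.ext rfl ?_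
      simp [smul_sub])
    rw [norm_zero, mul_zero] at h
    exact sub_eq_zero.1 (norm_le_zero_iff.1 h)
  let L : X →ₗ[ℂ] X :=
    { toFun := R
      map_add' := fun F G => by
        refine uniq _ _ (F + G) (hR _) ?_
        have := A.graph.add_mem (hR F) (hR G)
        convert this using 1
        refine Prod.ext rfl ?_
        simp only [smul_add, Prod.snd_add]
        abel
      map_smul' := fun c F => by
        refine uniq _ _ (c • F) (hR _) ?_
        have := A.graph.smul_mem c (hR F)
        convert this using 1
        refine Prod.ext rfl ?_
        simp only [RingHom.id_apply, Prod.smul_snd, smul_sub, smul_comm z c] }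
  refine ⟨L.mkContinuous C fun F => hb _ _ (hR F), ?_, L.mkContinuous_norm_le hC _⟩
  rw [isResolventAt_iff]
  exact ⟨hR, fun U F h => uniq _ _ F (hR F) h⟩

lemma IsResolventAt.unique {z : ℂ} {R R' : X →L[ℂ] X} (h : IsResolventAt A z R)
    (h' : IsResolventAt A z R') : R = R' := by
  ext F
  exact (isResolventAt_iff.1 h).2 _ _ ((isResolventAt_iff.1 h').1 F)

/-- The resolvent set is open. -/
lemma IsResolventAt.exists_of_near [CompleteSpace X] {z w : ℂ} {R : X →L[ℂ] X}
    (h : IsResolventAt A z R) (hw : ‖w - z‖ * ‖R‖ < 1) : ∃ R', IsResolventAt A w R' := by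
  obtain ⟨h1, h2⟩ := isResolventAt_iff.1 h
  -- Neumann series: on the domain w − A = (1 + (w − z)R)(z − A).
  set T : X →L[ℂ] X := -((w - z) • R) with hT
  have hT1 : ‖T‖ < 1 := by rw [hT, norm_neg, norm_smul]; exact hw
  obtain ⟨u, hu⟩ := isUnit_one_sub_of_norm_lt_one hT1
  have hu' : ∀ G, (u : X →L[ℂ] X) G = G + (w - z) • R G := by
    intro G; rw [hu, hT]; simp
  have h0 : 0 < 1 - ‖w - z‖ * ‖R‖ := by linarith
  have hS : ∀ F, ∃ U, (U, w • U - F) ∈ A.graph := by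
    intro F
    set G := (u⁻¹ : (X →L[ℂ] X)ˣ).1 F with hG
    have e : G + (w - z) • R G = F := by
      rw [← hu', hG, ← mul_apply_eq_comp, Units.mul_inv]; rfl
    refine ⟨R G, ?_⟩
    have := h1 G
    convert this using 2
    rw [← e, sub_smul]; abel
  have hB : ∀ U F, (U, w • U - F) ∈ A.graph → ‖U‖ ≤ ‖R‖ / (1 - ‖w - z‖ * ‖R‖) * ‖F‖ := by
    intro U F hU
    have h3 := h2 U (F - (w - z) • U) (by
      convert hU using 2
      rw [sub_smul]; abel)
    rw [div_mul_eq_mul_div, le_div_iff₀ h0]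
    have h4 : ‖U‖ ≤ ‖R‖ * (‖F‖ + ‖w - z‖ * ‖U‖) := by
      calc ‖U‖ = ‖R (F - (w - z) • U)‖ := by rw [h3]
        _ ≤ ‖R‖ * ‖F - (w - z) • U‖ := R.le_opNorm _
        _ ≤ _ := by
          gcongr
          exact (norm_sub_le _ _).trans (by rw [norm_smul])
    linarith
  obtain ⟨R', hR', -⟩ := exists_isResolventAt (by positivity) hS hB
  exact ⟨R', hR'⟩

end Resolvent

/-! ## Dissipative operators -/

/-- Dissipativity of an unbounded operator in a Hilbert space. -/
def IsDissipative {X : Type*} [NormedAddCommGroup X] [InnerProductSpace ℂ X]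
    (A : X →ₗ.[ℂ] X) : Prop :=
  ∀ U V, (U, V) ∈ A.graph → (inner ℂ U V).re ≤ 0

namespace IsDissipative

variable {X : Type*} [NormedAddCommGroup X] [InnerProductSpace ℂ X] {A : X →ₗ.[ℂ] X}

/-- Pair the equation with `U` and take real parts. -/
lemma re_mul_norm_le (hA : IsDissipative A) {z : ℂ} {U F : X} (h : (U, z • U - F) ∈ A.graph) :
    z.re * ‖U‖ ≤ ‖F‖ := by
  have h1 := hA _ _ h
  rw [inner_sub_right, inner_smul_right, inner_self_eq_norm_sq_to_K, Complex.sub_re] at h1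
  have h2 : (z * ((‖U‖ : ℝ) : ℂ) ^ 2).re = z.re * ‖U‖ ^ 2 := by
    rw [← Complex.ofReal_pow, Complex.re_mul_ofReal]
  have h3 : z.re * ‖U‖ ^ 2 ≤ ‖U‖ * ‖F‖ := by
    have := (Complex.re_le_norm (inner ℂ U F)).trans (norm_inner_le_norm U F)
    have h1' : (z * ((‖U‖ : ℝ) : ℂ) ^ 2).re - (inner ℂ U F).re ≤ 0 := h1
    linarith
  rcases (norm_nonneg U).eq_or_lt with h0 | h0
  · rw [← h0, mul_zero]; exact norm_nonneg F
  · refine le_of_mul_le_mul_left ?_ h0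
    linarith

lemma norm_resolvent_le (hA : IsDissipative A) {z : ℂ} (hz : 0 < z.re) {R : X →L[ℂ] X}
    (h : IsResolventAt A z R) : ‖R‖ ≤ 1 / z.re := by
  refine R.opNorm_le_bound (by positivity) fun F => ?_
  have := hA.re_mul_norm_le ((isResolventAt_iff.1 h).1 F)
  rw [one_div, inv_mul_eq_div, le_div_iff₀ hz]
  linarith

/-- A dissipative operator with `0` in its resolvent set has the right half plane there. -/
lemma exists_resolvent [CompleteSpace X] (hA : IsDissipative A) {R₀ : X →L[ℂ] X}
    (h0 : IsResolventAt A 0 R₀) {z : ℂ} (hz : 0 < z.re) : ∃ R, IsResolventAt A z R := by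
  set P : Set ℂ := {w | 0 < w.re} with hP
  set u : Set ℂ := {w | 0 < w.re ∧ ∃ R, IsResolventAt A w R} with hu
  -- As ‖R(w)‖ ≤ 1/Re w, each resolvent disc reaches radius Re w. This makes `u` both open and
  -- relatively closed in the half plane, and connectedness does the rest.
  have near : ∀ w ∈ u, ∀ w' : ℂ, 0 < w'.re → ‖w' - w‖ < w.re → w' ∈ u := by
    rintro w ⟨hw, R, hR⟩ w' hw' hd
    refine ⟨hw', hR.exists_of_near ?_⟩
    calc ‖w' - w‖ * ‖R‖ ≤ ‖w' - w‖ * (1 / w.re) := by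
          gcongr; exact hA.norm_resolvent_le hw hR
      _ < 1 := by rwa [mul_one_div, div_lt_one hw]
  have hsub : P ⊆ u := by
    refine (convex_halfSpace_re_gt 0).isPreconnected.subset_of_closure_inter_subset ?_ ?_ ?_
    · rw [Metric.isOpen_iff]
      intro w hw
      refine ⟨w.re, hw.1, fun w' hw' => near w hw w' ?_ ?_⟩
      · rw [Metric.mem_ball, dist_eq_norm] at hw'
        have := (abs_lt.1 ((Complex.abs_re_le_norm _).trans_lt hw')).1
        rw [Complex.sub_re] at this
        linarith
      · rwa [Metric.mem_ball, dist_eq_norm] at hw'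
    -- The half plane is entered from the resolvent disc around 0.
    · set ε : ℝ := 1 / (‖R₀‖ + 1) with hε
      have ε0 : 0 < ε := by positivity
      refine ⟨(ε : ℂ), by simpa using ε0, by simpa using ε0, h0.exists_of_near ?_⟩
      rw [sub_zero, Complex.norm_real, Real.norm_of_nonneg ε0.le, hε, one_div_mul_eq_div,
        div_lt_one (by positivity)]
      linarith
    · rintro w ⟨hw, hw0 : 0 < w.re⟩
      obtain ⟨w', hw', hd⟩ := Metric.mem_closure_iff.1 hw (w.re / 2) (by positivity)
      refine near w' hw' w hw0 ?_
      rw [dist_eq_norm] at hd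
      have := (abs_lt.1 ((Complex.abs_re_le_norm _).trans_lt hd)).2
      rw [Complex.sub_re] at this
      linarith
  exact (hsub hz).2

/-- An a priori bound at a point of the imaginary axis puts it into the resolvent set. -/
lemma exists_resolvent_of_bound [CompleteSpace X] (hA : IsDissipative A) {R₀ : X →L[ℂ] X}
    (h0 : IsResolventAt A 0 R₀) {z : ℂ} (hz : z.re = 0) {C : ℝ} (hC : 0 ≤ C)
    (hb : ∀ U F, (U, z • U - F) ∈ A.graph → ‖U‖ ≤ C * ‖F‖) :
    ∃ R, IsResolventAt A z R ∧ ‖R‖ ≤ C := by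
  -- Move right by ε into the half plane. There the a priori bound persists with 2C, as Cε ≤ 1/2;
  -- since 2Cε < 1 the resolvent disc around the shifted point contains `z`.
  set ε : ℝ := 1 / (2 * C + 1) with hε
  have ε0 : 0 < ε := by positivity
  have ε1 : ε * (2 * C + 1) = 1 := by rw [hε]; field_simp
  obtain ⟨R, hR⟩ := hA.exists_resolvent h0 (z := z + ε) (by simpa [hz] using ε0)
  have hRn : ‖R‖ ≤ 2 * C := by
    refine R.opNorm_le_bound (by positivity) fun F => ?_
    have h1 := (isResolventAt_iff.1 hR).1 F
    have h2 := hb (R F) (F - (ε : ℂ) • R F) (by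
      convert h1 using 2
      rw [add_smul]; abel)
    have h3 : ‖F - (ε : ℂ) • R F‖ ≤ ‖F‖ + ε * ‖R F‖ := by
      refine (norm_sub_le _ _).trans ?_
      rw [norm_smul, Complex.norm_real, Real.norm_of_nonneg ε0.le]
    have h4 : ‖R F‖ ≤ C * (‖F‖ + ε * ‖R F‖) := h2.trans (by gcongr)
    have h5 : C * ε ≤ 1 / 2 := by linarith
    have h6 := mul_le_mul_of_nonneg_right h5 (norm_nonneg (R F))
    linarith
  obtain ⟨R', hR'⟩ := hR.exists_of_near (w := z) (by
    rw [sub_add_cancel_left, norm_neg, Complex.norm_real, Real.norm_of_nonneg ε0.le]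
    have : ε * ‖R‖ ≤ ε * (2 * C) := by gcongr
    linarith)
  exact ⟨R', hR', R'.opNorm_le_bound hC fun F => hb _ _ ((isResolventAt_iff.1 hR').1 F)⟩

/-- Shifting the imaginary axis by one costs a factor two. -/
lemma norm_resolvent_one_add_le (hA : IsDissipative A) {z : ℂ} (hz : z.re = 0)
    {R R' : X →L[ℂ] X} (h : IsResolventAt A z R) (h' : IsResolventAt A (1 + z) R') :
    ‖R'‖ ≤ 2 * ‖R‖ := by
  refine R'.opNorm_le_bound (by positivity) fun F => ?_
  have h1 := (isResolventAt_iff.1 h').1 F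
  have h2 : ‖R' F‖ ≤ ‖F‖ := by
    have := hA.re_mul_norm_le h1
    simpa [hz] using this
  have h3 := (isResolventAt_iff.1 h).2 (R' F) (F - R' F) (by
    convert h1 using 2
    rw [add_smul, one_smul]; abel)
  calc ‖R' F‖ = ‖R (F - R' F)‖ := by rw [h3]
    _ ≤ ‖R‖ * ‖F - R' F‖ := R.le_opNorm _
    _ ≤ ‖R‖ * (‖F‖ + ‖F‖) := by
      gcongr; exact (norm_sub_le _ _).trans (by gcongr)
    _ = _ := by ring

/-- The domain of a maximal dissipative operator in a Hilbert space is dense. -/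
lemma denseRange_resolvent [CompleteSpace X] (hA : IsDissipative A) {z : ℂ} (hz : 0 < z.re)
    {R : X →L[ℂ] X} (h : IsResolventAt A z R) : DenseRange R := by
  have : (LinearMap.range R.toLinearMap).topologicalClosure = ⊤ := by
    rw [Submodule.topologicalClosure_eq_top_iff, Submodule.eq_bot_iff]
    -- For y orthogonal to the range, dissipativity at Ry gives Re z ‖Ry‖² ≤ 0. Hence Ry = 0, so (0,
    -- −y) lies in the graph and y = 0.
    intro y hy
    have h1 := (isResolventAt_iff.1 h).1 y
    have h2 := hA _ _ h1
    have h3 : inner ℂ (R y) y = 0 := (Submodule.mem_orthogonal _ _).1 hy _ ⟨y, rfl⟩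
    rw [inner_sub_right, h3, sub_zero, inner_smul_right, inner_self_eq_norm_sq_to_K] at h2
    have h4 : z.re * ‖R y‖ ^ 2 ≤ 0 := by
      have : (z * ((‖R y‖ : ℝ) : ℂ) ^ 2).re = z.re * ‖R y‖ ^ 2 := by
        rw [← Complex.ofReal_pow, Complex.re_mul_ofReal]
      rw [← this]; exact h2
    have h5 : R y = 0 := by
      rw [← norm_le_zero_iff]
      by_contra! hlt
      have : 0 < z.re * ‖R y‖ ^ 2 := by positivity
      linarith
    rw [h5, smul_zero, zero_sub] at h1
    have := LinearPMap.graph_fst_eq_zero_snd A h1 rfl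
    simpa using this
  intro x
  have hx : x ∈ (LinearMap.range R.toLinearMap).topologicalClosure := by rw [this]; trivial
  exact hx

end IsDissipative

/-! ## Generation of contraction semigroups -/

section Generation

variable {X : Type*} [NormedAddCommGroup X] [InnerProductSpace ℂ X]

/-- Along a curve whose right derivative is dissipative the norm does not increase. -/
lemma norm_le_of_re_inner_deriv_nonpos {f f' : ℝ → X} {a b : ℝ} (hab : a ≤ b)
    (hc : ContinuousOn f (Icc a b)) (hd : ∀ t ∈ Ico a b, HasDerivWithinAt f (f' t) (Ici t) t)
    (hi : ∀ t ∈ Ico a b, (inner ℂ (f t) (f' t)).re ≤ 0) : ‖f b‖ ≤ ‖f a‖ := by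
  have e : ∀ t, ‖f t‖ ^ 2 = (inner ℂ (f t) (f t)).re := fun t => by
    rw [inner_self_eq_norm_sq_to_K]
    simp [← Complex.ofReal_pow]
  have h := image_le_of_deriv_right_le_deriv_boundary (f := fun t => ‖f t‖ ^ 2)
    (f' := fun t => (inner ℂ (f t) (f' t) + inner ℂ (f' t) (f t)).re) (a := a) (b := b)
    (hc.norm.pow 2) (fun t ht => by
      simp only [e]
      exact Complex.reCLM.hasFDerivAt.comp_hasDerivWithinAt t ((hd t ht).inner ℂ (hd t ht)))
    (B := fun _ => ‖f a‖ ^ 2) (B' := fun _ => 0) le_rfl continuousOn_const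
    (fun t _ => hasDerivWithinAt_const _ _ _) (fun t ht => by
      have h2 : (inner ℂ (f' t) (f t)).re = (inner ℂ (f t) (f' t)).re := by
        rw [← inner_conj_symm, Complex.conj_re]
      rw [Complex.add_re, h2]
      linarith [hi t ht]) (right_mem_Icc.2 hab)
  exact (sq_le_sq₀ (norm_nonneg _) (norm_nonneg _)).1 h

/-- The first resolvent identity: R F solves the equation at `w` with datum (w − z)RF + F. -/
lemma IsResolventAt.apply_apply {A : X →ₗ.[ℂ] X} {z w : ℂ} {R R' : X →L[ℂ] X}
    (h : IsResolventAt A z R) (h' : IsResolventAt A w R') (F : X) :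
    (w - z) • R' (R F) = R F - R' F := by
  have h1 := (isResolventAt_iff.1 h).1 F
  have h2 := (isResolventAt_iff.1 h').2 (R F) ((w - z) • R F + F) (by
    convert h1 using 2
    rw [sub_smul]; abel)
  rw [map_add, map_smul] at h2
  exact eq_sub_of_add_eq h2

lemma IsResolventAt.commute {A : X →ₗ.[ℂ] X} {z w : ℂ} {R R' : X →L[ℂ] X}
    (h : IsResolventAt A z R) (h' : IsResolventAt A w R') : Commute R R' := by
  by_cases hzw : w = z
  · subst hzw
    rw [h.unique h']
  · ext F
    have h1 := h.apply_apply h' F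
    have h2 := h'.apply_apply h F
    have h3 : (w - z) • (R (R' F) - R' (R F)) = 0 := by
      rw [smul_sub, h1, ← neg_sub z w, neg_smul, h2]; abel
    exact sub_eq_zero.1 ((smul_eq_zero.1 h3).resolve_left (sub_ne_zero.2 hzw))

/-- The limit of a strongly convergent sequence of contractions, applied to a convergent sequence. -/
lemma tendsto_apply_of_contraction {E : ℕ → X →L[ℂ] X} {T : X →L[ℂ] X} (hE : ∀ n, ‖E n‖ ≤ 1)
    (hT : ∀ x, Tendsto (fun n => E n x) atTop (𝓝 (T x))) {z : ℕ → X} {z₀ : X}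
    (hz : Tendsto z atTop (𝓝 z₀)) : Tendsto (fun n => E n (z n)) atTop (𝓝 (T z₀)) := by
  have h1 : Tendsto (fun n => E n (z n - z₀)) atTop (𝓝 0) := by
    refine squeeze_zero_norm (fun n => ?_) (tendsto_iff_norm_sub_tendsto_zero.1 hz)
    exact (E n).le_of_opNorm_le_of_le (hE n) le_rfl |>.trans (by rw [one_mul])
  have := h1.add (hT z₀)
  simpa using this

/-- Strong convergence of contractions needs to be checked on a dense set only. -/
lemma exists_tendsto_of_dense [CompleteSpace X] {E : ℕ → X →L[ℂ] X} (hE : ∀ n, ‖E n‖ ≤ 1)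
    {D : Set X} (hD : Dense D) (h : ∀ x ∈ D, CauchySeq fun n => E n x) :
    ∃ T : X →L[ℂ] X, ‖T‖ ≤ 1 ∧ ∀ x, Tendsto (fun n => E n x) atTop (𝓝 (T x)) := by
  have hc : ∀ x, CauchySeq fun n => E n x := by
    intro x
    rw [Metric.cauchySeq_iff']
    intro ε hε
    obtain ⟨y, hy, hxy⟩ := Metric.mem_closure_iff.1 (hD x) (ε / 3) (by positivity)
    obtain ⟨N, hN⟩ := Metric.cauchySeq_iff'.1 (h y hy) (ε / 3) (by positivity)
    refine ⟨N, fun n hn => ?_⟩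
    have h1 := hN n hn
    rw [dist_eq_norm] at h1 hxy ⊢
    have h2 : ∀ k, ‖E k (x - y)‖ ≤ ‖x - y‖ := fun k => by
      simpa using (E k).le_of_opNorm_le (hE k) (x - y)
    have e : E n x - E N x = E n (x - y) + (E n y - E N y) - E N (x - y) := by
      simp only [map_sub]; abel
    rw [e]
    refine (norm_sub_le _ _).trans_lt ?_
    have h3 := norm_add_le (E n (x - y)) (E n y - E N y)
    linarith [h2 n, h2 N]
  choose T hT using fun x => cauchySeq_tendsto_of_complete (hc x)
  let L : X →ₗ[ℂ] X :=
    { toFun := T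
      map_add' := fun x y => tendsto_nhds_unique (hT (x + y)) (by
        simpa only [map_add] using (hT x).add (hT y))
      map_smul' := fun c x => tendsto_nhds_unique (hT (c • x)) (by
        simpa only [map_smul, RingHom.id_apply] using (hT x).const_smul c) }
  have hL : ∀ x, ‖L x‖ ≤ 1 * ‖x‖ := fun x =>
    le_of_tendsto (hT x).norm (Eventually.of_forall fun n => (E n).le_of_opNorm_le (hE n) x)
  exact ⟨L.mkContinuous 1 hL, L.mkContinuous_norm_le zero_le_one hL, hT⟩

/-! ### Yosida approximations and their exponentials -/

variable {A : X →ₗ.[ℂ] X} {R : ℕ → X →L[ℂ] X}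

/-- The Yosida approximations of `A`. -/
noncomputable def yosida (R : ℕ → X →L[ℂ] X) (n : ℕ) : X →L[ℂ] X :=
  (n + 1 : ℂ) • ((n + 1 : ℂ) • R n - 1)

lemma norm_natCast_add_one (n : ℕ) : ‖(n + 1 : ℂ)‖ = n + 1 := by
  rw [← Nat.cast_succ, Complex.norm_natCast, Nat.cast_succ]

lemma norm_smul_resolvent_le (hA : IsDissipative A) {n : ℕ}
    (hR : IsResolventAt A (n + 1) (R n)) : ‖(n + 1 : ℂ) • R n‖ ≤ 1 := by
  have hn : (0 : ℝ) < n + 1 := by positivity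
  have h := hA.norm_resolvent_le (by simpa using hn) hR
  rw [norm_smul, norm_natCast_add_one]
  have e : ((n : ℂ) + 1).re = n + 1 := by simp
  rw [e] at h
  calc (n + 1 : ℝ) * ‖R n‖ ≤ (n + 1) * (1 / (n + 1)) := by gcongr
    _ = 1 := by field_simp

lemma yosida_apply {n : ℕ} (hR : IsResolventAt A (n + 1) (R n)) {x y : X}
    (h : (x, y) ∈ A.graph) : yosida R n x = (n + 1 : ℂ) • R n y := by
  have h1 := (isResolventAt_iff.1 hR).2 x ((n + 1 : ℂ) • x - y) (by rwa [sub_sub_cancel])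
  rw [map_sub, map_smul] at h1
  simp only [yosida, smul_apply, sub_apply,
    one_apply_eq_self]
  congr 1
  rw [sub_eq_iff_eq_add] at h1 ⊢
  rw [h1, add_comm]

/-- Since (n+1)R_n is a contraction, Re⟨x, (n+1)R_n x⟩ ≤ ‖x‖². -/
lemma re_inner_yosida_nonpos (hA : IsDissipative A) {n : ℕ}
    (hR : IsResolventAt A (n + 1) (R n)) (x : X) : (inner ℂ x (yosida R n x)).re ≤ 0 := by
  have h1 := norm_smul_resolvent_le hA hR
  have e : inner ℂ x (yosida R n x)
      = ((n + 1 : ℝ) : ℂ) * (inner ℂ x (((n + 1 : ℂ) • R n) x) - ((‖x‖ ^ 2 : ℝ) : ℂ)) := by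
    simp only [yosida, smul_apply, sub_apply,
      one_apply_eq_self]
    rw [inner_smul_right, inner_sub_right, inner_self_eq_norm_sq_to_K]
    push_cast; rfl
  rw [e, Complex.re_ofReal_mul, Complex.sub_re, Complex.ofReal_re]
  have h2 := (Complex.re_le_norm (inner ℂ x (((n + 1 : ℂ) • R n) x))).trans
    (norm_inner_le_norm _ _)
  have h3 := ((n + 1 : ℂ) • R n).le_of_opNorm_le h1 x
  have h4 : ‖x‖ * ‖((n + 1 : ℂ) • R n) x‖ ≤ ‖x‖ * (1 * ‖x‖) := by gcongr
  refine mul_nonpos_of_nonneg_of_nonpos (by positivity) ?_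
  linarith

/-- `n R(n)` converges strongly to the identity. -/
lemma tendsto_smul_resolvent [CompleteSpace X] (hA : IsDissipative A)
    (hR : ∀ n : ℕ, IsResolventAt A (n + 1) (R n)) (x : X) :
    Tendsto (fun n : ℕ => (n + 1 : ℂ) • R n x) atTop (𝓝 x) := by
  -- On the domain (n+1)R_n − 1 equals R_n A, which tends to zero because ‖R_n‖ ≤ 1/(n+1).
  have key : ∀ F, Tendsto (fun n : ℕ => (n + 1 : ℂ) • R n (R 0 F)) atTop (𝓝 (R 0 F)) := by
    intro F
    have h1 := (isResolventAt_iff.1 (hR 0)).1 F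
    set y := ((0 : ℕ) + 1 : ℂ) • R 0 F - F
    have e : ∀ n : ℕ, (n + 1 : ℂ) • R n (R 0 F) = R 0 F + R n y := by
      intro n
      have := (isResolventAt_iff.1 (hR n)).2 (R 0 F) ((n + 1 : ℂ) • R 0 F - y)
        (by rwa [sub_sub_cancel])
      rw [map_sub, map_smul, sub_eq_iff_eq_add] at this
      exact this
    simp only [e]
    have : Tendsto (fun n : ℕ => R n y) atTop (𝓝 0) := by
      refine squeeze_zero_norm (a := fun n : ℕ => 1 / ((n : ℝ) + 1) * ‖y‖) (fun n => ?_) ?_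
      · have hn : (0 : ℝ) < n + 1 := by positivity
        have := hA.norm_resolvent_le (by simpa using hn) (hR n)
        rw [show ((n : ℂ) + 1).re = n + 1 by simp] at this
        exact (R n).le_of_opNorm_le this y
      · simpa using tendsto_one_div_add_atTop_nhds_zero_nat.mul_const ‖y‖
    simpa using this.const_add (R 0 F)
  have hd : DenseRange (R 0) := hA.denseRange_resolvent (by simp) (hR 0)
  obtain ⟨T, -, hT⟩ := exists_tendsto_of_dense (E := fun n : ℕ => (n + 1 : ℂ) • R n)
    (fun n => norm_smul_resolvent_le hA (hR n)) hd (by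
      rintro _ ⟨F, rfl⟩
      exact (key F).cauchySeq)
  have hTi : ⇑T = id := hd.equalizer T.continuous continuous_id (by
    ext F
    exact tendsto_nhds_unique (hT (R 0 F)) (key F))
  have := hT x
  rwa [hTi] at this

lemma commute_yosida (hR : ∀ n : ℕ, IsResolventAt A (n + 1) (R n)) (n m : ℕ) :
    Commute (yosida R n) (yosida R m) := by
  have h : Commute (R n) (R m) := (hR n).commute (hR m)
  exact ((((h.smul_left _).sub_left (Commute.one_left _)).smul_left _).smul_right _
    |>.sub_right (Commute.one_right _)).smul_right _

variable [CompleteSpace X]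

/-- The semigroup generated by a Yosida approximation. -/
noncomputable def yosidaExp (R : ℕ → X →L[ℂ] X) (n : ℕ) (t : ℝ) : X →L[ℂ] X :=
  NormedSpace.exp (t • yosida R n)

lemma hasDerivAt_yosidaExp (n : ℕ) (t : ℝ) :
    HasDerivAt (yosidaExp R n) (yosidaExp R n t * yosida R n) t :=
  hasDerivAt_exp_smul_const _ t

lemma hasDerivAt_yosidaExp_apply (n : ℕ) (t : ℝ) (x : X) :
    HasDerivAt (fun s => yosidaExp R n s x) (yosidaExp R n t (yosida R n x)) t :=
  ((ContinuousLinearMap.apply ℂ X x).restrictScalars ℝ).hasFDerivAt.comp_hasDerivAt t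
    (hasDerivAt_yosidaExp n t)

lemma yosidaExp_zero (n : ℕ) : yosidaExp R n 0 = 1 := by
  rw [yosidaExp, zero_smul, NormedSpace.exp_zero]

lemma yosidaExp_add (n : ℕ) (s t : ℝ) :
    yosidaExp R n (s + t) = yosidaExp R n s * yosidaExp R n t := by
  let _ : NormedAlgebra ℚ (X →L[ℂ] X) := NormedAlgebra.restrictScalars ℚ ℝ _
  rw [yosidaExp, add_smul, NormedSpace.exp_add_of_commute]
  · rfl
  · exact ((Commute.refl _).smul_left _).smul_right _

lemma commute_yosidaExp_yosida (n : ℕ) (t : ℝ) : Commute (yosidaExp R n t) (yosida R n) :=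
  (((Commute.refl (yosida R n)).smul_right t).exp_right).symm

lemma norm_yosidaExp_le (hA : IsDissipative A) {n : ℕ} (hR : IsResolventAt A (n + 1) (R n))
    {t : ℝ} (ht : 0 ≤ t) : ‖yosidaExp R n t‖ ≤ 1 := by
  refine ContinuousLinearMap.opNorm_le_bound _ zero_le_one fun x => ?_
  have := norm_le_of_re_inner_deriv_nonpos ht (f := fun s => yosidaExp R n s x)
    (f' := fun s => yosidaExp R n s (yosida R n x))
    (fun s _ => (hasDerivAt_yosidaExp_apply n s x).continuousAt.continuousWithinAt)
    (fun s _ => (hasDerivAt_yosidaExp_apply n s x).hasDerivWithinAt) (fun s _ => by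
      have e : yosidaExp R n s (yosida R n x) = yosida R n (yosidaExp R n s x) :=
        congrArg (fun T : X →L[ℂ] X => T x) (commute_yosidaExp_yosida n s).eq
      rw [e]
      exact re_inner_yosida_nonpos hA hR _)
  simpa [yosidaExp_zero] using this

/-- Interpolate by s ↦ e^(sA_n) e^((t−s)A_m): the approximations commute, so the derivative is a
contraction applied to A_n − A_m. -/
lemma norm_yosidaExp_sub_le (hA : IsDissipative A) (hR : ∀ n : ℕ, IsResolventAt A (n + 1) (R n))
    (n m : ℕ) {t : ℝ} (ht : 0 ≤ t) (x : X) :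
    ‖yosidaExp R n t x - yosidaExp R m t x‖ ≤ t * ‖yosida R n x - yosida R m x‖ := by
  set h : ℝ → X →L[ℂ] X := fun s => yosidaExp R n s * yosidaExp R m (t - s) with hh
  have hd : ∀ s, HasDerivAt h
      (yosidaExp R n s * yosidaExp R m (t - s) * (yosida R n - yosida R m)) s := by
    intro s
    have h1 := (hasDerivAt_yosidaExp (R := R) m (t - s)).scomp s
      ((hasDerivAt_const s t).sub (hasDerivAt_id s))
    have h2 := (hasDerivAt_yosidaExp (R := R) n s).mul h1
    have hc : Commute (yosida R n) (yosidaExp R m (t - s)) :=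
      ((commute_yosida hR n m).smul_right (t - s)).exp_right
    refine HasDerivAt.congr_deriv h2 ?_
    rw [zero_sub, neg_one_smul, Function.comp, mul_assoc (yosidaExp R n s) (yosida R n), hc.eq]
    noncomm_ring
  have hd' : ∀ s, HasDerivAt (fun s => h s x)
      ((yosidaExp R n s * yosidaExp R m (t - s) * (yosida R n - yosida R m)) x) s := fun s =>
    ((ContinuousLinearMap.apply ℂ X x).restrictScalars ℝ).hasFDerivAt.comp_hasDerivAt s (hd s)
  have := norm_image_sub_le_of_norm_deriv_le_segment' (f := fun s => h s x) (a := 0) (b := t)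
    (fun s _ => (hd' s).hasDerivWithinAt) (C := ‖yosida R n x - yosida R m x‖) (fun s hs => by
      have n1 := norm_yosidaExp_le hA (hR n) hs.1
      have n2 := norm_yosidaExp_le hA (hR m) (sub_nonneg.2 hs.2.le)
      have n3 : ‖yosidaExp R n s * yosidaExp R m (t - s)‖ ≤ 1 :=
        (norm_mul_le _ _).trans (mul_le_one₀ n1 (norm_nonneg _) n2)
      have := (yosidaExp R n s * yosidaExp R m (t - s)).le_of_opNorm_le n3
        ((yosida R n - yosida R m) x)
      rw [one_mul] at this
      exact this) t (right_mem_Icc.2 ht)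
  simp only [hh, sub_self, sub_zero, yosidaExp_zero, one_mul, mul_one] at this
  rw [mul_comm]
  exact this

/-- The Lumer–Phillips theorem in a Hilbert space. -/
theorem IsDissipative.exists_semigroup (hA : IsDissipative A)
    (hR : ∀ n : ℕ, IsResolventAt A (n + 1) (R n)) :
    ∃ S : ℝ → X →L[ℂ] X, IsC0Semigroup S ∧ IsGeneratorOf A S := by
  have hd : DenseRange (R 0) := hA.denseRange_resolvent (by simp) (hR 0)
  have hY : ∀ {x y : X}, (x, y) ∈ A.graph → Tendsto (fun n => yosida R n x) atTop (𝓝 y) := by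
    intro x y h
    simp only [fun n => yosida_apply (hR n) h]
    exact tendsto_smul_resolvent hA hR y
  have hYn : ∀ {x y : X}, (x, y) ∈ A.graph → ∀ n, ‖yosida R n x‖ ≤ ‖y‖ := by
    intro x y h n
    rw [yosida_apply (hR n) h]
    simpa using ((n + 1 : ℂ) • R n).le_of_opNorm_le (norm_smul_resolvent_le hA (hR n)) y
  -- On the domain A_n x converges, so e^(tA_n)x is a Cauchy sequence for t ≥ 0. For negative t the
  -- value is irrelevant and 0 serves.
  have hlim : ∀ t : ℝ, ∃ T : X →L[ℂ] X, 0 ≤ t →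
      ‖T‖ ≤ 1 ∧ ∀ x, Tendsto (fun n => yosidaExp R n t x) atTop (𝓝 (T x)) := by
    intro t
    by_cases ht : 0 ≤ t
    swap
    · exact ⟨0, fun h => absurd h ht⟩
    obtain ⟨T, hT⟩ := exists_tendsto_of_dense (E := fun n => yosidaExp R n t)
      (fun n => norm_yosidaExp_le hA (hR n) ht) hd (by
        rintro _ ⟨F, rfl⟩
        have hc := (hY ((isResolventAt_iff.1 (hR 0)).1 F)).cauchySeq
        rw [Metric.cauchySeq_iff'] at hc ⊢
        intro ε hε
        obtain ⟨N, hN⟩ := hc (ε / (t + 1)) (by positivity)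
        refine ⟨N, fun n hn => ?_⟩
        have h1 := hN n hn
        rw [dist_eq_norm, lt_div_iff₀ (by positivity)] at h1
        rw [dist_eq_norm]
        refine (norm_yosidaExp_sub_le hA hR n N ht _).trans_lt (lt_of_le_of_lt ?_ h1)
        rw [mul_comm]
        gcongr
        linarith)
    exact ⟨T, fun _ => hT⟩
  choose S hS using hlim
  have hS0 : S 0 = ContinuousLinearMap.id ℂ X := by
    ext x
    refine tendsto_nhds_unique ((hS 0 le_rfl).2 x) ?_
    simp only [yosidaExp_zero]
    exact tendsto_const_nhds
  have small : ∀ {x y : X}, (x, y) ∈ A.graph → ∀ n, ∀ t, 0 ≤ t →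
      ‖yosidaExp R n t x - x‖ ≤ t * ‖y‖ := by
    intro x y h n t ht
    have := norm_image_sub_le_of_norm_deriv_le_segment' (f := fun s => yosidaExp R n s x)
      (a := 0) (b := t) (fun s _ => (hasDerivAt_yosidaExp_apply n s x).hasDerivWithinAt)
      (C := ‖y‖) (fun s hs => by
        have := (yosidaExp R n s).le_of_opNorm_le (norm_yosidaExp_le hA (hR n) hs.1) (yosida R n x)
        rw [one_mul] at this
        exact this.trans (hYn h n)) t (right_mem_Icc.2 ht)
    simpa [yosidaExp_zero, mul_comm] using this
  -- A first order expansion with remainder. The image y = Ax need not lie in the domain, so it is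
  -- compared with a nearby y' that does.
  have expand : ∀ {x y y' w : X}, (x, y) ∈ A.graph → (y', w) ∈ A.graph → ∀ t, 0 ≤ t →
      ‖S t x - x - t • y‖ ≤ (2 * ‖y - y'‖ + t * ‖w‖) * t := by
    intro x y y' w h h' t ht
    have h1 : ∀ n, ‖yosidaExp R n t x - x - t • yosida R n x‖
        ≤ (2 * ‖yosida R n x - y'‖ + t * ‖w‖) * t := by
      intro n
      have := norm_image_sub_le_of_norm_deriv_le_segment'
        (f := fun s => yosidaExp R n s x - s • yosida R n x)
        (f' := fun s => yosidaExp R n s (yosida R n x) - (1 : ℝ) • yosida R n x)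
        (a := 0) (b := t)
        (fun s _ => ((hasDerivAt_yosidaExp_apply n s x).sub
          ((hasDerivAt_id s).smul_const (yosida R n x))).hasDerivWithinAt)
        (C := 2 * ‖yosida R n x - y'‖ + t * ‖w‖) (fun s hs => by
          set z := yosida R n x
          have e : yosidaExp R n s z - (1 : ℝ) • z
              = (yosidaExp R n s (z - y') - (z - y')) + (yosidaExp R n s y' - y') := by
            rw [one_smul, map_sub]; abel
          have b1 := (yosidaExp R n s).le_of_opNorm_le (norm_yosidaExp_le hA (hR n) hs.1) (z - y')
          have b2 := small h' n s hs.1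
          have b3 : s * ‖w‖ ≤ t * ‖w‖ := by gcongr; exact hs.2.le
          rw [e]
          refine (norm_add_le _ _).trans ?_
          have b4 := norm_sub_le (yosidaExp R n s (z - y')) (z - y')
          linarith) t (right_mem_Icc.2 ht)
      simp only [yosidaExp_zero, zero_smul, sub_zero, one_apply_eq_self] at this
      rwa [sub_right_comm] at this
    refine le_of_tendsto_of_tendsto' (b := atTop) ?_ ?_ h1
    · exact ((((hS t ht).2 x).sub_const x).sub ((hY h).const_smul t)).norm
    · exact (((((hY h).sub_const y').norm).const_mul 2).add_const _).mul_const t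
  have hDn : ∀ x : X, ∀ ε > 0, ∃ y w, (y, w) ∈ A.graph ∧ ‖x - y‖ < ε := by
    intro x ε hε
    obtain ⟨_, ⟨F, rfl⟩, hF⟩ := Metric.mem_closure_iff.1 (hd x) ε hε
    exact ⟨_, _, (isResolventAt_iff.1 (hR 0)).1 F, by rwa [← dist_eq_norm]⟩
  have gen : ∀ x y : X, (x, y) ∈ A.graph →
      Tendsto (fun t : ℝ => ((t : ℂ)⁻¹) • (S t x - x)) (𝓝[>] 0) (𝓝 y) := by
    intro x y h
    rw [Metric.tendsto_nhdsWithin_nhds]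
    intro ε hε
    obtain ⟨y', w, h', hy⟩ := hDn y (ε / 4) (by positivity)
    refine ⟨ε / (4 * (‖w‖ + 1)), by positivity, fun t ht htd => ?_⟩
    have ht0 : 0 < t := ht
    rw [dist_zero_right, Real.norm_of_nonneg ht0.le, lt_div_iff₀ (by positivity)] at htd
    have := expand h h' t ht0.le
    have e : ((t : ℂ)⁻¹) • (S t x - x) - y = ((t : ℂ)⁻¹) • (S t x - x - t • y) := by
      rw [smul_sub _ (S t x - x) (t • y), ← Complex.coe_smul t y, smul_smul, inv_mul_cancel₀
        (by exact_mod_cast ht0.ne'), one_smul]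
    rw [dist_eq_norm, e, norm_smul, norm_inv, Complex.norm_real, Real.norm_of_nonneg ht0.le,
      inv_mul_lt_iff₀ ht0]
    refine this.trans_lt ?_
    rw [mul_comm]
    gcongr
    have := norm_nonneg w
    nlinarith
  have semi : IsC0Semigroup S := by
    refine ⟨hS0, fun s t hs ht => ?_, fun x => ?_⟩
    · ext x
      refine tendsto_nhds_unique ((hS (s + t) (by positivity)).2 x) ?_
      simp only [yosidaExp_add]
      exact tendsto_apply_of_contraction (fun n => norm_yosidaExp_le hA (hR n) hs) (hS s hs).2
        ((hS t ht).2 x)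
    · rw [Metric.tendsto_nhdsWithin_nhds]
      intro ε hε
      obtain ⟨y, w, h, hy⟩ := hDn x (ε / 4) (by positivity)
      refine ⟨ε / (4 * (‖w‖ + 1)), by positivity, fun t ht htd => ?_⟩
      have ht0 : 0 < t := ht
      rw [dist_zero_right, Real.norm_of_nonneg ht0.le, lt_div_iff₀ (by positivity)] at htd
      have h1 : ‖S t y - y‖ ≤ t * ‖w‖ :=
        le_of_tendsto (((hS t ht0.le).2 y).sub_const y).norm
          (Eventually.of_forall fun n => small h n t ht0.le)
      have h2 := (S t).le_of_opNorm_le (hS t ht0.le).1 (x - y)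
      have e : S t x - x = S t (x - y) + (S t y - y) - (x - y) := by
        rw [map_sub]; abel
      rw [dist_eq_norm, e]
      have h3 := norm_sub_le (S t (x - y) + (S t y - y)) (x - y)
      have h4 := norm_add_le (S t (x - y)) (S t y - y)
      nlinarith
  refine ⟨S, semi, fun x y => ⟨gen x y, fun hxy => ?_⟩⟩
  -- The limit defines no proper extension of `A`: solving U − AU = x − y, the difference d = x − U
  -- has right derivative d at t = 0, while contractivity forces Re⟨d, d⟩ ≤ 0.
  have hU := (isResolventAt_iff.1 (hR 0)).1 (x - y)
  set U := R 0 (x - y)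
  simp only [Nat.cast_zero, zero_add, one_smul] at hU
  have h1 := hxy.sub (gen _ _ hU)
  set d := x - U with hdd
  have e1 : y - (U - (x - y)) = d := by rw [hdd]; abel
  have e2 : ∀ t : ℝ, (t : ℂ)⁻¹ • (S t x - x) - (t : ℂ)⁻¹ • (S t U - U)
      = (t : ℂ)⁻¹ • (S t d - d) := by
    intro t
    rw [← smul_sub, hdd, map_sub]; congr 1; abel
  simp only [e1, e2] at h1
  have h2 : (inner ℂ d d).re ≤ 0 := by
    refine le_of_tendsto ((Complex.continuous_re.tendsto _).comp
      ((tendsto_const_nhds (x := d)).inner (𝕜 := ℂ) h1)) ?_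
    filter_upwards [self_mem_nhdsWithin] with t ht
    have ht0 : 0 < t := ht
    change (inner ℂ d ((t : ℂ)⁻¹ • (S t d - d))).re ≤ 0
    rw [← Complex.ofReal_inv, inner_smul_right, Complex.re_ofReal_mul, inner_sub_right,
      inner_self_eq_norm_sq_to_K, Complex.sub_re]
    refine mul_nonpos_of_nonneg_of_nonpos (by positivity) ?_
    have h3 := (Complex.re_le_norm (inner ℂ d (S t d))).trans (norm_inner_le_norm _ _)
    have h4 := (S t).le_of_opNorm_le (hS t ht0.le).1 d
    have h5 : ‖d‖ * ‖S t d‖ ≤ ‖d‖ * (1 * ‖d‖) := by gcongr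
    have h6 : (((‖d‖ : ℝ) : ℂ) ^ 2).re = ‖d‖ ^ 2 := by rw [← Complex.ofReal_pow, Complex.ofReal_re]
    change _ - (((‖d‖ : ℝ) : ℂ) ^ 2).re ≤ 0
    rw [h6]
    linarith
  have h7 : d = 0 := by
    have : (inner ℂ d d).re = ‖d‖ ^ 2 := by
      rw [inner_self_eq_norm_sq_to_K]; simp [← Complex.ofReal_pow]
    rw [this] at h2
    exact norm_eq_zero.1 (pow_eq_zero_iff two_ne_zero |>.1 (le_antisymm h2 (sq_nonneg _)))
  have h8 : x = U := sub_eq_zero.1 h7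
  rw [← h8] at hU
  rwa [sub_sub_cancel] at hU

end Generation

/-! ## Semigroups with a dissipative generator -/

namespace IsC0Semigroup

section Banach

variable {X : Type*} [NormedAddCommGroup X] [NormedSpace ℂ X] {S : ℝ → X →L[ℂ] X}

lemma zero_apply (hS : IsC0Semigroup S) (x : X) : S 0 x = x := by rw [hS.map_zero]; rfl

lemma add_apply (hS : IsC0Semigroup S) {s t : ℝ} (hs : 0 ≤ s) (ht : 0 ≤ t) (x : X) :
    S (s + t) x = S s (S t x) := by rw [hS.map_add s t hs ht]; rfl

lemma apply_comm (hS : IsC0Semigroup S) {s t : ℝ} (hs : 0 ≤ s) (ht : 0 ≤ t) (x : X) :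
    S s (S t x) = S t (S s x) := by
  rw [← hS.add_apply hs ht, ← hS.add_apply ht hs, add_comm]

/-- Uniform boundedness: otherwise there are times t_n → 0 with ‖S(t_n)‖ > n + 1, all positive since
‖S(0)‖ ≤ 1, although S(t_n)x converges for each x. -/
lemma exists_bound_near_zero [CompleteSpace X] (hS : IsC0Semigroup S) :
    ∃ d > 0, ∃ M, ∀ t, 0 ≤ t → t ≤ d → ‖S t‖ ≤ M := by
  by_contra! hcon
  have h1 : ∀ n : ℕ, ∃ t, 0 ≤ t ∧ t ≤ 1 / ((n : ℝ) + 1) ∧ (n + 1 : ℝ) < ‖S t‖ := fun n =>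
    hcon (1 / ((n : ℝ) + 1)) (by positivity) (n + 1)
  choose t ht0 ht1 ht2 using h1
  have hpos : ∀ n, 0 < t n := by
    intro n
    refine (ht0 n).lt_of_ne fun h => ?_
    have h2 := ht2 n
    rw [← h, hS.map_zero] at h2
    have h3 := ContinuousLinearMap.norm_id_le (𝕜 := ℂ) (E := X)
    have : (0 : ℝ) ≤ n := by positivity
    linarith
  have hlim : Tendsto t atTop (𝓝[>] 0) := by
    rw [tendsto_nhdsWithin_iff]
    exact ⟨squeeze_zero ht0 ht1 tendsto_one_div_add_atTop_nhds_zero_nat,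
      Eventually.of_forall hpos⟩
  obtain ⟨C, hC⟩ := banach_steinhaus (g := fun n => S (t n)) (fun x => by
    obtain ⟨C, hC⟩ := ((hS.tendsto_zero x).comp hlim).norm.bddAbove_range
    exact ⟨C, fun n => hC ⟨n, rfl⟩⟩)
  obtain ⟨n, hn⟩ := exists_nat_gt C
  have := ht2 n
  have := hC n
  linarith

lemma exists_bound_on [CompleteSpace X] (hS : IsC0Semigroup S) (T : ℝ) :
    ∃ M, 0 ≤ M ∧ ∀ t, 0 ≤ t → t ≤ T → ‖S t‖ ≤ M := by
  obtain ⟨d, hd, M, hM⟩ := hS.exists_bound_near_zero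
  have key : ∀ n : ℕ, ∃ K, 0 ≤ K ∧ ∀ t, 0 ≤ t → t ≤ n * d → ‖S t‖ ≤ K := by
    intro n
    induction n with
    | zero =>
      refine ⟨max M 0, le_max_right _ _, fun t h0 h1 => (hM t h0 ?_).trans (le_max_left _ _)⟩
      simp at h1; linarith
    | succ n ih =>
      obtain ⟨K, hK, h⟩ := ih
      refine ⟨K + K * max M 0 + max M 0, by positivity, fun t h0 h1 => ?_⟩
      have hm : 0 ≤ max M 0 := le_max_right _ _
      have hmK : 0 ≤ K * max M 0 := by positivity
      push_cast at h1
      rcases le_total t d with h2 | h2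
      · exact ((hM t h0 h2).trans (le_max_left _ _)).trans (by linarith)
      · have e : t = (t - d) + d := by ring
        rw [e, hS.map_add _ _ (by linarith) hd.le]
        refine (ContinuousLinearMap.opNorm_comp_le _ _).trans ?_
        have h3 := h (t - d) (by linarith) (by linarith)
        have h4 := (hM d hd.le le_rfl).trans (le_max_left M 0)
        have : ‖S (t - d)‖ * ‖S d‖ ≤ K * max M 0 := by gcongr
        linarith
  obtain ⟨n, hn⟩ := exists_nat_ge (T / d)
  obtain ⟨K, hK, h⟩ := key n
  refine ⟨K, hK, fun t h0 h1 => h t h0 (h1.trans ?_)⟩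
  rwa [div_le_iff₀ hd] at hn

lemma tendsto_norm_sub (hS : IsC0Semigroup S) (x : X) :
    Tendsto (fun t => ‖S t x - x‖) (𝓝[≥] 0) (𝓝 0) := by
  have h : ContinuousWithinAt (fun t => S t x) (Ici 0) 0 := by
    rw [← continuousWithinAt_Ioi_iff_Ici, ContinuousWithinAt, hS.zero_apply]
    exact hS.tendsto_zero x
  have := (h.tendsto.sub_const x).norm
  rwa [hS.zero_apply, sub_self, norm_zero] at this

/-- On either side the difference equals S at the smaller of s, t applied to S(|s − t|)x − x; the
local bound makes this small also from the left. -/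
lemma continuousOn_apply [CompleteSpace X] (hS : IsC0Semigroup S) (x : X) :
    ContinuousOn (fun t => S t x) (Ici 0) := by
  intro t ht
  have ht : 0 ≤ t := ht
  obtain ⟨M, hM0, hM⟩ := hS.exists_bound_on (t + 1)
  rw [ContinuousWithinAt, tendsto_iff_norm_sub_tendsto_zero]
  have hb : Tendsto (fun s => M * ‖S |s - t| x - x‖) (𝓝[Ici 0] t) (𝓝 0) := by
    have h1 : Tendsto (fun s : ℝ => |s - t|) (𝓝[Ici 0] t) (𝓝[≥] 0) := by
      rw [tendsto_nhdsWithin_iff]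
      refine ⟨?_, Eventually.of_forall fun s => mem_Ici.2 (abs_nonneg _)⟩
      have : ContinuousAt (fun s : ℝ => |s - t|) t := by fun_prop
      simpa [ContinuousAt] using this.mono_left nhdsWithin_le_nhds
    simpa using ((hS.tendsto_norm_sub x).comp h1).const_mul M
  refine squeeze_zero' (Eventually.of_forall fun s => norm_nonneg _) ?_ hb
  filter_upwards [self_mem_nhdsWithin, mem_nhdsWithin_of_mem_nhds
    (Iio_mem_nhds (by linarith : t < t + 1))] with s hs hs1
  have hs : 0 ≤ s := hs
  have hs1 : s < t + 1 := hs1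
  rcases le_total s t with h | h
  · rw [abs_of_nonpos (by linarith)]
    have e : S t x = S s (S (-(s - t)) x) := by
      rw [← hS.add_apply hs (by linarith)]; congr 2; ring
    rw [e, ← map_sub, norm_sub_rev (S (-(s - t)) x)]
    exact (S s).le_of_opNorm_le (hM s hs hs1.le) _
  · rw [abs_of_nonneg (by linarith)]
    have e : S s x = S t (S (s - t) x) := by
      rw [← hS.add_apply ht (by linarith)]; congr 2; ring
    rw [e, ← map_sub]
    exact (S t).le_of_opNorm_le (hM t ht (by linarith)) _

variable {A : X →ₗ.[ℂ] X}

lemma apply_mem_graph (hS : IsC0Semigroup S) (hG : IsGeneratorOf A S) {x y : X}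
    (h : (x, y) ∈ A.graph) {t : ℝ} (ht : 0 ≤ t) : (S t x, S t y) ∈ A.graph := by
  rw [hG]
  have h1 := ((S t).continuous.tendsto y).comp ((hG x y).1 h)
  refine h1.congr' ?_
  filter_upwards [self_mem_nhdsWithin] with s hs
  have hs : 0 < s := hs
  simp only [Function.comp, map_smul, map_sub]
  rw [hS.apply_comm ht hs.le]

lemma commute_resolvent (hS : IsC0Semigroup S) (hG : IsGeneratorOf A S) {z : ℂ}
    {R : X →L[ℂ] X}
    (hR : IsResolventAt A z R) {t : ℝ} (ht : 0 ≤ t) (x : X) : S t (R x) = R (S t x) := by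
  have h := hS.apply_mem_graph hG ((isResolventAt_iff.1 hR).1 x) ht
  refine ((isResolventAt_iff.1 hR).2 _ _ ?_).symm
  rwa [map_sub, map_smul] at h

lemma hasDerivWithinAt (hS : IsC0Semigroup S) (hG : IsGeneratorOf A S) {x y : X}
    (h : (x, y) ∈ A.graph) {t : ℝ} (ht : 0 ≤ t) :
    HasDerivWithinAt (fun s => S s x) (S t y) (Ici t) t := by
  rw [← hasDerivWithinAt_Ioi_iff_Ici, hasDerivWithinAt_iff_tendsto_slope' (by simp)]
  have h0 : Tendsto (fun s => s - t) (𝓝[>] t) (𝓝[>] 0) := by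
    rw [tendsto_nhdsWithin_iff]
    refine ⟨?_, ?_⟩
    · have : ContinuousAt (fun s : ℝ => s - t) t := by fun_prop
      simpa [ContinuousAt] using this.mono_left nhdsWithin_le_nhds
    · filter_upwards [self_mem_nhdsWithin] with s hs
      exact mem_Ioi.2 (sub_pos.2 (mem_Ioi.1 hs))
  have h1 := (((S t).continuous.tendsto y).comp ((hG x y).1 h)).comp h0
  refine h1.congr' ?_
  filter_upwards [self_mem_nhdsWithin] with s hs
  have hs : t < s := hs
  simp only [Function.comp, map_smul, map_sub, slope, vsub_eq_sub]
  rw [← hS.add_apply ht (by linarith), ← Complex.ofReal_inv, Complex.coe_smul]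
  congr 4; ring

/-- The right derivative S(t)y is continuous in t, so the fundamental theorem of calculus turns it
into a two-sided derivative. -/
lemma hasDerivAt [CompleteSpace X] (hS : IsC0Semigroup S) (hG : IsGeneratorOf A S) {x y : X}
    (h : (x, y) ∈ A.graph) {t : ℝ} (ht : 0 < t) : HasDerivAt (fun s => S s x) (S t y) t := by
  have hi : ∀ s, 0 ≤ s → IntervalIntegrable (fun r => S r y) volume 0 s := fun s hs =>
    ((hS.continuousOn_apply y).mono (by rw [uIcc_of_le hs]; exact Icc_subset_Ici_self)).intervalIntegrable
  have hF : ∀ s, 0 ≤ s → S s x = x + ∫ r in 0..s, S r y := by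
    intro s hs
    rw [intervalIntegral.integral_eq_sub_of_hasDeriv_right (f := fun r => S r x)
      ((hS.continuousOn_apply x).mono (by rw [uIcc_of_le hs]; exact Icc_subset_Ici_self))
      (fun r hr => ?_) (hi s hs), hS.zero_apply]
    · abel
    · rw [min_eq_left hs] at hr
      exact (hS.hasDerivWithinAt hG h hr.1.le).Ioi_of_Ici
  have hd := intervalIntegral.integral_hasDerivAt_right (hi t ht.le)
    ((hS.continuousOn_apply y).mono Ioi_subset_Ici_self |>.stronglyMeasurableAtFilter isOpen_Ioi t ht)
    ((hS.continuousOn_apply y).continuousAt (Ici_mem_nhds ht))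
  refine (hd.const_add x).congr_of_eventuallyEq ?_
  filter_upwards [Ioi_mem_nhds ht] with s hs
  exact hF s (le_of_lt hs)

end Banach

variable {X : Type*} [NormedAddCommGroup X] [InnerProductSpace ℂ X] [CompleteSpace X]
  {S : ℝ → X →L[ℂ] X} {A : X →ₗ.[ℂ] X} {R : X →L[ℂ] X}

/-- The norm decreases along orbits starting in the dense domain. Nothing about the construction of
`S` is used, so this covers any semigroup generated by `A`. -/
lemma norm_le_one (hS : IsC0Semigroup S) (hG : IsGeneratorOf A S) (hA : IsDissipative A)
    (hR : IsResolventAt A 1 R) {t : ℝ} (ht : 0 ≤ t) : ‖S t‖ ≤ 1 := by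
  have hd : DenseRange R := hA.denseRange_resolvent (by simp) hR
  refine (S t).opNorm_le_bound zero_le_one fun x => ?_
  refine hd.induction_on x (isClosed_le (by fun_prop) (by fun_prop)) fun F => ?_
  have h := (isResolventAt_iff.1 hR).1 F
  have := norm_le_of_re_inner_deriv_nonpos ht (f := fun s => S s (R F))
    ((hS.continuousOn_apply _).mono Icc_subset_Ici_self)
    (fun s hs => hS.hasDerivWithinAt hG h hs.1)
    (fun s hs => hA _ _ (hS.apply_mem_graph hG h hs.1))
  rw [hS.zero_apply] at this
  rw [one_mul]
  exact this

end IsC0Semigroup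

/-! ## The Laplace transform of a contraction semigroup -/

section

variable {X : Type*} [NormedAddCommGroup X]

lemma integrableOn_pow_mul_exp (n : ℕ) :
    IntegrableOn (fun t : ℝ => t ^ n * Real.exp (-t)) (Ioi 0) := by
  have h := Real.GammaIntegral_convergent (s := n + 1) (by positivity)
  refine h.congr_fun (fun t _ => ?_) measurableSet_Ioi
  simp [mul_comm]

lemma norm_pow_mul_exp {z : ℂ} (hz : z.re = 1) {t : ℝ} (ht : 0 ≤ t) (n : ℕ) :
    ‖(t : ℂ) ^ n * Complex.exp (-(z * t))‖ = t ^ n * Real.exp (-t) := by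
  rw [norm_mul, norm_pow, Complex.norm_real, Real.norm_of_nonneg ht, Complex.norm_exp]
  simp [hz]

variable [InnerProductSpace ℂ X] {S : ℝ → X →L[ℂ] X} {A : X →ₗ.[ℂ] X}

lemma tendsto_laplace (hc : ∀ t, 0 ≤ t → ‖S t‖ ≤ 1) {z : ℂ} (hz : z.re = 1) (n : ℕ) (x : X) :
    Tendsto (fun t : ℝ => ((t : ℂ) ^ n * Complex.exp (-(z * t))) • S t x) atTop (𝓝 0) := by
  have h := (Real.tendsto_pow_mul_exp_neg_atTop_nhds_zero n).mul_const ‖x‖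
  rw [zero_mul] at h
  refine squeeze_zero_norm' ?_ h
  filter_upwards [eventually_ge_atTop 0] with t ht
  rw [norm_smul, norm_pow_mul_exp hz ht]
  gcongr
  simpa using (S t).le_of_opNorm_le (hc t ht) x

/-- Both R(R₁ − 1) and (zR − 1)R₁ represent ARR₁; the powers follow by commutation. On the right the
k factors of A are carried by R(z), leaving `R₁ ^ k` to be moved to the vector. -/
lemma IsResolventAt.pow_mul_sub_one_pow {z : ℂ} {R R₁ : X →L[ℂ] X} (hR : IsResolventAt A z R)
    (hR₁ : IsResolventAt A 1 R₁) (k j : ℕ) :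
    R ^ (j + k) * (R₁ - 1) ^ k = (z • R - 1) ^ k * R ^ j * R₁ ^ k := by
  have hcom : Commute R R₁ := hR.commute hR₁
  have h1 : R * (R₁ - 1) = (z • R - 1) * R₁ := by
    have h2 : (1 - z) • (R₁ * R) = R - R₁ := by
      ext F; exact hR.apply_apply hR₁ F
    rw [← hcom.eq] at h2
    rw [mul_sub, sub_mul, mul_one, one_mul, smul_mul_assoc]
    rw [sub_smul, one_smul] at h2
    rw [show z • (R * R₁) = R * R₁ - (R - R₁) by rw [← h2]; abel]
    abel
  have c1 : Commute R (R₁ - 1) := hcom.sub_right (Commute.one_right R)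
  have c2 : Commute (z • R - 1) R₁ := (hcom.smul_left z).sub_left (Commute.one_left _)
  have c3 : Commute (z • R - 1) R := ((Commute.refl R).smul_left z).sub_left (Commute.one_left _)
  rw [pow_add, mul_assoc, ← c1.mul_pow, h1, c2.mul_pow, ← mul_assoc, (c3.pow_pow k j).eq]

variable [CompleteSpace X]

namespace IsC0Semigroup

lemma integrableOn_laplace (hS : IsC0Semigroup S) (hc : ∀ t, 0 ≤ t → ‖S t‖ ≤ 1) {z : ℂ}
    (hz : z.re = 1) (n : ℕ) (x : X) :
    IntegrableOn (fun t : ℝ => ((t : ℂ) ^ n * Complex.exp (-(z * t))) • S t x) (Ioi 0) := by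
  refine ((integrableOn_pow_mul_exp n).mul_const ‖x‖).mono' ?_ ?_
  · refine ContinuousOn.aestronglyMeasurable ?_ measurableSet_Ioi
    exact (by fun_prop : Continuous fun t : ℝ => (t : ℂ) ^ n * Complex.exp (-(z * t))).continuousOn.smul
      ((hS.continuousOn_apply x).mono Ioi_subset_Ici_self)
  · filter_upwards [ae_restrict_mem measurableSet_Ioi] with t ht
    have ht : 0 < t := ht
    rw [norm_smul, norm_pow_mul_exp hz ht.le]
    gcongr
    simpa using (S t).le_of_opNorm_le (hc t ht.le) x

/-- The Laplace transform of `tⁿ S(t) x` is `n! R(z)^(n+1) x`. -/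
lemma integral_laplace (hS : IsC0Semigroup S) (hG : IsGeneratorOf A S)
    (hc : ∀ t, 0 ≤ t → ‖S t‖ ≤ 1) {z : ℂ} (hz : z.re = 1) {R : X →L[ℂ] X}
    (hR : IsResolventAt A z R) (n : ℕ) (x : X) :
    ∫ t in Ioi (0 : ℝ), ((t : ℂ) ^ n * Complex.exp (-(z * t))) • S t x
      = (n ! : ℂ) • (R ^ (n + 1)) x := by
  -- Since AR = zR − 1 the terms with z cancel, and integration over (0, ∞) gives the recursion
  -- expressing the transform of order n at x by n times that of order n − 1 at Rx. For n = 0 the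
  -- factor n removes the truncated exponent.
  have hd : ∀ (n : ℕ) (x : X) (t : ℝ), 0 < t →
      HasDerivAt (fun t : ℝ => ((t : ℂ) ^ n * Complex.exp (-(z * t))) • S t (R x))
        ((n * (t : ℂ) ^ (n - 1) * Complex.exp (-(z * t))) • S t (R x)
          - ((t : ℂ) ^ n * Complex.exp (-(z * t))) • S t x) t := by
    intro n x t ht
    have h1 := hS.hasDerivAt hG ((isResolventAt_iff.1 hR).1 x) ht
    have h2 : HasDerivAt (fun t : ℝ => (t : ℂ) ^ n * Complex.exp (-(z * t)))
        (n * (t : ℂ) ^ (n - 1) * Complex.exp (-(z * t))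
          + (t : ℂ) ^ n * (Complex.exp (-(z * t)) * (-z))) t := by
      have h3 := (hasDerivAt_pow n (t : ℂ)).mul
        (((hasDerivAt_id (t : ℂ)).const_mul z).neg.cexp)
      have := h3.comp_ofReal
      simpa using this
    refine (h2.smul h1).congr_deriv ?_
    rw [map_sub, map_smul]
    module
  have hcont : ∀ (n : ℕ) (x : X), ContinuousWithinAt
      (fun t : ℝ => ((t : ℂ) ^ n * Complex.exp (-(z * t))) • S t x) (Ici 0) 0 := fun n x =>
    (by fun_prop : Continuous fun t : ℝ =>
      (t : ℂ) ^ n * Complex.exp (-(z * t))).continuousWithinAt.smul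
      (hS.continuousOn_apply x 0 self_mem_Ici)
  induction n generalizing x with
  | zero =>
    have h := integral_Ioi_of_hasDerivAt_of_tendsto (hcont 0 (R x)) (hd 0 x)
      (by simpa using (hS.integrableOn_laplace hc hz 0 x).neg) (tendsto_laplace hc hz 0 (R x))
    simp only [Nat.cast_zero, zero_mul, zero_smul, zero_sub, integral_neg] at h
    rw [neg_inj] at h
    rw [h]
    simp [hS.zero_apply]
  | succ n ih =>
    have i1 : IntegrableOn (fun t : ℝ => ((n : ℂ) + 1) •
        (((t : ℂ) ^ n * Complex.exp (-(z * t))) • S t (R x))) (Ioi 0) :=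
      (hS.integrableOn_laplace hc hz n (R x)).smul ((n : ℂ) + 1)
    have i2 := hS.integrableOn_laplace hc hz (n + 1) x
    have e : ∀ t : ℝ, (((n + 1 : ℕ) : ℂ) * (t : ℂ) ^ (n + 1 - 1) * Complex.exp (-(z * t))) • S t (R x)
          - ((t : ℂ) ^ (n + 1) * Complex.exp (-(z * t))) • S t x
        = ((n : ℂ) + 1) • (((t : ℂ) ^ n * Complex.exp (-(z * t))) • S t (R x))
          - ((t : ℂ) ^ (n + 1) * Complex.exp (-(z * t))) • S t x := by
      intro t
      rw [Nat.add_sub_cancel, smul_smul, Nat.cast_succ, mul_assoc]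
    have h := integral_Ioi_of_hasDerivAt_of_tendsto (hcont (n + 1) (R x))
      (fun t ht => (hd (n + 1) x t ht).congr_deriv (e t))
      (i1.sub i2) (tendsto_laplace hc hz (n + 1) (R x))
    rw [integral_sub i1 i2, integral_smul, ih] at h
    simp only [Complex.ofReal_zero, ne_eq, Nat.succ_ne_zero, not_false_eq_true, zero_pow, zero_mul,
      zero_smul, sub_self] at h
    rw [← sub_eq_zero.1 h, smul_smul, pow_succ R (n + 1), mul_apply_eq_comp, Nat.factorial_succ]
    push_cast
    rfl

end IsC0Semigroup

/-- A resolvent estimate of order `|z|^(-1/4)` on the line `Re z = 1` bounds `S(t) A^k` for `t > 0`,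
where `A = (R₁ - 1) R₁⁻¹` on the domain of `A`. -/
theorem IsC0Semigroup.exists_norm_apply_sub_one_pow_le (hS : IsC0Semigroup S)
    (hG : IsGeneratorOf A S) (hc : ∀ t, 0 ≤ t → ‖S t‖ ≤ 1) {R : ℂ → X →L[ℂ] X}
    (hR : ∀ z : ℂ, z.re = 1 → IsResolventAt A z (R z)) {C : ℝ} (hC : 0 ≤ C)
    (hb : ∀ z : ℂ, z.re = 1 → ‖z‖ ^ (1 / 4 : ℝ) * ‖R z‖ ≤ C) (k : ℕ) :
    ∃ D, 0 ≤ D ∧ ∀ t > 0, ∀ x, t ^ (4 * k + 4) * Real.exp (-t) * ‖S t (((R 1 - 1) ^ k) x)‖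
      ≤ D * ‖(R 1 ^ k) x‖ := by
  -- With R(z) = O(|z|^(-1/4)) and zR(z) − 1 = O(|z|^(3/4)), the operator (zR − 1)^k R^(m+1−k) is
  -- O(|z|^((4k−m−1)/4)). The value 4k + 4 is the least m for which this exponent is below −1; it
  -- gives −5/4.
  set m := 4 * k + 4 with hm
  -- the bound on the transform
  have hbound : ∀ z : ℂ, z.re = 1 → ‖(z • R z - 1) ^ k * R z ^ (3 * k + 5)‖
      ≤ (C + 1) ^ (4 * k + 5) * ‖z‖ ^ (-(5 / 4) : ℝ) := by
    intro z hz
    have hz1 : 1 ≤ ‖z‖ := by simpa [hz] using Complex.re_le_norm z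
    have hz0 : 0 < ‖z‖ := by linarith
    set r := ‖z‖ ^ (1 / 4 : ℝ) with hr
    have hr1 : 1 ≤ r := Real.one_le_rpow hz1 (by norm_num)
    have hr0 : 0 < r := by linarith
    have hr4 : r ^ 4 = ‖z‖ := by
      rw [hr, ← Real.rpow_natCast, ← Real.rpow_mul hz0.le]; norm_num
    have hr5 : ‖z‖ ^ (-(5 / 4) : ℝ) = (r ^ 5)⁻¹ := by
      rw [hr, ← Real.rpow_natCast, ← Real.rpow_mul hz0.le, ← Real.rpow_neg hz0.le]; norm_num
    have h1 : ‖R z‖ ≤ (C + 1) * r⁻¹ := by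
      rw [← div_eq_mul_inv, le_div_iff₀ hr0]
      linarith [hb z hz, mul_comm ‖R z‖ r]
    have h2 : ‖z • R z - 1‖ ≤ (C + 1) * r ^ 3 := by
      have h3 : ‖z • R z‖ ≤ C * r ^ 3 := by
        rw [norm_smul, ← hr4]
        calc r ^ 4 * ‖R z‖ = (r * ‖R z‖) * r ^ 3 := by ring
          _ ≤ C * r ^ 3 := by gcongr; exact hb z hz
      have h4 : ‖(1 : X →L[ℂ] X)‖ ≤ 1 := ContinuousLinearMap.norm_id_le
      have h5 : 1 ≤ r ^ 3 := one_le_pow₀ hr1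
      calc ‖z • R z - 1‖ ≤ ‖z • R z‖ + ‖(1 : X →L[ℂ] X)‖ := norm_sub_le _ _
        _ ≤ C * r ^ 3 + r ^ 3 := by linarith
        _ = (C + 1) * r ^ 3 := by ring
    have hpow : ∀ (T : X →L[ℂ] X) (c : ℝ), ‖T‖ ≤ c → ∀ n : ℕ, ‖T ^ n‖ ≤ c ^ n := by
      intro T c hT n
      induction n with
      | zero =>
        rw [pow_zero, pow_zero]
        exact ContinuousLinearMap.norm_id_le
      | succ n ih =>
        rw [pow_succ, pow_succ]
        exact (norm_mul_le _ _).trans (mul_le_mul ih hT (norm_nonneg _) ((norm_nonneg _).trans ih))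
    calc _ ≤ ‖(z • R z - 1) ^ k‖ * ‖R z ^ (3 * k + 5)‖ := norm_mul_le _ _
      _ ≤ ((C + 1) * r ^ 3) ^ k * ((C + 1) * r⁻¹) ^ (3 * k + 5) :=
        mul_le_mul (hpow _ _ h2 k) (hpow _ _ h1 _) (norm_nonneg _) (by positivity)
      _ = (C + 1) ^ (4 * k + 5) * ‖z‖ ^ (-(5 / 4) : ℝ) := by
        rw [hr5, mul_pow, mul_pow, ← pow_mul, inv_pow, pow_add r (3 * k) 5,
          show 4 * k + 5 = k + (3 * k + 5) by ring, pow_add (C + 1) k]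
        field_simp
  have hJ : Integrable (fun ξ : ℝ => (1 + ‖ξ‖ ^ 2) ^ (-(5 / 4 : ℝ) / 2)) :=
    integrable_rpow_neg_one_add_norm_sq (by norm_num)
  set J := ∫ ξ : ℝ, (1 + ‖ξ‖ ^ 2) ^ (-(5 / 4 : ℝ) / 2)
  have hJ0 : 0 ≤ J := integral_nonneg fun ξ => by positivity
  refine ⟨m ! * (C + 1) ^ (4 * k + 5) * J, by positivity, fun t ht x => ?_⟩
  set x' := ((R 1 - 1) ^ k) x with hx'
  -- The Laplace transform on the line z = 1 + 2πiξ is the Fourier transform of this function.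
  set w : ℝ → X := (Ioi 0).indicator
    fun t => ((t : ℂ) ^ m * Complex.exp (-((1 : ℂ) * t))) • S t x' with hw
  have hwi : Integrable w :=
    (integrable_indicator_iff measurableSet_Ioi).2
      (hS.integrableOn_laplace hc (by simp) m x')
  have hF : ∀ ξ : ℝ, FourierTransform.fourier w ξ = (m ! : ℂ) •
      ((((1 + 2 * Real.pi * ξ * Complex.I : ℂ) • R (1 + 2 * Real.pi * ξ * Complex.I) - 1) ^ k
        * R (1 + 2 * Real.pi * ξ * Complex.I) ^ (3 * k + 5)) ((R 1 ^ k) x)) := by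
    intro ξ
    set z : ℂ := 1 + 2 * Real.pi * ξ * Complex.I with hz
    have hz1 : z.re = 1 := by simp [hz]
    have h1 := hS.integral_laplace hG hc hz1 (hR z hz1) m x'
    have h2 := (hR z hz1).pow_mul_sub_one_pow (hR 1 (by simp)) k (3 * k + 5)
    rw [Real.fourier_real_eq_integral_exp_smul, ← mul_apply_eq_comp, ← h2,
      mul_apply_eq_comp, ← hx', show 3 * k + 5 + k = m + 1 by omega, ← h1,
      ← integral_indicator measurableSet_Ioi]
    congr 1
    ext s
    rw [hw, indicator, indicator]
    split_ifs
    · rw [smul_smul, mul_left_comm, ← Complex.exp_add]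
      congr 3
      rw [hz]; push_cast; ring
    · simp
  have hFb : ∀ ξ : ℝ, ‖FourierTransform.fourier w ξ‖ ≤ m ! * (C + 1) ^ (4 * k + 5) * ‖(R 1 ^ k) x‖
      * (1 + ‖ξ‖ ^ 2) ^ (-(5 / 4 : ℝ) / 2) := by
    intro ξ
    rw [hF]
    set z : ℂ := 1 + 2 * Real.pi * ξ * Complex.I with hz
    have hz1 : z.re = 1 := by simp [hz]
    have hz2 : 1 + ‖ξ‖ ^ 2 ≤ ‖z‖ ^ 2 := by
      have hi : z.im = 2 * Real.pi * ξ := by simp [hz]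
      rw [Complex.sq_norm, Complex.normSq_apply, hz1, hi, Real.norm_eq_abs, sq_abs]
      nlinarith [Real.pi_gt_three, mul_nonneg (sq_nonneg ξ)
        (by nlinarith [Real.pi_gt_three] : 0 ≤ 4 * Real.pi ^ 2 - 1)]
    have h1 : ‖z‖ ^ (-(5 / 4) : ℝ) ≤ (1 + ‖ξ‖ ^ 2) ^ (-(5 / 4 : ℝ) / 2) := by
      have : ‖z‖ ^ (-(5 / 4) : ℝ) = (‖z‖ ^ 2) ^ (-(5 / 4 : ℝ) / 2) := by
        rw [← Real.rpow_natCast, ← Real.rpow_mul (norm_nonneg _)]; norm_num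
      rw [this]
      exact Real.rpow_le_rpow_of_nonpos (by positivity) hz2 (by norm_num)
    rw [norm_smul, Complex.norm_natCast]
    calc _ ≤ (m ! : ℝ) * ((C + 1) ^ (4 * k + 5) * ‖z‖ ^ (-(5 / 4) : ℝ) * ‖(R 1 ^ k) x‖) := by
          gcongr
          exact ContinuousLinearMap.le_of_opNorm_le _ (hbound z hz1) _
      _ ≤ (m ! : ℝ) * ((C + 1) ^ (4 * k + 5) * (1 + ‖ξ‖ ^ 2) ^ (-(5 / 4 : ℝ) / 2)
          * ‖(R 1 ^ k) x‖) := by gcongr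
      _ = _ := by ring
  have hFc : Continuous (FourierTransform.fourier w) :=
    VectorFourier.fourierIntegral_continuous Real.continuous_fourierChar
      (innerSL ℝ).continuous₂ hwi
  have hFi : Integrable (FourierTransform.fourier w) :=
    (hJ.const_mul _).mono' hFc.aestronglyMeasurable (Eventually.of_forall hFb)
  have hwt : w t = ((t : ℂ) ^ m * Complex.exp (-((1 : ℂ) * t))) • S t x' :=
    indicator_of_mem (mem_Ioi.2 ht) _
  have hwc : ContinuousAt w t := by
    have : ContinuousAt (fun t : ℝ => ((t : ℂ) ^ m * Complex.exp (-((1 : ℂ) * t))) • S t x') t :=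
      (by fun_prop : Continuous fun t : ℝ =>
        (t : ℂ) ^ m * Complex.exp (-((1 : ℂ) * t))).continuousAt.smul
        ((hS.continuousOn_apply x').continuousAt (Ici_mem_nhds ht))
    refine this.congr ?_
    filter_upwards [Ioi_mem_nhds ht] with s hs
    rw [hw, indicator_of_mem hs]
  -- The transform is integrable and `w` is continuous at `t`, so inversion bounds ‖w(t)‖ by the L¹
  -- norm of the transform.
  have hinv := hwi.fourierInv_fourier_eq hFi hwc
  have hnorm : ‖w t‖ = t ^ m * Real.exp (-t) * ‖S t x'‖ := by
    rw [hwt, norm_smul, norm_pow_mul_exp (by simp) ht.le]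
  rw [← hnorm, ← hinv, Real.fourierInv_eq']
  refine (norm_integral_le_integral_norm _).trans ?_
  calc _ ≤ ∫ ξ : ℝ, m ! * (C + 1) ^ (4 * k + 5) * ‖(R 1 ^ k) x‖
      * (1 + ‖ξ‖ ^ 2) ^ (-(5 / 4 : ℝ) / 2) := by
        refine integral_mono_of_nonneg (Eventually.of_forall fun ξ => norm_nonneg _)
          (hJ.const_mul _) (Eventually.of_forall fun ξ => ?_)
        refine le_trans (le_of_eq ?_) (hFb ξ)
        beta_reduce
        rw [norm_smul, Complex.norm_exp_ofReal_mul_I, one_mul]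
    _ = _ := by rw [integral_const_mul]; ring

end

/-! ## Gevrey regularity from bounds on `S(t) A^k` -/

lemma factorial_pow_le (j k : ℕ) : j ! ^ k ≤ (k * j)! := by
  induction k with
  | zero => simp
  | succ k ih =>
    rw [pow_succ, add_mul, one_mul]
    exact (Nat.mul_le_mul_right _ ih).trans (Nat.le_of_dvd (Nat.factorial_pos _)
      (Nat.factorial_mul_factorial_dvd_factorial_add _ _))

/-- By (j+1)^j ≤ e^(j+1) j! and (j!)^k ≤ (kj)!, the power (j+1)^((4k+4)j) costs (n!)^(4+4/k) and a
geometric factor. The gap to δ absorbs any geometric factor, since c^n ≤ e^c n!. -/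
lemma exists_pow_pow_le_factorial_rpow {k : ℕ} (hk : 0 < k) {δ : ℝ} (hδ : 4 + 4 / (k : ℝ) < δ)
    {E θ : ℝ} (hE : 0 ≤ E) (hθ : 0 < θ) : ∃ C, 0 ≤ C ∧ ∀ j r : ℕ,
      (E * ((j : ℝ) + 1) ^ (4 * k + 4)) ^ j
        ≤ C * θ ^ (k * j + r) * (((k * j + r)! : ℕ) : ℝ) ^ δ := by
  have hk' : (0 : ℝ) < k := by exact_mod_cast hk
  set N := 4 * k + 4 with hN
  set η := δ - (4 + 4 / (k : ℝ)) with hη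
  have hη0 : 0 < η := sub_pos.2 hδ
  set Q := max 1 (E * Real.exp 1 ^ N) with hQ
  have hQ1 : 1 ≤ Q := le_max_left _ _
  -- Defined by c^(ηn) = (Q/θ)^n, so that the factor (n!)^η pays for both the constants and θ^n.
  set c := (Q / θ) ^ η⁻¹ with hc
  have hQθ : 0 < Q / θ := by positivity
  have hc0 : 0 < c := Real.rpow_pos_of_pos hQθ _
  refine ⟨Real.exp 1 ^ N * Real.exp c ^ η, by positivity, fun j r => ?_⟩
  set n := k * j + r with hn
  have hf0 : (0 : ℝ) < (n ! : ℕ) := by exact_mod_cast n.factorial_pos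
  have h1 : ((j : ℝ) + 1) ^ j ≤ Real.exp 1 ^ (j + 1) * (j ! : ℕ) := by
    have := Real.pow_div_factorial_le_exp ((j : ℝ) + 1) (by positivity) j
    rw [div_le_iff₀ (by positivity)] at this
    rw [← Real.exp_nat_mul]
    simpa using this
  have h2 : (((j ! : ℕ) : ℝ)) ^ N ≤ (n ! : ℝ) ^ (4 + 4 / (k : ℝ)) := by
    have h3 : ((j ! : ℕ) : ℝ) ^ k ≤ (n ! : ℕ) := by
      exact_mod_cast (factorial_pow_le j k).trans (Nat.factorial_le (by omega))
    have h4 : ((j ! : ℕ) : ℝ) ^ N = (((j ! : ℕ) : ℝ) ^ k) ^ (4 + 4 / (k : ℝ)) := by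
      rw [← Real.rpow_natCast, ← Real.rpow_natCast, ← Real.rpow_mul (by positivity)]
      congr 1
      rw [hN]; push_cast; field_simp
    rw [h4]
    exact Real.rpow_le_rpow (by positivity) h3 (by positivity)
  have h5 : (Q / θ) ^ n ≤ Real.exp c ^ η * (n ! : ℝ) ^ η := by
    have h6 : c ^ n ≤ Real.exp c * (n ! : ℕ) := by
      have := Real.pow_div_factorial_le_exp c hc0.le n
      rwa [div_le_iff₀ hf0] at this
    have h7 : (Q / θ) ^ n = (c ^ n) ^ η := by
      rw [hc, ← Real.rpow_natCast, ← Real.rpow_natCast, ← Real.rpow_mul hQθ.le,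
        ← Real.rpow_mul hQθ.le]
      congr 1
      field_simp
    rw [h7, ← Real.mul_rpow (by positivity) (by positivity)]
    exact Real.rpow_le_rpow (by positivity) h6 hη0.le
  have hjn : j ≤ n := by
    have := Nat.le_mul_of_pos_left j hk
    omega
  calc (E * ((j : ℝ) + 1) ^ N) ^ j = E ^ j * (((j : ℝ) + 1) ^ j) ^ N := by
        rw [mul_pow, ← pow_mul, ← pow_mul, mul_comm N]
    _ ≤ E ^ j * (Real.exp 1 ^ (j + 1) * (j ! : ℕ)) ^ N := by gcongr
    _ = Real.exp 1 ^ N * (E * Real.exp 1 ^ N) ^ j * ((j ! : ℕ) : ℝ) ^ N := by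
        rw [mul_pow, mul_pow, ← pow_mul, ← pow_mul, add_mul, pow_add, one_mul, mul_comm j N]; ring
    _ ≤ Real.exp 1 ^ N * Q ^ n * (n ! : ℝ) ^ (4 + 4 / (k : ℝ)) := by
        gcongr
        exact (pow_le_pow_left₀ (by positivity) (le_max_right _ _) j).trans
          (pow_le_pow_right₀ hQ1 hjn)
    _ = Real.exp 1 ^ N * (Q / θ) ^ n * θ ^ n * (n ! : ℝ) ^ (4 + 4 / (k : ℝ)) := by
        rw [div_pow]; field_simp
    _ ≤ Real.exp 1 ^ N * (Real.exp c ^ η * (n ! : ℝ) ^ η) * θ ^ n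
          * (n ! : ℝ) ^ (4 + 4 / (k : ℝ)) := by gcongr
    _ = Real.exp 1 ^ N * Real.exp c ^ η * θ ^ n
          * ((n ! : ℝ) ^ η * (n ! : ℝ) ^ (4 + 4 / (k : ℝ))) := by ring
    _ = _ := by rw [← Real.rpow_add hf0, hη, sub_add_cancel]

/-! ### The operators `S(t) A^k` and differentiation in operator norm -/

section

variable {X : Type*} [NormedAddCommGroup X] [NormedSpace ℂ X]

/-- The bounded extension of `S(t) A^k`, where `A R = R - 1`. -/
noncomputable def semigroupMulPow [CompleteSpace X] (S : ℝ → X →L[ℂ] X) (R : X →L[ℂ] X) (k : ℕ) (t : ℝ) :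
    X →L[ℂ] X :=
  LinearMap.extendOfNorm (S t * (R - 1) ^ k).toLinearMap (R ^ k).toLinearMap

/-- A semigroup `S` commuting with an operator `R` of dense range, in the role of `(1 - A)⁻¹` for
its generator `A`, such that `S(t) (R - 1)^k` is dominated by `R^k`, with a bound of order `t^(-(4k+4))`. -/
structure IsSmoothingSemigroup (S : ℝ → X →L[ℂ] X) (R : X →L[ℂ] X) : Prop where
  isC0 : IsC0Semigroup S
  dense : DenseRange R
  comm : ∀ t, 0 ≤ t → Commute (S t) R
  hasDerivAt : ∀ t > 0, ∀ x, HasDerivAt (fun s => S s (R x)) (S t ((R - 1) x)) t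
  bound : ∀ k : ℕ, ∃ D, 0 ≤ D ∧ ∀ t > 0, ∀ x,
    t ^ (4 * k + 4) * Real.exp (-t) * ‖S t (((R - 1) ^ k) x)‖ ≤ D * ‖(R ^ k) x‖

lemma norm_mul_pow_apply_le {S : ℝ → X →L[ℂ] X} {R : X →L[ℂ] X} (k : ℕ) {t D : ℝ} (ht : 0 < t)
    (hD : ∀ x, t ^ (4 * k + 4) * Real.exp (-t) * ‖S t (((R - 1) ^ k) x)‖ ≤ D * ‖(R ^ k) x‖) (x : X) :
    ‖(S t * (R - 1) ^ k) x‖ ≤ (D * Real.exp t * (t ^ (4 * k + 4))⁻¹) * ‖(R ^ k) x‖ := by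
  have hp : 0 < t ^ (4 * k + 4) := by positivity
  have := hD x
  rw [mul_assoc, Real.exp_neg] at this
  rw [mul_apply_eq_comp]
  have h2 : t ^ (4 * k + 4) * ((Real.exp t)⁻¹ * ‖S t (((R - 1) ^ k) x)‖)
      * (Real.exp t * (t ^ (4 * k + 4))⁻¹) = ‖S t (((R - 1) ^ k) x)‖ := by
    have := Real.exp_ne_zero t
    field_simp
  rw [← h2]
  calc _ ≤ D * ‖(R ^ k) x‖ * (Real.exp t * (t ^ (4 * k + 4))⁻¹) := by gcongr
    _ = _ := by ring

namespace IsSmoothingSemigroup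

variable {S : ℝ → X →L[ℂ] X} {R : X →L[ℂ] X} (h : IsSmoothingSemigroup S R)
include h

lemma denseRange_pow (k : ℕ) : DenseRange (R ^ k) := by
  induction k with
  | zero => exact Function.Surjective.denseRange fun x => ⟨x, rfl⟩
  | succ k ih =>
    rw [pow_succ']
    exact h.dense.comp ih R.continuous

lemma ext (k : ℕ) {T T' : X →L[ℂ] X} (hT : ∀ x, T ((R ^ k) x) = T' ((R ^ k) x)) : T = T' :=
  DFunLike.coe_injective ((h.denseRange_pow k).equalizer T.continuous T'.continuous (funext hT))

variable [CompleteSpace X]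

lemma apply_pow (k : ℕ) {t : ℝ} (ht : 0 < t) (x : X) :
    semigroupMulPow S R k t ((R ^ k) x) = S t (((R - 1) ^ k) x) := by
  obtain ⟨D, -, hD⟩ := h.bound k
  exact LinearMap.extendOfNorm_eq (h.denseRange_pow k)
    ⟨_, norm_mul_pow_apply_le k ht (hD t ht)⟩ x

lemma exists_norm_le (k : ℕ) : ∃ D, 0 ≤ D ∧ ∀ t > 0,
    ‖semigroupMulPow S R k t‖ ≤ D * Real.exp t * (t ^ (4 * k + 4))⁻¹ := by
  obtain ⟨D, hD0, hD⟩ := h.bound k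
  exact ⟨D, hD0, fun t ht => LinearMap.opNorm_extendOfNorm_le (h.denseRange_pow k)
    (by positivity) (norm_mul_pow_apply_le k ht (hD t ht))⟩

lemma mulPow_zero {t : ℝ} (ht : 0 < t) : semigroupMulPow S R 0 t = S t :=
  h.ext 0 fun x => by rw [h.apply_pow 0 ht]; rfl

/-- Verified on the dense range of `R ^ (j + k)`, where all factors are explicit and commute. -/
lemma mulPow_add_add (j k : ℕ) {s t : ℝ} (hs : 0 < s) (ht : 0 < t) :
    semigroupMulPow S R (j + k) (s + t) = semigroupMulPow S R j s * semigroupMulPow S R k t := by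
  have hc : Commute (S t) (R - 1) := (h.comm t ht.le).sub_right (Commute.one_right _)
  have hc' : Commute (S t) ((R - 1) ^ j) := hc.pow_right j
  have hc2 : Commute ((R - 1) ^ k) (R ^ j) :=
    (((Commute.refl R).sub_left (Commute.one_left _)).pow_pow k j)
  refine h.ext (j + k) fun x => ?_
  have e1 : (R ^ (j + k)) x = (R ^ k) ((R ^ j) x) := by rw [add_comm, pow_add]; rfl
  have e2 : S t (((R - 1) ^ k) ((R ^ j) x)) = (R ^ j) (S t (((R - 1) ^ k) x)) := by
    have := congrArg (fun T : X →L[ℂ] X => T x)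
      ((hc2.symm.mul_right ((h.comm t ht.le).pow_right j).symm).eq)
    have h3 := congrArg (fun T : X →L[ℂ] X => T x) hc2.eq
    have h4 := congrArg (fun T : X →L[ℂ] X => T (((R - 1) ^ k) x))
      ((h.comm t ht.le).pow_right j).eq
    simp only [mul_apply_eq_comp] at h3 h4
    rw [h3, h4]
  have h5 := congrArg (fun T : X →L[ℂ] X => T (((R - 1) ^ k) x)) hc'.eq
  simp only [mul_apply_eq_comp] at h5
  rw [h.apply_pow _ (add_pos hs ht), mul_apply_eq_comp, e1, h.apply_pow k ht, e2, h.apply_pow j hs,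
    h.isC0.add_apply hs.le ht.le, pow_add, mul_apply_eq_comp, h5]

lemma mulPow_add (k : ℕ) {s t : ℝ} (hs : 0 < s) (ht : 0 < t) :
    semigroupMulPow S R k (s + t) = semigroupMulPow S R k s * S t := by
  rw [← h.mulPow_zero ht, ← h.mulPow_add_add k 0 hs ht, add_zero]

lemma mulPow_mul_add (k j r : ℕ) {s u : ℝ} (hs : 0 < s) (hu : 0 < u) :
    semigroupMulPow S R (k * j + r) (j * s + u)
      = semigroupMulPow S R k s ^ j * semigroupMulPow S R r u := by
  induction j with
  | zero => simp
  | succ j ih =>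
    rw [show k * (j + 1) + r = k + (k * j + r) by ring,
      show ((j + 1 : ℕ) : ℝ) * s + u = s + (j * s + u) by push_cast; ring,
      h.mulPow_add_add _ _ hs (by positivity), ih, pow_succ', mul_assoc]

/-- The mean value inequality holds along orbits of vectors R x, with a constant relative to ‖R x‖.
Density upgrades it to operator norm: this is the passage from strong to norm differentiability. -/
lemma norm_sub_sub_smul_le {s t ε : ℝ} (hs : 0 < s) (ht : 0 < t) {T : X →L[ℂ] X}
    (hT : ∀ r ∈ uIcc t s, ‖semigroupMulPow S R 1 r - T‖ ≤ ε) :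
    ‖S s - S t - (s - t) • T‖ ≤ ε * ‖s - t‖ := by
  have hε : 0 ≤ ε := (norm_nonneg _).trans (hT t left_mem_uIcc)
  refine ContinuousLinearMap.opNorm_le_bound _ (by positivity) fun y => ?_
  refine h.dense.induction_on y (isClosed_le (by fun_prop) (by fun_prop)) fun x => ?_
  have hd : ∀ r ∈ uIcc t s, HasDerivWithinAt (fun r => S r (R x) - r • T (R x))
      ((semigroupMulPow S R 1 r - T) (R x)) (uIcc t s) r := by
    intro r hr
    have hr0 : 0 < r := lt_of_lt_of_le (lt_min ht hs) hr.1
    have h1 := (h.hasDerivAt r hr0 x).sub ((hasDerivAt_id r).smul_const (T (R x)))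
    refine (h1.congr_deriv ?_).hasDerivWithinAt
    have h2 := h.apply_pow 1 hr0 x
    rw [pow_one, pow_one] at h2
    rw [sub_apply (semigroupMulPow S R 1 r), h2, one_smul]
  have := (convex_uIcc t s).norm_image_sub_le_of_norm_hasDerivWithin_le hd
    (C := ε * ‖R x‖) (fun r hr => ContinuousLinearMap.le_of_opNorm_le _ (hT r hr) _)
    left_mem_uIcc right_mem_uIcc
  calc ‖(S s - S t - (s - t) • T) (R x)‖
      = ‖S s (R x) - s • T (R x) - (S t (R x) - t • T (R x))‖ := by
        congr 1
        simp only [sub_apply, smul_apply]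
        module
    _ ≤ _ := this
    _ = _ := by ring

/-- The case T = 0 of the previous estimate: S(t)A is bounded locally on (0, ∞), so S is locally
Lipschitz in norm. -/
lemma continuousAt {t : ℝ} (ht : 0 < t) : ContinuousAt S t := by
  obtain ⟨D, hD0, hD⟩ := h.exists_norm_le 1
  set L := D * Real.exp (2 * t) * ((t / 2) ^ (4 * 1 + 4))⁻¹
  have hL : ∀ r, t / 2 ≤ r → r ≤ 2 * t → ‖semigroupMulPow S R 1 r - 0‖ ≤ L := by
    intro r h1 h2
    rw [sub_zero]
    have hr : 0 < t / 2 := half_pos ht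
    calc _ ≤ D * Real.exp r * (r ^ (4 * 1 + 4))⁻¹ := hD r (by linarith)
      _ ≤ D * Real.exp (2 * t) * ((t / 2) ^ (4 * 1 + 4))⁻¹ := by
        have : 0 < r := by linarith
        gcongr
  rw [ContinuousAt, tendsto_iff_norm_sub_tendsto_zero]
  have hlim : Tendsto (fun s => L * ‖s - t‖) (𝓝 t) (𝓝 0) := by
    have : ContinuousAt (fun s => L * ‖s - t‖) t := by fun_prop
    simpa [ContinuousAt] using this
  refine squeeze_zero' (Eventually.of_forall fun s => norm_nonneg _) ?_ hlim
  filter_upwards [Ioo_mem_nhds (by linarith : t / 2 < t) (by linarith : t < 2 * t)] with s hs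
  have := h.norm_sub_sub_smul_le (T := 0) (ε := L) (s := s) (t := t) (by linarith [hs.1]) ht
    fun r hr => hL r (le_trans (le_min (by linarith) hs.1.le) hr.1)
      (hr.2.trans (max_le (by linarith) hs.2.le))
  simpa using this

/-- Near t, S(s)A^k is the fixed operator S(t/2)A^k times S(s − t/2), so regularity of S transfers;
`hasDerivAt_mulPow` uses the same splitting. -/
lemma continuousAt_mulPow (k : ℕ) {t : ℝ} (ht : 0 < t) :
    ContinuousAt (semigroupMulPow S R k) t := by
  have h1 : ContinuousAt (fun s => semigroupMulPow S R k (t / 2) * S (s - t / 2)) t := by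
    refine continuousAt_const.mul (ContinuousAt.comp (g := S) ?_ (by fun_prop))
    exact h.continuousAt (by linarith)
  refine h1.congr ?_
  filter_upwards [Ioi_mem_nhds (by linarith : t / 2 < t)] with s hs
  have hs : t / 2 < s := hs
  rw [← h.mulPow_add k (by linarith) (by linarith)]
  congr 1; ring

lemma hasDerivAt_one {t : ℝ} (ht : 0 < t) : HasDerivAt S (semigroupMulPow S R 1 t) t := by
  rw [hasDerivAt_iff_isLittleO, Asymptotics.isLittleO_iff]
  intro ε hε
  have h1 := (h.continuousAt_mulPow 1 ht).eventually (Metric.ball_mem_nhds _ hε)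
  obtain ⟨d, hd, hball⟩ := Metric.eventually_nhds_iff_ball.1 (h1.and (Ioi_mem_nhds ht))
  filter_upwards [Metric.ball_mem_nhds t hd] with s hs
  refine h.norm_sub_sub_smul_le (hball s hs).2 ht fun r hr => ?_
  have hr' : r ∈ Metric.ball t d := by
    have := (convex_ball t d).ordConnected.uIcc_subset (Metric.mem_ball_self hd) hs
    exact this hr
  have := (hball r hr').1
  rw [dist_eq_norm] at this
  exact this.le

lemma hasDerivAt_mulPow (k : ℕ) {t : ℝ} (ht : 0 < t) :
    HasDerivAt (semigroupMulPow S R k) (semigroupMulPow S R (k + 1) t) t := by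
  have h1 : HasDerivAt (fun s => S (s - t / 2)) (semigroupMulPow S R 1 (t / 2)) t := by
    have h2 := h.hasDerivAt_one (half_pos ht)
    rw [show t / 2 = t - t / 2 by ring] at h2
    refine (h2.comp_sub_const t (t / 2)).congr_deriv ?_
    congr 1; ring
  have h3 := (h1.const_mul (semigroupMulPow S R k (t / 2)))
  rw [← h.mulPow_add_add k 1 (half_pos ht) (half_pos ht), add_halves] at h3
  refine h3.congr_of_eventuallyEq ?_
  filter_upwards [Ioi_mem_nhds (by linarith : t / 2 < t)] with s hs
  have hs : t / 2 < s := hs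
  rw [← h.mulPow_add k (by linarith) (by linarith)]
  congr 1; ring

lemma iteratedDeriv_eq (n : ℕ) {t : ℝ} (ht : 0 < t) :
    iteratedDeriv n S t = semigroupMulPow S R n t := by
  induction n generalizing t with
  | zero => rw [iteratedDeriv_zero, h.mulPow_zero ht]
  | succ n ih =>
    rw [iteratedDeriv_succ]
    have : iteratedDeriv n S =ᶠ[𝓝 t] semigroupMulPow S R n := by
      filter_upwards [Ioi_mem_nhds ht] with s hs using ih hs
    rw [this.deriv_eq, (h.hasDerivAt_mulPow n ht).deriv]

lemma contDiffOn_mulPow (n k : ℕ) : ContDiffOn ℝ n (semigroupMulPow S R k) (Ioi 0) := by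
  induction n generalizing k with
  | zero =>
    rw [Nat.cast_zero, contDiffOn_zero]
    exact fun t ht => (h.continuousAt_mulPow k ht).continuousWithinAt
  | succ n ih =>
    rw [Nat.cast_succ, contDiffOn_succ_iff_deriv_of_isOpen isOpen_Ioi]
    refine ⟨fun t ht => (h.hasDerivAt_mulPow k ht).differentiableAt.differentiableWithinAt,
      by simp, (ih (k + 1)).congr fun t ht => (h.hasDerivAt_mulPow k ht).deriv⟩

lemma contDiffOn : ContDiffOn ℝ ∞ S (Ioi 0) :=
  contDiffOn_infty.2 fun n => (h.contDiffOn_mulPow n 0).congr fun _ ht => (h.mulPow_zero ht).symm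

/-- Smoothing bounds of order `t^(-(4k+4))` on `S(t) A^k` give the Gevrey class `δ` for every
`δ > 4`. -/
theorem isGevreySemigroup {δ : ℝ} (hδ : 4 < δ) : IsGevreySemigroup S δ 0 := by
  refine ⟨h.contDiffOn, fun K hK hK0 θ hθ => ?_⟩
  rcases K.eq_empty_or_nonempty with rfl | hne
  · exact ⟨0, fun t ht => absurd ht (notMem_empty t)⟩
  obtain ⟨a, haK, ha⟩ := hK.exists_isLeast hne
  obtain ⟨b, hbK, hb⟩ := hK.exists_isGreatest hne
  have ha0 : 0 < a := hK0 haK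
  -- Such a k makes the exponent 4 + 4/k smaller than δ.
  obtain ⟨k, hk⟩ := exists_nat_gt (4 / (δ - 4))
  have hδ4 : 0 < δ - 4 := sub_pos.2 hδ
  have hk' : (0 : ℝ) < k := lt_trans (by positivity) hk
  have hk0 : 0 < k := by exact_mod_cast hk'
  have hkδ : 4 + 4 / (k : ℝ) < δ := by
    rw [div_lt_iff₀ hδ4] at hk
    have : 4 / (k : ℝ) < δ - 4 := by rw [div_lt_iff₀ hk']; linarith
    linarith
  choose D hD0 hD using h.exists_norm_le
  set F : ℕ → ℝ := fun r => D r * Real.exp b * ((a / 2) ^ (4 * r + 4))⁻¹ with hF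
  have hF0 : ∀ r, 0 ≤ F r := fun r => by have := hD0 r; positivity
  have hrem : ∀ r < k, ∀ u, a / 2 ≤ u → u ≤ b →
      ‖semigroupMulPow S R r u‖ ≤ ∑ i ∈ Finset.range k, F i := by
    intro r hr u h1 h2
    refine (hD r u (by linarith)).trans (le_trans ?_
      (Finset.single_le_sum (fun i _ => hF0 i) (Finset.mem_range.2 hr)))
    have := hD0 r
    have hu : 0 < u := by linarith
    simp only [hF]
    gcongr
  obtain ⟨C, hC0, hC⟩ := exists_pow_pow_le_factorial_rpow hk0 hkδ (hF0 k) hθ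
  refine ⟨C * ∑ i ∈ Finset.range k, F i, fun t ht n => ?_⟩
  have hat : a ≤ t := ha ht
  have htb : t ≤ b := hb ht
  set j := n / k
  set r := n % k
  have hn : k * j + r = n := Nat.div_add_mod n k
  have hr : r < k := Nat.mod_lt _ hk0
  have hj : (0 : ℝ) < (j : ℝ) + 1 := by positivity
  -- The j steps of length s use less than t/2, leaving at least a/2 for the remainder A^r S(u). The
  -- +1 keeps s meaningful for j = 0.
  set s := t / (2 * ((j : ℝ) + 1)) with hs
  have ht0 : 0 < t := by linarith
  have hs0 : 0 < s := by positivity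
  have hjs : j * s + s = t / 2 := by rw [hs]; field_simp
  have hj0 : (0 : ℝ) ≤ j * s := by positivity
  have hsum : 0 ≤ ∑ i ∈ Finset.range k, F i := Finset.sum_nonneg fun i _ => hF0 i
  have hk1 : ‖semigroupMulPow S R k s‖ ≤ F k * ((j : ℝ) + 1) ^ (4 * k + 4) := by
    have h1 : (a / 2) / ((j : ℝ) + 1) ≤ s := by
      rw [hs, div_div]
      gcongr
    have h2 : 0 < (a / 2) / ((j : ℝ) + 1) := by positivity
    have := hD0 k
    calc _ ≤ D k * Real.exp s * (s ^ (4 * k + 4))⁻¹ := hD k s hs0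
      _ ≤ D k * Real.exp b * (((a / 2) / ((j : ℝ) + 1)) ^ (4 * k + 4))⁻¹ := by
        gcongr
        linarith
      _ = _ := by
        simp only [hF]
        rw [div_pow, inv_div]
        ring
  have hpow : ‖semigroupMulPow S R k s ^ j‖ ≤ (F k * ((j : ℝ) + 1) ^ (4 * k + 4)) ^ j := by
    have hid : ‖(1 : X →L[ℂ] X)‖ ≤ 1 := ContinuousLinearMap.norm_id_le
    generalize semigroupMulPow S R k s = T at hk1 ⊢
    generalize F k * ((j : ℝ) + 1) ^ (4 * k + 4) = c at hk1 ⊢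
    generalize j = i
    induction i with
    | zero => simpa using hid
    | succ i ih =>
      rw [pow_succ, pow_succ]
      exact (norm_mul_le _ _).trans (mul_le_mul ih hk1 (norm_nonneg _) ((norm_nonneg _).trans ih))
  have hfac := h.mulPow_mul_add k j r hs0 (u := t - j * s) (by linarith)
  rw [add_sub_cancel, hn] at hfac
  rw [h.iteratedDeriv_eq n ht0, hfac]
  have hfin := hC j r
  rw [hn] at hfin
  calc _ ≤ ‖semigroupMulPow S R k s ^ j‖ * ‖semigroupMulPow S R r (t - j * s)‖ := norm_mul_le _ _
    _ ≤ (C * θ ^ n * (n ! : ℝ) ^ δ) * ∑ i ∈ Finset.range k, F i :=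
      mul_le_mul (hpow.trans hfin) (hrem r hr _ (by linarith) (by linarith)) (norm_nonneg _)
        (by positivity)
    _ = _ := by ring

end IsSmoothingSemigroup

end

/-! ### From resolvent decay on the imaginary axis to the Gevrey class -/

section

variable {X : Type*} [NormedAddCommGroup X] [InnerProductSpace ℂ X] {A : X →ₗ.[ℂ] X}

/-- A resolvent estimate of order `|lam|^(-1/4)` on the imaginary axis carries over to the
line `Re z = 1`. -/
lemma IsDissipative.exists_rpow_mul_norm_resolvent_le (hA : IsDissipative A)
    {T : ℝ → X →L[ℂ] X} (hT : ∀ lam : ℝ, IsResolventAt A (Complex.I * lam) (T lam))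
    (hb : ∃ C lam₀ : ℝ, ∀ lam : ℝ, lam₀ ≤ |lam| → |lam| ^ (1 / 4 : ℝ) * ‖T lam‖ ≤ C) :
    ∃ C, 0 ≤ C ∧ ∀ (z : ℂ) (R : X →L[ℂ] X), z.re = 1 → IsResolventAt A z R →
      ‖z‖ ^ (1 / 4 : ℝ) * ‖R‖ ≤ C := by
  obtain ⟨C, lam₀, hC⟩ := hb
  set m := max lam₀ 1 with hm
  have hm1 : 1 ≤ m := le_max_right _ _
  -- The 4 is 2·2, from shifting the line by one and from comparing ‖z‖ with |Im z|. For small |Im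
  -- z| the contraction bound ‖R‖ ≤ 1 suffices.
  refine ⟨max (4 * C) ((1 + m) ^ (1 / 4 : ℝ)), le_max_of_le_right (by positivity),
    fun z R hz hR => ?_⟩
  have hzn : ‖z‖ ≤ 1 + |z.im| := by simpa [hz] using Complex.norm_le_abs_re_add_abs_im z
  rcases le_total m |z.im| with h | h
  · refine le_max_of_le_left ?_
    have e : z = 1 + Complex.I * z.im := by
      apply Complex.ext <;> simp [hz]
    have h1 : ‖R‖ ≤ 2 * ‖T z.im‖ :=
      hA.norm_resolvent_one_add_le (by simp) (hT z.im) (e ▸ hR)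
    have h2 : ‖z‖ ^ (1 / 4 : ℝ) ≤ 2 * |z.im| ^ (1 / 4 : ℝ) := by
      calc ‖z‖ ^ (1 / 4 : ℝ) ≤ (2 * |z.im|) ^ (1 / 4 : ℝ) :=
            Real.rpow_le_rpow (norm_nonneg _) (by linarith) (by norm_num)
        _ = 2 ^ (1 / 4 : ℝ) * |z.im| ^ (1 / 4 : ℝ) := Real.mul_rpow (by norm_num) (abs_nonneg _)
        _ ≤ 2 * |z.im| ^ (1 / 4 : ℝ) := by
          gcongr
          exact Real.rpow_le_self_of_one_le (by norm_num) (by norm_num)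
    calc ‖z‖ ^ (1 / 4 : ℝ) * ‖R‖ ≤ (2 * |z.im| ^ (1 / 4 : ℝ)) * (2 * ‖T z.im‖) :=
          mul_le_mul h2 h1 (norm_nonneg _) (by positivity)
      _ = 4 * (|z.im| ^ (1 / 4 : ℝ) * ‖T z.im‖) := by ring
      _ ≤ 4 * C := by
        gcongr
        exact hC _ ((le_max_left _ _).trans h)
  · refine le_max_of_le_right ?_
    have h1 : ‖R‖ ≤ 1 := by simpa [hz] using hA.norm_resolvent_le (by simp [hz]) hR
    calc ‖z‖ ^ (1 / 4 : ℝ) * ‖R‖ ≤ (1 + m) ^ (1 / 4 : ℝ) * 1 :=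
          mul_le_mul (Real.rpow_le_rpow (norm_nonneg _) (by linarith) (by norm_num)) h1
            (norm_nonneg _) (by positivity)
      _ = _ := mul_one _

variable [CompleteSpace X]

/-- A contraction semigroup whose resolvent decays like `|lam|^(-1/4)` on the imaginary axis is of
Gevrey class `δ` for every `δ > 4`. -/
theorem IsDissipative.isGevreySemigroup (hA : IsDissipative A) {T : ℝ → X →L[ℂ] X}
    (hT : ∀ lam : ℝ, IsResolventAt A (Complex.I * lam) (T lam))
    (hb : ∃ C lam₀ : ℝ, ∀ lam : ℝ, lam₀ ≤ |lam| → |lam| ^ (1 / 4 : ℝ) * ‖T lam‖ ≤ C)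
    {S : ℝ → X →L[ℂ] X} (hS : IsC0Semigroup S) (hG : IsGeneratorOf A S) {δ : ℝ} (hδ : 4 < δ) :
    IsGevreySemigroup S δ 0 := by
  have h0 : IsResolventAt A 0 (T 0) := by simpa using hT 0
  have hex : ∀ z : ℂ, ∃ R : X →L[ℂ] X, z.re = 1 → IsResolventAt A z R := fun z => by
    by_cases hz : z.re = 1
    · obtain ⟨R, hR⟩ := hA.exists_resolvent h0 (z := z) (by rw [hz]; exact one_pos)
      exact ⟨R, fun _ => hR⟩
    · exact ⟨0, fun h => absurd h hz⟩
  choose R hR using hex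
  have hR1 : IsResolventAt A 1 (R 1) := hR 1 (by simp)
  obtain ⟨C, hC0, hC⟩ := hA.exists_rpow_mul_norm_resolvent_le hT hb
  have hc : ∀ t, 0 ≤ t → ‖S t‖ ≤ 1 := fun t ht => hS.norm_le_one hG hA hR1 ht
  have hsm : IsSmoothingSemigroup S (R 1) :=
    { isC0 := hS
      dense := hA.denseRange_resolvent (by simp) hR1
      comm := fun t ht => ContinuousLinearMap.ext fun x => hS.commute_resolvent hG hR1 ht x
      hasDerivAt := fun t ht x => by
        have := hS.hasDerivAt hG ((isResolventAt_iff.1 hR1).1 x) ht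
        rwa [one_smul] at this
      bound := fun k => hS.exists_norm_apply_sub_one_pow_le hG hc hR hC0
        (fun z hz => hC z _ hz (hR z hz)) k }
  exact hsm.isGevreySemigroup hδ

end

/-! ## The semigroup of the beam -/

namespace BeamData

lemma isDissipative_operator (p : BeamData) : IsDissipative p.operator := fun U V h =>
  ((mem_operator_graph p U V).1 h).re_inner_nonpos

lemma exists_isResolventAt_zero (p : BeamData) : ∃ R, IsResolventAt p.operator 0 R := by
  obtain ⟨C, hC⟩ := OperatorGraph.exists_norm_le p
  obtain ⟨R, hR, -⟩ := exists_isResolventAt (A := p.operator) (z := 0) (le_max_right C 0)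
    (fun F => by
      -- At z = 0 the resolvent equation reads −𝓐U = F.
      obtain ⟨U, hU⟩ := p.exists_operatorGraph (-F)
      exact ⟨U, (mem_operator_graph p _ _).2 (by simpa using hU)⟩)
    (fun U F h => by
      have h1 := hC U (-F) (by simpa using (mem_operator_graph p _ _).1 h)
      rw [norm_neg] at h1
      exact h1.trans (by gcongr; exact le_max_left _ _))
  exact ⟨R, hR⟩

lemma exists_isResolventAt_I_mul (p : BeamData) (lam : ℝ) :
    ∃ R, IsResolventAt p.operator (Complex.I * lam) R := by
  obtain ⟨R₀, h0⟩ := p.exists_isResolventAt_zero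
  by_cases hlam : lam = 0
  · exact ⟨R₀, by simpa [hlam] using h0⟩
  · obtain ⟨C, hC⟩ := p.exists_norm_le_of_frequency hlam
    obtain ⟨R, hR, -⟩ := p.isDissipative_operator.exists_resolvent_of_bound h0
      (z := Complex.I * lam) (by simp) (le_max_right C 0) fun U F h =>
        (hC ((mem_operator_graph p _ _).1 h)).trans (by gcongr; exact le_max_left _ _)
    exact ⟨R, hR⟩

lemma rpow_mul_norm_resolvent_le (p : BeamData) {T : ℝ → p.Phase →L[ℂ] p.Phase}
    (hT : ∀ lam : ℝ, IsResolventAt p.operator (Complex.I * lam) (T lam)) :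
    ∃ C lam₀ : ℝ, ∀ lam : ℝ, lam₀ ≤ |lam| → |lam| ^ (1 / 4 : ℝ) * ‖T lam‖ ≤ C := by
  obtain ⟨C, lam₀, hC⟩ := p.exists_norm_le_of_high
  refine ⟨max C 0, max lam₀ 1, fun lam h => ?_⟩
  have hl : 0 < |lam| := lt_of_lt_of_le (lt_max_of_lt_right one_pos) h
  have hp : 0 < |lam| ^ (1 / 4 : ℝ) := Real.rpow_pos_of_pos hl _
  rw [mul_comm, ← le_div_iff₀ hp]
  refine (T lam).opNorm_le_bound (by positivity) fun F => ?_
  rw [div_mul_eq_mul_div, le_div_iff₀ hp, mul_comm]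
  refine (hC ((le_max_left _ _).trans h)
    ((mem_operator_graph p _ _).1 ((isResolventAt_iff.1 (hT lam)).1 F))).trans ?_
  gcongr
  exact le_max_left _ _

end BeamData

theorem theorem3 (p : BeamData) :
    -- the beam operator generates a strongly continuous semigroup,
    (∃ S : ℝ → p.Phase →L[ℂ] p.Phase, IsC0Semigroup S ∧ IsGeneratorOf p.operator S) ∧
    -- this semigroup is of Gevrey class `δ` for `t > 0`, for every `δ > 4`,
    (∀ S : ℝ → p.Phase →L[ℂ] p.Phase, IsC0Semigroup S → IsGeneratorOf p.operator S →
      ∀ δ : ℝ, 4 < δ → IsGevreySemigroup S δ 0) ∧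
    -- the imaginary axis lies in the resolvent set, with the stated resolvent estimate
    (∃ R : ℝ → p.Phase →L[ℂ] p.Phase,
      (∀ lam : ℝ, IsResolventAt p.operator (Complex.I * lam) (R lam)) ∧
      ∃ C lam₀ : ℝ, ∀ lam : ℝ, lam₀ ≤ |lam| → |lam| ^ (1 / 4 : ℝ) * ‖R lam‖ ≤ C) := by
  have hA := p.isDissipative_operator
  choose T hT using p.exists_isResolventAt_I_mul
  have hb := p.rpow_mul_norm_resolvent_le hT
  refine ⟨?_, fun S hS hG δ hδ => hA.isGevreySemigroup hT hb hS hG hδ, T, hT, hb⟩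
  have h0 : IsResolventAt p.operator 0 (T 0) := by simpa using hT 0
  have hex : ∀ n : ℕ, ∃ R, IsResolventAt p.operator (n + 1) R := fun n =>
    hA.exists_resolvent h0 (by simp; positivity)
  choose R hR using hex
  exact hA.exists_semigroup hR
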